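/- **Notation.** Let $0<|q|<1$ and $0<|p|<1$. Put $(x;q)=\prod_{k\ge0}(1-xq^k)$, $(x;p,q)=\prod_{j,k\ge0}(1-xp^jq^k)$, $\theta(x;q)=(x;q)(q/x;q)$, $\Gamma(x)=(pq/x;p,q)/(x;p,q)$; several arguments, or a sign $\pm$, in such a symbol denote the product over all of them. For $u\in(\mathbb C^*)^{2m+6}$ with $\prod_r u_r=(pq)^{m+1}$ let $$E^m(u)=\prod_{0\le r<s\le 2m+5}(u_ru_s;p,q)\;\frac{(p;p)(q;q)}2\int_{\mathcal C}\frac{\prod_{r=0}^{2m+5}\Gamma(u_rz^{\pm1})}{\Gamma(z^{\pm2})}\frac{dz}{2\pi iz},$$ where $\mathcal C$ circles once around the origin in the positive direction and separates the points $u_rp^jq^k$ (inside) from the points $u_r^{-1}p^{-j}q^{-k}$ (outside), $j,k\ge0$; where no such contour exists, $E^m$ is defined by analytic continuation. For $b\in\mathbb C^*$, $t=(t_1,\dots,t_4)\in(\mathbb C^*)^4$ let $$E(b;t;p,q)=\frac{E^5\bigl(t_1,\tfrac{pq}{bt_1},\dots,t_4,\tfrac{pq}{bt_4},\pm\sqrt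 b,\pm\sqrt{bq},\pm\sqrt{bp},\pm\sqrt{bpq}\bigr)}{\prod_{r=1}^4\bigl(bt_r^2,\tfrac{p^2q^2}{bt_r^2};p,q\bigr)},$$ continued analytically in $(b,t)$ to the zeros of the denominator. **Statement.** Let $0<|q|<1$ and let $\tau_1,\dots,\tau_4\in\mathbb R$ satisfy $\tau_1>1$ and $\tau_1-1\le\tau_r\le2-\tau_1$ for $r=2,3,4$. Then for all $b\in\mathbb C^*$ and $t\in(\mathbb C^*)^4$ $$\lim_{p\to0}E(b;t_1p^{\tau_1},\dots,t_4p^{\tau_4};p,q)=G(b,t),$$ where $p\to0$ through nonzero complex numbers and $p^{\tau_r}=\exp(\tau_r\log p)$, with $\log p$ any choice of logarithm of $p$ (the same for all $r$). Here $$\begin{aligned}G(b,t)={}&\prod_{r\ge2:\,\tau_r=\tau_1-1}\Bigl(\frac{qt_r}{bt_1};q\Bigr)\prod_{r\ge2:\,\tau_r=2-\tau_1}\Bigl(\frac{q^2}{b^2t_1t_r};q\Bigr)\frac{(q/b,\,qb^2;q)}{(q/b^2,\,qb;q)}\,(q;q)\\&\times\int_{\mathcal C}\left(\frac{(1-z^{-2})(\frac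 q{bz^2},\frac q{t_1z};q)}{(\frac b{z^2},\frac q{bt_1z};q)}\right)^{1_{\{\tau_1=3/2\}}}\frac{\theta(\frac{qbz}{t_1};q)}{(\frac q{bt_1}z,\frac{t_1}z;q)}\prod_{r\ge2:\,\tau_r=\tau_1-1}\frac{(\frac{bt_r}z;q)}{(\frac{t_r}z;q)}\prod_{r\ge2:\,\tau_r=2-\tau_1}\frac{(\frac q{t_rz};q)}{(\frac q{bt_rz};q)}\,\frac{dz}{2\pi iz},\end{aligned}$$ whenever $(q/b^2,qb;q)\ne0$ and there is a contour $\mathcal C$, circling once around the origin in the positive direction (a deformation of the unit circle), that separates the zeros of $(\frac{q}{bt_1}z;q)$ (outside) from the zeros of all the other factors of the denominator of the integrand (inside): those of $(\frac{t_1}z;q)$; of $(\frac b{z^2},\frac q{bt_1z};q)$ if $\tau_1=3/2$; of $(\frac{t_r}z;q)$ for $r\ge2$ with $\tau_r=\tau_1-1$; and of $(\frac q{bt_rz};q)$ for $r\ge2$ with $\tau_r=2-\tau_1$. For all other $(b,t)\in\mathbb C^*\times(\mathbb C^*)^4$, $G(b,t)$ is given by analytic continuation: $G$ is holomorphic on $(\mathbb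 C^*)^5$. -/

import Mathlib

open Filter Topology

noncomputable section

namespace EllipticBeta

/-- The infinite `q`-shifted factorial `(x; q) = ∏_{k ≥ 0} (1 - x q^k)`. -/
def qPoch (x q : ℂ) : ℂ := ∏' k : ℕ, (1 - x * q ^ k)

/-- The double shifted factorial `(x; p, q) = ∏_{j, k ≥ 0} (1 - x p^j q^k)`. -/
def pqPoch (x p q : ℂ) : ℂ := ∏' n : ℕ × ℕ, (1 - x * p ^ n.1 * q ^ n.2)

/-- The theta function `θ(x; q) = (x, q / x; q)`. -/
def theta (x q : ℂ) : ℂ := qPoch x q * qPoch (q / x) q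

/-- The elliptic gamma function `Γ(x; p, q) = (p q / x; p, q) / (x; p, q)`. -/
def ellGamma (x p q : ℂ) : ℂ := pqPoch (p * q / x) p q / pqPoch x p q

/-- The integral of `f(z) dz` along the curve `γ`, parametrised by `[0, 1]`. -/
def contourIntegral (γ : ℝ → ℂ) (f : ℂ → ℂ) : ℂ :=
  ∫ s in (0 : ℝ)..1, f (γ s) * deriv γ s

/-- The winding number of the curve `γ` around a point `w` that it does not meet. -/
def windingNumber (γ : ℝ → ℂ) (w : ℂ) : ℂ :=
  (2 * Real.pi * Complex.I)⁻¹ * contourIntegral γ (fun z => (z - w)⁻¹)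

/-- `γ` is a closed `C¹` curve (its derivative may vanish, so corners are allowed) that circles
once around the origin in the positive direction and separates the points of `A` (which lie inside)
from those of `B` (which lie outside). -/
structure IsSeparatingContour (γ : ℝ → ℂ) (A B : Set ℂ) : Prop where
  contDiff : ContDiff ℝ 1 γ
  closed : γ 0 = γ 1
  ne_zero : ∀ s ∈ Set.Icc (0 : ℝ) 1, γ s ≠ 0
  avoids : ∀ s ∈ Set.Icc (0 : ℝ) 1, γ s ∉ A ∪ B
  origin : windingNumber γ 0 = 1
  inside : ∀ w ∈ A, windingNumber γ w = 1
  outside : ∀ w ∈ B, windingNumber γ w = 0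

/-! ### The renormalised elliptic beta integrals `E^m` -/

/-- The points `t_r p^j q^k`. -/
def innerPoles {n : ℕ} (t : Fin n → ℂ) (p q : ℂ) : Set ℂ :=
  {z | ∃ (r : Fin n) (j k : ℕ), z = t r * p ^ j * q ^ k}

/-- The points `t_r⁻¹ p^{-j} q^{-k}`. -/
def outerPoles {n : ℕ} (t : Fin n → ℂ) (p q : ℂ) : Set ℂ :=
  {z | ∃ (r : Fin n) (j k : ℕ), z = (t r * p ^ j * q ^ k)⁻¹}

/-- There is a contour separating the points `t_r p^j q^k` from their reciprocals. -/
def HasContour {n : ℕ} (t : Fin n → ℂ) (p q : ℂ) : Prop :=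
  ∃ γ : ℝ → ℂ, IsSeparatingContour γ (innerPoles t p q) (outerPoles t p q)

/-- `∏_r Γ(t_r z^{±1}) / Γ(z^{±2})`. -/
def betaIntegrand {n : ℕ} (t : Fin n → ℂ) (p q z : ℂ) : ℂ :=
  (∏ r, ellGamma (t r * z) p q * ellGamma (t r / z) p q) /
    (ellGamma (z ^ 2) p q * ellGamma (1 / z ^ 2) p q)

open Classical in
/-- The renormalised elliptic beta integral given by its contour integral
(the value does not depend on the contour; it is `0` if there is no contour). -/
def betaByContour {n : ℕ} (t : Fin n → ℂ) (p q : ℂ) : ℂ :=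
  if h : HasContour t p q then
    (∏ r, ∏ s ∈ Finset.Ioi r, pqPoch (t r * t s) p q) * (qPoch p p * qPoch q q / 2) *
      contourIntegral h.choose
        (fun z => betaIntegrand t p q z / (2 * Real.pi * Complex.I * z))
  else 0

open Classical in
/-- The renormalised elliptic beta integral `E^m(t)` for `t_0 ⋯ t_{2m+5} = (pq)^{m+1}`.
The parameters for which a contour exists are, for fixed `p` and `q`, the complement of a locally
finite union of analytic hypersurfaces in this parameter space, and elsewhere the value is the
analytic continuation, that is, the limit of the values at parameters for which a contour exists. -/
def ellBeta (m : ℕ) (t : Fin (2 * m + 6) → ℂ) (p q : ℂ) : ℂ :=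
  if HasContour t p q then betaByContour t p q
  else limUnder
    (𝓝[{u : Fin (2 * m + 6) → ℂ | ∏ r, u r = (p * q) ^ (m + 1) ∧ HasContour u p q}] t)
    (fun u => betaByContour u p q)

/-! ### The elliptic hypergeometric integral `E(b; t; p, q)` -/

/-- The sixteen parameters `t_r`, `pq / (b t_r)`, `±√b`, `±√(bq)`, `±√(bp)`, `±√(bpq)`. -/
def ellParams (b : ℂ) (t : Fin 4 → ℂ) (p q : ℂ) : Fin (2 * 5 + 6) → ℂ :=
  ![t 0, p * q / (b * t 0), t 1, p * q / (b * t 1),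
    t 2, p * q / (b * t 2), t 3, p * q / (b * t 3),
    b ^ (1 / 2 : ℂ), -b ^ (1 / 2 : ℂ),
    (b * q) ^ (1 / 2 : ℂ), -(b * q) ^ (1 / 2 : ℂ),
    (b * p) ^ (1 / 2 : ℂ), -(b * p) ^ (1 / 2 : ℂ),
    (b * p * q) ^ (1 / 2 : ℂ), -(b * p * q) ^ (1 / 2 : ℂ)]

/-- `∏_r (b t_r², p² q² / (b t_r²); p, q)`. -/
def ellDenom (b : ℂ) (t : Fin 4 → ℂ) (p q : ℂ) : ℂ :=
  ∏ r, pqPoch (b * t r ^ 2) p q * pqPoch (p ^ 2 * q ^ 2 / (b * t r ^ 2)) p q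

/-- The parameters `(b, t)` at which `E^5` is given by a contour integral and `ellDenom` does
not vanish; again the complement of a locally finite union of analytic hypersurfaces. -/
def ellGeneric (p q : ℂ) : Set (ℂ × (Fin 4 → ℂ)) :=
  {x | x.1 ≠ 0 ∧ (∀ r, x.2 r ≠ 0) ∧ HasContour (ellParams x.1 x.2 p q) p q ∧
    ellDenom x.1 x.2 p q ≠ 0}

open Classical in
/-- The elliptic hypergeometric integral `E(b; t; p, q)`, that is, `E^5` at the parameters
`ellParams` divided by `ellDenom`, continued analytically in `(b, t)` to the exceptional
parameters. -/
def ellE (b : ℂ) (t : Fin 4 → ℂ) (p q : ℂ) : ℂ :=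
  if (b, t) ∈ ellGeneric p q then ellBeta 5 (ellParams b t p q) p q / ellDenom b t p q
  else limUnder (𝓝[ellGeneric p q] (b, t))
    (fun x => ellBeta 5 (ellParams x.1 x.2 p q) p q / ellDenom x.1 x.2 p q)

/-! ### The limit. The index `0 : Fin 4` plays the role of the index `1` in `t_1`, `τ_1`. -/

/-- The zeros of the denominator of `limitIntegrand` that lie inside the contour: those of
`(t_1/z; q)`, of `(b/z², q/(b t_1 z); q)` if `τ_1 = 3/2`, of `(t_r/z; q)` if `τ_r = τ_1 - 1`, and
of `(q/(b t_r z); q)` if `τ_r = 2 - τ_1`, for `r ≥ 2`. -/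
def limitInnerPoles (q : ℂ) (τ : Fin 4 → ℝ) (b : ℂ) (t : Fin 4 → ℂ) : Set ℂ :=
  {z | ∃ k : ℕ, z = t 0 * q ^ k ∨
    (τ 0 = 3 / 2 ∧ (z ^ 2 = b * q ^ k ∨ z = q / (b * t 0) * q ^ k)) ∨
    (∃ r, r ≠ 0 ∧ τ r = τ 0 - 1 ∧ z = t r * q ^ k) ∨
    (∃ r, r ≠ 0 ∧ τ r = 2 - τ 0 ∧ z = q / (b * t r) * q ^ k)}

/-- The zeros of `(q z / (b t_1); q)`. -/
def limitOuterPoles (q : ℂ) (b : ℂ) (t : Fin 4 → ℂ) : Set ℂ :=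
  {z | ∃ k : ℕ, q / (b * t 0) * z * q ^ k = 1}

/-- The integrand of the limiting integral, without `dz / (2πiz)`. -/
def limitIntegrand (q : ℂ) (τ : Fin 4 → ℝ) (b : ℂ) (t : Fin 4 → ℂ) (z : ℂ) : ℂ :=
  (if τ 0 = 3 / 2 then
      ((1 - 1 / z ^ 2) * qPoch (q / (b * z ^ 2)) q * qPoch (q / (t 0 * z)) q) /
        (qPoch (b / z ^ 2) q * qPoch (q / (b * t 0 * z)) q)
    else 1) *
  (theta (q * b * z / t 0) q / (qPoch (q / (b * t 0) * z) q * qPoch (t 0 / z) q)) *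
  (∏ r with r ≠ 0 ∧ τ r = τ 0 - 1, qPoch (b * t r / z) q / qPoch (t r / z) q) *
  (∏ r with r ≠ 0 ∧ τ r = 2 - τ 0, qPoch (q / (t r * z)) q / qPoch (q / (b * t r * z)) q)

/-- The factor in front of the limiting integral. -/
def limitPrefactor (q : ℂ) (τ : Fin 4 → ℝ) (b : ℂ) (t : Fin 4 → ℂ) : ℂ :=
  (∏ r with r ≠ 0 ∧ τ r = τ 0 - 1, qPoch (q * t r / (b * t 0)) q) *
  (∏ r with r ≠ 0 ∧ τ r = 2 - τ 0, qPoch (q ^ 2 / (b ^ 2 * t 0 * t r)) q) *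
  ((qPoch (q / b) q * qPoch (q * b ^ 2) q) / (qPoch (q / b ^ 2) q * qPoch (q * b) q)) *
  qPoch q q

end EllipticBeta

end

noncomputable section
namespace EllipticBeta

/-! ### Infinite products -/

/-! Put z = s w with s = p^{τ_1-1}, and c = p^{3-2τ_1}, e_r = p^{τ_r-τ_1+1}, f_r = p^{2-τ_1-τ_r}.
Then p = c s², e_r f_r = c, and the parameters of the integral are p s a and s e_r u_r, with a = t_1
and u_r = t_r fixed. The hypotheses on τ say that s → 0 and that each of c, e_r, f_r tends to 1
(exponent zero) or to 0; this is the source of the indicator conditions in G.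

Breaking the symmetry. The integrand is invariant under z ↦ 1/z, and some of its factors have
arguments that blow up as s → 0. By a three-term theta relation (`thetaSplit_add`),
θ(1/b²;q)/θ(1/b;q) is φ(z) + φ(1/z) for an explicit theta quotient φ = `thetaSplit`. Since z and 1/z
contribute equally, multiplying the integrand by φ changes the integral only by an explicit factor.
The theta functions in φ cancel exactly the factors that blow up, so that the product becomes, in
the variable w, the function `scaledIntegrand` (`ell_mul_thetaSplit`), which behaves well up to p =
0 and becomes there the integrand of G (`scaledIntegrand_limScales`).

Removing the contour. For special parameters the inner poles collide with the outer poles, those of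
(qw/(ba);q), and the integral exists only by continuation; the continuation has to be controlled
uniformly in p. If x q^k = 1 and y q^l = 1, then x y q^{k+l} = 1, and this refines to a Bezout
identity between finite q-factorials (`exists_bezout_qFin`). It writes a multiple of the integrand
as a sum of two terms, one without inner poles outside a small circle, the other without outer poles
inside a large circle. The sum of the two circle integrals is `regIntegral`, which is regular in
parameters and scales without any separation hypothesis. Of the factors of the multiplier, one
cancels against the numerator, most cancel against the prefactor, and two remain. The outcome is
`poleFactor` · E = `regE`.

Dividing by the pole factor. The quotient `regE`/`poleFactor` is continued in b by Cauchy's integral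
over a circle that avoids the zeros of `poleFactor` (`extE`). This is legitimate because for generic
(a, u) the quotient has a finite limit at every zero in the disc. At b² = q^{j+1} the original
integral has a contour when |pq| < |b| and t is generic. At (ba)² = c q^{n+2} there are two cases:
if τ_1 < 3/2, then c → 0 and these zeros leave the disc; if τ_1 = 3/2, then c = 1 and `regIntegral`
vanishes, being a sum of residues at points W_0, …, W_n with W_k W_{n-k} = 1 that is odd under w ↦
1/w (`theta_antisymm`, `regIntegral_eq_zero`). Hence E = `extE` for small p (`IsLocal.ellE_eq`). As
`extE` is continuous in the scales and holomorphic in the parameters, both the limit and its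
holomorphy follow, and `regE_eq` at the limiting scales identifies the limit with the integral G.

Supporting facts are the independence of contour integrals from the contour
(`contourIntegral_div_eq`), the existence of star-shaped separating contours, and the density of
generic parameters, obtained by rotating the parameters at different speeds. -/

theorem differentiable_tprod_one_sub {ι : Type*} {a : ι → ℂ} (ha : Summable fun i => ‖a i‖) :
    Differentiable ℂ fun x : ℂ => ∏' i, (1 - x * a i) := by
  intro x
  have hu : Summable fun i => (‖x‖ + 1) * ‖a i‖ := ha.mul_left _
  have h := Summable.hasProdUniformlyOn_one_add (f := fun i (y : ℂ) => -(y * a i))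
    (isCompact_closedBall x 1) hu
    (Eventually.of_forall fun i y hy => by
      rw [norm_neg, norm_mul]
      gcongr
      have : ‖y - x‖ ≤ 1 := by simpa [dist_eq_norm] using hy
      calc ‖y‖ = ‖x + (y - x)‖ := by ring_nf
        _ ≤ ‖x‖ + ‖y - x‖ := norm_add_le _ _
        _ ≤ _ := by linarith)
    (fun i => by fun_prop)
  rw [hasProdUniformlyOn_iff_tendstoUniformlyOn] at h
  have h2 := (h.mono Metric.ball_subset_closedBall).tendstoLocallyUniformlyOn
  have h3 := h2.differentiableOn (Eventually.of_forall fun s => by fun_prop) Metric.isOpen_ball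
  simp only [← sub_eq_add_neg] at h3
  exact (h3 x (Metric.mem_ball_self one_pos)).differentiableAt
    (Metric.isOpen_ball.mem_nhds (Metric.mem_ball_self one_pos))

theorem tprod_one_sub_eq_zero_iff {ι : Type*} {a : ι → ℂ} (ha : Summable fun i => ‖a i‖) :
    ∏' i, (1 - a i) = 0 ↔ ∃ i, a i = 1 := by
  constructor
  · intro h
    by_contra! hne
    have := tprod_one_add_ne_zero_of_summable (f := fun i => -a i)
      (fun i h => hne i (by linear_combination -h)) (by simpa using ha)
    simp only [← sub_eq_add_neg] at this
    exact this h
  · rintro ⟨i, hi⟩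
    exact tprod_of_exists_eq_zero ⟨i, by rw [hi, sub_self]⟩

theorem multipliable_one_sub {ι : Type*} {a : ι → ℂ} (ha : Summable fun i => ‖a i‖) :
    Multipliable fun i => 1 - a i := by
  simpa only [← sub_eq_add_neg] using
    multipliable_one_add_of_summable (f := fun i => -a i) (by simpa using ha)

theorem summable_norm_pow {q : ℂ} (hq : ‖q‖ < 1) : Summable fun k : ℕ => ‖q ^ k‖ := by
  simpa using summable_geometric_of_lt_one (norm_nonneg q) hq

theorem summable_norm_pow_mul_pow {p q : ℂ} (hp : ‖p‖ < 1) (hq : ‖q‖ < 1) :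
    Summable fun n : ℕ × ℕ => ‖p ^ n.1 * q ^ n.2‖ := by
  simpa only [norm_mul] using (summable_norm_pow hp).mul_of_nonneg (summable_norm_pow hq)
    (fun _ => norm_nonneg _) (fun _ => norm_nonneg _)

theorem summable_norm_mul_pow {q : ℂ} (x : ℂ) (hq : ‖q‖ < 1) :
    Summable fun k : ℕ => ‖x * q ^ k‖ := by
  simpa only [norm_mul] using (summable_norm_pow hq).mul_left ‖x‖

theorem summable_norm_mul_pow_mul_pow {p q : ℂ} (x : ℂ) (hp : ‖p‖ < 1) (hq : ‖q‖ < 1) :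
    Summable fun n : ℕ × ℕ => ‖x * p ^ n.1 * q ^ n.2‖ := by
  simpa only [norm_mul, mul_assoc] using (summable_norm_pow_mul_pow hp hq).mul_left ‖x‖

/-! ### The `q`-shifted factorial -/

theorem differentiable_qPoch {q : ℂ} (hq : ‖q‖ < 1) : Differentiable ℂ fun x => qPoch x q :=
  differentiable_tprod_one_sub (summable_norm_pow hq)

theorem qPoch_eq_zero_iff {q : ℂ} (hq : ‖q‖ < 1) {x : ℂ} :
    qPoch x q = 0 ↔ ∃ k : ℕ, x * q ^ k = 1 :=
  tprod_one_sub_eq_zero_iff (summable_norm_mul_pow x hq)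

theorem qPoch_ne_zero_of_norm_lt {q : ℂ} (hq : ‖q‖ < 1) {x : ℂ} (hx : ‖x‖ < 1) :
    qPoch x q ≠ 0 := by
  rw [Ne, qPoch_eq_zero_iff hq]
  rintro ⟨k, hk⟩
  have : ‖x * q ^ k‖ < 1 := by
    rw [norm_mul, norm_pow]
    exact mul_lt_one_of_nonneg_of_lt_one_left (norm_nonneg _) hx (pow_le_one₀ (norm_nonneg _) hq.le)
  rw [hk, norm_one] at this
  exact lt_irrefl _ this

theorem qPoch_eq_mul {q : ℂ} (hq : ‖q‖ < 1) (x : ℂ) :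
    qPoch x q = (1 - x) * qPoch (x * q) q := by
  have h := (multipliable_one_sub (summable_norm_mul_pow (x * q) hq))
  have := tprod_eq_zero_mul' (f := fun k : ℕ => 1 - x * q ^ k)
    (by simpa only [pow_succ', mul_assoc] using h)
  simpa only [qPoch, pow_zero, mul_one, pow_succ', mul_assoc] using this

/-- The finite `q`-shifted factorial `∏_{k < n} (1 - x q^k)`. -/
def qFin (q x : ℂ) (n : ℕ) : ℂ := ∏ k ∈ Finset.range n, (1 - x * q ^ k)

theorem qPoch_eq_qFin_mul {q : ℂ} (hq : ‖q‖ < 1) (x : ℂ) (n : ℕ) :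
    qPoch x q = qFin q x n * qPoch (x * q ^ n) q := by
  induction n with
  | zero => simp [qFin]
  | succ n ih =>
    rw [ih, qPoch_eq_mul hq (x * q ^ n), qFin, qFin, Finset.prod_range_succ]
    ring_nf

theorem qFin_eq_zero_iff {q x : ℂ} {n : ℕ} : qFin q x n = 0 ↔ ∃ k < n, x * q ^ k = 1 := by
  simp only [qFin, Finset.prod_eq_zero_iff, Finset.mem_range, sub_eq_zero, eq_comm (a := (1 : ℂ))]

@[simp] theorem qPoch_zero (q : ℂ) : qPoch 0 q = 1 := by simp [qPoch]

theorem qPoch_zero_right (x : ℂ) : qPoch x 0 = 1 - x := by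
  rw [qPoch_eq_mul (by simp)]; simp

theorem qPoch_mul_neg {q : ℂ} (hq : ‖q‖ < 1) (x : ℂ) :
    qPoch x q * qPoch (-x) q = qPoch (x ^ 2) (q ^ 2) := by
  unfold qPoch
  rw [← Multipliable.tprod_mul (multipliable_one_sub (summable_norm_mul_pow x hq))
    (multipliable_one_sub (summable_norm_mul_pow (-x) hq))]
  congr 1; ext k; ring

theorem norm_sq_lt_one {q : ℂ} (hq : ‖q‖ < 1) : ‖q ^ 2‖ < 1 := by
  rw [norm_pow]; exact pow_lt_one₀ (norm_nonneg _) hq two_ne_zero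

theorem qPoch_even_odd {q : ℂ} (hq : ‖q‖ < 1) (x : ℂ) :
    qPoch x q = qPoch x (q ^ 2) * qPoch (x * q) (q ^ 2) := by
  have h2 := norm_sq_lt_one hq
  have := tprod_even_mul_odd (f := fun k : ℕ => 1 - x * q ^ k)
    (by simpa only [pow_mul] using multipliable_one_sub (summable_norm_mul_pow x h2))
    (by simpa only [pow_mul, pow_succ', mul_assoc]
          using multipliable_one_sub (summable_norm_mul_pow (x * q) h2))
  simpa only [qPoch, pow_mul, pow_succ', mul_assoc] using this.symm

/-- Continuity jointly in the argument and the base is what lets the nome tend to 0. A geometric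
majorant with ratio strictly between ‖p‖ and 1 serves for a whole neighbourhood, so dominated
convergence applies to the product. -/
theorem continuousAt_qPoch {x p : ℂ} (hp : ‖p‖ < 1) :
    ContinuousAt (fun y : ℂ × ℂ => qPoch y.1 y.2) (x, p) := by
  obtain ⟨P, hP, hP1⟩ := exists_between hp
  have hP0 : 0 ≤ P := (norm_nonneg p).trans hP.le
  have h1 : ∀ᶠ y : ℂ × ℂ in 𝓝 (x, p), ‖y.1‖ < ‖x‖ + 1 ∧ ‖y.2‖ < P :=
    ((continuous_fst.norm.tendsto (x, p)).eventually_lt_const (by simp)).and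
      ((continuous_snd.norm.tendsto (x, p)).eventually_lt_const hP)
  have := tendsto_tprod_one_add_of_dominated_convergence (𝓕 := 𝓝 (x, p))
    (f := fun (y : ℂ × ℂ) (k : ℕ) => -(y.1 * y.2 ^ k)) (g := fun k => -(x * p ^ k))
    (bound := fun k => (‖x‖ + 1) * P ^ k)
    ((summable_geometric_of_lt_one hP0 hP1).mul_left _)
    (fun k => (Continuous.tendsto (by fun_prop) (x, p)))
    (h1.mono fun y hy k => by
      rw [norm_neg, norm_mul, norm_pow]
      gcongr
      exacts [hy.1.le, hy.2.le])
  simp only [← sub_eq_add_neg] at this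
  exact this

/-! ### The double shifted factorial -/

section
variable {p q : ℂ}

theorem differentiable_pqPoch (hp : ‖p‖ < 1) (hq : ‖q‖ < 1) :
    Differentiable ℂ fun x => pqPoch x p q := by
  simpa only [pqPoch, mul_assoc] using
    differentiable_tprod_one_sub (summable_norm_pow_mul_pow hp hq)

theorem pqPoch_eq_zero_iff (hp : ‖p‖ < 1) (hq : ‖q‖ < 1) {x : ℂ} :
    pqPoch x p q = 0 ↔ ∃ j k : ℕ, x * p ^ j * q ^ k = 1 := by
  rw [pqPoch, tprod_one_sub_eq_zero_iff (summable_norm_mul_pow_mul_pow x hp hq)]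
  simp

theorem pqPoch_ne_zero_of_norm_lt (hp : ‖p‖ < 1) (hq : ‖q‖ < 1) {x : ℂ} (hx : ‖x‖ < 1) :
    pqPoch x p q ≠ 0 := by
  rw [Ne, pqPoch_eq_zero_iff hp hq]
  rintro ⟨j, k, hk⟩
  have : ‖x * p ^ j * q ^ k‖ < 1 := by
    rw [norm_mul, norm_mul, norm_pow, norm_pow]
    refine mul_lt_one_of_nonneg_of_lt_one_left (by positivity) ?_ (pow_le_one₀ (norm_nonneg _) hq.le)
    exact mul_lt_one_of_nonneg_of_lt_one_left (norm_nonneg _) hx (pow_le_one₀ (norm_nonneg _) hp.le)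
  rw [hk, norm_one] at this
  exact lt_irrefl _ this

theorem pqPoch_comm (x : ℂ) : pqPoch x p q = pqPoch x q p := by
  unfold pqPoch
  rw [← (Equiv.prodComm ℕ ℕ).tprod_eq]
  congr 1; ext n; simp only [Equiv.prodComm_apply, Prod.fst_swap, Prod.snd_swap]; ring

theorem hasProd_qPoch (hp : ‖p‖ < 1) (hq : ‖q‖ < 1) (x : ℂ) :
    HasProd (fun j : ℕ => qPoch (x * p ^ j) q) (pqPoch x p q) := by
  have h : HasProd (fun n : ℕ × ℕ => 1 - x * p ^ n.1 * q ^ n.2) (pqPoch x p q) :=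
    (multipliable_one_sub (summable_norm_mul_pow_mul_pow x hp hq)).hasProd
  have h2 (j : ℕ) : HasProd (fun k : ℕ => 1 - x * p ^ j * q ^ k) (qPoch (x * p ^ j) q) :=
    (multipliable_one_sub (summable_norm_mul_pow (x * p ^ j) hq)).hasProd
  exact HasProd.prod_fiberwise h h2

theorem multipliable_qPoch (hp : ‖p‖ < 1) (hq : ‖q‖ < 1) (x : ℂ) :
    Multipliable fun j : ℕ => qPoch (x * p ^ j) q :=
  (hasProd_qPoch hp hq x).multipliable

theorem pqPoch_eq_tprod (hp : ‖p‖ < 1) (hq : ‖q‖ < 1) (x : ℂ) :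
    pqPoch x p q = ∏' j : ℕ, qPoch (x * p ^ j) q :=
  (hasProd_qPoch hp hq x).tprod_eq.symm

theorem pqPoch_eq_mul (hp : ‖p‖ < 1) (hq : ‖q‖ < 1) (x : ℂ) :
    pqPoch x p q = qPoch x q * pqPoch (x * p) p q := by
  rw [pqPoch_eq_tprod hp hq, pqPoch_eq_tprod hp hq]
  have h := multipliable_qPoch hp hq (x * p)
  have := tprod_eq_zero_mul' (f := fun j : ℕ => qPoch (x * p ^ j) q)
    (by simpa only [pow_succ', mul_assoc] using h)
  simpa only [pow_zero, mul_one, pow_succ', mul_assoc] using this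

theorem pqPoch_eq_mul' (hp : ‖p‖ < 1) (hq : ‖q‖ < 1) (x : ℂ) :
    pqPoch x p q = qPoch x p * pqPoch (x * q) p q := by
  rw [pqPoch_comm, pqPoch_eq_mul hq hp, pqPoch_comm]

@[simp] theorem pqPoch_zero : pqPoch 0 p q = 1 := by simp [pqPoch]

theorem pqPoch_zero_mid (hq : ‖q‖ < 1) (x : ℂ) : pqPoch x 0 q = qPoch x q := by
  rw [pqPoch_eq_mul (by simp) hq]; simp

theorem pqPoch_mul_neg (hp : ‖p‖ < 1) (hq : ‖q‖ < 1) (x : ℂ) :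
    pqPoch x p q * pqPoch (-x) p q = pqPoch (x ^ 2) (p ^ 2) (q ^ 2) := by
  unfold pqPoch
  rw [← Multipliable.tprod_mul (multipliable_one_sub (summable_norm_mul_pow_mul_pow x hp hq))
    (multipliable_one_sub (summable_norm_mul_pow_mul_pow (-x) hp hq))]
  congr 1; ext k; ring

theorem pqPoch_even_odd (hp : ‖p‖ < 1) (hq : ‖q‖ < 1) (x : ℂ) :
    pqPoch x p q = pqPoch x (p ^ 2) q * pqPoch (x * p) (p ^ 2) q := by
  have h2 := norm_sq_lt_one hp
  rw [pqPoch_eq_tprod hp hq, pqPoch_eq_tprod h2 hq, pqPoch_eq_tprod h2 hq]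
  have := tprod_even_mul_odd (f := fun k : ℕ => qPoch (x * p ^ k) q)
    (by simpa only [pow_mul] using multipliable_qPoch h2 hq x)
    (by simpa only [pow_mul, pow_succ', mul_assoc] using multipliable_qPoch h2 hq (x * p))
  simpa only [pow_mul, pow_succ', mul_assoc] using this.symm

/-- Combined with `pqPoch_mul_neg`, this fuses the eight parameters ±√b, ±√(bq), ±√(bp), ±√(bpq)
into a single double factorial. -/
theorem pqPoch_quadruple (hp : ‖p‖ < 1) (hq : ‖q‖ < 1) (x : ℂ) :
    pqPoch x p q = pqPoch x (p ^ 2) (q ^ 2) * pqPoch (x * q) (p ^ 2) (q ^ 2) *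
      pqPoch (x * p) (p ^ 2) (q ^ 2) * pqPoch (x * p * q) (p ^ 2) (q ^ 2) := by
  have h2 := norm_sq_lt_one hp
  have h (y : ℂ) : pqPoch y (p ^ 2) q
      = pqPoch y (p ^ 2) (q ^ 2) * pqPoch (y * q) (p ^ 2) (q ^ 2) := by
    rw [pqPoch_comm, pqPoch_even_odd hq h2, pqPoch_comm, pqPoch_comm (y * q)]
  rw [pqPoch_even_odd hp hq, h, h]; ring

theorem continuousAt_pqPoch {x : ℂ} (hp : ‖p‖ < 1) (hq : ‖q‖ < 1) :
    ContinuousAt (fun y : ℂ × ℂ => pqPoch y.1 y.2 q) (x, p) := by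
  obtain ⟨P, hP, hP1⟩ := exists_between hp
  have hP0 : 0 ≤ P := (norm_nonneg p).trans hP.le
  have h1 : ∀ᶠ y : ℂ × ℂ in 𝓝 (x, p), ‖y.1‖ < ‖x‖ + 1 ∧ ‖y.2‖ < P :=
    ((continuous_fst.norm.tendsto (x, p)).eventually_lt_const (by simp)).and
      ((continuous_snd.norm.tendsto (x, p)).eventually_lt_const hP)
  have hs : Summable fun n : ℕ × ℕ => (‖x‖ + 1) * (P ^ n.1 * ‖q‖ ^ n.2) :=
    ((summable_geometric_of_lt_one hP0 hP1).mul_of_nonneg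
      (summable_geometric_of_lt_one (norm_nonneg q) hq) (fun _ => by positivity)
      (fun _ => by positivity)).mul_left _
  have := tendsto_tprod_one_add_of_dominated_convergence (𝓕 := 𝓝 (x, p))
    (f := fun (y : ℂ × ℂ) (n : ℕ × ℕ) => -(y.1 * y.2 ^ n.1 * q ^ n.2))
    (g := fun n => -(x * p ^ n.1 * q ^ n.2)) hs
    (fun k => (Continuous.tendsto (by fun_prop) (x, p)))
    (h1.mono fun y hy k => by
      rw [norm_neg, norm_mul, norm_mul, norm_pow, norm_pow, mul_assoc]
      gcongr
      exacts [hy.1.le, hy.2.le])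
  simp only [← sub_eq_add_neg] at this
  exact this

end

/-! ### Theta functions -/

section
variable {q : ℂ}

theorem theta_inv_mul (hq : q ≠ 0) (x : ℂ) : theta (q / x) q = theta x q := by
  by_cases hx : x = 0
  · subst hx; simp [theta]
  rw [theta, theta, mul_comm]; congr 2; field_simp

theorem theta_mul_self (hq0 : q ≠ 0) (hq : ‖q‖ < 1) {x : ℂ} (hx : x ≠ 0) :
    theta (q * x) q = -x⁻¹ * theta x q := by
  rw [theta, theta, qPoch_eq_mul hq x, mul_comm x q,
    show q / (q * x) = x⁻¹ by field_simp, qPoch_eq_mul hq x⁻¹,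
    show x⁻¹ * q = q / x by field_simp]
  field_simp
  ring

theorem theta_inv (hq0 : q ≠ 0) (hq : ‖q‖ < 1) {x : ℂ} (hx : x ≠ 0) :
    theta x⁻¹ q = -x⁻¹ * theta x q := by
  rw [← theta_inv_mul hq0, ← theta_mul_self hq0 hq hx, div_inv_eq_mul]

theorem theta_eq_zero_iff (hq0 : q ≠ 0) (hq : ‖q‖ < 1) {x : ℂ} (hx : x ≠ 0) :
    theta x q = 0 ↔ ∃ n : ℤ, x = q ^ n := by
  rw [theta, mul_eq_zero, qPoch_eq_zero_iff hq, qPoch_eq_zero_iff hq]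
  constructor
  · rintro (⟨k, hk⟩ | ⟨k, hk⟩)
    · exact ⟨-k, by rw [zpow_neg, zpow_natCast]; exact eq_inv_of_mul_eq_one_left hk⟩
    · refine ⟨k + 1, ?_⟩
      field_simp at hk
      rw [← hk, zpow_add_one₀ hq0, zpow_natCast]; ring
  · rintro ⟨n, rfl⟩
    rcases le_or_gt n 0 with h | h
    · left
      obtain ⟨k, rfl⟩ := Int.exists_eq_neg_ofNat h
      exact ⟨k, by simp [hq0]⟩
    · right
      obtain ⟨k, rfl⟩ : ∃ k : ℕ, n = k + 1 := ⟨(n - 1).toNat, by omega⟩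
      refine ⟨k, ?_⟩
      rw [zpow_add_one₀ hq0, zpow_natCast]; field_simp

/-- The multiplier of the theta function under `x ↦ q^m x`. -/
def thetaMult (q : ℂ) (m : ℤ) : ℂ := (-1) ^ m * (q ^ (m * (m - 1) / 2))⁻¹

theorem thetaMult_succ (hq0 : q ≠ 0) (m : ℤ) :
    thetaMult q (m + 1) = -(q ^ m)⁻¹ * thetaMult q m := by
  have h : (m + 1) * (m + 1 - 1) / 2 = m * (m - 1) / 2 + m := by
    rw [show (m + 1) * (m + 1 - 1) = m * (m - 1) + m * 2 by ring,
      Int.add_mul_ediv_right _ _ two_ne_zero]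
  rw [thetaMult, thetaMult, h, zpow_add₀ hq0, zpow_add_one₀ (by norm_num), mul_inv]
  ring

theorem thetaMult_neg (hq0 : q ≠ 0) (m : ℤ) : thetaMult q m = q ^ m * thetaMult q (-m) := by
  have h : -m * (-m - 1) / 2 = m * (m - 1) / 2 + m := by
    rw [show -m * (-m - 1) = m * (m - 1) + m * 2 by ring,
      Int.add_mul_ediv_right _ _ two_ne_zero]
  have h1 : ((-1 : ℂ)) ^ (-m) = (-1) ^ m := by rw [zpow_neg, ← inv_zpow]; norm_num
  rw [thetaMult, thetaMult, h, h1, zpow_add₀ hq0, mul_inv]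
  have := zpow_ne_zero m hq0
  field_simp

theorem theta_zpow_mul (hq0 : q ≠ 0) (hq : ‖q‖ < 1) {x : ℂ} (hx : x ≠ 0) (m : ℤ) :
    theta (q ^ m * x) q = thetaMult q m * x ^ (-m) * theta x q := by
  have hs (n : ℤ) : theta (q ^ (n + 1) * x) q = -(q ^ n * x)⁻¹ * theta (q ^ n * x) q := by
    rw [zpow_add_one₀ hq0, mul_comm _ q, mul_assoc,
      theta_mul_self hq0 hq (mul_ne_zero (zpow_ne_zero _ hq0) hx)]
  have hr (n : ℤ) : thetaMult q (n + 1) * x ^ (-(n + 1)) * theta x q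
      = -(q ^ n * x)⁻¹ * (thetaMult q n * x ^ (-n) * theta x q) := by
    rw [thetaMult_succ hq0, neg_add, zpow_add₀ hx, zpow_neg_one, mul_inv]; ring
  induction m using Int.induction_on with
  | zero => simp [thetaMult]
  | succ n ih => rw [hs, hr, ih]
  | pred n ih =>
    have h0 : -(q ^ (-(n : ℤ) - 1) * x)⁻¹ ≠ 0 :=
      neg_ne_zero.2 (inv_ne_zero (mul_ne_zero (zpow_ne_zero _ hq0) hx))
    have h1 := hs (-(n : ℤ) - 1)
    have h2 := hr (-(n : ℤ) - 1)
    rw [sub_add_cancel] at h1 h2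
    -- For negative exponents the recursion is run backwards; its multiplier is nonzero and cancels.
    exact mul_left_cancel₀ h0 (by rw [← h1, ← h2, ih])

theorem differentiableAt_theta (hq : ‖q‖ < 1) {x : ℂ} (hx : x ≠ 0) :
    DifferentiableAt ℂ (fun x => theta x q) x := by
  unfold theta
  exact (differentiable_qPoch hq x).mul
    ((differentiable_qPoch hq _).comp x ((differentiableAt_const q).div differentiableAt_id hx))

end

end EllipticBeta
end

noncomputable section
namespace EllipticBeta

/-! ### Integrals along closed curves -/

/-- A closed `C¹` curve in the punctured plane that circles once around the origin. -/
structure IsLoop (γ : ℝ → ℂ) : Prop where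
  contDiff : ContDiff ℝ 1 γ
  closed : γ 0 = γ 1
  ne_zero : ∀ s ∈ Set.Icc (0 : ℝ) 1, γ s ≠ 0
  origin : windingNumber γ 0 = 1

theorem IsSeparatingContour.isLoop {γ : ℝ → ℂ} {A B : Set ℂ} (h : IsSeparatingContour γ A B) :
    IsLoop γ := ⟨h.contDiff, h.closed, h.ne_zero, h.origin⟩

section
variable {γ : ℝ → ℂ} {f g : ℂ → ℂ}

theorem contourIntegral_congr (h : ∀ s ∈ Set.Icc (0 : ℝ) 1, f (γ s) = g (γ s)) :
    contourIntegral γ f = contourIntegral γ g := by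
  refine intervalIntegral.integral_congr fun s hs => ?_
  rw [Set.uIcc_of_le zero_le_one] at hs
  simp only [h s hs]

theorem intervalIntegrable_contour (hγ : ContDiff ℝ 1 γ)
    (hf : ContinuousOn (fun s => f (γ s)) (Set.Icc 0 1)) :
    IntervalIntegrable (fun s => f (γ s) * deriv γ s) MeasureTheory.volume 0 1 := by
  apply ContinuousOn.intervalIntegrable
  rw [Set.uIcc_of_le zero_le_one]
  exact hf.mul (hγ.continuous_deriv le_rfl).continuousOn

theorem contourIntegral_add (hγ : ContDiff ℝ 1 γ)
    (hf : ContinuousOn (fun s => f (γ s)) (Set.Icc 0 1))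
    (hg : ContinuousOn (fun s => g (γ s)) (Set.Icc 0 1)) :
    contourIntegral γ (fun z => f z + g z) = contourIntegral γ f + contourIntegral γ g := by
  unfold contourIntegral
  rw [← intervalIntegral.integral_add (intervalIntegrable_contour hγ hf)
    (intervalIntegrable_contour hγ hg)]
  simp only [add_mul]

theorem contourIntegral_const_mul (c : ℂ) :
    contourIntegral γ (fun z => c * f z) = c * contourIntegral γ f := by
  unfold contourIntegral
  rw [← intervalIntegral.integral_const_mul]
  simp only [mul_assoc]

/-- A time at which the curve passes through w with nonzero velocity is isolated among such times,
and a discrete subset of the line is countable. -/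
theorem countable_setOf_eq_deriv_ne_zero (γ : ℝ → ℂ) (w : ℂ) :
    {s | γ s = w ∧ deriv γ s ≠ 0}.Countable := by
  have hd : DiscreteTopology {s | γ s = w ∧ deriv γ s ≠ 0} := by
    rw [discreteTopology_subtype_iff]
    rintro s ⟨hs, hs'⟩
    have h1 := (differentiableAt_of_deriv_ne_zero hs').hasDerivAt.eventually_ne (c := w) hs'
    rw [← disjoint_iff, disjoint_principal_right]
    filter_upwards [h1] with x hx hx2 using hx hx2.1
  exact Set.countable_coe_iff.1 (TopologicalSpace.separableSpace_iff_countable.1 inferInstance)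

/-- A countable set of points does not affect an integral along a curve. -/
theorem contourIntegral_congr_countable {Z : Set ℂ} (hZ : Z.Countable)
    (h : ∀ s ∈ Set.Icc (0 : ℝ) 1, γ s ∉ Z → f (γ s) = g (γ s)) :
    contourIntegral γ f = contourIntegral γ g := by
  have hc : (⋃ w ∈ Z, {s | γ s = w ∧ deriv γ s ≠ 0}).Countable :=
    hZ.biUnion fun w _ => countable_setOf_eq_deriv_ne_zero γ w
  refine intervalIntegral.integral_congr_ae ?_
  filter_upwards [hc.ae_notMem MeasureTheory.volume] with s hs hs2
  rw [Set.uIoc_of_le zero_le_one] at hs2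
  by_cases hz : γ s ∈ Z
  -- At a time spent in Z either the velocity vanishes, and with it both integrands, or the time
  -- belongs to the countable set discarded above.
  · by_cases hd : deriv γ s = 0
    · simp [hd]
    · exact absurd (Set.mem_iUnion₂.2 ⟨γ s, hz, by exact ⟨rfl, hd⟩⟩) hs
  · rw [h s ⟨hs2.1.le, hs2.2⟩ hz]

end

theorem IsLoop.exists_lift {γ : ℝ → ℂ} (h : IsLoop γ) :
    ∃ g : ℝ → ℂ, (∀ s ∈ Set.Icc (0 : ℝ) 1, HasDerivAt g (deriv γ s / γ s) s) ∧
      (∀ s ∈ Set.Icc (0 : ℝ) 1, Complex.exp (g s) = γ s) ∧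
      g 1 = g 0 + 2 * Real.pi * Complex.I := by
  have hγc := h.contDiff.continuous
  have hγ'c := h.contDiff.continuous_deriv le_rfl
  have hopen : IsOpen {s | γ s ≠ 0} := isOpen_ne_fun hγc continuous_const
  have hcont : ContinuousOn (fun s => deriv γ s / γ s) {s | γ s ≠ 0} :=
    hγ'c.continuousOn.div hγc.continuousOn fun s hs => hs
  have hg (s) (hs : s ∈ Set.Icc (0 : ℝ) 1) :
      HasDerivAt (fun s => Complex.log (γ 0) + ∫ x in (0 : ℝ)..s, deriv γ x / γ x)
        (deriv γ s / γ s) s := by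
    refine HasDerivAt.const_add _ (intervalIntegral.integral_hasDerivAt_right ?_ ?_ ?_)
    · refine (hcont.mono fun x hx => ?_).intervalIntegrable
      rw [Set.uIcc_of_le hs.1] at hx
      exact h.ne_zero x ⟨hx.1, hx.2.trans hs.2⟩
    · exact hcont.stronglyMeasurableAtFilter hopen s (h.ne_zero s hs)
    · exact hcont.continuousAt (hopen.mem_nhds (h.ne_zero s hs))
  refine ⟨_, hg, ?_, ?_⟩
  -- The function γ · exp(-G) has derivative zero and equals 1 at s = 0. The increment of G is the
  -- integral of dz/z, hence 2πi times the winding number about 0.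
  · set G := fun s => Complex.log (γ 0) + ∫ x in (0 : ℝ)..s, deriv γ x / γ x
    have hd (s) (hs : s ∈ Set.Icc (0 : ℝ) 1) :
        HasDerivAt (fun s => γ s * Complex.exp (-G s)) 0 s := by
      have h1 := ((h.contDiff.differentiable one_ne_zero) s).hasDerivAt.mul (hg s hs).neg.cexp
      convert! h1 using 1
      have := h.ne_zero s hs
      field_simp
      ring
    have hconst := constant_of_has_deriv_right_zero (a := (0 : ℝ)) (b := 1)
      (f := fun s => γ s * Complex.exp (-G s))
      (fun s hs => (hd s hs).continuousAt.continuousWithinAt)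
      (fun s hs => (hd s ⟨hs.1, hs.2.le⟩).hasDerivWithinAt)
    have h0 : γ 0 * Complex.exp (-G 0) = 1 := by
      have h00 := h.ne_zero 0 (by simp)
      simp [G, Complex.exp_neg, Complex.exp_log h00, h00]
    intro s hs
    have := hconst s hs
    simp only [h0] at this
    rw [Complex.exp_neg] at this
    have he := Complex.exp_ne_zero (G s)
    field_simp at this
    exact this.symm
  · have h1 := h.origin
    simp only [windingNumber, contourIntegral, sub_zero] at h1
    have h2 : ∫ x in (0 : ℝ)..1, deriv γ x / γ x = 2 * Real.pi * Complex.I := by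
      have h3 : (2 * Real.pi * Complex.I : ℂ) ≠ 0 := Complex.two_pi_I_ne_zero
      rw [inv_mul_eq_one₀ h3] at h1
      rw [h1]
      congr 1; ext x; ring
    simp [h2]

/-- The open annulus `r < ‖z‖ < R`. -/
def annulus (r R : ℝ) : Set ℂ := {z | r < ‖z‖ ∧ ‖z‖ < R}

theorem isOpen_annulus (r R : ℝ) : IsOpen (annulus r R) :=
  (isOpen_lt continuous_const continuous_norm).inter (isOpen_lt continuous_norm continuous_const)

theorem IsLoop.exists_annulus {γ : ℝ → ℂ} (h : IsLoop γ) :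
    ∃ r R : ℝ, 0 < r ∧ ∀ s ∈ Set.Icc (0 : ℝ) 1, γ s ∈ annulus r R := by
  have hc : IsCompact (Set.Icc (0 : ℝ) 1) := isCompact_Icc
  have hn : (Set.Icc (0 : ℝ) 1).Nonempty := ⟨0, by simp⟩
  have hcn : ContinuousOn (fun s => ‖γ s‖) (Set.Icc 0 1) := h.contDiff.continuous.norm.continuousOn
  obtain ⟨a, ha, hmin⟩ := hc.exists_isMinOn hn hcn
  obtain ⟨b, hb, hmax⟩ := hc.exists_isMaxOn hn hcn
  have hpos := norm_pos_iff.2 (h.ne_zero a ha)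
  refine ⟨‖γ a‖ / 2, ‖γ b‖ + 1, half_pos hpos, fun s hs => ⟨?_, ?_⟩⟩
  · have := hmin hs; simp only [Set.mem_ofPred_eq] at this; linarith
  · have := hmax hs; simp only [Set.mem_ofPred_eq] at this; linarith

/-- The integral of a holomorphic function along a loop in an annulus. -/
theorem exists_contourIntegral_eq {r R : ℝ} (hr : 0 < r) {f : ℂ → ℂ}
    (hf : DifferentiableOn ℂ f (annulus r R)) :
    ∃ κ : ℂ, ∀ γ : ℝ → ℂ, IsLoop γ → (∀ s ∈ Set.Icc (0 : ℝ) 1, γ s ∈ annulus r R) →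
      contourIntegral γ f = κ := by
  by_cases hR : 0 < R
  swap
  · exact ⟨0, fun γ _ hγ => absurd ((norm_nonneg _).trans_lt (hγ 0 (by simp)).2) hR⟩
  -- The strip S is the preimage of the annulus under exp. On this convex set f(exp ζ) exp ζ has a
  -- primitive K; the difference K(ζ + 2πi) - K(ζ) is constant, and it is the integral of f along
  -- every loop, since the logarithm of a loop increases by 2πi.
  set S : Set ℂ := {ζ | Real.log r < ζ.re} ∩ {ζ | ζ.re < Real.log R}
  have hSc : Convex ℝ S := (convex_halfSpace_re_gt _).inter (convex_halfSpace_re_lt _)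
  have hSo : IsOpen S :=
    (isOpen_lt continuous_const Complex.continuous_re).inter
      (isOpen_lt Complex.continuous_re continuous_const)
  have hexp (ζ : ℂ) : Complex.exp ζ ∈ annulus r R ↔ ζ ∈ S := by
    simp only [annulus, Complex.norm_exp, Set.mem_ofPred_eq, S, Set.mem_inter_iff]
    rw [Real.log_lt_iff_lt_exp hr, Real.lt_log_iff_exp_lt hR]
  have hH : DifferentiableOn ℂ (fun ζ => f (Complex.exp ζ) * Complex.exp ζ) S :=
    (hf.comp Complex.differentiable_exp.differentiableOn fun ζ hζ => (hexp ζ).2 hζ).mul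
      Complex.differentiable_exp.differentiableOn
  obtain ⟨K, hK⟩ := hSc.exists_forall_hasDerivWithinAt hH
  have hK' (ζ) (hζ : ζ ∈ S) := (hK ζ hζ).hasDerivAt (hSo.mem_nhds hζ)
  have hS2 (ζ : ℂ) : ζ + 2 * Real.pi * Complex.I ∈ S ↔ ζ ∈ S := by simp [S]
  obtain ⟨κ, hκ⟩ := hSo.exists_is_const_of_deriv_eq_zero (𝕜 := ℂ)
    (f := fun ζ => K (ζ + 2 * Real.pi * Complex.I) - K ζ) hSc.isPreconnected
    (fun ζ hζ => by
      exact (((hK' _ ((hS2 ζ).2 hζ)).comp_add_const ζ _).sub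
        (hK' ζ hζ)).differentiableAt.differentiableWithinAt)
    (fun ζ hζ => by
      refine (((hK' _ ((hS2 ζ).2 hζ)).comp_add_const ζ _).sub (hK' ζ hζ)).deriv.trans ?_
      rw [Complex.exp_periodic ζ, sub_self]; rfl)
  refine ⟨κ, fun γ hγ hγA => ?_⟩
  obtain ⟨g, hg, hge, hg1⟩ := hγ.exists_lift
  have hgS (s) (hs : s ∈ Set.Icc (0 : ℝ) 1) : g s ∈ S := by
    rw [← hexp, hge s hs]; exact hγA s hs
  have h1 := intervalIntegral.integral_eq_sub_of_hasDerivAt (a := (0 : ℝ)) (b := 1)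
    (f := fun s => K (g s)) (f' := fun s => f (γ s) * deriv γ s)
    (fun s hs => by
      rw [Set.uIcc_of_le zero_le_one] at hs
      have := (hK' _ (hgS s hs)).comp s (hg s hs)
      convert! this using 1
      rw [hge s hs]
      have := hγ.ne_zero s hs
      field_simp)
    (intervalIntegrable_contour hγ.contDiff
      (hf.continuousOn.comp hγ.contDiff.continuous.continuousOn hγA))
  rw [contourIntegral, h1, hg1]
  exact hκ (g 0) (hgS 0 (by simp))

/-! ### Independence of the contour for integrands with poles -/

section Poles

variable {r R : ℝ} {γ₁ γ₂ : ℝ → ℂ}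

theorem continuousOn_inv_prod_sub {γ : ℝ → ℂ} (hγ : Continuous γ) {l : Multiset ℂ}
    (h : ∀ a ∈ l, ∀ s ∈ Set.Icc (0 : ℝ) 1, γ s ≠ a) :
    ContinuousOn (fun s => ((l.map fun a => γ s - a).prod)⁻¹) (Set.Icc 0 1) := by
  have h1 : Continuous fun s => (l.map fun a => γ s - a).prod := by
    induction l using Multiset.induction with
    | empty => simpa using continuous_const
    | cons a l ih =>
      simp only [Multiset.map_cons, Multiset.prod_cons]
      exact (hγ.sub continuous_const).mul (ih fun b hb => h b (Multiset.mem_cons_of_mem hb))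
  refine h1.continuousOn.inv₀ fun s hs => ?_
  rw [Ne, Multiset.prod_eq_zero_iff, Multiset.mem_map]
  rintro ⟨a, ha, hs0⟩
  exact h a ha s hs (sub_eq_zero.1 hs0)

/-- A pole of order at least two, without lower terms, has a single-valued primitive. -/
theorem contourIntegral_pow_inv_eq_zero {γ : ℝ → ℂ} (hγ : IsLoop γ) {a : ℂ}
    (ha : ∀ s ∈ Set.Icc (0 : ℝ) 1, γ s ≠ a) {n : ℕ} (hn : n ≠ 0) :
    contourIntegral γ (fun z => ((z - a) ^ (n + 1))⁻¹) = 0 := by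
  have hd (s) (hs : s ∈ Set.Icc (0 : ℝ) 1) : HasDerivAt (fun s => -(n : ℂ)⁻¹ * ((γ s - a) ^ n)⁻¹)
      (((γ s - a) ^ (n + 1))⁻¹ * deriv γ s) s := by
    have hne : γ s - a ≠ 0 := sub_ne_zero.2 (ha s hs)
    have h1 := ((((hγ.contDiff.differentiable one_ne_zero) s).hasDerivAt.sub_const a).pow n).inv
      (pow_ne_zero n hne)
    convert! h1.const_mul (-(n : ℂ)⁻¹) using 1
    obtain ⟨m, rfl⟩ := Nat.exists_eq_succ_of_ne_zero hn
    have : ((m + 1 : ℕ) : ℂ) ≠ 0 := by exact_mod_cast m.succ_ne_zero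
    simp only [Nat.succ_eq_add_one, Nat.add_sub_cancel, Pi.pow_apply]
    field_simp
    ring
  have := intervalIntegral.integral_eq_sub_of_hasDerivAt (a := (0 : ℝ)) (b := 1)
    (fun s hs => hd s (by rwa [Set.uIcc_of_le zero_le_one] at hs))
    (intervalIntegrable_contour hγ.contDiff (f := fun z => ((z - a) ^ (n + 1))⁻¹)
      (((hγ.contDiff.continuous.sub continuous_const).pow _).continuousOn.inv₀
        fun s hs => pow_ne_zero _ (sub_ne_zero.2 (ha s hs))))
  rw [contourIntegral, this, hγ.closed, sub_self]

/-- Induction on the number of poles. Two different poles a, b are separated by the partial fraction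
1/((z-a)(z-b)) = (1/(z-a) - 1/(z-b))/(a-b). If all poles coincide, the integral is a winding number
or, for higher order, zero. -/
theorem contourIntegral_inv_prod_sub (h₁ : IsLoop γ₁) (h₂ : IsLoop γ₂) (n : ℕ) :
    ∀ l : Multiset ℂ, l.card = n → (∀ a ∈ l, ∀ s ∈ Set.Icc (0 : ℝ) 1, γ₁ s ≠ a ∧ γ₂ s ≠ a) →
      (∀ a ∈ l, windingNumber γ₁ a = windingNumber γ₂ a) →
      contourIntegral γ₁ (fun z => ((l.map fun a => z - a).prod)⁻¹) =
        contourIntegral γ₂ (fun z => ((l.map fun a => z - a).prod)⁻¹) := by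
  induction n with
  | zero =>
    intro l hl _ _
    rw [Multiset.card_eq_zero] at hl
    subst hl
    have h (γ : ℝ → ℂ) (hγ : IsLoop γ) : contourIntegral γ (fun _ => 1) = 0 := by
      have := intervalIntegral.integral_eq_sub_of_hasDerivAt (a := (0 : ℝ)) (b := 1)
        (fun s _ => ((hγ.contDiff.differentiable one_ne_zero) s).hasDerivAt)
        ((hγ.contDiff.continuous_deriv le_rfl).intervalIntegrable _ _)
      simp only [contourIntegral, one_mul, this, hγ.closed, sub_self]
    simp [h γ₁ h₁, h γ₂ h₂]
  | succ n ih =>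
    intro l hl hav hw
    obtain ⟨a, ha⟩ := Multiset.exists_mem_of_ne_zero (s := l) (by rintro rfl; simp at hl)
    obtain ⟨m, rfl⟩ := Multiset.exists_cons_of_mem ha
    have hm : m.card = n := by simpa using hl
    by_cases hall : ∀ b ∈ m, b = a
    · obtain rfl : m = Multiset.replicate n a := Multiset.eq_replicate.2 ⟨hm, hall⟩
      simp only [Multiset.map_cons, Multiset.map_replicate, Multiset.prod_cons,
        Multiset.prod_replicate, ← pow_succ']
      rcases Nat.eq_zero_or_pos n with rfl | hn
      · have := hw a (Multiset.mem_cons_self _ _)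
        rw [windingNumber, windingNumber] at this
        simpa [Complex.two_pi_I_ne_zero, Real.pi_ne_zero] using this
      · rw [contourIntegral_pow_inv_eq_zero h₁ (fun s hs => (hav a (Multiset.mem_cons_self _ _) s hs).1)
          hn.ne', contourIntegral_pow_inv_eq_zero h₂
            (fun s hs => (hav a (Multiset.mem_cons_self _ _) s hs).2) hn.ne']
    · push Not at hall
      obtain ⟨b, hb, hba⟩ := hall
      obtain ⟨m', rfl⟩ := Multiset.exists_cons_of_mem hb
      have key (γ : ℝ → ℂ) (hγ : IsLoop γ)
          (hav : ∀ c ∈ a ::ₘ b ::ₘ m', ∀ s ∈ Set.Icc (0 : ℝ) 1, γ s ≠ c) :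
          contourIntegral γ (fun z => (((a ::ₘ b ::ₘ m').map fun a => z - a).prod)⁻¹) =
            (a - b)⁻¹ * contourIntegral γ (fun z => (((a ::ₘ m').map fun a => z - a).prod)⁻¹) +
            -(a - b)⁻¹ * contourIntegral γ (fun z => (((b ::ₘ m').map fun a => z - a).prod)⁻¹) := by
        have hc := hγ.contDiff.continuous
        rw [← contourIntegral_const_mul, ← contourIntegral_const_mul,
          ← contourIntegral_add hγ.contDiff]
        · refine contourIntegral_congr fun s hs => ?_
          simp only [Multiset.map_cons, Multiset.prod_cons, mul_inv]
          have h1 : γ s - a ≠ 0 := sub_ne_zero.2 (hav a (by simp) s hs)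
          have h2 : γ s - b ≠ 0 := sub_ne_zero.2 (hav b (by simp) s hs)
          have h3 : a - b ≠ 0 := sub_ne_zero.2 hba.symm
          field_simp
          ring
        · refine continuousOn_const.mul (continuousOn_inv_prod_sub hc fun c hc => hav c ?_)
          simp only [Multiset.mem_cons] at hc ⊢; tauto
        · refine continuousOn_const.mul (continuousOn_inv_prod_sub hc fun c hc => hav c ?_)
          simp only [Multiset.mem_cons] at hc ⊢; tauto
      rw [key γ₁ h₁ fun c hc s hs => (hav c hc s hs).1,
        key γ₂ h₂ fun c hc s hs => (hav c hc s hs).2]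
      have hcard : m'.card + 1 = n := by simpa using hm
      rw [ih (a ::ₘ m') (by simpa using hcard)
          (fun c hc => hav c (by simp only [Multiset.mem_cons] at hc ⊢; tauto))
          (fun c hc => hw c (by simp only [Multiset.mem_cons] at hc ⊢; tauto)),
        ih (b ::ₘ m') (by simpa using hcard)
          (fun c hc => hav c (by simp only [Multiset.mem_cons] at hc ⊢; tauto))
          (fun c hc => hw c (by simp only [Multiset.mem_cons] at hc ⊢; tauto))]

/-- A pole a inside the annulus is removed by writing f(z) = f(a) + (z-a) · `dslope f a z`, which
leaves a constant numerator and a shorter product. A pole outside the annulus is absorbed into the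
holomorphic factor. -/
theorem contourIntegral_mul_inv_prod_sub (hr : 0 < r) (h₁ : IsLoop γ₁) (h₂ : IsLoop γ₂)
    (hA₁ : ∀ s ∈ Set.Icc (0 : ℝ) 1, γ₁ s ∈ annulus r R)
    (hA₂ : ∀ s ∈ Set.Icc (0 : ℝ) 1, γ₂ s ∈ annulus r R) (l : Multiset ℂ) :
    ∀ f : ℂ → ℂ, DifferentiableOn ℂ f (annulus r R) →
      (∀ a ∈ l, ∀ s ∈ Set.Icc (0 : ℝ) 1, γ₁ s ≠ a ∧ γ₂ s ≠ a) →
      (∀ a ∈ l, windingNumber γ₁ a = windingNumber γ₂ a) →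
      contourIntegral γ₁ (fun z => f z * ((l.map fun a => z - a).prod)⁻¹) =
        contourIntegral γ₂ (fun z => f z * ((l.map fun a => z - a).prod)⁻¹) := by
  induction l using Multiset.induction with
  | empty =>
    intro f hf _ _
    obtain ⟨κ, hκ⟩ := exists_contourIntegral_eq hr hf
    simp [hκ γ₁ h₁ hA₁, hκ γ₂ h₂ hA₂]
  | cons a l ih =>
    intro f hf hav hw
    have hav' := fun c hc => hav c (Multiset.mem_cons_of_mem hc)
    have hw' := fun c hc => hw c (Multiset.mem_cons_of_mem hc)
    by_cases ha : a ∈ annulus r R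
    · have hds : DifferentiableOn ℂ (dslope f a) (annulus r R) :=
        (Complex.differentiableOn_dslope ((isOpen_annulus r R).mem_nhds ha)).2 hf
      have key (γ : ℝ → ℂ) (hγ : IsLoop γ) (hA : ∀ s ∈ Set.Icc (0 : ℝ) 1, γ s ∈ annulus r R)
          (hav : ∀ c ∈ a ::ₘ l, ∀ s ∈ Set.Icc (0 : ℝ) 1, γ s ≠ c) :
          contourIntegral γ (fun z => f z * (((a ::ₘ l).map fun a => z - a).prod)⁻¹) =
            contourIntegral γ (fun z => dslope f a z * ((l.map fun a => z - a).prod)⁻¹) +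
            f a * contourIntegral γ (fun z => (((a ::ₘ l).map fun a => z - a).prod)⁻¹) := by
        have hc := hγ.contDiff.continuous
        rw [← contourIntegral_const_mul, ← contourIntegral_add hγ.contDiff]
        · refine contourIntegral_congr fun s hs => ?_
          simp only [Multiset.map_cons, Multiset.prod_cons, mul_inv]
          have h1 : γ s - a ≠ 0 := sub_ne_zero.2 (hav a (by simp) s hs)
          rw [dslope_of_ne _ (hav a (by simp) s hs), slope_def_field]
          field_simp
          ring
        · exact (hds.continuousOn.comp hc.continuousOn hA).mul
            (continuousOn_inv_prod_sub hc fun c hc => hav c (Multiset.mem_cons_of_mem hc))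
        · exact continuousOn_const.mul (continuousOn_inv_prod_sub hc hav)
      rw [key γ₁ h₁ hA₁ fun c hc s hs => (hav c hc s hs).1,
        key γ₂ h₂ hA₂ fun c hc s hs => (hav c hc s hs).2, ih _ hds hav' hw',
        contourIntegral_inv_prod_sub h₁ h₂ _ _ rfl hav hw]
    · have hf' : DifferentiableOn ℂ (fun z => f z * (z - a)⁻¹) (annulus r R) := by
        refine hf.mul (DifferentiableOn.inv (by fun_prop) fun z hz => sub_ne_zero.2 ?_)
        rintro rfl; exact ha hz
      simpa only [Multiset.map_cons, Multiset.prod_cons, mul_inv, mul_assoc] using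
        ih _ hf' hav' hw'

end Poles

/-! ### Zeros of holomorphic functions in the punctured plane -/

theorem isPreconnected_compl_zero : IsPreconnected ({0}ᶜ : Set ℂ) :=
  (isConnected_compl_singleton_of_one_lt_rank (by simp) (0 : ℂ)).isPreconnected

theorem analyticOnNhd_compl_zero {D : ℂ → ℂ} (hD : DifferentiableOn ℂ D {0}ᶜ) :
    AnalyticOnNhd ℂ D {0}ᶜ :=
  hD.analyticOnNhd isOpen_compl_singleton

theorem finite_zeros_annulus {r : ℝ} (R : ℝ) (hr : 0 < r) {D : ℂ → ℂ}
    (hD : DifferentiableOn ℂ D {0}ᶜ) (hw : ∃ w ≠ 0, D w ≠ 0) :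
    {z | r ≤ ‖z‖ ∧ ‖z‖ ≤ R ∧ D z = 0}.Finite := by
  by_contra hinf
  have hK : IsCompact {z : ℂ | r ≤ ‖z‖ ∧ ‖z‖ ≤ R} := by
    refine (isCompact_closedBall (0 : ℂ) R).of_isClosed_subset ?_ fun z hz => by
      simpa using hz.2
    exact (isClosed_le continuous_const continuous_norm).inter
      (isClosed_le continuous_norm continuous_const)
  obtain ⟨a, haK, ha⟩ := Set.Infinite.exists_accPt_of_subset_isCompact hinf hK
    fun z hz => ⟨hz.1, hz.2.1⟩
  have ha0 : a ≠ 0 := by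
    rintro rfl
    have := haK.1
    simp only [norm_zero] at this
    linarith
  obtain ⟨w, hw0, hw⟩ := hw
  refine hw ((analyticOnNhd_compl_zero hD).eqOn_zero_of_preconnected_of_frequently_eq_zero
    isPreconnected_compl_zero ha0 ?_ hw0)
  exact (accPt_iff_frequently_nhdsNE.1 ha).mono fun z hz => hz.2.2

/-- The zeros of a holomorphic function in an annulus can be split off. -/
theorem exists_eq_prod_sub_mul {r R : ℝ} (hr : 0 < r) (n : ℕ) :
    ∀ D : ℂ → ℂ, DifferentiableOn ℂ D {0}ᶜ → (∃ w ≠ 0, D w ≠ 0) →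
    {z | r ≤ ‖z‖ ∧ ‖z‖ ≤ R ∧ D z = 0}.ncard = n →
    ∃ (l : Multiset ℂ) (k : ℂ → ℂ), (∀ a ∈ l, a ≠ 0 ∧ D a = 0) ∧ DifferentiableOn ℂ k {0}ᶜ ∧
      (∀ z ∈ annulus r R, k z ≠ 0) ∧ ∀ z ≠ 0, D z = (l.map fun a => z - a).prod * k z := by
  induction n with
  | zero =>
    intro D hD hw hn
    refine ⟨0, D, by simp, hD, fun z hz hz0 => ?_, by simp⟩
    rw [Set.ncard_eq_zero (finite_zeros_annulus R hr hD hw)] at hn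
    exact (Set.ext_iff.1 hn z).1 ⟨hz.1.le, hz.2.le, hz0⟩
  | succ n ih =>
    intro D hD hw hn
    obtain ⟨a, ha⟩ : {z | r ≤ ‖z‖ ∧ ‖z‖ ≤ R ∧ D z = 0}.Nonempty := by
      rw [← Set.ncard_pos (Set.finite_of_ncard_ne_zero (by omega))]; omega
    have ha0 : a ≠ 0 := by
      rintro rfl
      have := ha.1
      simp only [norm_zero] at this
      linarith
    have hDa := analyticOnNhd_compl_zero hD a ha0
    obtain ⟨m, g, hg, hg0, hgD⟩ : ∃ (m : ℕ) (g : ℂ → ℂ), AnalyticAt ℂ g a ∧ g a ≠ 0 ∧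
        ∀ᶠ z in 𝓝 a, D z = (z - a) ^ m • g z := by
      refine hDa.exists_eventuallyEq_pow_smul_nonzero_iff.2 fun h => ?_
      obtain ⟨w, hw0, hw⟩ := hw
      exact hw ((analyticOnNhd_compl_zero hD).eqOn_zero_of_preconnected_of_eventuallyEq_zero
        isPreconnected_compl_zero ha0 h hw0)
    have hm : m ≠ 0 := by
      rintro rfl
      have := hgD.self_of_nhds
      simp only [pow_zero, one_smul] at this
      exact hg0 (this ▸ ha.2.2)
    -- The full power of z - a is divided out, with the missing value at a filled in. The induction
    -- counts distinct zeros, so removing a with its multiplicity lowers the count by exactly one.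
    set D₁ : ℂ → ℂ := Function.update (fun z => D z / (z - a) ^ m) a (g a) with hD₁
    have hD₁a : D₁ a = g a := by simp [hD₁]
    have hD₁z (z) (hz : z ≠ a) : D₁ z = D z / (z - a) ^ m := by simp [hD₁, hz]
    have hfac (z) : D z = (z - a) ^ m * D₁ z := by
      by_cases hz : z = a
      · subst hz; rw [sub_self, zero_pow hm, zero_mul]; exact ha.2.2
      · rw [hD₁z z hz, mul_div_cancel₀]
        exact pow_ne_zero _ (sub_ne_zero.2 hz)
    have hdiff : DifferentiableOn ℂ D₁ {0}ᶜ := by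
      intro z hz
      by_cases hza : z = a
      · subst hza
        have : D₁ =ᶠ[𝓝 z] g := by
          filter_upwards [hgD] with y hy
          by_cases hyz : y = z
          · rw [hyz, hD₁a]
          · rw [hD₁z y hyz, hy, smul_eq_mul, mul_div_cancel_left₀]
            exact pow_ne_zero _ (sub_ne_zero.2 hyz)
        exact (hg.differentiableAt.congr_of_eventuallyEq this).differentiableWithinAt
      · have h1 : DifferentiableAt ℂ (fun z => D z / (z - a) ^ m) z :=
          (hD.differentiableAt (isOpen_compl_singleton.mem_nhds hz)).div (by fun_prop)
            (pow_ne_zero _ (sub_ne_zero.2 hza))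
        refine (h1.congr_of_eventuallyEq ?_).differentiableWithinAt
        filter_upwards [isOpen_ne.mem_nhds hza] with y hy using hD₁z y hy
    have hset : {z | r ≤ ‖z‖ ∧ ‖z‖ ≤ R ∧ D z = 0}
        = insert a {z | r ≤ ‖z‖ ∧ ‖z‖ ≤ R ∧ D₁ z = 0} := by
      ext z
      simp only [Set.mem_insert_iff, Set.mem_ofPred_eq]
      by_cases hza : z = a
      · subst hza; simpa using ha
      · rw [hfac, mul_eq_zero]; simp [hza, sub_eq_zero]
    have hna : a ∉ {z | r ≤ ‖z‖ ∧ ‖z‖ ≤ R ∧ D₁ z = 0} := fun h => hg0 (hD₁a ▸ h.2.2)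
    have hw₁ : ∃ w ≠ 0, D₁ w ≠ 0 := ⟨a, ha0, by rwa [hD₁a]⟩
    rw [hset, Set.ncard_insert_of_notMem hna (finite_zeros_annulus R hr hdiff hw₁)] at hn
    obtain ⟨l, k, hl, hk, hk0, hlk⟩ := ih D₁ hdiff hw₁ (by omega)
    refine ⟨Multiset.replicate m a + l, k, fun b hb => ?_, hk, hk0, fun z hz => ?_⟩
    · rcases Multiset.mem_add.1 hb with hb | hb
      · rw [Multiset.eq_of_mem_replicate hb]; exact ⟨ha0, ha.2.2⟩
      · exact ⟨(hl b hb).1, by rw [hfac, (hl b hb).2, mul_zero]⟩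
    · rw [hfac, hlk z hz]; simp [mul_assoc]

/-- Two loops with the same winding numbers about all poles give the same integral. -/
theorem contourIntegral_div_eq {N D : ℂ → ℂ} (hN : DifferentiableOn ℂ N {0}ᶜ)
    (hD : DifferentiableOn ℂ D {0}ᶜ) {γ₁ γ₂ : ℝ → ℂ} (h₁ : IsLoop γ₁) (h₂ : IsLoop γ₂)
    (hD₁ : ∀ s ∈ Set.Icc (0 : ℝ) 1, D (γ₁ s) ≠ 0) (hD₂ : ∀ s ∈ Set.Icc (0 : ℝ) 1, D (γ₂ s) ≠ 0)
    (hw : ∀ a ≠ 0, D a = 0 → windingNumber γ₁ a = windingNumber γ₂ a) :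
    contourIntegral γ₁ (fun z => N z / D z) = contourIntegral γ₂ (fun z => N z / D z) := by
  obtain ⟨r₁, R₁, hr₁, hA₁⟩ := h₁.exists_annulus
  obtain ⟨r₂, R₂, hr₂, hA₂⟩ := h₂.exists_annulus
  set r := min r₁ r₂
  set R := max R₁ R₂
  have hr : 0 < r := lt_min hr₁ hr₂
  have hA₁' (s) (hs : s ∈ Set.Icc (0 : ℝ) 1) : γ₁ s ∈ annulus r R :=
    ⟨(min_le_left _ _).trans_lt (hA₁ s hs).1, (hA₁ s hs).2.trans_le (le_max_left _ _)⟩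
  have hA₂' (s) (hs : s ∈ Set.Icc (0 : ℝ) 1) : γ₂ s ∈ annulus r R :=
    ⟨(min_le_right _ _).trans_lt (hA₂ s hs).1, (hA₂ s hs).2.trans_le (le_max_right _ _)⟩
  have h01 : (0 : ℝ) ∈ Set.Icc (0 : ℝ) 1 := by simp
  -- Both curves lie in one annulus, where D is a polynomial with the zeros of D times a
  -- nonvanishing factor k; then N/k is holomorphic there and only finitely many poles are left.
  obtain ⟨l, k, hl, hk, hk0, hlk⟩ := exists_eq_prod_sub_mul (R := R) hr _ D hD
    ⟨γ₁ 0, h₁.ne_zero 0 h01, hD₁ 0 h01⟩ rfl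
  have hsub : annulus r R ⊆ {0}ᶜ := by
    rintro z hz rfl
    have := hz.1
    simp only [norm_zero] at this
    linarith
  have := contourIntegral_mul_inv_prod_sub hr h₁ h₂ hA₁' hA₂' l (fun z => N z / k z)
    ((hN.mono hsub).div (hk.mono hsub) hk0)
    (fun a ha s hs => ⟨fun h => hD₁ s hs (h ▸ (hl a ha).2), fun h => hD₂ s hs (h ▸ (hl a ha).2)⟩)
    (fun a ha => hw a (hl a ha).1 (hl a ha).2)
  have e (γ : ℝ → ℂ) (hγ : IsLoop γ) :
      contourIntegral γ (fun z => N z / D z) =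
        contourIntegral γ (fun z => N z / k z * ((l.map fun a => z - a).prod)⁻¹) :=
    contourIntegral_congr fun s hs => by
      rw [hlk _ (hγ.ne_zero s hs), ← div_eq_mul_inv, div_div, mul_comm]
  rw [e γ₁ h₁, e γ₂ h₂, this]

end EllipticBeta
end

noncomputable section
namespace EllipticBeta

/-! ### Winding numbers of star-shaped curves -/

/-- The hypotheses say that the curve does not meet the segment from w to a. Then 1 - (a-w)/(γ-w)
stays in the slit plane, and its principal logarithm is a single-valued primitive of the difference
of the two integrands. -/
theorem windingNumber_eq_of_forall_ne {γ : ℝ → ℂ} (hγ : ContDiff ℝ 1 γ) (hc : γ 0 = γ 1) {w a : ℂ}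
    (hw : ∀ s ∈ Set.Icc (0 : ℝ) 1, γ s ≠ w)
    (ha : ∀ s ∈ Set.Icc (0 : ℝ) 1, ∀ x : ℝ, 1 ≤ x → a - w ≠ x * (γ s - w)) :
    windingNumber γ a = windingNumber γ w := by
  have hne (s) (hs : s ∈ Set.Icc (0 : ℝ) 1) : γ s - a ≠ 0 := fun h0 =>
    ha s hs 1 le_rfl (by push_cast; linear_combination -h0)
  have hd (s) (hs : s ∈ Set.Icc (0 : ℝ) 1) :
      HasDerivAt (fun s => Complex.log (1 - (a - w) / (γ s - w)))
        ((γ s - a)⁻¹ * deriv γ s + -1 * (γ s - w)⁻¹ * deriv γ s) s := by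
    have h0 := sub_ne_zero.2 (hw s hs)
    have hsl : 1 - (a - w) / (γ s - w) ∈ Complex.slitPlane := by
      rw [Complex.mem_slitPlane_iff]
      by_contra! hc
      refine ha s hs ((a - w) / (γ s - w)).re ?_ ?_
      · have := hc.1; simp only [Complex.sub_re, Complex.one_re] at this; linarith
      · have h2 := hc.2
        simp only [Complex.sub_im, Complex.one_im, zero_sub, neg_eq_zero] at h2
        have : (((a - w) / (γ s - w)).re : ℂ) = (a - w) / (γ s - w) :=
          Complex.ext (by simp) (by simp [h2])
        rw [this, div_mul_cancel₀ _ h0]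
    have h1 := ((((hγ.differentiable one_ne_zero) s).hasDerivAt.sub_const w |>.inv h0).const_mul
      (a - w)).const_sub 1
    have h2 : HasDerivAt (fun s => 1 - (a - w) / (γ s - w))
        (-((a - w) * (-deriv γ s / (γ s - w) ^ 2))) s := by
      simpa only [div_eq_mul_inv, Pi.inv_apply] using h1
    have h2 := h2.clog_real hsl
    convert! h2 using 1
    have h3 : 1 - (a - w) / (γ s - w) ≠ 0 := Complex.slitPlane_ne_zero hsl
    have h4 := hne s hs
    rw [show 1 - (a - w) / (γ s - w) = (γ s - a) / (γ s - w) by field_simp; ring]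
    field_simp
    ring
  have hI1 := intervalIntegrable_contour hγ (f := fun z => (z - a)⁻¹)
    ((hγ.continuous.sub continuous_const).continuousOn.inv₀ hne)
  have hI2 := intervalIntegrable_contour hγ (f := fun z => -1 * (z - w)⁻¹)
    (continuousOn_const.mul ((hγ.continuous.sub continuous_const).continuousOn.inv₀
      fun s hs => sub_ne_zero.2 (hw s hs)))
  have key := intervalIntegral.integral_eq_sub_of_hasDerivAt (a := (0 : ℝ)) (b := 1)
    (fun s hs => hd s (by rwa [Set.uIcc_of_le zero_le_one] at hs)) (hI1.add hI2)
  rw [intervalIntegral.integral_add hI1 hI2, hc, sub_self] at key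
  have h5 : contourIntegral γ (fun z => -1 * (z - w)⁻¹)
    = -1 * contourIntegral γ (fun z => (z - w)⁻¹) := contourIntegral_const_mul _
  unfold windingNumber
  congr 1
  unfold contourIntegral at h5 ⊢
  rw [h5] at key
  linear_combination key

theorem IsLoop.windingNumber_eq_one {γ : ℝ → ℂ} (h : IsLoop γ) {a : ℂ}
    (ha : ∀ s ∈ Set.Icc (0 : ℝ) 1, ∀ x : ℝ, 1 ≤ x → a ≠ x * γ s) : windingNumber γ a = 1 := by
  rw [windingNumber_eq_of_forall_ne h.contDiff h.closed h.ne_zero (by simpa using ha), h.origin]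

/-- The curve misses the ray from b away from the origin, so log(1 - γ/b) is a single-valued
primitive. -/
theorem windingNumber_eq_zero {γ : ℝ → ℂ} (hγ : ContDiff ℝ 1 γ) (hc : γ 0 = γ 1) {b : ℂ}
    (hb0 : b ≠ 0) (hb : ∀ s ∈ Set.Icc (0 : ℝ) 1, ∀ x : ℝ, 1 ≤ x → γ s ≠ x * b) :
    windingNumber γ b = 0 := by
  have hne (s) (hs : s ∈ Set.Icc (0 : ℝ) 1) : γ s - b ≠ 0 := fun h0 =>
    hb s hs 1 le_rfl (by push_cast; linear_combination h0)
  have hd (s) (hs : s ∈ Set.Icc (0 : ℝ) 1) :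
      HasDerivAt (fun s => Complex.log (1 - γ s / b)) ((γ s - b)⁻¹ * deriv γ s) s := by
    have hsl : 1 - γ s / b ∈ Complex.slitPlane := by
      rw [Complex.mem_slitPlane_iff]
      by_contra! hc
      refine hb s hs (γ s / b).re ?_ ?_
      · have := hc.1; simp only [Complex.sub_re, Complex.one_re] at this; linarith
      · have h2 := hc.2
        simp only [Complex.sub_im, Complex.one_im, zero_sub, neg_eq_zero] at h2
        have : ((γ s / b).re : ℂ) = γ s / b := Complex.ext (by simp) (by simp [h2])
        rw [this, div_mul_cancel₀ _ hb0]
    have h2 := HasDerivAt.clog_real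
      ((((hγ.differentiable one_ne_zero) s).hasDerivAt.div_const b).const_sub 1) hsl
    convert! h2 using 1
    have h4 := hne s hs
    have h5 : b - γ s ≠ 0 := fun h => h4 (by linear_combination -h)
    rw [show 1 - γ s / b = (b - γ s) / b by field_simp]
    field_simp
    ring
  have hI1 := intervalIntegrable_contour hγ (f := fun z => (z - b)⁻¹)
    ((hγ.continuous.sub continuous_const).continuousOn.inv₀ hne)
  have key := intervalIntegral.integral_eq_sub_of_hasDerivAt (a := (0 : ℝ)) (b := 1)
    (fun s hs => hd s (by rwa [Set.uIcc_of_le zero_le_one] at hs)) hI1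
  rw [windingNumber, contourIntegral, key, hc, sub_self, mul_zero]

/-- The star-shaped curve `r(u) u`, `u` on the unit circle, with `r = exp ∘ h`. -/
def starCurve (h : ℂ → ℝ) (s : ℝ) : ℂ :=
  Complex.exp (h (Complex.exp (2 * Real.pi * Complex.I * s)) + 2 * Real.pi * Complex.I * s)

theorem starCurve_eq (h : ℂ → ℝ) (s : ℝ) : starCurve h s =
    Complex.exp (h (Complex.exp (2 * Real.pi * Complex.I * s))) *
      Complex.exp (2 * Real.pi * Complex.I * s) := Complex.exp_add _ _

theorem starCurve_ne_zero (h : ℂ → ℝ) (s : ℝ) : starCurve h s ≠ 0 := Complex.exp_ne_zero _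

theorem norm_exp_two_pi (s : ℝ) : ‖Complex.exp (2 * Real.pi * Complex.I * s)‖ = 1 := by
  rw [Complex.norm_exp]; simp

theorem norm_starCurve (h : ℂ → ℝ) (s : ℝ) : ‖starCurve h s‖ =
    Real.exp (h (Complex.exp (2 * Real.pi * Complex.I * s))) := by
  rw [starCurve_eq, norm_mul, norm_exp_two_pi, mul_one, Complex.norm_exp, Complex.ofReal_re]

theorem isLoop_starCurve {h : ℂ → ℝ} (hh : ContDiff ℝ 1 h) : IsLoop (starCurve h) := by
  have hlin : ContDiff ℝ 1 fun s : ℝ => (2 * Real.pi * Complex.I * s : ℂ) :=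
    contDiff_const.mul Complex.ofRealCLM.contDiff
  have hexp : ContDiff ℝ 1 fun s : ℝ => Complex.exp (2 * Real.pi * Complex.I * s) := hlin.cexp
  have harg : ContDiff ℝ 1 fun s : ℝ => ((h (Complex.exp (2 * Real.pi * Complex.I * s)) : ℝ) : ℂ) +
      2 * Real.pi * Complex.I * s :=
    (Complex.ofRealCLM.contDiff.comp (hh.comp hexp)).add hlin
  have hcd : ContDiff ℝ 1 (starCurve h) := harg.cexp
  have hclosed : starCurve h 0 = starCurve h 1 := by
    simp [starCurve_eq]
  refine ⟨hcd, hclosed, fun s _ => starCurve_ne_zero h s, ?_⟩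
  have hd (s : ℝ) : deriv (starCurve h) s = starCurve h s * deriv (fun s : ℝ =>
      ((h (Complex.exp (2 * Real.pi * Complex.I * s)) : ℝ) : ℂ) + 2 * Real.pi * Complex.I * s) s :=
    ((harg.differentiable one_ne_zero s).hasDerivAt.cexp).deriv
  have : contourIntegral (starCurve h) (fun z => (z - 0)⁻¹) = 2 * Real.pi * Complex.I := by
    unfold contourIntegral
    have e : ∀ s : ℝ, (starCurve h s - 0)⁻¹ * deriv (starCurve h) s = deriv (fun s : ℝ =>
      ((h (Complex.exp (2 * Real.pi * Complex.I * s)) : ℝ) : ℂ) + 2 * Real.pi * Complex.I * s) s := by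
      intro s
      rw [hd, sub_zero, inv_mul_cancel_left₀ (starCurve_ne_zero h s)]
    simp only [e]
    rw [intervalIntegral.integral_eq_sub_of_hasDerivAt
      (fun s _ => (harg.differentiable one_ne_zero s).hasDerivAt)
      ((harg.continuous_deriv le_rfl).intervalIntegrable _ _)]
    simp
  rw [windingNumber, this, inv_mul_cancel₀ Complex.two_pi_I_ne_zero]

/-- The circle of radius `R` around the origin. -/
def circleCurve (R : ℝ) : ℝ → ℂ := starCurve fun _ => Real.log R

theorem circleCurve_eq {R : ℝ} (hR : 0 < R) (s : ℝ) :
    circleCurve R s = circleMap 0 R (2 * Real.pi * s) := by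
  rw [circleCurve, starCurve_eq, circleMap, ← Complex.ofReal_exp, Real.exp_log hR]
  push_cast; ring_nf

theorem norm_circleCurve {R : ℝ} (hR : 0 < R) (s : ℝ) : ‖circleCurve R s‖ = R := by
  rw [circleCurve, norm_starCurve, Real.exp_log hR]

theorem isLoop_circleCurve (R : ℝ) : IsLoop (circleCurve R) := isLoop_starCurve contDiff_const

theorem windingNumber_circleCurve_of_lt {R : ℝ} (hR : 0 < R) {a : ℂ} (ha : ‖a‖ < R) :
    windingNumber (circleCurve R) a = 1 :=
  (isLoop_circleCurve R).windingNumber_eq_one fun s _ x hx h => by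
    rw [h, norm_mul, norm_circleCurve hR, Complex.norm_real, Real.norm_of_nonneg (by linarith)] at ha
    nlinarith

theorem windingNumber_circleCurve_of_gt {R : ℝ} (hR : 0 < R) {a : ℂ} (ha : R < ‖a‖) :
    windingNumber (circleCurve R) a = 0 :=
  windingNumber_eq_zero (isLoop_circleCurve R).contDiff (isLoop_circleCurve R).closed
    (norm_pos_iff.1 (hR.trans ha)) fun s _ x hx h => by
      have := congr_arg norm h
      rw [norm_circleCurve hR, norm_mul, Complex.norm_real, Real.norm_of_nonneg (by linarith)] at this
      nlinarith

theorem contourIntegral_circleCurve {R : ℝ} (hR : 0 < R) (f : ℂ → ℂ) :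
    contourIntegral (circleCurve R) f = ∮ z in C(0, R), f z := by
  have h1 : circleCurve R = fun s => circleMap 0 R (2 * Real.pi * s) := funext (circleCurve_eq hR)
  have h2 (s : ℝ) : deriv (circleCurve R) s
      = 2 * Real.pi * deriv (circleMap 0 R) (2 * Real.pi * s) := by
    rw [h1]
    have := ((differentiable_circleMap 0 R) (2 * Real.pi * s)).hasDerivAt.scomp s
      ((hasDerivAt_id s).const_mul (2 * Real.pi))
    convert! this.deriv using 1
    simp
  unfold contourIntegral circleIntegral
  simp only [h2]
  have h3 := intervalIntegral.integral_comp_mul_left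
    (fun θ => deriv (circleMap 0 R) θ • f (circleMap 0 R θ)) (c := 2 * Real.pi) (a := 0) (b := 1)
    (by positivity)
  rw [mul_zero, mul_one] at h3
  rw [eq_inv_smul_iff₀ (by positivity)] at h3
  rw [← h3, ← intervalIntegral.integral_smul]
  refine intervalIntegral.integral_congr fun s _ => ?_
  simp only [circleCurve_eq hR, smul_eq_mul, Complex.real_smul]
  push_cast
  have : (Real.pi : ℂ) ≠ 0 := by exact_mod_cast Real.pi_ne_zero
  field_simp

/-! ### Existence of contours -/

theorem exists_separating_radius {A B : Set ℝ} (hA : ∀ y, {a ∈ A | y ≤ a}.Finite)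
    (hB : ∀ y, {b ∈ B | b ≤ y}.Finite) (hAB : ∀ a ∈ A, ∀ b ∈ B, a < b) :
    ∃ y, (∀ a ∈ A, a < y) ∧ ∀ b ∈ B, y < b := by
  classical
  rcases B.eq_empty_or_nonempty with rfl | ⟨b₀, hb₀⟩
  · obtain ⟨M, hM⟩ := (hA 0).bddAbove
    refine ⟨max M 0 + 1, fun a ha => ?_, by simp⟩
    rcases le_or_gt 0 a with h | h
    · have : a ≤ M := hM ⟨ha, h⟩
      linarith [le_max_left M 0]
    · linarith [le_max_right M 0]
  · have hne : {b ∈ B | b ≤ b₀}.Nonempty := ⟨b₀, hb₀, le_rfl⟩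
    obtain ⟨β, hβ, hmin⟩ := (hB b₀).exists_minimalFor id _ hne
    have hβB (b) (hb : b ∈ B) : β ≤ b := by
      rcases le_total b b₀ with h | h
      · by_contra! hlt
        exact absurd (hmin ⟨hb, h⟩ hlt.le) (not_le.2 hlt)
      · exact hβ.2.trans h
    rcases A.eq_empty_or_nonempty with rfl | ⟨a₀, ha₀⟩
    · exact ⟨β - 1, by simp, fun b hb => by linarith [hβB b hb]⟩
    · obtain ⟨α, hα, hmax⟩ := (hA a₀).exists_maximalFor id _ ⟨a₀, ha₀, le_rfl⟩
      have hαA (a) (ha : a ∈ A) : a ≤ α := by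
        rcases le_total a₀ a with h | h
        · by_contra! hlt
          exact absurd (hmax ⟨ha, h⟩ hlt.le) (not_le.2 hlt)
        · exact h.trans hα.2
      have := hAB α hα.1 β hβ.1
      exact ⟨(α + β) / 2, fun a ha => by linarith [hαA a ha], fun b hb => by linarith [hβB b hb]⟩

/-- A star-shaped contour exists when on every ray the inner points precede the outer points. -/
theorem exists_isSeparatingContour {A B : Set ℂ} (hA0 : 0 ∉ A) (hB0 : 0 ∉ B)
    (hA : ∀ ε > 0, {a ∈ A | ε ≤ ‖a‖}.Finite) (hB : ∀ R, {b ∈ B | ‖b‖ ≤ R}.Finite)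
    (hAB : ∀ a ∈ A, ∀ b ∈ B, ∀ x : ℝ, 1 ≤ x → a ≠ x * b) :
    ∃ γ, IsSeparatingContour γ A B ∧ ∀ s, γ s ≠ 0 := by
  have hA' : ∀ a ∈ A, 0 < ‖a‖ := fun a ha => norm_pos_iff.2 fun h => hA0 (h ▸ ha)
  have hB' : ∀ b ∈ B, 0 < ‖b‖ := fun b hb => norm_pos_iff.2 fun h => hB0 (h ▸ hb)
  -- The admissible values of the logarithm of the radius in the direction z form an interval, hence
  -- a convex set. Off the unit circle nothing is required.
  set t : ℂ → Set ℝ := fun z => {y | ‖z‖ = 1 → (∀ a ∈ A, a = ‖a‖ * z → Real.log ‖a‖ < y) ∧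
    ∀ b ∈ B, b = ‖b‖ * z → y < Real.log ‖b‖} with ht
  have hconv (z : ℂ) : Convex ℝ (t z) := by
    rw [convex_iff_ordConnected]
    refine ⟨fun x hx y hy w hw hz => ⟨fun a ha haz => ?_, fun b hb hbz => ?_⟩⟩
    · exact ((hx hz).1 a ha haz).trans_le hw.1
    · exact hw.2.trans_lt ((hy hz).2 b hb hbz)
  have hloc (z : ℂ) : ∃ c : ℝ, ∀ᶠ y in 𝓝 z, c ∈ t y := by
    by_cases hz : ‖z‖ = 1
    · obtain ⟨y, hy1, hy2⟩ := exists_separating_radius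
        (A := (fun a => Real.log ‖a‖) '' {a ∈ A | a = ‖a‖ * z})
        (B := (fun b => Real.log ‖b‖) '' {b ∈ B | b = ‖b‖ * z})
        (fun y => ((hA (Real.exp y) (Real.exp_pos _)).image fun a => Real.log ‖a‖).subset (by
          rintro _ ⟨⟨a, ha, rfl⟩, hya⟩
          exact ⟨a, ⟨ha.1, (Real.le_log_iff_exp_le (hA' a ha.1)).1 hya⟩, rfl⟩))
        (fun y => ((hB (Real.exp y)).image fun a => Real.log ‖a‖).subset (by
          rintro _ ⟨⟨a, ha, rfl⟩, hya⟩
          exact ⟨a, ⟨ha.1, (Real.log_le_iff_le_exp (hB' a ha.1)).1 hya⟩, rfl⟩))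
        (by
          rintro _ ⟨a, ⟨ha, haz⟩, rfl⟩ _ ⟨b, ⟨hb, hbz⟩, rfl⟩
          refine Real.log_lt_log (hA' a ha) ?_
          by_contra! hle
          refine hAB a ha b hb (‖a‖ / ‖b‖) ((one_le_div (hB' b hb)).2 hle) ?_
          have h1 : (‖b‖ : ℂ) ≠ 0 := by exact_mod_cast (hB' b hb).ne'
          rw [haz, hbz]
          simp only [norm_mul, hz, mul_one, Complex.norm_real, norm_norm]
          push_cast
          field_simp)
      refine ⟨y, ?_⟩
      -- A point can obstruct the constant y only if it is an inner point of modulus at least e^y or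
      -- an outer point of modulus at most e^y. There are finitely many of these, so directions
      -- close to but different from z carry no obstruction.
      set P : Set ℂ := (fun a => a / ‖a‖) '' {a ∈ A | Real.exp y ≤ ‖a‖} ∪
        (fun a => a / ‖a‖) '' {a ∈ B | ‖a‖ ≤ Real.exp y}
      have hP : P.Finite := ((hA _ (Real.exp_pos y)).image _).union ((hB _).image _)
      have hev : ∀ᶠ w in 𝓝 z, w ∉ P \ {z} :=
        (hP.subset Set.sdiff_subset).isClosed.isOpen_compl.mem_nhds (by simp)
      filter_upwards [hev] with w hw hw1
      by_cases hwz : w = z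
      · subst hwz
        exact ⟨fun a ha haz => hy1 _ ⟨a, ⟨ha, haz⟩, rfl⟩, fun b hb hbz => hy2 _ ⟨b, ⟨hb, hbz⟩, rfl⟩⟩
      · refine ⟨fun a ha haz => ?_, fun b hb hbz => ?_⟩
        · by_contra! hle
          refine hw ⟨Or.inl ⟨a, ⟨ha, (Real.le_log_iff_exp_le (hA' a ha)).1 hle⟩, ?_⟩, hwz⟩
          have h1 : (‖a‖ : ℂ) ≠ 0 := by exact_mod_cast (hA' a ha).ne'
          simp only
          rw [div_eq_iff h1, mul_comm]; exact haz
        · by_contra! hle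
          refine hw ⟨Or.inr ⟨b, ⟨hb, (Real.log_le_iff_le_exp (hB' b hb)).1 hle⟩, ?_⟩, hwz⟩
          have h1 : (‖b‖ : ℂ) ≠ 0 := by exact_mod_cast (hB' b hb).ne'
          simp only
          rw [div_eq_iff h1, mul_comm]; exact hbz
    · refine ⟨0, ?_⟩
      filter_upwards [(isOpen_ne_fun continuous_norm continuous_const).mem_nhds hz] with w hw hw1
      exact absurd hw1 hw
  -- A partition of unity patches the local constants into a C¹ radius function; convexity of the
  -- admissible sets preserves the constraints.
  obtain ⟨g, hg⟩ := exists_contMDiffMap_forall_mem_convex_of_local_const (n := 1)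
    (modelWithCornersSelf ℝ ℂ) hconv hloc
  have hgc : ContDiff ℝ 1 g := g.contMDiff.contDiff
  have hL := isLoop_starCurve hgc
  have key (s : ℝ) (x : ℝ) (hx : 0 < x) (w : ℂ) (hw : w = x * starCurve g s) :
      w = ‖w‖ * Complex.exp (2 * Real.pi * Complex.I * s) ∧ ‖w‖ = x *
        Real.exp (g (Complex.exp (2 * Real.pi * Complex.I * s))) := by
    have h1 : ‖w‖ = x * Real.exp (g (Complex.exp (2 * Real.pi * Complex.I * s))) := by
      rw [hw, norm_mul, norm_starCurve, Complex.norm_real, Real.norm_of_nonneg hx.le]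
    refine ⟨?_, h1⟩
    rw [h1, hw, starCurve_eq]; push_cast; ring
  have hin (a) (ha : a ∈ A) (s : ℝ) (x : ℝ) (hx : 1 ≤ x) : a ≠ x * starCurve g s := by
    intro h
    obtain ⟨h1, h2⟩ := key s x (by linarith) a h
    have h3 := (hg _ (norm_exp_two_pi s)).1 a ha h1
    rw [Real.log_lt_iff_lt_exp (hA' a ha), h2] at h3
    nlinarith [Real.exp_pos (g (Complex.exp (2 * Real.pi * Complex.I * s)))]
  have hout (b) (hb : b ∈ B) (s : ℝ) (x : ℝ) (hx : 1 ≤ x) : starCurve g s ≠ x * b := by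
    intro h
    have hx0 : (x : ℂ) ≠ 0 := by exact_mod_cast (by linarith : x ≠ 0)
    obtain ⟨h1, h2⟩ := key s x⁻¹ (by positivity) b (by rw [h]; push_cast; field_simp)
    have h3 := (hg _ (norm_exp_two_pi s)).2 b hb h1
    rw [Real.lt_log_iff_exp_lt (hB' b hb), h2] at h3
    have : x⁻¹ ≤ 1 := inv_le_one_of_one_le₀ hx
    nlinarith [Real.exp_pos (g (Complex.exp (2 * Real.pi * Complex.I * s)))]
  refine ⟨starCurve g, ⟨hL.contDiff, hL.closed, hL.ne_zero, ?_, hL.origin, ?_, ?_⟩,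
    starCurve_ne_zero g⟩
  · rintro s - (hs | hs)
    · exact hin _ hs s 1 le_rfl (by simp)
    · exact hout _ hs s 1 le_rfl (by simp)
  · exact fun a ha => hL.windingNumber_eq_one fun s _ x hx => hin a ha s x hx
  · exact fun b hb => windingNumber_eq_zero hL.contDiff hL.closed (fun h => hB0 (h ▸ hb))
      fun s _ x hx => hout b hb s x hx

/-! ### Scaling and inverting curves -/

theorem contourIntegral_scale (γ : ℝ → ℂ) (c : ℂ) (f : ℂ → ℂ) :
    contourIntegral (fun s => c * γ s) f = contourIntegral γ (fun z => c * f (c * z)) := by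
  unfold contourIntegral
  congr 1; ext s
  rw [deriv_const_mul_field]; ring

theorem windingNumber_scale {γ : ℝ → ℂ} {c : ℂ} (hc : c ≠ 0) (w : ℂ) :
    windingNumber (fun s => c * γ s) (c * w) = windingNumber γ w := by
  unfold windingNumber
  rw [contourIntegral_scale]
  congr 2; ext z
  rw [← mul_sub, mul_inv, mul_inv_cancel_left₀ hc]

theorem IsSeparatingContour.scale {γ : ℝ → ℂ} {A B : Set ℂ} (h : IsSeparatingContour γ A B)
    {c : ℂ} (hc : c ≠ 0) :
    IsSeparatingContour (fun s => c * γ s) {z | c⁻¹ * z ∈ A} {z | c⁻¹ * z ∈ B} where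
  contDiff := contDiff_const.mul h.contDiff
  closed := by rw [h.closed]
  ne_zero s hs := mul_ne_zero hc (h.ne_zero s hs)
  avoids s hs := by
    have := h.avoids s hs
    simpa [inv_mul_cancel_left₀ hc] using this
  origin := by rw [← mul_zero c, windingNumber_scale hc, h.origin]
  inside w hw := by rw [← mul_inv_cancel_left₀ hc w, windingNumber_scale hc, h.inside _ hw]
  outside w hw := by rw [← mul_inv_cancel_left₀ hc w, windingNumber_scale hc, h.outside _ hw]

theorem IsSeparatingContour.mono {γ : ℝ → ℂ} {A B A' B' : Set ℂ} (h : IsSeparatingContour γ A B)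
    (hA : A' ⊆ A) (hB : B' ⊆ B) : IsSeparatingContour γ A' B' :=
  ⟨h.contDiff, h.closed, h.ne_zero, fun s hs hm => h.avoids s hs (Set.union_subset_union hA hB hm),
    h.origin, fun w hw => h.inside w (hA hw), fun w hw => h.outside w (hB hw)⟩

/-- The image of a curve under inversion, with the direction reversed. -/
def invCurve (γ : ℝ → ℂ) (s : ℝ) : ℂ := (γ (1 - s))⁻¹

theorem contourIntegral_invCurve {γ : ℝ → ℂ} (hγ : ContDiff ℝ 1 γ) (h0 : ∀ s, γ s ≠ 0)
    (f : ℂ → ℂ) : contourIntegral (invCurve γ) f = contourIntegral γ (fun z => f z⁻¹ / z ^ 2) := by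
  have hd (s : ℝ) : deriv (invCurve γ) s = deriv γ (1 - s) / γ (1 - s) ^ 2 := by
    have h1 : HasDerivAt (fun s : ℝ => 1 - s) (-1) s := by
      simpa using (hasDerivAt_id s).const_sub 1
    have := (((hγ.differentiable one_ne_zero) (1 - s)).hasDerivAt.scomp s h1).inv (h0 _)
    convert! this.deriv using 1
    simp
  unfold contourIntegral
  have := intervalIntegral.integral_comp_sub_left (a := 0) (b := 1)
    (fun s => f (γ s)⁻¹ / γ s ^ 2 * deriv γ s) 1
  rw [sub_self, sub_zero] at this
  rw [← this]
  congr 1; ext s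
  rw [hd, invCurve]; ring

/-- The identity (1/z - w)⁻¹/z² = 1/z - 1/(z - 1/w) shows that the winding number of the inverted
curve about w is 1 minus that of the original curve about 1/w. Inversion therefore exchanges inside
and outside. -/
theorem IsSeparatingContour.inv {γ : ℝ → ℂ} {A B : Set ℂ} (h : IsSeparatingContour γ A B)
    (h0 : ∀ s, γ s ≠ 0) (hA0 : 0 ∉ A) (hB0 : 0 ∉ B) :
    IsSeparatingContour (invCurve γ) B⁻¹ A⁻¹ := by
  have hmem (s : ℝ) (hs : s ∈ Set.Icc (0 : ℝ) 1) : 1 - s ∈ Set.Icc (0 : ℝ) 1 :=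
    ⟨by linarith [hs.2], by linarith [hs.1]⟩
  have hw (w : ℂ) (hw0 : w ≠ 0) (hav : ∀ s ∈ Set.Icc (0 : ℝ) 1, γ s ≠ w⁻¹) :
      windingNumber (invCurve γ) w = 1 - windingNumber γ w⁻¹ := by
    rw [windingNumber, contourIntegral_invCurve h.contDiff h0]
    have e : contourIntegral γ (fun z => (z⁻¹ - w)⁻¹ / z ^ 2) =
        contourIntegral γ (fun z => (z - 0)⁻¹) + -1 * contourIntegral γ (fun z => (z - w⁻¹)⁻¹) := by
      rw [← contourIntegral_const_mul, ← contourIntegral_add h.contDiff]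
      · refine contourIntegral_congr fun s hs => ?_
        have h1 := h0 s
        have h2 : γ s - w⁻¹ ≠ 0 := sub_ne_zero.2 (hav s hs)
        have h3 : 1 - w * γ s ≠ 0 := fun h3 => h2 (by
          rw [sub_eq_zero, eq_comm]; exact inv_eq_of_mul_eq_one_right (by linear_combination -h3))
        have h4 : γ s - w⁻¹ = -(1 - w * γ s) / w := by field_simp; ring
        have h5 : (γ s)⁻¹ - w = (1 - w * γ s) / γ s := by field_simp
        rw [h4, h5, sub_zero]
        field_simp
        ring
      · exact (h.contDiff.continuous.sub continuous_const).continuousOn.inv₀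
          fun s hs => by simpa using h0 s
      · exact continuousOn_const.mul ((h.contDiff.continuous.sub continuous_const).continuousOn.inv₀
          fun s hs => sub_ne_zero.2 (hav s hs))
    have h6 := h.origin
    unfold windingNumber at h6 ⊢
    rw [e]; linear_combination h6
  constructor
  · exact (h.contDiff.comp (contDiff_const.sub contDiff_id)).inv fun s => h0 _
  · simp [invCurve, h.closed]
  · exact fun s hs => inv_ne_zero (h0 _)
  · intro s hs
    have := h.avoids _ (hmem s hs)
    simpa [invCurve, or_comm] using this
  · rw [windingNumber, contourIntegral_invCurve h.contDiff h0, ← h.origin, windingNumber]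
    congr 1
    refine contourIntegral_congr fun s hs => ?_
    have := h0 s
    simp only [sub_zero, inv_inv]
    field_simp
  · intro w hwB
    have h1 : w⁻¹ ∈ B := hwB
    rw [hw w (fun h => hB0 (by simpa [h] using h1))
      fun s hs he => h.avoids s hs (Or.inr (he ▸ h1)), h.outside _ h1, sub_zero]
  · intro w hwA
    have h1 : w⁻¹ ∈ A := hwA
    rw [hw w (fun h => hA0 (by simpa [h] using h1))
      fun s hs he => h.avoids s hs (Or.inl (he ▸ h1)), h.inside _ h1, sub_self]

end EllipticBeta
end

noncomputable section
namespace EllipticBeta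

/-! ### The Weierstrass relation for theta functions -/

section
variable {q : ℂ}

theorem hasDerivAt_mul_of_eq_zero {f g : ℂ → ℂ} {f' x : ℂ} (hf : HasDerivAt f f' x)
    (hf0 : f x = 0) (hg : DifferentiableAt ℂ g x) :
    HasDerivAt (fun y => f y * g y) (f' * g x) x := by
  have := hf.mul hg.hasDerivAt
  rw [hf0, zero_mul, add_zero] at this
  exact this

/-- The zeros are simple: two vanishing factors would give q^{i+1} = 1, which contradicts |q| < 1.
-/
theorem exists_hasDerivAt_qPoch (hq : ‖q‖ < 1) {x : ℂ} (hx : qPoch x q = 0) :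
    ∃ d ≠ 0, HasDerivAt (fun y => qPoch y q) d x := by
  obtain ⟨k, hk⟩ := (qPoch_eq_zero_iff hq).1 hx
  have hq0 : q ^ k ≠ 0 := fun h => by simp [h] at hk
  have hd : DifferentiableAt ℂ (fun y => (∏ j ∈ Finset.range k, (1 - y * q ^ j)) *
      qPoch (y * q ^ (k + 1)) q) x := by
    refine DifferentiableAt.mul ?_ ((differentiable_qPoch hq _).comp x (by fun_prop))
    fun_prop
  have h1 : HasDerivAt (fun y : ℂ => 1 - y * q ^ k) (-q ^ k) x := by
    simpa using ((hasDerivAt_id x).mul_const (q ^ k)).const_sub 1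
  refine ⟨_, mul_ne_zero (neg_ne_zero.2 hq0) ?_,
    (hasDerivAt_mul_of_eq_zero h1 (by simp [hk]) hd).congr_of_eventuallyEq
      (Eventually.of_forall fun y => ?_)⟩
  · refine mul_ne_zero (Finset.prod_ne_zero_iff.2 fun j hj => ?_) ?_
    · rw [Finset.mem_range] at hj
      intro h0
      obtain ⟨i, rfl⟩ := Nat.exists_eq_add_of_lt hj
      have : q ^ (i + 1) = 1 := by
        have h2 : x * q ^ j = 1 := by linear_combination -h0
        rw [show j + i + 1 = j + (i + 1) by ring, pow_add, ← mul_assoc, h2, one_mul] at hk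
        exact hk
      have h3 : ‖q ^ (i + 1)‖ < 1 := by
        rw [norm_pow]; exact pow_lt_one₀ (norm_nonneg _) hq (by omega)
      rw [this] at h3; simp at h3
    · refine qPoch_ne_zero_of_norm_lt hq ?_
      rw [pow_succ, ← mul_assoc, hk, one_mul]; exact hq
  · simp only
    rw [qPoch_eq_qFin_mul hq y (k + 1), qFin, Finset.prod_range_succ]
    ring

/-- The factors (x;q) and (q/x;q) have simple zeros and never vanish together, since that would
force q^{k+l+1} = 1. -/
theorem exists_hasDerivAt_theta (hq0 : q ≠ 0) (hq : ‖q‖ < 1) {x : ℂ} (hx0 : x ≠ 0)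
    (hx : theta x q = 0) : ∃ d ≠ 0, HasDerivAt (fun y => theta y q) d x := by
  have hcomp : DifferentiableAt ℂ (fun y => qPoch (q / y) q) x :=
    (differentiable_qPoch hq _).comp x ((differentiableAt_const q).div differentiableAt_id hx0)
  have hnot (h1 : qPoch x q = 0) (h2 : qPoch (q / x) q = 0) : False := by
    obtain ⟨k, hk⟩ := (qPoch_eq_zero_iff hq).1 h1
    obtain ⟨l, hl⟩ := (qPoch_eq_zero_iff hq).1 h2
    have : q ^ (k + l + 1) = 1 := by
      calc q ^ (k + l + 1) = (x * q ^ k) * (q / x * q ^ l) := by field_simp; ring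
        _ = 1 := by rw [hk, hl, one_mul]
    have h3 : ‖q ^ (k + l + 1)‖ < 1 := by
      rw [norm_pow]; exact pow_lt_one₀ (norm_nonneg _) hq (by omega)
    rw [this] at h3; simp at h3
  rcases mul_eq_zero.1 hx with h1 | h2
  · obtain ⟨d, hd0, hd⟩ := exists_hasDerivAt_qPoch hq h1
    exact ⟨_, mul_ne_zero hd0 fun h2 => hnot h1 h2, hasDerivAt_mul_of_eq_zero hd h1 hcomp⟩
  · obtain ⟨d, hd0, hd⟩ := exists_hasDerivAt_qPoch hq h2
    have h3 : HasDerivAt (fun y => q / y) (-(q / x ^ 2)) x := by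
      simpa [div_eq_mul_inv] using (hasDerivAt_inv hx0).const_mul q
    have h4 := hd.comp x h3
    refine ⟨_, mul_ne_zero (mul_ne_zero hd0 (neg_ne_zero.2 (div_ne_zero hq0 (pow_ne_zero 2 hx0))))
      fun h1 => hnot h1 h2, (hasDerivAt_mul_of_eq_zero h4 h2
        (differentiable_qPoch hq x)).congr_of_eventuallyEq (Eventually.of_forall fun y => ?_)⟩
    simp only [theta, Function.comp]; ring

/-- A quotient of functions on `ℂ*` with the same multiplier is constant when the denominator has
simple zeros, at which the numerator vanishes. -/
theorem exists_eq_const_mul {h D m : ℂ → ℂ} (hq0 : q ≠ 0) (hq : ‖q‖ < 1)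
    (hh : ∀ x ≠ 0, DifferentiableAt ℂ h x) (hD : ∀ x ≠ 0, DifferentiableAt ℂ D x)
    (hm : ∀ x ≠ 0, m x ≠ 0)
    (hhq : ∀ x ≠ 0, h (q * x) = m x * h x) (hDq : ∀ x ≠ 0, D (q * x) = m x * D x)
    (hz : ∀ x ≠ 0, D x = 0 → h x = 0 ∧ deriv D x ≠ 0) :
    ∃ κ, ∀ x ≠ 0, h x = κ * D x := by
  classical
  have hhd : DifferentiableOn ℂ h {0}ᶜ := fun x hx => (hh x hx).differentiableWithinAt
  have hDd : DifferentiableOn ℂ D {0}ᶜ := fun x hx => (hD x hx).differentiableWithinAt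
  have hiso (x) (hx : x ≠ 0) : ∀ᶠ y in 𝓝[≠] x, D y ≠ 0 := by
    by_cases h0 : D x = 0
    · have := (hD x hx).hasDerivAt.eventually_ne (c := 0) (hz x hx h0).2
      simpa using this
    · exact ((hD x hx).continuousAt.eventually_ne h0).filter_mono nhdsWithin_le_nhds
  -- The quotient h/D, with the quotient of the derivatives filled in at the simple zeros of D, is
  -- holomorphic on the punctured plane.
  set k : ℂ → ℂ := fun x => if D x = 0 then deriv h x / deriv D x else h x / D x with hk
  have hkd (x) (hx : x ≠ 0) : DifferentiableAt ℂ k x := by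
    by_cases h0 : D x = 0
    · have hn : {0}ᶜ ∈ 𝓝 x := isOpen_compl_singleton.mem_nhds hx
      have h1 : DifferentiableAt ℂ (fun y => dslope h x y / dslope D x y) x :=
        (((Complex.differentiableOn_dslope hn).2 hhd).differentiableAt hn).div
        (((Complex.differentiableOn_dslope hn).2 hDd).differentiableAt hn)
        (by rw [dslope_same]; exact (hz x hx h0).2)
      refine h1.congr_of_eventuallyEq ?_
      have h2 := hiso x hx
      rw [eventually_nhdsWithin_iff] at h2
      filter_upwards [h2] with y hy
      by_cases hyx : y = x
      · subst hyx; simp [hk, h0, dslope_same]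
      · simp only [hk, if_neg (hy hyx), dslope_of_ne _ hyx, slope_def_field, h0, (hz x hx h0).1,
          sub_zero]
        have := sub_ne_zero.2 hyx
        field_simp
    · refine ((hh x hx).div (hD x hx) h0).congr_of_eventuallyEq ?_
      filter_upwards [(hD x hx).continuousAt.eventually_ne h0] with y hy
      simp [hk, hy]
  have hkq (x) (hx : x ≠ 0) : k (q * x) = k x := by
    have e : (fun y => k (q * y)) =ᶠ[𝓝[≠] x] k := by
      filter_upwards [hiso x hx, nhdsWithin_le_nhds (isOpen_compl_singleton.mem_nhds hx :
        ({0}ᶜ : Set ℂ) ∈ 𝓝 x)] with y hy hy0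
      have h1 : D (q * y) ≠ 0 := by rw [hDq y hy0]; exact mul_ne_zero (hm y hy0) hy
      simp only [hk, if_neg hy, if_neg h1, hDq y hy0, hhq y hy0]
      rw [mul_div_mul_left _ _ (hm y hy0)]
    have c1 : Tendsto (fun y => k (q * y)) (𝓝[≠] x) (𝓝 (k (q * x))) :=
      (ContinuousAt.comp (f := fun y => q * y) (hkd (q * x) (mul_ne_zero hq0 hx)).continuousAt
        (by fun_prop)).tendsto.mono_left nhdsWithin_le_nhds
    exact tendsto_nhds_unique c1 (((hkd x hx).continuousAt.tendsto.mono_left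
      nhdsWithin_le_nhds).congr' e.symm)
  have hkn (x) (hx : x ≠ 0) (n : ℤ) : k (q ^ n * x) = k x := by
    induction n with
    | zero => simp
    | succ n ih =>
      rw [zpow_add_one₀ hq0, mul_comm _ q, mul_assoc,
        hkq _ (mul_ne_zero (zpow_ne_zero _ hq0) hx), ih]
    | pred n ih =>
      rw [← ih, ← hkq (q ^ (-(n : ℤ) - 1) * x) (mul_ne_zero (zpow_ne_zero _ hq0) hx), ← mul_assoc,
        zpow_sub_one₀ hq0]
      field_simp
  -- Invariance under multiplication by q reduces every nonzero x to the compact annulus |q| ≤ |x| ≤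
  -- 1.
  have hbdd : ∃ C, ∀ x ≠ 0, ‖k x‖ ≤ C := by
    have hK : IsCompact {x : ℂ | ‖q‖ ≤ ‖x‖ ∧ ‖x‖ ≤ 1} := by
      refine (isCompact_closedBall (0 : ℂ) 1).of_isClosed_subset ?_ fun z hz => by simpa using hz.2
      exact (isClosed_le continuous_const continuous_norm).inter
        (isClosed_le continuous_norm continuous_const)
    have hq0' := norm_pos_iff.2 hq0
    obtain ⟨C, hC⟩ := hK.exists_bound_of_continuousOn (f := k) fun x hx =>
      (hkd x (norm_pos_iff.1 (hq0'.trans_le hx.1))).continuousAt.continuousWithinAt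
    refine ⟨C, fun x hx => ?_⟩
    obtain ⟨n, hn1, hn2⟩ := exists_mem_Ioc_zpow (x := ‖x‖⁻¹) (y := ‖q‖⁻¹)
      (inv_pos.2 (norm_pos_iff.2 hx)) ((one_lt_inv₀ hq0').2 hq)
    rw [← hkn x hx (-n)]
    have hx0 := norm_pos_iff.2 hx
    have hn0 := zpow_pos hq0' n
    rw [inv_zpow, inv_lt_inv₀ hn0 hx0] at hn1
    rw [inv_zpow, inv_le_inv₀ hx0 (zpow_pos hq0' _), zpow_add_one₀ hq0'.ne'] at hn2
    refine hC _ ⟨?_, ?_⟩ <;> rw [norm_mul, norm_zpow, zpow_neg]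
    · rw [inv_mul_eq_div, le_div_iff₀ hn0]; linarith
    · rw [inv_mul_eq_div, div_le_one hn0]; exact hn1.le
  obtain ⟨C, hC⟩ := hbdd
  -- Liouville's theorem for the bounded entire function k ∘ exp.
  have hconst (x) (hx : x ≠ 0) : k x = k 1 := by
    have hdiff : Differentiable ℂ fun ζ => k (Complex.exp ζ) := fun ζ =>
      DifferentiableAt.comp ζ (hkd _ (Complex.exp_ne_zero ζ)) Complex.differentiable_exp.differentiableAt
    have := hdiff.apply_eq_apply_of_bounded (by
      rw [isBounded_iff_forall_norm_le]
      exact ⟨C, by rintro _ ⟨ζ, rfl⟩; exact hC _ (Complex.exp_ne_zero ζ)⟩) (Complex.log x) 0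
    simpa [Complex.exp_log hx] using this
  refine ⟨k 1, fun x hx => ?_⟩
  by_cases h0 : D x = 0
  · rw [h0, (hz x hx h0).1, mul_zero]
  · rw [← hconst x hx]; simp [hk, h0]

/-- The summand of the partition of a constant that breaks the symmetry `z ↔ 1 / z`. -/
def thetaSplit (q b T z : ℂ) : ℂ :=
  theta (b / z ^ 2) q * theta (T / (b * z)) q * theta (1 / (b * T * z)) q /
    (theta (1 / z ^ 2) q * theta (T / z) q * theta (1 / (T * z)) q)

theorem theta_one_div (hq0 : q ≠ 0) (hq : ‖q‖ < 1) {x : ℂ} (hx : x ≠ 0) :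
    theta (1 / x) q = -x⁻¹ * theta x q := by rw [one_div, theta_inv hq0 hq hx]

theorem theta_one (hq : ‖q‖ < 1) : theta 1 q = 0 := by
  rw [theta, qPoch_eq_mul hq 1]; simp

/-- After clearing denominators this is the Weierstrass three-term relation with T as the variable.
The combined numerator h(x) and D(x) = θ(x/z) θ(xz) have the same multiplier x⁻² under x ↦ qx, and h
vanishes at z and 1/z, hence at all zeros of D. So h = κ D, and κ is read off at one point. -/
theorem thetaSplit_add (hq0 : q ≠ 0) (hq : ‖q‖ < 1) {b T z : ℂ} (hb : b ≠ 0) (hT : T ≠ 0)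
    (hz : z ≠ 0) (h1 : theta (1 / b) q ≠ 0) (h2 : theta (1 / (b * z ^ 2)) q ≠ 0)
    (h3 : theta (1 / z ^ 2) q ≠ 0) (h4 : theta (T / z) q ≠ 0) (h5 : theta (1 / (T * z)) q ≠ 0) :
    thetaSplit q b T z + thetaSplit q b T (1 / z) = theta (1 / b ^ 2) q / theta (1 / b) q := by
  have hb2 := pow_ne_zero 2 hb
  have hz2 := pow_ne_zero 2 hz
  have hbz := mul_ne_zero hb hz
  have inv (x : ℂ) (hx : x ≠ 0) : theta (1 / x) q = -x⁻¹ * theta x q := theta_one_div hq0 hq hx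
  have mulq (x y : ℂ) (hx : x ≠ 0) (hy : y ≠ 0) :
      theta (q * x / y) q * theta (q * x * y) q = x⁻¹ ^ 2 * (theta (x / y) q * theta (x * y) q) := by
    rw [mul_div_assoc, mul_assoc q, theta_mul_self hq0 hq (div_ne_zero hx hy),
      theta_mul_self hq0 hq (mul_ne_zero hx hy)]
    field_simp
  have dif (x y : ℂ) (hx : x ≠ 0) (hy : y ≠ 0) :
      DifferentiableAt ℂ (fun x => theta (x / y) q * theta (x * y) q) x :=
    ((differentiableAt_theta hq (div_ne_zero hx hy)).comp x
      (differentiableAt_id.div_const y)).mul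
    ((differentiableAt_theta hq (mul_ne_zero hx hy)).comp x (differentiableAt_id.mul_const y))
  set h : ℂ → ℂ := fun x => theta (b / z ^ 2) q * (theta (x / (b * z)) q * theta (x * (b * z)) q) -
    z⁻¹ ^ 2 * theta (b * z ^ 2) q * (theta (x / (b / z)) q * theta (x * (b / z)) q) with hh
  set D : ℂ → ℂ := fun x => theta (x / z) q * theta (x * z) q with hDdef
  have hhq (x : ℂ) (hx : x ≠ 0) : h (q * x) = x⁻¹ ^ 2 * h x := by
    simp only [hh, mulq x _ hx hbz, mulq x _ hx (div_ne_zero hb hz)]; ring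
  have hDq (x : ℂ) (hx : x ≠ 0) : D (q * x) = x⁻¹ ^ 2 * D x := mulq x z hx hz
  have e1 : theta (z ^ 2 / b) q = -(z ^ 2 / b) * theta (b / z ^ 2) q := by
    rw [← one_div_div, inv _ (div_ne_zero hb hz2), one_div]
  have hz0 : h z = 0 := by
    simp only [hh]
    rw [show z / (b * z) = 1 / b by field_simp, show z * (b * z) = b * z ^ 2 by ring,
      show z / (b / z) = z ^ 2 / b by field_simp, show z * (b / z) = b by field_simp, e1, inv b hb]
    field_simp; ring
  have hz1 : h (1 / z) = 0 := by
    simp only [hh]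
    rw [show 1 / z / (b * z) = 1 / (b * z ^ 2) by field_simp,
      show 1 / z * (b * z) = b by field_simp, show 1 / z / (b / z) = 1 / b by field_simp,
      show 1 / z * (b / z) = b / z ^ 2 by field_simp, inv b hb, inv _ (mul_ne_zero hb hz2)]
    field_simp; ring
  have hzn (x : ℂ) (hx : x ≠ 0) (hx0 : h x = 0) (n : ℤ) : h (q ^ n * x) = 0 := by
    induction n with
    | zero => simpa
    | succ n ih =>
      rw [zpow_add_one₀ hq0, mul_comm _ q, mul_assoc, hhq _ (mul_ne_zero (zpow_ne_zero _ hq0) hx),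
        ih, mul_zero]
    | pred n ih =>
      have hne := mul_ne_zero (zpow_ne_zero (-(n : ℤ) - 1) hq0) hx
      have := hhq _ hne
      rw [← mul_assoc, zpow_sub_one₀ hq0, mul_left_comm q, mul_inv_cancel₀ hq0, mul_one, ih,
        ← zpow_sub_one₀ hq0] at this
      exact (mul_eq_zero.1 this.symm).resolve_left (pow_ne_zero 2 (inv_ne_zero hne))
  obtain ⟨κ, hκ⟩ := exists_eq_const_mul (h := h) (D := D) (m := fun x => x⁻¹ ^ 2) hq0 hq
    (fun x hx => ((dif x _ hx hbz).const_mul _).sub ((dif x _ hx (div_ne_zero hb hz)).const_mul _))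
    (fun x hx => dif x z hx hz) (fun x hx => pow_ne_zero 2 (inv_ne_zero hx)) hhq hDq
    (fun x hx hDx => by
      have hA : DifferentiableAt ℂ (fun x => theta (x / z) q) x :=
        (differentiableAt_theta hq (div_ne_zero hx hz)).fun_comp' x (differentiableAt_id.div_const z)
      have hB : DifferentiableAt ℂ (fun x => theta (x * z) q) x :=
        (differentiableAt_theta hq (mul_ne_zero hx hz)).fun_comp' x (differentiableAt_id.mul_const z)
      have hnot (hA0 : theta (x / z) q = 0) (hB0 : theta (x * z) q = 0) : False := by
        obtain ⟨m, hm⟩ := (theta_eq_zero_iff hq0 hq (div_ne_zero hx hz)).1 hA0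
        obtain ⟨n, hn⟩ := (theta_eq_zero_iff hq0 hq (mul_ne_zero hx hz)).1 hB0
        refine h3 ((theta_eq_zero_iff hq0 hq (one_div_ne_zero hz2)).2 ⟨m - n, ?_⟩)
        rw [zpow_sub₀ hq0, ← hm, ← hn]; field_simp
      rcases mul_eq_zero.1 hDx with h0 | h0
      · obtain ⟨m, hm⟩ := (theta_eq_zero_iff hq0 hq (div_ne_zero hx hz)).1 h0
        refine ⟨?_, ?_⟩
        · rw [(div_eq_iff hz).1 hm]; exact hzn z hz hz0 m
        · obtain ⟨d, hd0, hd⟩ := exists_hasDerivAt_theta hq0 hq (div_ne_zero hx hz) h0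
          have hc : HasDerivAt (fun x => theta (x / z) q) (d * (1 / z)) x :=
            HasDerivAt.comp (h := fun x => x / z) x hd ((hasDerivAt_id x).div_const z)
          have := hasDerivAt_mul_of_eq_zero hc h0 hB
          have e : deriv D x = d * (1 / z) * theta (x * z) q := this.deriv
          rw [e]
          exact mul_ne_zero (mul_ne_zero hd0 (one_div_ne_zero hz)) fun hB0 => hnot h0 hB0
      · obtain ⟨m, hm⟩ := (theta_eq_zero_iff hq0 hq (mul_ne_zero hx hz)).1 h0
        refine ⟨?_, ?_⟩
        · rw [show x = q ^ m * (1 / z) by rw [← hm]; field_simp]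
          exact hzn _ (one_div_ne_zero hz) hz1 m
        · obtain ⟨d, hd0, hd⟩ := exists_hasDerivAt_theta hq0 hq (mul_ne_zero hx hz) h0
          have hc : HasDerivAt (fun x => theta (x * z) q) (d * (1 * z)) x :=
            HasDerivAt.comp (h := fun x => x * z) x hd ((hasDerivAt_id x).mul_const z)
          have := hasDerivAt_mul_of_eq_zero hc h0 hA
          have e : deriv D x = d * (1 * z) * theta (x / z) q := by
            rw [← this.deriv]; congr 1; ext y; simp only [hDdef]; ring
          rw [e, one_mul]
          exact mul_ne_zero (mul_ne_zero hd0 hz) fun hA0 => hnot hA0 h0)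
  have hb' : theta b q ≠ 0 := fun h0 => h1 (by rw [inv b hb, h0, mul_zero])
  have hbz' : theta (b * z ^ 2) q ≠ 0 := fun h0 =>
    h2 (by rw [inv _ (mul_ne_zero hb hz2), h0, mul_zero])
  have hz2' : theta (z ^ 2) q ≠ 0 := fun h0 => h3 (by rw [inv _ hz2, h0, mul_zero])
  have hTz' : theta (T * z) q ≠ 0 := fun h0 =>
    h5 (by rw [inv _ (mul_ne_zero hT hz), h0, mul_zero])
  -- At x = bz the first product in h contains θ(1) = 0, so κ is given by the second product alone.
  have k1 := hκ (b * z) hbz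
  simp only [hh, hDdef] at k1
  rw [div_self hbz, theta_one hq, show b * z / (b / z) = z ^ 2 by field_simp,
    show b * z * (b / z) = b ^ 2 by field_simp, mul_div_cancel_right₀ b hz,
    show b * z * z = b * z ^ 2 by ring] at k1
  have k2 := hκ T hT
  simp only [hh, hDdef] at k2
  have hf1 : thetaSplit q b T z = b⁻¹ * theta (b / z ^ 2) q *
      (theta (T / (b * z)) q * theta (T * (b * z)) q) /
      (theta (1 / z ^ 2) q * (theta (T / z) q * theta (T * z) q)) := by
    rw [thetaSplit, show b * T * z = T * (b * z) by ring, inv _ (mul_ne_zero hT hbz),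
      inv _ (mul_ne_zero hT hz)]
    field_simp
  have hf2 : thetaSplit q b T (1 / z) = -b⁻¹ * z⁻¹ ^ 2 * theta (b * z ^ 2) q *
      (theta (T / (b / z)) q * theta (T * (b / z)) q) /
      (theta (1 / z ^ 2) q * (theta (T / z) q * theta (T * z) q)) := by
    rw [thetaSplit, show b / (1 / z) ^ 2 = b * z ^ 2 by field_simp,
      show T / (b * (1 / z)) = T / (b / z) by field_simp,
      show 1 / (b * T * (1 / z)) = 1 / (T * (b / z)) by field_simp,
      show 1 / (1 / z) ^ 2 = z ^ 2 by field_simp, show T / (1 / z) = T * z by field_simp,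
      show 1 / (T * (1 / z)) = 1 / (T / z) by field_simp,
      inv _ (mul_ne_zero hT (div_ne_zero hb hz)), inv _ (div_ne_zero hT hz), inv _ hz2]
    field_simp
  have k3 : κ * theta b q = -(z⁻¹ ^ 2 * (theta (z ^ 2) q * theta (b ^ 2) q)) :=
    mul_right_cancel₀ hbz' (by linear_combination -k1)
  rw [hf1, hf2, ← add_div, show b⁻¹ * theta (b / z ^ 2) q *
      (theta (T / (b * z)) q * theta (T * (b * z)) q) + -b⁻¹ * z⁻¹ ^ 2 * theta (b * z ^ 2) q *
      (theta (T / (b / z)) q * theta (T * (b / z)) q) = b⁻¹ * (κ *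
      (theta (T / z) q * theta (T * z) q)) by rw [← k2]; ring, inv _ hb2, inv _ hb, inv _ hz2]
  rw [eq_div_of_mul_eq hb' k3]
  rw [mul_comm T z] at hTz' ⊢
  field_simp

end
end EllipticBeta
end

noncomputable section
namespace EllipticBeta

/-! ### A Bezout identity for finite `q`-shifted factorials -/

section
variable {A : Type*} [CommRing A]

/-- Double induction from the splitting 1 - x y q^{K+L} = (1 - x q^K) + x q^K (1 - y q^L) of the
last factor. The preceding K + L factors lie in the ideals for (K, L+1) and for (K+1, L), and the
two summands supply precisely the factor that each of these ideals lacks. -/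
theorem prod_one_sub_mem_span (x y q : A) (K : ℕ) : ∀ L N : ℕ, K + L ≤ N + 1 →
    ∏ n ∈ Finset.range N, (1 - x * y * q ^ n) ∈ Ideal.span
      {∏ n ∈ Finset.range K, (1 - x * q ^ n), ∏ n ∈ Finset.range L, (1 - y * q ^ n)} := by
  have hdvd {M N : ℕ} (h : M ≤ N) : ∏ n ∈ Finset.range M, (1 - x * y * q ^ n) ∣
      ∏ n ∈ Finset.range N, (1 - x * y * q ^ n) :=
    Finset.prod_dvd_prod_of_subset _ _ _ (Finset.range_mono h)
  induction K with
  | zero => intro L N _; rw [Ideal.mem_span_pair]; exact ⟨_, 0, by simp; rfl⟩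
  | succ K ihK =>
    intro L
    induction L with
    | zero => intro N _; rw [Ideal.mem_span_pair]; exact ⟨0, _, by simp; rfl⟩
    | succ L ihL =>
      intro N hN
      refine Ideal.mem_of_dvd _ (hdvd (M := K + L + 1) (by omega)) ?_
      obtain ⟨u, v, h1⟩ := Ideal.mem_span_pair.1 (ihK (L + 1) (K + L) (by omega))
      obtain ⟨u', v', h2⟩ := Ideal.mem_span_pair.1 (ihL (K + L) (by omega))
      rw [Ideal.mem_span_pair, Finset.prod_range_succ]
      rw [Finset.prod_range_succ] at h1 h2 ⊢
      rw [Finset.prod_range_succ]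
      refine ⟨u + x * q ^ K * (1 - y * q ^ L) * u', (1 - x * q ^ K) * v + x * q ^ K * v', ?_⟩
      rw [pow_add]
      linear_combination (1 - x * q ^ K) * h1 + x * q ^ K * (1 - y * q ^ L) * h2

theorem prod_mem_span_prod {ι : Type*} (I : Finset ι) (P a : ι → A) (b : A)
    (h : ∀ i ∈ I, P i ∈ Ideal.span {a i, b}) :
    ∏ i ∈ I, P i ∈ Ideal.span {∏ i ∈ I, a i, b} := by
  classical
  induction I using Finset.induction with
  | empty => rw [Ideal.mem_span_pair]; exact ⟨1, 0, by simp⟩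
  | insert i I hi ih =>
    obtain ⟨u, v, h1⟩ := Ideal.mem_span_pair.1 (h i (Finset.mem_insert_self i I))
    obtain ⟨u', v', h2⟩ := Ideal.mem_span_pair.1
      (ih fun j hj => h j (Finset.mem_insert_of_mem hj))
    rw [Finset.prod_insert hi, Finset.prod_insert hi, Ideal.mem_span_pair]
    refine ⟨u * u', u * a i * v' + v * (∏ i ∈ I, P i), ?_⟩
    linear_combination (∏ i ∈ I, P i) * h1 + u * a i * h2

end

/-- The ideal membership is applied in the ring of C¹ functions of all arguments, so that the
coefficients come out as differentiable functions and not merely as numbers at each point. -/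
theorem exists_bezout_qFin (q : ℂ) (ι : Type*) [Fintype ι] (K : ℕ) :
    ∃ U V : (ι → ℂ) × ℂ → ℂ, ContDiff ℂ 1 U ∧ ContDiff ℂ 1 V ∧ ∀ (α : ι → ℂ) (β : ℂ),
      ∏ i, qFin q (α i * β) (2 * K) = U (α, β) * ∏ i, qFin q (α i) K + V (α, β) * qFin q β K := by
  let S : Subring ((ι → ℂ) × ℂ → ℂ) :=
    { carrier := {f | ContDiff ℂ 1 f}
      mul_mem' := fun {f g} (ha : ContDiff ℂ 1 f) (hb : ContDiff ℂ 1 g) =>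
        (ha.mul hb : ContDiff ℂ 1 (f * g))
      add_mem' := fun {f g} (ha : ContDiff ℂ 1 f) (hb : ContDiff ℂ 1 g) =>
        (ha.add hb : ContDiff ℂ 1 (f + g))
      one_mem' := (contDiff_const : ContDiff ℂ 1 fun _ => (1 : ℂ))
      zero_mem' := (contDiff_const : ContDiff ℂ 1 fun _ => (0 : ℂ))
      neg_mem' := fun {f} (ha : ContDiff ℂ 1 f) => (ha.neg : ContDiff ℂ 1 (-f)) }
  let x (i : ι) : S := ⟨fun z => z.1 i, by change ContDiff ℂ 1 _; fun_prop⟩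
  let y : S := ⟨fun z => z.2, by change ContDiff ℂ 1 _; fun_prop⟩
  let c : S := ⟨fun _ => q, by change ContDiff ℂ 1 _; fun_prop⟩
  obtain ⟨u, v, h⟩ := Ideal.mem_span_pair.1 (prod_mem_span_prod Finset.univ
    (fun i => ∏ n ∈ Finset.range (2 * K), (1 - x i * y * c ^ n))
    (fun i => ∏ n ∈ Finset.range K, (1 - x i * c ^ n)) (∏ n ∈ Finset.range K, (1 - y * c ^ n))
    fun i _ => prod_one_sub_mem_span (x i) y c K K (2 * K) (by omega))
  refine ⟨u, v, u.2, v.2, fun α β => ?_⟩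
  let ev : S →+* ℂ := (Pi.evalRingHom (fun _ => ℂ) (α, β)).comp S.subtype
  have h2 := congr_arg ev h
  simp only [map_add, map_mul, map_prod, map_sub, map_one, map_pow] at h2
  have e1 (i : ι) : ev (x i) = α i := rfl
  have e2 : ev y = β := rfl
  have e3 : ev c = q := rfl
  have e4 : ev u = u.1 (α, β) := rfl
  have e5 : ev v = v.1 (α, β) := rfl
  simp only [e1, e2, e3, e4, e5] at h2
  simp only [qFin]
  exact h2.symm

/-! ### Integrals depending on parameters -/

section
variable {a b : ℝ} {γ g : ℝ → ℂ}

theorem continuousOn_intervalIntegral {X V : Type*} [TopologicalSpace X]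
    [FirstCountableTopology X] [NormedAddCommGroup V] [NormedSpace ℝ V] (hab : a ≤ b)
    {f : X × ℝ → V} {U : Set X} (hf : ContinuousOn f (U ×ˢ Set.Icc a b)) :
    ContinuousOn (fun x => ∫ s in a..b, f (x, s)) U := by
  rw [continuousOn_iff_continuous_domRestrict]
  have h1 : Continuous (Function.uncurry fun (x : U) (s : ℝ) =>
      f (x, (Set.projIcc a b hab s : ℝ))) := by
    have hp : Continuous fun z : U × ℝ => (Set.projIcc a b hab z.2 : ℝ) :=
      continuous_subtype_val.comp (continuous_projIcc.comp continuous_snd)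
    exact hf.comp_continuous ((continuous_subtype_val.comp continuous_fst).prodMk hp) fun z =>
        ⟨z.1.2, (Set.projIcc a b hab z.2).2⟩
  refine (intervalIntegral.continuous_parametric_intervalIntegral_of_continuous'
    (μ := MeasureTheory.volume) h1 a b).congr
    fun x => ?_
  refine intervalIntegral.integral_congr fun s hs => ?_
  rw [Set.uIcc_of_le hab] at hs
  simp only [Set.projIcc_of_mem hab hs]

theorem continuousOn_integral_curve {X : Type*} [TopologicalSpace X] [FirstCountableTopology X]
    (hab : a ≤ b) (hγ : Continuous γ)
    (hg : Continuous g) {F : X × ℂ → ℂ} {S : Set (X × ℂ)} (hF : ContinuousOn F S) {U : Set X}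
    (hU : ∀ x ∈ U, ∀ s ∈ Set.Icc a b, (x, γ s) ∈ S) :
    ContinuousOn (fun x => ∫ s in a..b, F (x, γ s) * g s) U :=
  continuousOn_intervalIntegral (f := fun z : X × ℝ => F (z.1, γ z.2) * g z.2) hab
    ((hF.comp (f := fun z : X × ℝ => (z.1, γ z.2)) (by fun_prop) fun z hz => hU _ hz.1 _ hz.2).mul
      (hg.comp continuous_snd).continuousOn)

/-- Differentiation under the integral sign in several complex parameters; C¹ regularity over ℂ is a
convenient form of holomorphy that survives integration. -/
theorem contDiffOn_integral_curve {E : Type*} [NormedAddCommGroup E] [NormedSpace ℂ E]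
    (hab : a ≤ b) (hγ : Continuous γ) (hg : Continuous g) {F : E × ℂ → ℂ} {S : Set (E × ℂ)}
    (hS : IsOpen S) (hF : ContDiffOn ℂ 1 F S) {U : Set E} (hUo : IsOpen U)
    (hU : ∀ x ∈ U, ∀ s ∈ Set.Icc a b, (x, γ s) ∈ S) :
    ContDiffOn ℂ 1 (fun x => ∫ s in a..b, F (x, γ s) * g s) U := by
  have hF' : ContinuousOn (fderiv ℂ F) S := hF.continuousOn_fderiv_of_isOpen hS le_rfl
  have hFd (z) (hz : z ∈ S) : HasFDerivAt F (fderiv ℂ F z) z :=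
    ((hF.differentiableOn one_ne_zero).differentiableAt (hS.mem_nhds hz)).hasFDerivAt
  set D : E × ℝ → E →L[ℂ] ℂ := fun z =>
    g z.2 • (fderiv ℂ F (z.1, γ z.2)).comp (ContinuousLinearMap.inl ℂ E ℂ) with hD
  have hDc : ContinuousOn D {z | (z.1, γ z.2) ∈ S} := by
    have h1 : ContinuousOn (fun z : E × ℝ => fderiv ℂ F (z.1, γ z.2)) {z | (z.1, γ z.2) ∈ S} :=
      hF'.comp (f := fun z : E × ℝ => (z.1, γ z.2)) (by fun_prop) fun z hz => hz
    exact ContinuousOn.smul (f := fun z : E × ℝ => g z.2) (by fun_prop)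
      (h1.clm_comp continuousOn_const)
  have hO : IsOpen {z : E × ℝ | (z.1, γ z.2) ∈ S} := hS.preimage (by fun_prop)
  have key (x₀) (hx₀ : x₀ ∈ U) : HasFDerivAt (fun x => ∫ s in a..b, F (x, γ s) * g s)
      (∫ s in a..b, D (x₀, s)) x₀ := by
    have hsub : ∀ x ∈ U, Set.MapsTo (fun s : ℝ => ((x, s) : E × ℝ)) (Set.Icc a b)
        {z | (z.1, γ z.2) ∈ S} := fun x hx s hs => hU x hx s hs
    have hD₀ : ContinuousOn (fun s => D (x₀, s)) (Set.Icc a b) :=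
      hDc.comp (by fun_prop) (hsub x₀ hx₀)
    obtain ⟨C, hC⟩ := isCompact_Icc.exists_bound_of_continuousOn hD₀
    have hn : IsOpen ({z : E × ℝ | (z.1, γ z.2) ∈ S} ∩ D ⁻¹' Metric.ball 0 (C + 1)) :=
      hDc.isOpen_inter_preimage hO Metric.isOpen_ball
    -- Compactness of the parameter interval yields a neighbourhood of the base point on which the
    -- derivative of the integrand is bounded by C + 1 uniformly along the curve.
    obtain ⟨u, v, hu, hv, hxu, hIv, huv⟩ := generalized_tube_lemma (s := {x₀}) isCompact_singleton
      (isCompact_Icc (a := a) (b := b)) hn (by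
        rintro ⟨x, s⟩ ⟨hx, hs⟩
        obtain rfl : x = x₀ := hx
        exact ⟨hU _ hx₀ s hs, by simpa using (hC s hs).trans_lt (lt_add_one C)⟩)
    have hcont (x) (hx : x ∈ U) : ContinuousOn (fun s => F (x, γ s) * g s) (Set.Icc a b) :=
      (hF.continuousOn.comp (by fun_prop) fun s hs => hU x hx s hs).mul hg.continuousOn
    have hI : Set.uIoc a b ⊆ Set.Icc a b := by
      rw [Set.uIoc_of_le hab]; exact Set.Ioc_subset_Icc_self
    refine intervalIntegral.hasFDerivAt_integral_of_dominated_of_fderiv_le (s := u ∩ U)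
      (F := fun x s => F (x, γ s) * g s) (F' := fun x s => D (x, s)) (bound := fun _ => C + 1)
      ((hu.inter hUo).mem_nhds ⟨hxu rfl, hx₀⟩) ?_ ?_ ?_ ?_ ?_ ?_
    · filter_upwards [hUo.mem_nhds hx₀] with x hx
      exact ((hcont x hx).mono hI).aestronglyMeasurable measurableSet_uIoc
    · apply ContinuousOn.intervalIntegrable
      rw [Set.uIcc_of_le hab]; exact hcont x₀ hx₀
    · exact (hD₀.mono hI).aestronglyMeasurable measurableSet_uIoc
    · refine Eventually.of_forall fun s hs x hx => ?_
      have := (huv ⟨hx.1, hIv (hI hs)⟩ : (x, s) ∈ _).2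
      simpa using (by simpa using this : ‖D (x, s)‖ < C + 1).le
    · exact intervalIntegrable_const
    · refine Eventually.of_forall fun s hs x hx => ?_
      have h1 := HasFDerivAt.comp (f := fun x => (x, γ s)) x (hFd _ (hU x hx.2 s (hI hs)))
        ((hasFDerivAt_id x).prodMk (hasFDerivAt_const (γ s) x))
      have h2 := h1.mul_const (g s)
      convert! h2 using 1
  rw [show (1 : WithTop ℕ∞) = 0 + 1 by simp, contDiffOn_succ_iff_fderiv_of_isOpen hUo]
  refine ⟨fun x hx => (key x hx).differentiableAt.differentiableWithinAt, by simp, ?_⟩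
  rw [contDiffOn_zero]
  exact (continuousOn_intervalIntegral hab (hDc.mono fun z hz => hU _ hz.1 _ hz.2)).congr
    fun x hx => (key x hx).fderiv

end

/-- Cauchy's formula for a quotient that extends continuously to the zeros of its denominator. -/
theorem mul_cauchy_integral_div {N M : ℂ → ℂ} {c : ℂ} {ε : ℝ}
    (hN : ∀ z ∈ Metric.closedBall c ε, DifferentiableAt ℂ N z)
    (hM : ∀ z ∈ Metric.closedBall c ε, DifferentiableAt ℂ M z)
    (hM0 : ∀ z ∈ Metric.sphere c ε, M z ≠ 0)
    (hl : ∀ z ∈ Metric.ball c ε, M z = 0 → (∀ᶠ y in 𝓝[≠] z, M y ≠ 0) ∧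
      ∃ L, Tendsto (fun y => N y / M y) (𝓝[≠] z) (𝓝 L)) {b : ℂ} (hb : b ∈ Metric.ball c ε) :
    M b * ((2 * Real.pi * Complex.I)⁻¹ * ∮ β in C(c, ε), N β / M β / (β - b)) = N b := by
  classical
  -- The quotient is extended by its limits. The extension is continuous on the closed disc and
  -- differentiable off a countable set, which is enough for Cauchy's formula.
  set h : ℂ → ℂ := fun z => if M z = 0 then limUnder (𝓝[≠] z) (fun y => N y / M y) else N z / M z
    with hh
  set Z : Set ℂ := {z ∈ Metric.ball c ε | M z = 0} with hZ
  have hZc : Z.Countable := by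
    have hd : DiscreteTopology Z := by
      rw [discreteTopology_subtype_iff]
      rintro z ⟨hz, hz0⟩
      rw [← disjoint_iff, disjoint_principal_right]
      filter_upwards [(hl z hz hz0).1] with y hy hyZ
      exact hy hyZ.2
    exact Set.countable_coe_iff.1 (TopologicalSpace.separableSpace_iff_countable.1 inferInstance)
  have hreg (z) (hz : z ∈ Metric.closedBall c ε) (h0 : M z ≠ 0) : DifferentiableAt ℂ h z := by
    refine ((hN z hz).div (hM z hz) h0).congr_of_eventuallyEq ?_
    filter_upwards [(hM z hz).continuousAt.eventually_ne h0] with y hy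
    simp [hh, hy]
  have hball (z) (hz : z ∈ Metric.closedBall c ε) (h0 : M z = 0) : z ∈ Metric.ball c ε := by
    by_contra hc
    refine hM0 z ?_ h0
    rw [Metric.mem_sphere]; rw [Metric.mem_ball] at hc; rw [Metric.mem_closedBall] at hz
    exact le_antisymm hz (not_lt.1 hc)
  have hcont : ContinuousOn h (Metric.closedBall c ε) := by
    intro z hz
    by_cases h0 : M z = 0
    · obtain ⟨h1, L, hL⟩ := hl z (hball z hz h0) h0
      have e : h z = L := by simp only [hh, if_pos h0]; exact hL.limUnder_eq
      refine ContinuousAt.continuousWithinAt ?_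
      rw [continuousAt_iff_punctured_nhds, e]
      refine hL.congr' ?_
      filter_upwards [h1] with y hy
      simp [hh, hy]
    · exact (hreg z hz h0).continuousAt.continuousWithinAt
  have hε : 0 < ε := Metric.pos_of_mem_ball hb
  have key := Complex.two_pi_I_inv_smul_circleIntegral_sub_inv_smul_of_differentiable_on_off_countable
    hZc hb hcont fun z hz => hreg z (Metric.ball_subset_closedBall hz.1) fun h0 => hz.2 ⟨hz.1, h0⟩
  have e2 : (∮ β in C(c, ε), N β / M β / (β - b)) = ∮ β in C(c, ε), (β - b)⁻¹ • h β := by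
    refine circleIntegral.integral_congr hε.le fun β hβ => ?_
    simp only [hh, if_neg (hM0 β hβ), smul_eq_mul]
    rw [div_eq_inv_mul]
  rw [e2]
  rw [smul_eq_mul] at key
  rw [key]
  -- At a zero of M the left side is 0, and so is N b, because N is the product of M, which tends to
  -- 0, and of N/M, which has a finite limit.
  by_cases h0 : M b = 0
  · obtain ⟨h1, L, hL⟩ := hl b hb h0
    have hbc := Metric.ball_subset_closedBall hb
    have t1 : Tendsto (fun y => M y * (N y / M y)) (𝓝[≠] b) (𝓝 (M b * L)) :=
      ((hM b hbc).continuousAt.tendsto.mono_left nhdsWithin_le_nhds).mul hL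
    have t2 : Tendsto (fun y => M y * (N y / M y)) (𝓝[≠] b) (𝓝 (N b)) := by
      refine ((hN b hbc).continuousAt.tendsto.mono_left nhdsWithin_le_nhds).congr' ?_
      filter_upwards [h1] with y hy
      rw [mul_div_cancel₀ _ hy]
    rw [tendsto_nhds_unique t2 t1, h0, zero_mul, zero_mul]
  · simp only [hh, if_neg h0]
    rw [mul_div_cancel₀ _ h0]

end EllipticBeta
end

noncomputable section
namespace EllipticBeta

/-! ### The rescaled integrand -/

/-- The parameters `(b, a, u)`; here `a` is `t_0` and `u` are the remaining `t_r`. -/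
abbrev Params := ℂ × ℂ × (Fin 3 → ℂ)

/-- The scales `(s, c, e, f)`, with nome `p = c s ^ 2` and `e r * f r = c`. -/
abbrev Scales := ℂ × ℂ × (Fin 3 → ℂ) × (Fin 3 → ℂ)

/-- Three arguments built from b and a alone, then those with u_r in the numerator and those with
q/(b u_r). -/
abbrev PoleIndex := Fin 3 ⊕ (Fin 3 ⊕ Fin 3)

/-- The nome `p = c s ^ 2`. -/
def nome (η : Scales) : ℂ := η.2.1 * η.1 ^ 2

/-- The arguments of the shifted factorials whose zeros lie inside the contour. -/
def innerArg (q : ℂ) (y : Params × Scales) (w : ℂ) : PoleIndex → ℂ :=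
  Sum.elim ![y.2.2.1 * y.1.1 / w ^ 2, y.1.2.1 / w, y.2.2.1 * q / (y.1.1 * y.1.2.1 * w)]
    (Sum.elim (fun r => y.1.2.2 r * y.2.2.2.1 r / w)
      (fun r => q * y.2.2.2.2 r / (y.1.1 * y.1.2.2 r * w)))

/-- The arguments of the shifted factorials whose zeros lie outside the contour. -/
def outerArg (q : ℂ) (y : Params × Scales) (w : ℂ) : PoleIndex → ℂ :=
  Sum.elim ![q * w / (y.1.1 * y.1.2.1), y.1.1 * y.2.1 ^ 2 * w ^ 2, y.1.2.1 * y.2.1 ^ 2 * w]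
    (Sum.elim (fun r => y.1.2.2 r * y.2.1 ^ 2 * y.2.2.2.1 r * w)
      (fun r => q * y.2.1 ^ 2 * y.2.2.2.2 r * w / (y.1.1 * y.1.2.2 r)))

/-- The arguments of the double shifted factorials in the numerator. -/
def numerArg (q : ℂ) (y : Params × Scales) (w : ℂ) : Fin 5 ⊕ (Fin 3 × Fin 4) → ℂ :=
  Sum.elim ![y.2.2.1 * q / (y.1.1 * w ^ 2), q * y.2.1 ^ 2 * w ^ 2 / y.1.1,
      y.1.1 * y.1.2.1 * y.2.1 ^ 2 * w, nome y.2 * q * w / y.1.2.1, nome y.2 * y.1.1 * y.1.2.1 / w]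
    (fun r => ![q * y.2.2.2.2 r.1 / (y.1.2.2 r.1 * w),
      q * y.2.1 ^ 2 * y.2.2.2.2 r.1 * w / y.1.2.2 r.1,
      y.1.1 * y.1.2.2 r.1 * y.2.2.2.1 r.1 / w,
      y.1.1 * y.1.2.2 r.1 * y.2.1 ^ 2 * y.2.2.2.1 r.1 * w] r.2)

/-- The numerator of the rescaled integrand, without the factor `(c q / (a w); p, q)`. -/
def numer (q : ℂ) (y : Params × Scales) (w : ℂ) : ℂ :=
  qPoch (y.2.1 ^ 2 * w ^ 2) (nome y.2) * qPoch (y.2.2.1 / w ^ 2) (nome y.2) *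
    theta (y.1.2.1 / (y.1.1 * w)) q * ∏ i, pqPoch (numerArg q y w i) (nome y.2) q

/-- The argument of the remaining factor of the numerator. -/
def extraArg (q : ℂ) (y : Params × Scales) (w : ℂ) : ℂ := y.2.2.1 * q / (y.1.2.1 * w)

/-- The rescaled integrand. -/
def scaledIntegrand (q : ℂ) (y : Params × Scales) (w : ℂ) : ℂ :=
  numer q y w * pqPoch (extraArg q y w) (nome y.2) q /
    ((∏ i, pqPoch (innerArg q y w i) (nome y.2) q) * ∏ i, pqPoch (outerArg q y w i) (nome y.2) q)

/-- The double shifted factorial without its first `N` factors with `p`-degree zero. -/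
def pqTail (p q : ℂ) (N : ℕ) (x : ℂ) : ℂ := qPoch (x * q ^ N) q * pqPoch (x * p) p q

theorem pqPoch_eq_qFin_mul {p q : ℂ} (hp : ‖p‖ < 1) (hq : ‖q‖ < 1) (x : ℂ) (N : ℕ) :
    pqPoch x p q = qFin q x N * pqTail p q N x := by
  rw [pqPoch_eq_mul hp hq, qPoch_eq_qFin_mul hq x N, pqTail, mul_assoc]

def bezoutU (q : ℂ) (K : ℕ) : (PoleIndex → ℂ) × ℂ → ℂ := (exists_bezout_qFin q PoleIndex K).choose

def bezoutV (q : ℂ) (K : ℕ) : (PoleIndex → ℂ) × ℂ → ℂ :=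
  (exists_bezout_qFin q PoleIndex K).choose_spec.choose

theorem contDiff_bezoutU (q : ℂ) (K : ℕ) : ContDiff ℂ 1 (bezoutU q K) :=
  (exists_bezout_qFin q PoleIndex K).choose_spec.choose_spec.1

theorem contDiff_bezoutV (q : ℂ) (K : ℕ) : ContDiff ℂ 1 (bezoutV q K) :=
  (exists_bezout_qFin q PoleIndex K).choose_spec.choose_spec.2.1

theorem bezout_qFin (q : ℂ) (K : ℕ) (α : PoleIndex → ℂ) (β : ℂ) :
    ∏ i, qFin q (α i * β) (2 * K) =
      bezoutU q K (α, β) * ∏ i, qFin q (α i) K + bezoutV q K (α, β) * qFin q β K :=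
  (exists_bezout_qFin q PoleIndex K).choose_spec.choose_spec.2.2 α β

/-- The first of the outer arguments, `q w / (b a)`. -/
def mainOuter : PoleIndex := Sum.inl 0

/-- The first 2K factors of degree zero in p belonging to `extraArg` are dropped. They are equal to
the factor with index `Sum.inl 0` of the left side of the Bezout identity, because the corresponding
inner argument times the main outer argument is `extraArg`. -/
def regNum (q : ℂ) (K : ℕ) (y : Params × Scales) (w : ℂ) : ℂ :=
  numer q y w * pqTail (nome y.2) q (2 * K) (extraArg q y w)

def regNumU (q : ℂ) (K : ℕ) (y : Params × Scales) (w : ℂ) : ℂ :=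
  bezoutU q K (innerArg q y w, outerArg q y w mainOuter) * regNum q K y w

def regNumV (q : ℂ) (K : ℕ) (y : Params × Scales) (w : ℂ) : ℂ :=
  bezoutV q K (innerArg q y w, outerArg q y w mainOuter) * regNum q K y w

/-- The U-term of the Bezout identity cancels the first K factors of every inner argument, and with
them the inner poles outside the small circle. -/
def regDenU (q : ℂ) (K : ℕ) (y : Params × Scales) (w : ℂ) : ℂ :=
  (∏ i, pqTail (nome y.2) q K (innerArg q y w i)) * ∏ i, pqPoch (outerArg q y w i) (nome y.2) q

/-- The V-term cancels the first K factors of the main outer argument, the only outer argument with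
zeros inside the large circle. -/
def regDenV (q : ℂ) (K : ℕ) (y : Params × Scales) (w : ℂ) : ℂ :=
  (∏ i, pqPoch (innerArg q y w i) (nome y.2) q) *
    (pqTail (nome y.2) q K (outerArg q y w mainOuter) *
      ∏ i ∈ {mainOuter}ᶜ, pqPoch (outerArg q y w i) (nome y.2) q)

/-! ### Regularity -/

/-- Parameters where all the functions above are regular. -/
def regular : Set ((Params × Scales) × ℂ) :=
  {z | z.1.1.1 ≠ 0 ∧ z.1.1.2.1 ≠ 0 ∧ (∀ r, z.1.1.2.2 r ≠ 0) ∧ z.2 ≠ 0 ∧ ‖nome z.1.2‖ < 1}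

section
variable {q : ℂ}

theorem _root_.ContinuousOn.pqPoch {X : Type*} [TopologicalSpace X] {f p : X → ℂ} {S : Set X}
    (hf : ContinuousOn f S) (hp : ContinuousOn p S) (h : ∀ x ∈ S, ‖p x‖ < 1) (hq : ‖q‖ < 1) :
    ContinuousOn (fun x => pqPoch (f x) (p x) q) S := fun x hx =>
  ContinuousAt.comp_continuousWithinAt (f := fun x => (f x, p x)) (continuousAt_pqPoch (h x hx) hq)
    ((hf x hx).prodMk (hp x hx))

theorem _root_.ContinuousOn.qPoch {X : Type*} [TopologicalSpace X] {f p : X → ℂ} {S : Set X}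
    (hf : ContinuousOn f S) (hp : ContinuousOn p S) (h : ∀ x ∈ S, ‖p x‖ < 1) :
    ContinuousOn (fun x => qPoch (f x) (p x)) S := fun x hx =>
  ContinuousAt.comp_continuousWithinAt (f := fun x => (f x, p x)) (continuousAt_qPoch (h x hx))
    ((hf x hx).prodMk (hp x hx))

theorem _root_.ContDiffOn.pqPoch {X : Type*} [NormedAddCommGroup X] [NormedSpace ℂ X] {f : X → ℂ}
    {p : ℂ} {S : Set X} (hf : ContDiffOn ℂ 1 f S) (hp : ‖p‖ < 1) (hq : ‖q‖ < 1) :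
    ContDiffOn ℂ 1 (fun x => pqPoch (f x) p q) S :=
  (differentiable_pqPoch hp hq).contDiff.comp_contDiffOn hf

theorem _root_.ContDiffOn.qPoch {X : Type*} [NormedAddCommGroup X] [NormedSpace ℂ X] {f : X → ℂ}
    {S : Set X} (hf : ContDiffOn ℂ 1 f S) (hq : ‖q‖ < 1) :
    ContDiffOn ℂ 1 (fun x => qPoch (f x) q) S :=
  (differentiable_qPoch hq).contDiff.comp_contDiffOn hf

theorem continuous_nome : Continuous nome := by unfold nome; fun_prop

theorem continuousOn_nome_fst {S : Set ((Params × Scales) × ℂ)} :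
    ContinuousOn (fun z : (Params × Scales) × ℂ => nome z.1.2) S :=
  (continuous_nome.comp (continuous_snd.comp continuous_fst)).continuousOn

theorem isOpen_regular : IsOpen regular := by
  have h (r : Fin 3) : IsOpen {z : (Params × Scales) × ℂ | z.1.1.2.2 r ≠ 0} :=
    isOpen_ne_fun (by fun_prop) continuous_const
  have h2 : IsOpen {z : (Params × Scales) × ℂ | ∀ r, z.1.1.2.2 r ≠ 0} := by
    have := isOpen_iInter_of_finite h
    convert! this using 1
    ext z; simp
  exact (isOpen_ne_fun (by fun_prop) continuous_const).inter
    ((isOpen_ne_fun (by fun_prop) continuous_const).inter (h2.inter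
    ((isOpen_ne_fun (by fun_prop) continuous_const).inter
      (isOpen_lt (continuous_nome.comp (continuous_snd.comp continuous_fst)).norm continuous_const))))

theorem continuousOn_innerArg (i : PoleIndex) :
    ContinuousOn (fun z : (Params × Scales) × ℂ => innerArg q z.1 z.2 i) regular := by
  rcases i with i | r | r
  · fin_cases i <;> simp only [innerArg, Sum.elim_inl] <;>
      refine ContinuousOn.div (by fun_prop) (by fun_prop) fun z hz => ?_
    · exact pow_ne_zero 2 hz.2.2.2.1
    · exact hz.2.2.2.1
    · exact mul_ne_zero (mul_ne_zero hz.1 hz.2.1) hz.2.2.2.1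
  · simp only [innerArg, Sum.elim_inr, Sum.elim_inl]
    exact ContinuousOn.div (by fun_prop) (by fun_prop) fun z hz => hz.2.2.2.1
  · simp only [innerArg, Sum.elim_inl, Sum.elim_inr]
    exact ContinuousOn.div (by fun_prop) (by fun_prop) fun z hz =>
      mul_ne_zero (mul_ne_zero hz.1 (hz.2.2.1 r)) hz.2.2.2.1

theorem continuousOn_outerArg (i : PoleIndex) :
    ContinuousOn (fun z : (Params × Scales) × ℂ => outerArg q z.1 z.2 i) regular := by
  rcases i with i | r | r
  · fin_cases i <;> simp [outerArg, Sum.elim_inl]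
    · exact ContinuousOn.div (by fun_prop) (by fun_prop) fun z hz => mul_ne_zero hz.1 hz.2.1
    · fun_prop
    · fun_prop
  · simp only [outerArg, Sum.elim_inl, Sum.elim_inr]
    fun_prop
  · simp only [outerArg, Sum.elim_inl, Sum.elim_inr]
    exact ContinuousOn.div (by fun_prop) (by fun_prop) fun z hz =>
      mul_ne_zero hz.1 (hz.2.2.1 r)

theorem continuousOn_extraArg :
    ContinuousOn (fun z : (Params × Scales) × ℂ => extraArg q z.1 z.2) regular :=
  ContinuousOn.div (by fun_prop) (by fun_prop) fun z hz => mul_ne_zero hz.2.1 hz.2.2.2.1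

theorem continuousOn_numerArg (i) :
    ContinuousOn (fun z : (Params × Scales) × ℂ => numerArg q z.1 z.2 i) regular := by
  have hn := continuousOn_nome_fst (S := regular)
  rcases i with i | ⟨r, i⟩
  · fin_cases i <;> simp [numerArg, Sum.elim_inl]
    · exact ContinuousOn.div (by fun_prop) (by fun_prop) fun z hz =>
        mul_ne_zero hz.1 (pow_ne_zero 2 hz.2.2.2.1)
    · exact ContinuousOn.div (by fun_prop) (by fun_prop) fun z hz => hz.1
    · fun_prop
    · exact ContinuousOn.div (by fun_prop) (by fun_prop) fun z hz => hz.2.1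
    · exact ContinuousOn.div (by fun_prop) (by fun_prop) fun z hz => hz.2.2.2.1
  · fin_cases i <;> simp [numerArg, Sum.elim_inr]
    · exact ContinuousOn.div (by fun_prop) (by fun_prop) fun z hz =>
        mul_ne_zero (hz.2.2.1 r) hz.2.2.2.1
    · exact ContinuousOn.div (by fun_prop) (by fun_prop) fun z hz => hz.2.2.1 r
    · exact ContinuousOn.div (by fun_prop) (by fun_prop) fun z hz => hz.2.2.2.1
    · fun_prop

/-- The regular parameters with given scales. -/
def regularAt (η : Scales) : Set (Params × ℂ) := {z | ((z.1, η), z.2) ∈ regular}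

theorem isOpen_regularAt (η : Scales) : IsOpen (regularAt η) :=
  isOpen_regular.preimage (by fun_prop)

theorem contDiffOn_innerArg (η : Scales) (i : PoleIndex) :
    ContDiffOn ℂ 1 (fun z : Params × ℂ => innerArg q (z.1, η) z.2 i) (regularAt η) := by
  rcases i with i | r | r
  · fin_cases i <;> simp only [innerArg, Sum.elim_inl] <;>
      refine ContDiffOn.div (by fun_prop) (by fun_prop) fun z hz => ?_
    · exact pow_ne_zero 2 hz.2.2.2.1
    · exact hz.2.2.2.1
    · exact mul_ne_zero (mul_ne_zero hz.1 hz.2.1) hz.2.2.2.1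
  · simp only [innerArg, Sum.elim_inl, Sum.elim_inr]
    exact ContDiffOn.div (by fun_prop) (by fun_prop) fun z hz => hz.2.2.2.1
  · simp only [innerArg, Sum.elim_inl, Sum.elim_inr]
    exact ContDiffOn.div (by fun_prop) (by fun_prop) fun z hz =>
      mul_ne_zero (mul_ne_zero hz.1 (hz.2.2.1 r)) hz.2.2.2.1

theorem contDiffOn_outerArg (η : Scales) (i : PoleIndex) :
    ContDiffOn ℂ 1 (fun z : Params × ℂ => outerArg q (z.1, η) z.2 i) (regularAt η) := by
  rcases i with i | r | r
  · fin_cases i <;> simp [outerArg, Sum.elim_inl]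
    · exact ContDiffOn.div (by fun_prop) (by fun_prop) fun z hz => mul_ne_zero hz.1 hz.2.1
    · fun_prop
    · fun_prop
  · simp only [outerArg, Sum.elim_inl, Sum.elim_inr]
    fun_prop
  · simp only [outerArg, Sum.elim_inl, Sum.elim_inr]
    exact ContDiffOn.div (by fun_prop) (by fun_prop) fun z hz =>
      mul_ne_zero hz.1 (hz.2.2.1 r)

theorem contDiffOn_extraArg (η : Scales) :
    ContDiffOn ℂ 1 (fun z : Params × ℂ => extraArg q (z.1, η) z.2) (regularAt η) :=
  ContDiffOn.div (by fun_prop) (by fun_prop) fun z hz => mul_ne_zero hz.2.1 hz.2.2.2.1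

theorem contDiffOn_numerArg (η : Scales) (i) :
    ContDiffOn ℂ 1 (fun z : Params × ℂ => numerArg q (z.1, η) z.2 i) (regularAt η) := by
  rcases i with i | ⟨r, i⟩
  · fin_cases i <;> simp [numerArg, nome, Sum.elim_inl]
    · exact ContDiffOn.div (by fun_prop) (by fun_prop) fun z hz =>
        mul_ne_zero hz.1 (pow_ne_zero 2 hz.2.2.2.1)
    · exact ContDiffOn.div (by fun_prop) (by fun_prop) fun z hz => hz.1
    · fun_prop
    · exact ContDiffOn.div (by fun_prop) (by fun_prop) fun z hz => hz.2.1
    · exact ContDiffOn.div (by fun_prop) (by fun_prop) fun z hz => hz.2.2.2.1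
  · fin_cases i <;> simp [numerArg, Sum.elim_inr]
    · exact ContDiffOn.div (by fun_prop) (by fun_prop) fun z hz =>
        mul_ne_zero (hz.2.2.1 r) hz.2.2.2.1
    · exact ContDiffOn.div (by fun_prop) (by fun_prop) fun z hz => hz.2.2.1 r
    · exact ContDiffOn.div (by fun_prop) (by fun_prop) fun z hz => hz.2.2.2.1
    · fun_prop

theorem _root_.ContinuousOn.pqTail {X : Type*} [TopologicalSpace X] {f p : X → ℂ} {S : Set X}
    (hf : ContinuousOn f S) (hp : ContinuousOn p S) (h : ∀ x ∈ S, ‖p x‖ < 1) (hq : ‖q‖ < 1)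
    (N : ℕ) : ContinuousOn (fun x => pqTail (p x) q N (f x)) S :=
  ((hf.mul continuousOn_const).qPoch continuousOn_const fun _ _ => hq).mul
    ((hf.mul hp).pqPoch hp h hq)

theorem _root_.ContDiffOn.pqTail {X : Type*} [NormedAddCommGroup X] [NormedSpace ℂ X] {f : X → ℂ}
    {p : ℂ} {S : Set X} (hf : ContDiffOn ℂ 1 f S) (hp : ‖p‖ < 1) (hq : ‖q‖ < 1) (N : ℕ) :
    ContDiffOn ℂ 1 (fun x => pqTail p q N (f x)) S :=
  ((hf.mul contDiffOn_const).qPoch hq).mul ((hf.mul contDiffOn_const).pqPoch hp hq)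

theorem continuousOn_numer (hq : ‖q‖ < 1) :
    ContinuousOn (fun z : (Params × Scales) × ℂ => numer q z.1 z.2) regular := by
  have hn := continuousOn_nome_fst (S := regular)
  have h (z : (Params × Scales) × ℂ) (hz : z ∈ regular) : ‖nome z.1.2‖ < 1 := hz.2.2.2.2
  have h1 : ContinuousOn (fun z : (Params × Scales) × ℂ => z.1.1.2.1 / (z.1.1.1 * z.2)) regular :=
    ContinuousOn.div (by fun_prop) (by fun_prop) fun z hz => mul_ne_zero hz.1 hz.2.2.2.1
  have h2 : ContinuousOn (fun z : (Params × Scales) × ℂ => q / (z.1.1.2.1 / (z.1.1.1 * z.2)))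
      regular := ContinuousOn.div (by fun_prop) h1 fun z hz =>
        div_ne_zero hz.2.1 (mul_ne_zero hz.1 hz.2.2.2.1)
  refine ((ContinuousOn.mul (ContinuousOn.qPoch (by fun_prop) hn h) (ContinuousOn.qPoch
    (ContinuousOn.div (by fun_prop) (by fun_prop) fun z hz => pow_ne_zero 2 hz.2.2.2.1) hn h)).mul
    ((h1.qPoch continuousOn_const fun _ _ => hq).mul
      (h2.qPoch continuousOn_const fun _ _ => hq))).mul
    (continuousOn_finsetProd _ fun i _ => (continuousOn_numerArg i).pqPoch hn h hq)

theorem contDiffOn_numer (hq : ‖q‖ < 1) {η : Scales}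
    (hη : ‖nome η‖ < 1) :
    ContDiffOn ℂ 1 (fun z : Params × ℂ => numer q (z.1, η) z.2) (regularAt η) := by
  have h1 : ContDiffOn ℂ 1 (fun z : Params × ℂ => z.1.2.1 / (z.1.1 * z.2)) (regularAt η) :=
    ContDiffOn.div (by fun_prop) (by fun_prop) fun z hz => mul_ne_zero hz.1 hz.2.2.2.1
  have h2 : ContDiffOn ℂ 1 (fun z : Params × ℂ => q / (z.1.2.1 / (z.1.1 * z.2)))
      (regularAt η) := ContDiffOn.div (by fun_prop) h1 fun z hz =>
        div_ne_zero hz.2.1 (mul_ne_zero hz.1 hz.2.2.2.1)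
  unfold numer
  dsimp only
  refine ((ContDiffOn.mul (ContDiffOn.qPoch (by fun_prop) hη) (ContDiffOn.qPoch
    (ContDiffOn.div (by fun_prop) (by fun_prop) fun z hz => pow_ne_zero 2 hz.2.2.2.1) hη)).mul
    ((h1.qPoch hq).mul (h2.qPoch hq))).mul
    (contDiffOn_prod fun i _ => (contDiffOn_numerArg η i).pqPoch hη hq)

theorem continuousOn_reg (hq : ‖q‖ < 1) (K : ℕ) :
    ContinuousOn (fun z : (Params × Scales) × ℂ => regNumU q K z.1 z.2) regular ∧
    ContinuousOn (fun z : (Params × Scales) × ℂ => regNumV q K z.1 z.2) regular ∧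
    ContinuousOn (fun z : (Params × Scales) × ℂ => regDenU q K z.1 z.2) regular ∧
    ContinuousOn (fun z : (Params × Scales) × ℂ => regDenV q K z.1 z.2) regular := by
  have hn := continuousOn_nome_fst (S := regular)
  have h (z : (Params × Scales) × ℂ) (hz : z ∈ regular) : ‖nome z.1.2‖ < 1 := hz.2.2.2.2
  have hin : ContinuousOn (fun z : (Params × Scales) × ℂ =>
      (innerArg q z.1 z.2, outerArg q z.1 z.2 mainOuter)) regular :=
    (continuousOn_pi.2 fun i => continuousOn_innerArg i).prodMk (continuousOn_outerArg _)
  have hreg : ContinuousOn (fun z : (Params × Scales) × ℂ => regNum q K z.1 z.2) regular :=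
    (continuousOn_numer hq).mul (continuousOn_extraArg.pqTail hn h hq _)
  refine ⟨?_, ?_, ?_, ?_⟩
  · exact ((contDiff_bezoutU q K).continuous.comp_continuousOn hin).mul hreg
  · exact ((contDiff_bezoutV q K).continuous.comp_continuousOn hin).mul hreg
  · exact (continuousOn_finsetProd _ fun i _ => (continuousOn_innerArg i).pqTail hn h hq K).mul
      (continuousOn_finsetProd _ fun i _ => (continuousOn_outerArg i).pqPoch hn h hq)
  · exact (continuousOn_finsetProd _ fun i _ => (continuousOn_innerArg i).pqPoch hn h hq).mul
      (((continuousOn_outerArg _).pqTail hn h hq K).mul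
        (continuousOn_finsetProd _ fun i _ => (continuousOn_outerArg i).pqPoch hn h hq))

theorem contDiffOn_reg (hq : ‖q‖ < 1) (K : ℕ) {η : Scales} (hη : ‖nome η‖ < 1) :
    ContDiffOn ℂ 1 (fun z : Params × ℂ => regNumU q K (z.1, η) z.2) (regularAt η) ∧
    ContDiffOn ℂ 1 (fun z : Params × ℂ => regNumV q K (z.1, η) z.2) (regularAt η) ∧
    ContDiffOn ℂ 1 (fun z : Params × ℂ => regDenU q K (z.1, η) z.2) (regularAt η) ∧
    ContDiffOn ℂ 1 (fun z : Params × ℂ => regDenV q K (z.1, η) z.2) (regularAt η) := by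
  have hin : ContDiffOn ℂ 1 (fun z : Params × ℂ =>
      (innerArg q (z.1, η) z.2, outerArg q (z.1, η) z.2 mainOuter)) (regularAt η) :=
    (contDiffOn_pi.2 fun i => contDiffOn_innerArg η i).prodMk (contDiffOn_outerArg η _)
  have e0 : ContDiffOn ℂ 1 (fun z : Params × ℂ => pqTail (nome η) q (2 * K)
      (extraArg q (z.1, η) z.2)) (regularAt η) := (contDiffOn_extraArg η).pqTail hη hq _
  have hreg : ContDiffOn ℂ 1 (fun z : Params × ℂ => regNum q K (z.1, η) z.2) (regularAt η) :=
    (contDiffOn_numer hq hη).mul e0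
  have e1 : ContDiffOn ℂ 1 (fun z : Params × ℂ => ∏ i, pqTail (nome η) q K
      (innerArg q (z.1, η) z.2 i)) (regularAt η) :=
    contDiffOn_prod fun i _ => (contDiffOn_innerArg η i).pqTail hη hq K
  have e2 : ContDiffOn ℂ 1 (fun z : Params × ℂ => ∏ i, pqPoch
      (outerArg q (z.1, η) z.2 i) (nome η) q) (regularAt η) :=
    contDiffOn_prod fun i _ => (contDiffOn_outerArg η i).pqPoch hη hq
  have e3 : ContDiffOn ℂ 1 (fun z : Params × ℂ => ∏ i, pqPoch
      (innerArg q (z.1, η) z.2 i) (nome η) q) (regularAt η) :=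
    contDiffOn_prod fun i _ => (contDiffOn_innerArg η i).pqPoch hη hq
  have e4 : ContDiffOn ℂ 1 (fun z : Params × ℂ => ∏ i ∈ {mainOuter}ᶜ, pqPoch
      (outerArg q (z.1, η) z.2 i) (nome η) q) (regularAt η) :=
    contDiffOn_prod fun i _ => (contDiffOn_outerArg η i).pqPoch hη hq
  have e5 : ContDiffOn ℂ 1 (fun z : Params × ℂ => pqTail (nome η) q K
      (outerArg q (z.1, η) z.2 mainOuter)) (regularAt η) :=
    (contDiffOn_outerArg η _).pqTail hη hq K
  exact ⟨((contDiff_bezoutU q K).comp_contDiffOn hin).mul hreg,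
    ((contDiff_bezoutV q K).comp_contDiffOn hin).mul hreg, e1.mul e2, e3.mul (e5.mul e4)⟩

end
end EllipticBeta
end

noncomputable section
namespace EllipticBeta

/-! ### Zeros of the denominators -/

section
variable {q : ℂ}

/-- The inner arguments are monomials in 1/w, so a bound on one circle holds everywhere outside it;
the outer arguments behave in the opposite way. -/
theorem norm_innerArg_le {y : Params × Scales} {w : ℂ} {ρ : ℝ} (hρ : 0 < ρ) (hw : ρ ≤ ‖w‖)
    (i : PoleIndex) : ‖innerArg q y w i‖ ≤ ‖innerArg q y ρ i‖ := by
  have h1 : ‖(ρ : ℂ)‖ ≤ ‖w‖ := by rwa [Complex.norm_real, Real.norm_of_nonneg hρ.le]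
  have h0 : 0 < ‖(ρ : ℂ)‖ := by rwa [Complex.norm_real, Real.norm_of_nonneg hρ.le]
  rcases i with i | r | r
  · fin_cases i <;> simp only [innerArg, Sum.elim_inl, Fin.zero_eta, Fin.mk_one, Fin.reduceFinMk,
      Matrix.cons_val, norm_div, norm_pow, norm_mul]
    · gcongr
    · gcongr
    · by_cases h : ‖y.1.1‖ * ‖y.1.2.1‖ = 0
      · simp [h]
      · have : 0 < ‖y.1.1‖ * ‖y.1.2.1‖ := lt_of_le_of_ne (by positivity) (Ne.symm h)
        gcongr
  · simp only [innerArg, Sum.elim_inl, Sum.elim_inr, norm_div]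
    gcongr
  · simp only [innerArg, Sum.elim_inr, norm_div, norm_mul]
    by_cases h : ‖y.1.1‖ * ‖y.1.2.2 r‖ = 0
    · simp [h]
    · have : 0 < ‖y.1.1‖ * ‖y.1.2.2 r‖ := lt_of_le_of_ne (by positivity) (Ne.symm h)
      gcongr

theorem norm_outerArg_le {y : Params × Scales} {w : ℂ} {ρ : ℝ} (hw : ‖w‖ ≤ ρ)
    (i : PoleIndex) : ‖outerArg q y w i‖ ≤ ‖outerArg q y ρ i‖ := by
  have h1 : ‖w‖ ≤ ‖(ρ : ℂ)‖ := by
    rwa [Complex.norm_real, Real.norm_of_nonneg ((norm_nonneg w).trans hw)]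
  rcases i with i | r | r
  · fin_cases i <;> simp only [outerArg, Sum.elim_inl, Fin.zero_eta, Fin.mk_one, Fin.reduceFinMk,
      Matrix.cons_val, norm_div, norm_pow, norm_mul] <;> gcongr
  · simp only [outerArg, Sum.elim_inl, Sum.elim_inr, norm_mul]
    gcongr
  · simp only [outerArg, Sum.elim_inr, norm_div, norm_mul]
    gcongr

theorem pqTail_ne_zero {p x : ℂ} (hp : ‖p‖ < 1) (hq : ‖q‖ < 1) {N : ℕ} (h1 : ‖x * q ^ N‖ < 1)
    (h2 : ‖x * p‖ < 1) : pqTail p q N x ≠ 0 :=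
  mul_ne_zero (qPoch_ne_zero_of_norm_lt hq h1) (pqPoch_ne_zero_of_norm_lt hp hq h2)

theorem pqPoch_eq_zero_of_pqTail {p x : ℂ} (hp : ‖p‖ < 1) (hq : ‖q‖ < 1) {N : ℕ}
    (h : pqTail p q N x = 0) : pqPoch x p q = 0 := by
  rw [pqPoch_eq_qFin_mul hp hq x N, h, mul_zero]

/-- The zeros of the denominator of `scaledIntegrand` inside the contour. -/
def innerZeros (q : ℂ) (y : Params × Scales) : Set ℂ :=
  {w | w ≠ 0 ∧ ∃ i, pqPoch (innerArg q y w i) (nome y.2) q = 0}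

/-- The zeros of the denominator of `scaledIntegrand` outside the contour. -/
def outerZeros (q : ℂ) (y : Params × Scales) : Set ℂ :=
  {w | w ≠ 0 ∧ ∃ i, pqPoch (outerArg q y w i) (nome y.2) q = 0}

/-- Parameters for which the two circles of radii `r ≤ R` can be used to regularise the integral of
`scaledIntegrand`. -/
structure IsAdmissible (q : ℂ) (r R : ℝ) (K : ℕ) (y : Params × Scales) : Prop where
  regular : (y, 1) ∈ regular
  inner : ∀ i, ‖innerArg q y R i‖ < 1
  inner_pow : ∀ i, ‖innerArg q y r i * q ^ K‖ < 1
  inner_nome : ∀ i, ‖innerArg q y r i * nome y.2‖ < 1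
  main : ‖outerArg q y r mainOuter‖ < 1
  main_pow : ‖outerArg q y R mainOuter * q ^ K‖ < 1
  main_nome : ‖outerArg q y R mainOuter * nome y.2‖ < 1
  outer : ∀ i ≠ mainOuter, ‖outerArg q y R i‖ < 1

theorem mem_regular_of {y : Params × Scales} (h : (y, 1) ∈ regular) {w : ℂ} (hw : w ≠ 0) :
    (y, w) ∈ regular := ⟨h.1, h.2.1, h.2.2.1, hw, h.2.2.2.2⟩

variable {r R : ℝ} {K : ℕ} {y : Params × Scales}

theorem IsAdmissible.nome_lt (h : IsAdmissible q r R K y) : ‖nome y.2‖ < 1 := h.regular.2.2.2.2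

theorem norm_mul_le_of_le {x x' z : ℂ} (h : ‖x‖ ≤ ‖x'‖) (h' : ‖x' * z‖ < 1) : ‖x * z‖ < 1 := by
  rw [norm_mul] at *
  exact (mul_le_mul_of_nonneg_right h (norm_nonneg z)).trans_lt h'

/-- The tails of the inner factors can only vanish for |w| < r, by the bounds on `innerArg` times
q^K and times the nome. The outer factors can only vanish for |w| > r. So the small circle separates
the zeros that are left. -/
theorem regDenU_eq_zero (hq : ‖q‖ < 1) (hr : 0 < r) (hrR : r ≤ R) (h : IsAdmissible q r R K y)
    {w : ℂ} (hw : w ≠ 0) (h0 : regDenU q K y w = 0) :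
    (‖w‖ < r ∧ w ∈ innerZeros q y) ∨ (r < ‖w‖ ∧ w ∈ outerZeros q y) := by
  have hp := h.nome_lt
  rcases mul_eq_zero.1 h0 with h0 | h0
  · obtain ⟨i, -, hi⟩ := Finset.prod_eq_zero_iff.1 h0
    refine Or.inl ⟨?_, hw, i, pqPoch_eq_zero_of_pqTail hp hq hi⟩
    by_contra! hle
    have := norm_innerArg_le (q := q) (y := y) hr hle i
    exact pqTail_ne_zero hp hq (norm_mul_le_of_le this (h.inner_pow i))
      (norm_mul_le_of_le this (h.inner_nome i)) hi
  · obtain ⟨i, -, hi⟩ := Finset.prod_eq_zero_iff.1 h0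
    refine Or.inr ⟨?_, hw, i, hi⟩
    by_contra! hle
    by_cases him : i = mainOuter
    · subst him
      exact pqPoch_ne_zero_of_norm_lt hp hq ((norm_outerArg_le hle _).trans_lt h.main) hi
    · exact pqPoch_ne_zero_of_norm_lt hp hq
        ((norm_outerArg_le (hle.trans hrR) _).trans_lt (h.outer i him)) hi

/-- The mirror image of `regDenU_eq_zero` for the large circle, on which all inner arguments and all
outer arguments except the main one are below 1 in modulus. -/
theorem regDenV_eq_zero (hq : ‖q‖ < 1) (hr : 0 < r) (hrR : r ≤ R) (h : IsAdmissible q r R K y)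
    {w : ℂ} (hw : w ≠ 0) (h0 : regDenV q K y w = 0) :
    (‖w‖ < R ∧ w ∈ innerZeros q y) ∨ (R < ‖w‖ ∧ w ∈ outerZeros q y) := by
  have hp := h.nome_lt
  rcases mul_eq_zero.1 h0 with h0 | h0
  · obtain ⟨i, -, hi⟩ := Finset.prod_eq_zero_iff.1 h0
    refine Or.inl ⟨?_, hw, i, hi⟩
    by_contra! hle
    exact pqPoch_ne_zero_of_norm_lt hp hq
      ((norm_innerArg_le (hr.trans_le hrR) hle i).trans_lt (h.inner i)) hi
  rcases mul_eq_zero.1 h0 with h0 | h0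
  · refine Or.inr ⟨?_, hw, mainOuter, pqPoch_eq_zero_of_pqTail hp hq h0⟩
    by_contra! hle
    have := norm_outerArg_le (q := q) (y := y) hle mainOuter
    exact pqTail_ne_zero hp hq (norm_mul_le_of_le this h.main_pow)
      (norm_mul_le_of_le this h.main_nome) h0
  · obtain ⟨i, him, hi⟩ := Finset.prod_eq_zero_iff.1 h0
    refine Or.inr ⟨?_, hw, i, hi⟩
    by_contra! hle
    exact pqPoch_ne_zero_of_norm_lt hp hq
        ((norm_outerArg_le hle _).trans_lt (h.outer i (by simpa using him))) hi

theorem isOpen_isAdmissible (hr : 0 < r) (hrR : r ≤ R) : IsOpen {y | IsAdmissible q r R K y} := by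
  have hr' : (r : ℂ) ≠ 0 := by exact_mod_cast hr.ne'
  have hR' : (R : ℂ) ≠ 0 := by exact_mod_cast (hr.trans_le hrR).ne'
  rw [isOpen_iff_mem_nhds]
  intro y h
  have c1 (w : ℂ) (hw : w ≠ 0) (i) : ContinuousAt (fun y => innerArg q y w i) y :=
    ContinuousAt.comp (f := fun y => (y, w)) ((continuousOn_innerArg i).continuousAt
      (isOpen_regular.mem_nhds (mem_regular_of h.regular hw))) (by fun_prop)
  have c2 (w : ℂ) (hw : w ≠ 0) (i) : ContinuousAt (fun y => outerArg q y w i) y :=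
    ContinuousAt.comp (f := fun y => (y, w)) ((continuousOn_outerArg i).continuousAt
      (isOpen_regular.mem_nhds (mem_regular_of h.regular hw))) (by fun_prop)
  have c3 : ContinuousAt (fun y : Params × Scales => nome y.2) y :=
    (continuous_nome.comp continuous_snd).continuousAt
  have e0 : ∀ᶠ y' in 𝓝 y, (y', (1 : ℂ)) ∈ EllipticBeta.regular :=
    ContinuousAt.eventually_mem (f := fun y' : Params × Scales => (y', (1 : ℂ))) (by fun_prop)
      (isOpen_regular.mem_nhds h.regular)
  filter_upwards [e0, eventually_all.2 fun i => (c1 R hR' i).norm.eventually_lt_const (h.inner i),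
    eventually_all.2 fun i => ((c1 r hr' i).mul_const (q ^ K)).norm.eventually_lt_const
      (h.inner_pow i),
    eventually_all.2 fun i => ((c1 r hr' i).mul c3).norm.eventually_lt_const (h.inner_nome i),
    (c2 r hr' mainOuter).norm.eventually_lt_const h.main,
    ((c2 R hR' mainOuter).mul_const (q ^ K)).norm.eventually_lt_const h.main_pow,
    ((c2 R hR' mainOuter).mul c3).norm.eventually_lt_const h.main_nome,
    eventually_all.2 fun i => eventually_all.2 fun hi : i ≠ mainOuter =>
      (c2 R hR' i).norm.eventually_lt_const (h.outer i hi)] with y' h0 h1 h2 h3 h4 h5 h6 h7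
  exact ⟨h0, h1, h2, h3, h4, h5, h6, h7⟩

/-! ### The regularised integral -/

/-- Up to an explicit factor, the integral of `scaledIntegrand`. -/
def regIntegral (q : ℂ) (r R : ℝ) (K : ℕ) (y : Params × Scales) : ℂ :=
  contourIntegral (circleCurve r)
    (fun w => regNumU q K y w / (regDenU q K y w * (2 * Real.pi * Complex.I * w))) +
  contourIntegral (circleCurve R)
    (fun w => regNumV q K y w / (regDenV q K y w * (2 * Real.pi * Complex.I * w)))

theorem two_pi_I_mul_ne_zero {w : ℂ} (hw : w ≠ 0) : 2 * Real.pi * Complex.I * w ≠ 0 :=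
  mul_ne_zero Complex.two_pi_I_ne_zero hw

theorem circleCurve_ne_zero (R s : ℝ) : circleCurve R s ≠ 0 := starCurve_ne_zero _ s

theorem continuous_circleCurve (R : ℝ) : Continuous (circleCurve R) :=
  (isLoop_circleCurve R).contDiff.continuous

theorem continuous_deriv_circleCurve (R : ℝ) : Continuous (deriv (circleCurve R)) :=
  (isLoop_circleCurve R).contDiff.continuous_deriv le_rfl

theorem regDenU_circleCurve_ne_zero (hq : ‖q‖ < 1) (hr : 0 < r) (hrR : r ≤ R)
    (h : IsAdmissible q r R K y) (s : ℝ) : regDenU q K y (circleCurve r s) ≠ 0 := fun h0 => by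
  have := regDenU_eq_zero hq hr hrR h (circleCurve_ne_zero r s) h0
  rw [norm_circleCurve hr] at this
  rcases this with h | h <;> exact lt_irrefl _ h.1

theorem regDenV_circleCurve_ne_zero (hq : ‖q‖ < 1) (hr : 0 < r) (hrR : r ≤ R)
    (h : IsAdmissible q r R K y) (s : ℝ) : regDenV q K y (circleCurve R s) ≠ 0 := fun h0 => by
  have := regDenV_eq_zero hq hr hrR h (circleCurve_ne_zero R s) h0
  rw [norm_circleCurve (hr.trans_le hrR)] at this
  rcases this with h | h <;> exact lt_irrefl _ h.1

theorem continuousOn_regIntegral (hq : ‖q‖ < 1) (hr : 0 < r) (hrR : r ≤ R) :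
    ContinuousOn (regIntegral q r R K) {y | IsAdmissible q r R K y} := by
  obtain ⟨c1, c2, c3, c4⟩ := continuousOn_reg hq K
  have hlin : Continuous fun z : (Params × Scales) × ℂ => 2 * Real.pi * Complex.I * z.2 := by
    fun_prop
  refine ContinuousOn.add ?_ ?_
  · refine continuousOn_integral_curve (F := fun z => regNumU q K z.1 z.2 /
      (regDenU q K z.1 z.2 * (2 * Real.pi * Complex.I * z.2))) (S := regular ∩
      {z | regDenU q K z.1 z.2 ≠ 0}) zero_le_one (continuous_circleCurve r)
      (continuous_deriv_circleCurve r) ?_ fun y hy s _ =>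
        ⟨mem_regular_of hy.regular (circleCurve_ne_zero r s),
          regDenU_circleCurve_ne_zero hq hr hrR hy s⟩
    exact (c1.mono Set.inter_subset_left).div ((c3.mono Set.inter_subset_left).mul
      hlin.continuousOn) fun z hz => mul_ne_zero hz.2 (two_pi_I_mul_ne_zero hz.1.2.2.2.1)
  · refine continuousOn_integral_curve (F := fun z => regNumV q K z.1 z.2 /
      (regDenV q K z.1 z.2 * (2 * Real.pi * Complex.I * z.2))) (S := regular ∩
      {z | regDenV q K z.1 z.2 ≠ 0}) zero_le_one (continuous_circleCurve R)
      (continuous_deriv_circleCurve R) ?_ fun y hy s _ =>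
        ⟨mem_regular_of hy.regular (circleCurve_ne_zero R s),
          regDenV_circleCurve_ne_zero hq hr hrR hy s⟩
    exact (c2.mono Set.inter_subset_left).div ((c4.mono Set.inter_subset_left).mul
      hlin.continuousOn) fun z hz => mul_ne_zero hz.2 (two_pi_I_mul_ne_zero hz.1.2.2.2.1)

theorem isOpen_setOf_isAdmissible (hr : 0 < r) (hrR : r ≤ R) (η : Scales) :
    IsOpen {x | IsAdmissible q r R K (x, η)} :=
  (isOpen_isAdmissible hr hrR).preimage (by fun_prop : Continuous fun x : Params => (x, η))

theorem contDiffOn_regIntegral (hq : ‖q‖ < 1) (hr : 0 < r) (hrR : r ≤ R) {η : Scales}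
    (hη : ‖nome η‖ < 1) :
    ContDiffOn ℂ 1 (fun x => regIntegral q r R K (x, η)) {x | IsAdmissible q r R K (x, η)} := by
  obtain ⟨c1, c2, c3, c4⟩ := contDiffOn_reg hq K hη
  have hlin : ContDiff ℂ 1 fun z : Params × ℂ => 2 * Real.pi * Complex.I * z.2 := by
    fun_prop
  have hO := isOpen_regularAt η
  refine ContDiffOn.add ?_ ?_
  · refine contDiffOn_integral_curve (F := fun z => regNumU q K (z.1, η) z.2 /
      (regDenU q K (z.1, η) z.2 * (2 * Real.pi * Complex.I * z.2))) (S := regularAt η ∩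
      {z | regDenU q K (z.1, η) z.2 ≠ 0}) zero_le_one (continuous_circleCurve r)
      (continuous_deriv_circleCurve r) ?_ ?_ (isOpen_setOf_isAdmissible hr hrR η)
      fun y hy s _ => ⟨mem_regular_of hy.regular (circleCurve_ne_zero r s),
          regDenU_circleCurve_ne_zero hq hr hrR hy s⟩
    · exact c3.continuousOn.isOpen_inter_preimage hO isOpen_compl_singleton
    · exact (c1.mono Set.inter_subset_left).div ((c3.mono Set.inter_subset_left).mul
        hlin.contDiffOn) fun z hz => mul_ne_zero hz.2 (two_pi_I_mul_ne_zero hz.1.2.2.2.1)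
  · refine contDiffOn_integral_curve (F := fun z => regNumV q K (z.1, η) z.2 /
      (regDenV q K (z.1, η) z.2 * (2 * Real.pi * Complex.I * z.2))) (S := regularAt η ∩
      {z | regDenV q K (z.1, η) z.2 ≠ 0}) zero_le_one (continuous_circleCurve R)
      (continuous_deriv_circleCurve R) ?_ ?_ (isOpen_setOf_isAdmissible hr hrR η)
      fun y hy s _ => ⟨mem_regular_of hy.regular (circleCurve_ne_zero R s),
          regDenV_circleCurve_ne_zero hq hr hrR hy s⟩
    · exact c4.continuousOn.isOpen_inter_preimage hO isOpen_compl_singleton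
    · exact (c2.mono Set.inter_subset_left).div ((c4.mono Set.inter_subset_left).mul
        hlin.contDiffOn) fun z hz => mul_ne_zero hz.2 (two_pi_I_mul_ne_zero hz.1.2.2.2.1)

theorem differentiableOn_reg (hq : ‖q‖ < 1) (K : ℕ) (h : (y, 1) ∈ regular) :
    DifferentiableOn ℂ (regNumU q K y) {0}ᶜ ∧ DifferentiableOn ℂ (regNumV q K y) {0}ᶜ ∧
    DifferentiableOn ℂ (regDenU q K y) {0}ᶜ ∧ DifferentiableOn ℂ (regDenV q K y) {0}ᶜ := by
  rcases y with ⟨x, η⟩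
  obtain ⟨c1, c2, c3, c4⟩ := contDiffOn_reg (η := η) hq K h.2.2.2.2
  have hmap : ∀ w ∈ ({0}ᶜ : Set ℂ), (x, w) ∈ regularAt η := fun w hw => mem_regular_of h hw
  have hd : DifferentiableOn ℂ (fun w : ℂ => (x, w)) {0}ᶜ := by fun_prop
  have key (f : Params × ℂ → ℂ) (hf : ContDiffOn ℂ 1 f (regularAt η)) :
      DifferentiableOn ℂ (fun w => f (x, w)) {0}ᶜ :=
    (hf.differentiableOn one_ne_zero).comp hd hmap
  exact ⟨key _ c1, key _ c2, key _ c3, key _ c4⟩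

/-- The Bezout identity divided by the denominator of the integrand. The factor with index `Sum.inl
0` is missing on the left because it has been traded for the factors removed from `extraArg`. -/
theorem bezout_scaledIntegrand (hq : ‖q‖ < 1) (K : ℕ) (h : (y, 1) ∈ regular) {w : ℂ} (hw : w ≠ 0)
    (h1 : w ∉ innerZeros q y) (h2 : w ∉ outerZeros q y) :
    (∏ i ∈ {Sum.inl 0}ᶜ, qFin q (innerArg q y w i * outerArg q y w mainOuter) (2 * K)) *
      scaledIntegrand q y w =
    regNumU q K y w / regDenU q K y w + regNumV q K y w / regDenV q K y w := by
  have hp : ‖nome y.2‖ < 1 := h.2.2.2.2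
  have n1 (i) : pqPoch (innerArg q y w i) (nome y.2) q ≠ 0 := fun h0 => h1 ⟨hw, i, h0⟩
  have n2 (i) : pqPoch (outerArg q y w i) (nome y.2) q ≠ 0 := fun h0 => h2 ⟨hw, i, h0⟩
  have hx : extraArg q y w = innerArg q y w (Sum.inl 0) * outerArg q y w mainOuter := by
    have hb := h.1
    simp only [extraArg, innerArg, outerArg, mainOuter, Sum.elim_inl, Matrix.cons_val_zero]
    field_simp
  have hbez := bezout_qFin q K (innerArg q y w) (outerArg q y w mainOuter)
  rw [← Finset.prod_mul_prod_compl {Sum.inl 0}, Finset.prod_singleton, ← hx] at hbez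
  have d1 : ∏ i, pqPoch (innerArg q y w i) (nome y.2) q =
      (∏ i, qFin q (innerArg q y w i) K) * ∏ i, pqTail (nome y.2) q K (innerArg q y w i) := by
    rw [← Finset.prod_mul_distrib]
    exact Finset.prod_congr rfl fun i _ => pqPoch_eq_qFin_mul hp hq _ K
  have d2 : ∏ i, pqPoch (outerArg q y w i) (nome y.2) q =
      qFin q (outerArg q y w mainOuter) K * (pqTail (nome y.2) q K (outerArg q y w mainOuter) *
      ∏ i ∈ {mainOuter}ᶜ, pqPoch (outerArg q y w i) (nome y.2) q) := by
    rw [← Finset.prod_mul_prod_compl {mainOuter}, Finset.prod_singleton, ← mul_assoc,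
      ← pqPoch_eq_qFin_mul hp hq]
  have e1 : ∏ i, pqPoch (innerArg q y w i) (nome y.2) q ≠ 0 :=
    Finset.prod_ne_zero_iff.2 fun i _ => n1 i
  have e2 : ∏ i, pqPoch (outerArg q y w i) (nome y.2) q ≠ 0 :=
    Finset.prod_ne_zero_iff.2 fun i _ => n2 i
  rw [regNumU, regNumV, regDenU, regDenV, scaledIntegrand, regNum,
    pqPoch_eq_qFin_mul hp hq (extraArg q y w) (2 * K), d1, d2]
  rw [d1] at e1; rw [d2] at e2
  obtain ⟨a1, a2⟩ := mul_ne_zero_iff.1 e1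
  obtain ⟨b1, b2⟩ := mul_ne_zero_iff.1 e2
  generalize (∏ i, qFin q (innerArg q y w i) K) = A at *
  generalize (∏ i, pqTail (nome y.2) q K (innerArg q y w i)) = A' at *
  generalize qFin q (outerArg q y w mainOuter) K = C at *
  generalize (pqTail (nome y.2) q K (outerArg q y w mainOuter) *
      ∏ i ∈ {mainOuter}ᶜ, pqPoch (outerArg q y w i) (nome y.2) q) = C' at *
  field_simp
  linear_combination numer q y w * pqTail (nome y.2) q (2 * K) (extraArg q y w) * hbez

/-- The regularised integral as a contour integral. -/
theorem regIntegral_eq (hq : ‖q‖ < 1) (hr : 0 < r) (hrR : r ≤ R) (h : IsAdmissible q r R K y)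
    {γ : ℝ → ℂ} (hγ : IsSeparatingContour γ (innerZeros q y) (outerZeros q y)) :
    regIntegral q r R K y = contourIntegral γ (fun w => (∏ i ∈ {Sum.inl 0}ᶜ,
      qFin q (innerArg q y w i * outerArg q y w mainOuter) (2 * K)) *
      (scaledIntegrand q y w / (2 * Real.pi * Complex.I * w))) := by
  obtain ⟨c1, c2, c3, c4⟩ := differentiableOn_reg hq K h.regular
  have hR := hr.trans_le hrR
  have hlin : DifferentiableOn ℂ (fun w : ℂ => 2 * Real.pi * Complex.I * w) {0}ᶜ := by fun_prop
  have hz (D : ℂ → ℂ) (ρ : ℝ) (hρ : ∀ w ≠ 0, D w = 0 → (‖w‖ < ρ ∧ w ∈ innerZeros q y) ∨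
      (ρ < ‖w‖ ∧ w ∈ outerZeros q y)) (w : ℂ) (hw : w ≠ 0)
      (h0 : D w * (2 * Real.pi * Complex.I * w) = 0) :
      (‖w‖ < ρ ∧ w ∈ innerZeros q y) ∨ (ρ < ‖w‖ ∧ w ∈ outerZeros q y) :=
    hρ w hw ((mul_eq_zero.1 h0).resolve_right (two_pi_I_mul_ne_zero hw))
  -- For each of the two terms the given contour and the circle have the same winding numbers about
  -- all remaining poles, so the circle integral can be moved to the common contour and the two
  -- integrals added there.
  have key (N D : ℂ → ℂ) (hN : DifferentiableOn ℂ N {0}ᶜ) (hD : DifferentiableOn ℂ D {0}ᶜ)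
      (ρ : ℝ) (hρ0 : 0 < ρ) (hρ : ∀ w ≠ 0, D w = 0 → (‖w‖ < ρ ∧ w ∈ innerZeros q y) ∨
      (ρ < ‖w‖ ∧ w ∈ outerZeros q y)) :
      contourIntegral (circleCurve ρ) (fun w => N w / (D w * (2 * Real.pi * Complex.I * w))) =
      contourIntegral γ (fun w => N w / (D w * (2 * Real.pi * Complex.I * w))) := by
    refine contourIntegral_div_eq hN (hD.mul hlin) (isLoop_circleCurve ρ) hγ.isLoop ?_ ?_ ?_
    · intro s _ h0
      have := hz D ρ hρ _ (circleCurve_ne_zero ρ s) h0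
      rw [norm_circleCurve hρ0] at this
      rcases this with h | h <;> exact lt_irrefl _ h.1
    · intro s hs h0
      have := hz D ρ hρ _ (hγ.ne_zero s hs) h0
      exact hγ.avoids s hs (this.imp (fun h => h.2) fun h => h.2)
    · intro w hw h0
      rcases hz D ρ hρ w hw h0 with h | h
      · rw [hγ.inside w h.2, windingNumber_circleCurve_of_lt hρ0 h.1]
      · rw [hγ.outside w h.2, windingNumber_circleCurve_of_gt hρ0 h.1]
  have hcont (N D : ℂ → ℂ) (hN : DifferentiableOn ℂ N {0}ᶜ) (hD : DifferentiableOn ℂ D {0}ᶜ)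
      (ρ : ℝ) (hρ : ∀ w ≠ 0, D w = 0 → (‖w‖ < ρ ∧ w ∈ innerZeros q y) ∨
      (ρ < ‖w‖ ∧ w ∈ outerZeros q y)) : ContinuousOn (fun s => N (γ s) /
        (D (γ s) * (2 * Real.pi * Complex.I * γ s))) (Set.Icc 0 1) := by
    have hγc := hγ.contDiff.continuous.continuousOn (s := Set.Icc (0 : ℝ) 1)
    refine (hN.continuousOn.comp hγc fun s hs => hγ.ne_zero s hs).div
      ((hD.mul hlin).continuousOn.comp hγc fun s hs => hγ.ne_zero s hs) fun s hs h0 => ?_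
    have := hz D ρ hρ _ (hγ.ne_zero s hs) h0
    exact hγ.avoids s hs (this.imp (fun h => h.2) fun h => h.2)
  have z1 := fun w hw => regDenU_eq_zero hq hr hrR h (w := w) hw
  have z2 := fun w hw => regDenV_eq_zero hq hr hrR h (w := w) hw
  rw [regIntegral, key _ _ c1 c3 r hr z1, key _ _ c2 c4 R hR z2,
    ← contourIntegral_add hγ.contDiff (hcont _ _ c1 c3 r z1) (hcont _ _ c2 c4 R z2)]
  refine contourIntegral_congr fun s hs => ?_
  have h0 := hγ.ne_zero s hs
  have hav := hγ.avoids s hs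
  rw [Set.mem_union, not_or] at hav
  rw [← mul_div_assoc, bezout_scaledIntegrand hq K h.regular h0 hav.1 hav.2, add_div, div_div,
    div_div]

end
end EllipticBeta
end

noncomputable section
namespace EllipticBeta

/-! ### The prefactor -/

/-- The arguments of the factors of the prefactor that do not tend to `1` with the nome. -/
def crossArg (q : ℂ) (y : Params × Scales) : Fin 3 ⊕ Fin 3 → ℂ :=
  Sum.elim (fun r => q * (y.1.2.2 r * y.2.2.2.1 r) / (y.1.1 * y.1.2.1))
    (fun r => q ^ 2 * y.2.2.2.2 r / (y.1.1 ^ 2 * y.1.2.1 * y.1.2.2 r))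

/-- The arguments of the factors coming from pairs of the parameters `t`. -/
def pairArg (q : ℂ) (y : Params × Scales) : (Fin 3 × Fin 2) ⊕ (Fin 3 × Fin 3 × Fin 3) → ℂ :=
  Sum.elim (fun i => ![nome y.2 * y.2.1 ^ 2 * y.2.2.2.1 i.1 * y.1.2.1 * y.1.2.2 i.1,
      nome y.2 * y.2.1 ^ 2 * q * y.2.2.2.2 i.1 * y.1.2.1 / (y.1.1 * y.1.2.2 i.1)] i.2)
    (fun i => if i.1 < i.2.1 then
      ![y.2.1 ^ 2 * y.2.2.2.1 i.1 * y.2.2.2.1 i.2.1 * y.1.2.2 i.1 * y.1.2.2 i.2.1, 0,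
        q ^ 2 * y.2.1 ^ 2 * y.2.2.2.2 i.1 * y.2.2.2.2 i.2.1 /
          (y.1.1 ^ 2 * y.1.2.2 i.1 * y.1.2.2 i.2.1)] i.2.2
      else if i.1 = i.2.1 then 0 else
      ![q * y.2.1 ^ 2 * y.2.2.2.1 i.1 * y.2.2.2.2 i.2.1 * y.1.2.2 i.1 / (y.1.1 * y.1.2.2 i.2.1),
        q * y.2.1 ^ 2 * y.2.2.2.1 i.2.1 * y.2.2.2.2 i.1 * y.1.2.2 i.2.1 / (y.1.1 * y.1.2.2 i.1),
        0] i.2.2)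

/-- The factors of the prefactor that depend on `b` only. -/
def basePrefactor (q b p : ℂ) : ℂ :=
  qPoch (-(b * q)) q * qPoch (b ^ 2 * q) (q ^ 2) * (qPoch p p * qPoch q q) *
    (pqPoch (-(b * p)) p q * pqPoch (-(b * p * q)) p q) ^ 2 *
    (pqPoch (b ^ 2 * p) (p ^ 2) (q ^ 2) * pqPoch (b ^ 2 * p * q) (p ^ 2) (q ^ 2) ^ 2 *
      pqPoch (b ^ 2 * p * q ^ 2) (p ^ 2) (q ^ 2) * pqPoch (b ^ 2 * p ^ 2 * q) (p ^ 2) (q ^ 2) ^ 2) ^ 2 *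
    pqPoch (p * q / b) p q ^ 4

/-- The prefactor of the integral of `scaledIntegrand`, without the factors from `crossArg`. -/
def corePrefactor (q : ℂ) (y : Params × Scales) : ℂ :=
  basePrefactor q y.1.1 (nome y.2) * ∏ i, pqPoch (pairArg q y i) (nome y.2) q

def prefactor (q : ℂ) (y : Params × Scales) : ℂ :=
  corePrefactor q y * ∏ i, pqPoch (crossArg q y i) (nome y.2) q

def regPrefactor (q : ℂ) (K : ℕ) (y : Params × Scales) : ℂ :=
  corePrefactor q y * ∏ i, pqTail (nome y.2) q (2 * K) (crossArg q y i)

/-- The factor at whose zeros the regularised integral does not determine the integral. -/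
def singFactor (q : ℂ) (K : ℕ) (y : Params × Scales) : ℂ :=
  qFin q (q / y.1.1) (2 * K) * qFin q (y.2.2.1 * q ^ 2 / (y.1.1 * y.1.2.1) ^ 2) (2 * K)

/-- The regularised elliptic hypergeometric integral. -/
def regE (q : ℂ) (r R : ℝ) (K : ℕ) (y : Params × Scales) : ℂ :=
  regPrefactor q K y * regIntegral q r R K y

section
variable {q : ℂ} {r R : ℝ} {K : ℕ} {y : Params × Scales}

/-- In these products of an inner argument with the main outer argument the variable w cancels, so
the Bezout multiplier leaves the integral as a constant. Only q/b and c q²/(ba)² are not matched by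
factors of the prefactor. -/
theorem prod_qFin_cross (h : (y, 1) ∈ regular) {w : ℂ} (hw : w ≠ 0) (N : ℕ) :
    ∏ i ∈ {Sum.inl 0}ᶜ, qFin q (innerArg q y w i * outerArg q y w mainOuter) N =
      qFin q (q / y.1.1) N * qFin q (y.2.2.1 * q ^ 2 / (y.1.1 * y.1.2.1) ^ 2) N *
        ∏ i, qFin q (crossArg q y i) N := by
  obtain ⟨hb, ha, hu, -⟩ := h
  have e : ({Sum.inl 0}ᶜ : Finset PoleIndex) = {Sum.inl 1, Sum.inl 2} ∪
      Finset.univ.map ⟨Sum.inr, Sum.inr_injective⟩ := by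
    ext i; rcases i with i | i
    · fin_cases i <;> simp
    · simp
  rw [e, Finset.prod_union, Finset.prod_pair (by simp), Finset.prod_map]
  · congr 1
    · congr 2
      · simp only [innerArg, outerArg, mainOuter, Sum.elim_inl, Matrix.cons_val]
        have := ha; have := hb; dsimp only at *
        field_simp
      · simp only [innerArg, outerArg, mainOuter, Sum.elim_inl, Matrix.cons_val]
        have := ha; have := hb; dsimp only at *
        field_simp
    · refine Finset.prod_congr rfl fun i _ => ?_
      congr 1
      rcases i with i | i
      · simp only [innerArg, outerArg, mainOuter, crossArg, Sum.elim_inl, Sum.elim_inr,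
          Matrix.cons_val, Function.Embedding.coeFn_mk]
        field_simp
      · have := hu i
        simp only [innerArg, outerArg, mainOuter, crossArg, Sum.elim_inl, Sum.elim_inr,
          Matrix.cons_val, Function.Embedding.coeFn_mk]
        dsimp only at *
        field_simp
  · rw [Finset.disjoint_left]; simp

/-- The regularised integral in terms of a contour integral of `scaledIntegrand`. -/
theorem regE_eq (hq : ‖q‖ < 1) (hr : 0 < r) (hrR : r ≤ R) (h : IsAdmissible q r R K y)
    {γ : ℝ → ℂ} (hγ : IsSeparatingContour γ (innerZeros q y) (outerZeros q y)) :
    regE q r R K y = singFactor q K y * (prefactor q y * contourIntegral γ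
      (fun w => scaledIntegrand q y w / (2 * Real.pi * Complex.I * w))) := by
  have e : contourIntegral γ (fun w => (∏ i ∈ {Sum.inl 0}ᶜ,
      qFin q (innerArg q y w i * outerArg q y w mainOuter) (2 * K)) *
      (scaledIntegrand q y w / (2 * Real.pi * Complex.I * w))) =
      contourIntegral γ (fun w => (singFactor q K y * ∏ i, qFin q (crossArg q y i) (2 * K)) *
      (scaledIntegrand q y w / (2 * Real.pi * Complex.I * w))) :=
    contourIntegral_congr fun s hs => by
      rw [prod_qFin_cross h.regular (hγ.ne_zero s hs)]; rfl
  have e2 : ∏ i, pqPoch (crossArg q y i) (nome y.2) q = (∏ i, qFin q (crossArg q y i) (2 * K)) *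
      ∏ i, pqTail (nome y.2) q (2 * K) (crossArg q y i) := by
    rw [← Finset.prod_mul_distrib]
    exact Finset.prod_congr rfl fun i _ => pqPoch_eq_qFin_mul h.nome_lt hq _ _
  rw [regE, regIntegral_eq hq hr hrR h hγ, e, contourIntegral_const_mul, prefactor, e2,
    regPrefactor]
  ring

theorem continuousOn_crossArg (i) :
    ContinuousOn (fun y : Params × Scales => crossArg q y i) {y | (y, 1) ∈ regular} := by
  rcases i with i | i
  · simp only [crossArg, Sum.elim_inl]
    exact ContinuousOn.div (by fun_prop) (by fun_prop) fun z hz => mul_ne_zero hz.1 hz.2.1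
  · simp only [crossArg, Sum.elim_inr]
    exact ContinuousOn.div (by fun_prop) (by fun_prop) fun z hz =>
      mul_ne_zero (mul_ne_zero (pow_ne_zero 2 hz.1) hz.2.1) (hz.2.2.1 i)

theorem continuousOn_pairArg (i) :
    ContinuousOn (fun y : Params × Scales => pairArg q y i) {y | (y, 1) ∈ regular} := by
  have hn : Continuous fun y : Params × Scales => nome y.2 := continuous_nome.comp continuous_snd
  rcases i with ⟨i, j⟩ | ⟨i, i', j⟩
  · fin_cases j <;> simp [pairArg]
    · fun_prop
    · exact ContinuousOn.div (by fun_prop) (by fun_prop) fun z hz => mul_ne_zero hz.1 (hz.2.2.1 i)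
  · simp only [pairArg, Sum.elim_inr]
    split_ifs
    · fin_cases j <;> simp
      · fun_prop
      · fun_prop
      · exact ContinuousOn.div (by fun_prop) (by fun_prop) fun z hz =>
          mul_ne_zero (mul_ne_zero (pow_ne_zero 2 hz.1) (hz.2.2.1 i)) (hz.2.2.1 i')
    · fun_prop
    · fin_cases j <;> simp
      · exact ContinuousOn.div (by fun_prop) (by fun_prop) fun z hz =>
          mul_ne_zero hz.1 (hz.2.2.1 i')
      · exact ContinuousOn.div (by fun_prop) (by fun_prop) fun z hz =>
          mul_ne_zero hz.1 (hz.2.2.1 i)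
      · fun_prop

theorem contDiffOn_crossArg (η : Scales) (i) : ContDiffOn ℂ 1
    (fun x : Params => crossArg q (x, η) i) {x | ((x, η), 1) ∈ regular} := by
  rcases i with i | i
  · simp only [crossArg, Sum.elim_inl]
    exact ContDiffOn.div (by fun_prop) (by fun_prop) fun z hz => mul_ne_zero hz.1 hz.2.1
  · simp only [crossArg, Sum.elim_inr]
    exact ContDiffOn.div (by fun_prop) (by fun_prop) fun z hz =>
      mul_ne_zero (mul_ne_zero (pow_ne_zero 2 hz.1) hz.2.1) (hz.2.2.1 i)

theorem contDiffOn_pairArg (η : Scales) (i) : ContDiffOn ℂ 1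
    (fun x : Params => pairArg q (x, η) i) {x | ((x, η), 1) ∈ regular} := by
  rcases i with ⟨i, j⟩ | ⟨i, i', j⟩
  · fin_cases j <;> simp [pairArg]
    · fun_prop
    · exact ContDiffOn.div (by fun_prop) (by fun_prop) fun z hz => mul_ne_zero hz.1 (hz.2.2.1 i)
  · simp only [pairArg, Sum.elim_inr]
    split_ifs
    · fin_cases j <;> simp
      · fun_prop
      · fun_prop
      · exact ContDiffOn.div (by fun_prop) (by fun_prop) fun z hz =>
          mul_ne_zero (mul_ne_zero (pow_ne_zero 2 hz.1) (hz.2.2.1 i)) (hz.2.2.1 i')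
    · fun_prop
    · fin_cases j <;> simp
      · exact ContDiffOn.div (by fun_prop) (by fun_prop) fun z hz =>
          mul_ne_zero hz.1 (hz.2.2.1 i')
      · exact ContDiffOn.div (by fun_prop) (by fun_prop) fun z hz =>
          mul_ne_zero hz.1 (hz.2.2.1 i)
      · fun_prop

theorem _root_.ContinuousOn.pqPoch_sq {X : Type*} [TopologicalSpace X] {f p : X → ℂ} {S : Set X}
    (hf : ContinuousOn f S) (hp : ContinuousOn p S) (h : ∀ x ∈ S, ‖p x‖ < 1) (hq : ‖q‖ < 1) :
    ContinuousOn (fun x => EllipticBeta.pqPoch (f x) (p x ^ 2) (q ^ 2)) S :=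
  hf.pqPoch (hp.pow 2) (fun x hx => norm_sq_lt_one (h x hx)) (norm_sq_lt_one hq)

theorem continuousOn_basePrefactor (hq : ‖q‖ < 1) :
    ContinuousOn (fun y : Params × Scales => basePrefactor q y.1.1 (nome y.2))
      {y | (y, 1) ∈ regular} := by
  have hn : ContinuousOn (fun y : Params × Scales => nome y.2) {y | (y, 1) ∈ regular} :=
    (continuous_nome.comp continuous_snd).continuousOn
  have h (y : Params × Scales) (hy : y ∈ {y | (y, 1) ∈ regular}) : ‖nome y.2‖ < 1 := hy.2.2.2.2
  have hb : ContinuousOn (fun y : Params × Scales => y.1.1) {y | (y, 1) ∈ regular} := by fun_prop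
  refine ((((ContinuousOn.mul ?_ ?_).mul (ContinuousOn.mul ?_ ?_)).mul
    ((ContinuousOn.mul ?_ ?_).pow 2)).mul ((((ContinuousOn.mul ?_ (ContinuousOn.pow ?_ 2)).mul
    ?_).mul (ContinuousOn.pow ?_ 2)).pow 2)).mul (ContinuousOn.pow ?_ 4)
  · exact ContinuousOn.qPoch (by fun_prop) continuousOn_const fun _ _ => hq
  · exact ContinuousOn.qPoch (by fun_prop) continuousOn_const fun _ _ => norm_sq_lt_one hq
  · exact hn.qPoch hn h
  · fun_prop
  · exact (hb.mul hn).neg.pqPoch hn h hq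
  · exact ((hb.mul hn).mul continuousOn_const).neg.pqPoch hn h hq
  · exact ((hb.pow 2).mul hn).pqPoch_sq hn h hq
  · exact (((hb.pow 2).mul hn).mul continuousOn_const).pqPoch_sq hn h hq
  · exact (((hb.pow 2).mul hn).mul continuousOn_const).pqPoch_sq hn h hq
  · exact (((hb.pow 2).mul (hn.pow 2)).mul continuousOn_const).pqPoch_sq hn h hq
  · exact ((hn.mul continuousOn_const).div hb fun y hy => hy.1).pqPoch hn h hq

theorem contDiffOn_basePrefactor (hq : ‖q‖ < 1) {p : ℂ} (hp : ‖p‖ < 1) :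
    ContDiffOn ℂ 1 (fun b : ℂ => basePrefactor q b p) {0}ᶜ := by
  have hp2 := norm_sq_lt_one hp
  have hq2 := norm_sq_lt_one hq
  refine ((((ContDiffOn.mul ?_ ?_).mul contDiffOn_const).mul
    ((ContDiffOn.mul ?_ ?_).pow 2)).mul ((((ContDiffOn.mul ?_ (ContDiffOn.pow ?_ 2)).mul
    ?_).mul (ContDiffOn.pow ?_ 2)).pow 2)).mul (ContDiffOn.pow ?_ 4)
  · exact ContDiffOn.qPoch (by fun_prop) hq
  · exact ContDiffOn.qPoch (by fun_prop) hq2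
  · exact ContDiffOn.pqPoch (by fun_prop) hp hq
  · exact ContDiffOn.pqPoch (by fun_prop) hp hq
  · exact ContDiffOn.pqPoch (by fun_prop) hp2 hq2
  · exact ContDiffOn.pqPoch (by fun_prop) hp2 hq2
  · exact ContDiffOn.pqPoch (by fun_prop) hp2 hq2
  · exact ContDiffOn.pqPoch (by fun_prop) hp2 hq2
  · exact ContDiffOn.pqPoch (ContDiffOn.div (by fun_prop) (by fun_prop) fun b hb => hb) hp hq

theorem continuousOn_regE (hq : ‖q‖ < 1) (hr : 0 < r) (hrR : r ≤ R) :
    ContinuousOn (regE q r R K) {y | IsAdmissible q r R K y} := by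
  have hn : ContinuousOn (fun y : Params × Scales => nome y.2) {y | (y, 1) ∈ regular} :=
    (continuous_nome.comp continuous_snd).continuousOn
  have h (y : Params × Scales) (hy : y ∈ {y | (y, 1) ∈ regular}) : ‖nome y.2‖ < 1 := hy.2.2.2.2
  refine ContinuousOn.mul (ContinuousOn.mono ?_ fun y hy =>
    IsAdmissible.regular hy) (continuousOn_regIntegral hq hr hrR)
  exact ((continuousOn_basePrefactor hq).mul (continuousOn_finsetProd _ fun i _ =>
    (continuousOn_pairArg i).pqPoch hn h hq)).mul (continuousOn_finsetProd _ fun i _ =>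
    (continuousOn_crossArg i).pqTail hn h hq _)

theorem contDiffOn_regE (hq : ‖q‖ < 1) (hr : 0 < r) (hrR : r ≤ R) {η : Scales}
    (hη : ‖nome η‖ < 1) :
    ContDiffOn ℂ 1 (fun x => regE q r R K (x, η)) {x | IsAdmissible q r R K (x, η)} := by
  refine ContDiffOn.mul (ContDiffOn.mono (s := {x | ((x, η), 1) ∈ regular}) ?_ fun y hy =>
    IsAdmissible.regular hy) (contDiffOn_regIntegral hq hr hrR hη)
  have e1 : ContDiffOn ℂ 1 (fun x : Params => basePrefactor q x.1 (nome η))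
      {x | ((x, η), 1) ∈ regular} :=
    (contDiffOn_basePrefactor hq hη).comp (by fun_prop) fun x hx => hx.1
  have e2 : ContDiffOn ℂ 1 (fun x : Params => ∏ i, pqPoch (pairArg q (x, η) i) (nome η) q)
      {x | ((x, η), 1) ∈ regular} :=
    contDiffOn_prod fun i _ => (contDiffOn_pairArg η i).pqPoch hη hq
  have e3 : ContDiffOn ℂ 1 (fun x : Params => ∏ i, pqTail (nome η) q (2 * K) (crossArg q (x, η) i))
      {x | ((x, η), 1) ∈ regular} :=
    contDiffOn_prod fun i _ => (contDiffOn_crossArg η i).pqTail hη hq _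
  exact (e1.mul e2).mul e3

theorem continuous_qFin (N : ℕ) : Continuous fun x => qFin q x N := by unfold qFin; fun_prop

theorem contDiff_qFin (N : ℕ) : ContDiff ℂ 1 fun x => qFin q x N := by unfold qFin; fun_prop

theorem continuousOn_singFactor :
    ContinuousOn (singFactor q K) {y | (y, 1) ∈ regular} :=
  ((continuous_qFin _).comp_continuousOn
    (ContinuousOn.div (by fun_prop) (by fun_prop) fun z hz => hz.1)).mul
  ((continuous_qFin _).comp_continuousOn (ContinuousOn.div (by fun_prop) (by fun_prop)
    fun z hz => pow_ne_zero 2 (mul_ne_zero hz.1 hz.2.1)))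

theorem contDiffOn_singFactor (η : Scales) :
    ContDiffOn ℂ 1 (fun x => singFactor q K (x, η)) {x | ((x, η), 1) ∈ regular} :=
  ((contDiff_qFin _).comp_contDiffOn
    (ContDiffOn.div (by fun_prop) (by fun_prop) fun z hz => hz.1)).mul
  ((contDiff_qFin _).comp_contDiffOn (ContDiffOn.div (by fun_prop) (by fun_prop)
    fun z hz => pow_ne_zero 2 (mul_ne_zero hz.1 hz.2.1)))

end
end EllipticBeta
end

noncomputable section
namespace EllipticBeta

/-! ### Elliptic beta integrals: independence of the contour, continuity -/

section
variable {n : ℕ} {p q : ℂ}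

/-- The factor 1/Γ(z^{±2}) simplifies to θ(z²;p) θ(z⁻²;q), written out here; thus the numerator is
holomorphic on the punctured plane. -/
def betaNum (u : Fin n → ℂ) (p q z : ℂ) : ℂ :=
  (∏ r, pqPoch (p * q / (u r * z)) p q * pqPoch (p * q / (u r / z)) p q) *
    (qPoch (z ^ 2) p * qPoch (p / z ^ 2) p * (qPoch (q * z ^ 2) q * qPoch (1 / z ^ 2) q))

def betaDen (u : Fin n → ℂ) (p q z : ℂ) : ℂ := ∏ r, pqPoch (u r * z) p q * pqPoch (u r / z) p q

theorem countable_setOf_sq_mem {S : Set ℂ} (hS : S.Countable) : {z : ℂ | z ^ 2 ∈ S}.Countable := by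
  refine ((hS.image fun x => x ^ (1 / 2 : ℂ)).union (hS.image fun x => -x ^ (1 / 2 : ℂ))).mono ?_
  intro z hz
  have h : z ^ 2 = ((z ^ 2) ^ (1 / 2 : ℂ)) ^ 2 := by
    rw [← Complex.cpow_nat_mul]; simp
  rcases sq_eq_sq_iff_eq_or_eq_neg.1 h with h | h
  · exact Or.inl ⟨_, hz, h.symm⟩
  · exact Or.inr ⟨_, hz, h.symm⟩

theorem pqPoch_split (hp : ‖p‖ < 1) (hq : ‖q‖ < 1) (x : ℂ) :
    pqPoch x p q = qPoch x p * qPoch (q * x) q * pqPoch (p * q * x) p q := by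
  rw [pqPoch_eq_mul' hp hq, pqPoch_eq_mul hp hq, show x * q * p = p * q * x by ring, mul_comm x q]
  ring

theorem pqPoch_split' (hp : ‖p‖ < 1) (hq : ‖q‖ < 1) (x : ℂ) :
    pqPoch x p q = qPoch x q * qPoch (p * x) p * pqPoch (p * q * x) p q := by
  rw [pqPoch_eq_mul hp hq, pqPoch_eq_mul' hp hq, show x * p * q = p * q * x by ring, mul_comm x p]
  ring

/-- At the excluded points the literal quotient takes the default value 0 of division by zero,
although the singularity is removable. There are only countably many such points, which do not
affect the integral. -/
theorem betaIntegrand_eq (hp : ‖p‖ < 1) (hq : ‖q‖ < 1) (u : Fin n → ℂ) {z : ℂ}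
    (h1 : pqPoch (p * q / z ^ 2) p q ≠ 0) (h2 : pqPoch (p * q * z ^ 2) p q ≠ 0) :
    betaIntegrand u p q z = betaNum u p q z / betaDen u p q z := by
  unfold betaIntegrand betaNum betaDen ellGamma
  have e (r : Fin n) : pqPoch (p * q / (u r * z)) p q / pqPoch (u r * z) p q *
      (pqPoch (p * q / (u r / z)) p q / pqPoch (u r / z) p q) =
      (pqPoch (p * q / (u r * z)) p q * pqPoch (p * q / (u r / z)) p q) /
      (pqPoch (u r * z) p q * pqPoch (u r / z) p q) := div_mul_div_comm _ _ _ _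
  simp only [e]
  rw [Finset.prod_div_distrib, div_mul_div_comm, div_div_div_eq]
  rw [pqPoch_split hp hq (z ^ 2), pqPoch_split' hp hq (1 / z ^ 2)]
  rw [show p * q * (1 / z ^ 2) = p * q / z ^ 2 by ring, show p * (1 / z ^ 2) = p / z ^ 2 by ring,
    show p * q / (1 / z ^ 2) = p * q * z ^ 2 by rw [div_div_eq_mul_div, div_one]]
  generalize (∏ r, pqPoch (u r * z) p q * pqPoch (u r / z) p q) = D
  rw [← mul_div_mul_right _ D (mul_ne_zero h1 h2)]
  congr 1
  ring

/-- The exceptional points of `betaIntegrand_eq`. -/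
theorem countable_betaExceptional (p q : ℂ) (hp : ‖p‖ < 1) (hq : ‖q‖ < 1) :
    {z : ℂ | pqPoch (p * q / z ^ 2) p q = 0 ∨ pqPoch (p * q * z ^ 2) p q = 0}.Countable := by
  have h : (Set.range fun n : ℕ × ℕ => p * q * p ^ n.1 * q ^ n.2).Countable :=
    Set.countable_range _
  refine (countable_setOf_sq_mem (h.union (h.image fun x => x⁻¹))).mono ?_
  rintro z (hz | hz)
  · obtain ⟨j, k, hjk⟩ := (pqPoch_eq_zero_iff hp hq).1 hz
    refine Or.inl ⟨(j, k), ?_⟩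
    have h0 : z ^ 2 ≠ 0 := fun h0 => by rw [h0] at hjk; simp at hjk
    rw [div_mul_eq_mul_div, div_mul_eq_mul_div, div_eq_one_iff_eq h0] at hjk
    exact hjk
  · obtain ⟨j, k, hjk⟩ := (pqPoch_eq_zero_iff hp hq).1 hz
    exact Or.inr ⟨_, ⟨(j, k), rfl⟩, inv_eq_of_mul_eq_one_right (by rw [← hjk]; ring)⟩

theorem betaDen_eq_zero_iff (hp0 : p ≠ 0) (hq0 : q ≠ 0) (hp : ‖p‖ < 1) (hq : ‖q‖ < 1)
    {u : Fin n → ℂ} (hu : ∀ r, u r ≠ 0) {z : ℂ} (hz : z ≠ 0) :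
    betaDen u p q z = 0 ↔ z ∈ innerPoles u p q ∨ z ∈ outerPoles u p q := by
  simp only [betaDen, Finset.prod_eq_zero_iff, Finset.mem_univ, true_and, mul_eq_zero,
    pqPoch_eq_zero_iff hp hq, innerPoles, outerPoles, Set.mem_ofPred_eq]
  have e1 (r : Fin n) (j k : ℕ) : u r * z * p ^ j * q ^ k = 1 ↔ z = (u r * p ^ j * q ^ k)⁻¹ := by
    have hne : u r * p ^ j * q ^ k ≠ 0 :=
      mul_ne_zero (mul_ne_zero (hu r) (pow_ne_zero _ hp0)) (pow_ne_zero _ hq0)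
    rw [← one_div, eq_div_iff hne]
    constructor <;> intro h <;> rw [← h] <;> ring
  have e2 (r : Fin n) (j k : ℕ) : u r / z * p ^ j * q ^ k = 1 ↔ z = u r * p ^ j * q ^ k := by
    rw [div_mul_eq_mul_div, div_mul_eq_mul_div, div_eq_one_iff_eq hz, eq_comm]
  simp only [e1, e2, exists_or]
  exact or_comm

theorem differentiableOn_beta (hp : ‖p‖ < 1) (hq : ‖q‖ < 1) {u : Fin n → ℂ} (hu : ∀ r, u r ≠ 0) :
    DifferentiableOn ℂ (betaNum u p q) {0}ᶜ ∧ DifferentiableOn ℂ (betaDen u p q) {0}ᶜ := by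
  have hpq := differentiable_pqPoch hp hq
  have a1 (r) : DifferentiableOn ℂ (fun z => u r * z) {0}ᶜ := by fun_prop
  have a2 (r) : DifferentiableOn ℂ (fun z => u r / z) {0}ᶜ :=
    DifferentiableOn.div (by fun_prop) (by fun_prop) fun z hz => hz
  have a3 (r) : DifferentiableOn ℂ (fun z => p * q / (u r * z)) {0}ᶜ :=
    DifferentiableOn.div (by fun_prop) (a1 r) fun z hz => mul_ne_zero (hu r) hz
  have a4 (r) : DifferentiableOn ℂ (fun z => p * q / (u r / z)) {0}ᶜ :=
    DifferentiableOn.div (by fun_prop) (a2 r) fun z hz => div_ne_zero (hu r) hz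
  have a5 (c : ℂ) : DifferentiableOn ℂ (fun z : ℂ => c / z ^ 2) {0}ᶜ :=
    DifferentiableOn.div (by fun_prop) (by fun_prop) fun z hz => pow_ne_zero 2 hz
  refine ⟨(DifferentiableOn.fun_finsetProd fun r _ => ?_).mul (DifferentiableOn.mul
    (DifferentiableOn.mul ?_ ?_) (DifferentiableOn.mul ?_ ?_)),
    DifferentiableOn.fun_finsetProd fun r _ => ?_⟩
  · exact (hpq.comp_differentiableOn (a3 r)).mul (hpq.comp_differentiableOn (a4 r))
  · exact (differentiable_qPoch hp).comp_differentiableOn (by fun_prop)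
  · exact (differentiable_qPoch hp).comp_differentiableOn (a5 p)
  · exact (differentiable_qPoch hq).comp_differentiableOn (by fun_prop)
  · exact (differentiable_qPoch hq).comp_differentiableOn (a5 1)
  · exact (hpq.comp_differentiableOn (a1 r)).mul (hpq.comp_differentiableOn (a2 r))

theorem contourIntegral_beta_eq (hp0 : p ≠ 0) (hq0 : q ≠ 0) (hp : ‖p‖ < 1) (hq : ‖q‖ < 1)
    {u : Fin n → ℂ} (hu : ∀ r, u r ≠ 0) {γ₁ γ₂ : ℝ → ℂ}
    (h₁ : IsSeparatingContour γ₁ (innerPoles u p q) (outerPoles u p q))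
    (h₂ : IsSeparatingContour γ₂ (innerPoles u p q) (outerPoles u p q)) :
    contourIntegral γ₁ (fun z => betaIntegrand u p q z / (2 * Real.pi * Complex.I * z)) =
    contourIntegral γ₂
      (fun z => betaNum u p q z / (betaDen u p q z * (2 * Real.pi * Complex.I * z))) := by
  obtain ⟨hN, hD⟩ := differentiableOn_beta hp hq hu
  have hlin : DifferentiableOn ℂ (fun w : ℂ => 2 * Real.pi * Complex.I * w) {0}ᶜ := by fun_prop
  have hz (z : ℂ) (hz : z ≠ 0) (h : betaDen u p q z * (2 * Real.pi * Complex.I * z) = 0) :=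
    (betaDen_eq_zero_iff hp0 hq0 hp hq hu hz).1
      ((mul_eq_zero.1 h).resolve_right (two_pi_I_mul_ne_zero hz))
  rw [contourIntegral_congr_countable (countable_betaExceptional p q hp hq)
    (g := fun z => betaNum u p q z / (betaDen u p q z * (2 * Real.pi * Complex.I * z)))]
  · refine contourIntegral_div_eq hN (hD.mul hlin) h₁.isLoop h₂.isLoop ?_ ?_ ?_
    · exact fun s hs h0 => h₁.avoids s hs (hz _ (h₁.ne_zero s hs) h0)
    · exact fun s hs h0 => h₂.avoids s hs (hz _ (h₂.ne_zero s hs) h0)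
    · intro a ha h0
      rcases hz a ha h0 with h | h
      · rw [h₁.inside a h, h₂.inside a h]
      · rw [h₁.outside a h, h₂.outside a h]
  · intro s hs hZ
    simp only [Set.mem_ofPred_eq, not_or] at hZ
    rw [betaIntegrand_eq hp hq u hZ.1 hZ.2, div_div]

/-! ### Stability of contours -/

/-- If w is closer to w₀ than the curve is, the segment between them does not meet the curve. -/
theorem eventually_windingNumber_eq {γ : ℝ → ℂ} (hγ : ContDiff ℝ 1 γ) (hc : γ 0 = γ 1) {w₀ : ℂ}
    (hw : ∀ s ∈ Set.Icc (0 : ℝ) 1, γ s ≠ w₀) :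
    ∀ᶠ w in 𝓝 w₀, (∀ s ∈ Set.Icc (0 : ℝ) 1, γ s ≠ w) ∧
      windingNumber γ w = windingNumber γ w₀ := by
  obtain ⟨s₀, hs₀, hmin⟩ := isCompact_Icc.exists_isMinOn (Set.nonempty_Icc.2 zero_le_one)
    (f := fun s => ‖γ s - w₀‖) (by have := hγ.continuous; fun_prop)
  have hd : 0 < ‖γ s₀ - w₀‖ := norm_pos_iff.2 (sub_ne_zero.2 (hw s₀ hs₀))
  filter_upwards [Metric.ball_mem_nhds w₀ hd] with w hwd
  rw [mem_ball_iff_norm] at hwd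
  have hlt (s) (hs : s ∈ Set.Icc (0 : ℝ) 1) : ‖w - w₀‖ < ‖γ s - w₀‖ := hwd.trans_le (hmin hs)
  refine ⟨fun s hs h => ?_, windingNumber_eq_of_forall_ne hγ hc hw fun s hs x hx h => ?_⟩
  · have := hlt s hs; rw [h] at this; exact lt_irrefl _ this
  · have := hlt s hs
    rw [h, norm_mul, Complex.norm_real, Real.norm_of_nonneg (by linarith)] at this
    nlinarith [norm_nonneg (γ s - w₀)]

/-- One contour serves a whole neighbourhood of parameters: all but finitely many poles are,
uniformly, very close to 0 or very far away, and the winding numbers about the finitely many others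
are locally constant. -/
theorem IsSeparatingContour.eventually (hp0 : p ≠ 0) (hq0 : q ≠ 0) (hp : ‖p‖ < 1) (hq : ‖q‖ < 1)
    {u₀ : Fin n → ℂ} (hu₀ : ∀ r, u₀ r ≠ 0) {γ : ℝ → ℂ}
    (h : IsSeparatingContour γ (innerPoles u₀ p q) (outerPoles u₀ p q)) :
    ∀ᶠ u in 𝓝 u₀, IsSeparatingContour γ (innerPoles u p q) (outerPoles u p q) := by
  obtain ⟨r, R, hr, hrR⟩ := h.isLoop.exists_annulus
  have hR : 0 < R := (norm_nonneg _).trans_lt (hrR 0 (by simp)).2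
  set δ := min r R⁻¹ with hδ
  have hδ0 : 0 < δ := lt_min hr (inv_pos.2 hR)
  -- The curve lies in r < |z| < R. A point of modulus below min(r, 1/R) is inside the inner circle,
  -- and its reciprocal is outside the outer circle, so only these finitely many exponents need
  -- individual treatment.
  have hJ : {m : ℕ × ℕ | δ ≤ (‖u₀‖ + 1) * ‖p ^ m.1 * q ^ m.2‖}.Finite := by
    have h1 := ((summable_norm_pow_mul_pow hp hq).mul_left (‖u₀‖ + 1)).tendsto_cofinite_zero
    have := h1.eventually_lt_const hδ0
    simpa only [Filter.eventually_cofinite, not_lt] using this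
  have e1 : ∀ᶠ u in 𝓝 u₀, ∀ r, u r ≠ 0 := eventually_all.2 fun i =>
    (continuous_apply i).continuousAt.eventually_ne (hu₀ i)
  have e2 : ∀ᶠ u in 𝓝 u₀, ‖u‖ < ‖u₀‖ + 1 :=
    continuous_norm.continuousAt.eventually_lt_const (lt_add_one _)
  have e3 : ∀ᶠ u in 𝓝 u₀, ∀ i : Fin n, ∀ m ∈ {m : ℕ × ℕ | δ ≤ (‖u₀‖ + 1) * ‖p ^ m.1 * q ^ m.2‖},
      ((∀ s ∈ Set.Icc (0 : ℝ) 1, γ s ≠ u i * p ^ m.1 * q ^ m.2) ∧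
        windingNumber γ (u i * p ^ m.1 * q ^ m.2) = 1) ∧
      ((∀ s ∈ Set.Icc (0 : ℝ) 1, γ s ≠ (u i * p ^ m.1 * q ^ m.2)⁻¹) ∧
        windingNumber γ (u i * p ^ m.1 * q ^ m.2)⁻¹ = 0) := by
    refine eventually_all.2 fun i => (eventually_all_finite hJ).2 fun m _ => ?_
    have hne : u₀ i * p ^ m.1 * q ^ m.2 ≠ 0 :=
      mul_ne_zero (mul_ne_zero (hu₀ i) (pow_ne_zero _ hp0)) (pow_ne_zero _ hq0)
    have hc : ContinuousAt (fun u : Fin n → ℂ => u i * p ^ m.1 * q ^ m.2) u₀ :=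
      ((continuousAt_apply i u₀).mul_const _).mul_const _
    have hin : u₀ i * p ^ m.1 * q ^ m.2 ∈ innerPoles u₀ p q := ⟨i, m.1, m.2, rfl⟩
    have hout : (u₀ i * p ^ m.1 * q ^ m.2)⁻¹ ∈ outerPoles u₀ p q := ⟨i, m.1, m.2, rfl⟩
    have a1 := hc.eventually (eventually_windingNumber_eq h.contDiff h.closed
      (w₀ := u₀ i * p ^ m.1 * q ^ m.2) fun s hs he => h.avoids s hs (Or.inl (he ▸ hin)))
    have a2 := (hc.inv₀ hne).eventually (eventually_windingNumber_eq h.contDiff h.closed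
      (w₀ := (u₀ i * p ^ m.1 * q ^ m.2)⁻¹) fun s hs he => h.avoids s hs (Or.inr (he ▸ hout)))
    rw [h.inside _ hin] at a1
    rw [h.outside _ hout] at a2
    exact a1.and a2
  filter_upwards [e1, e2, e3] with u h1 h2 h3
  have key (i : Fin n) (m : ℕ × ℕ) : ((∀ s ∈ Set.Icc (0 : ℝ) 1, γ s ≠ u i * p ^ m.1 * q ^ m.2) ∧
        windingNumber γ (u i * p ^ m.1 * q ^ m.2) = 1) ∧
      ((∀ s ∈ Set.Icc (0 : ℝ) 1, γ s ≠ (u i * p ^ m.1 * q ^ m.2)⁻¹) ∧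
        windingNumber γ (u i * p ^ m.1 * q ^ m.2)⁻¹ = 0) := by
    by_cases hm : δ ≤ (‖u₀‖ + 1) * ‖p ^ m.1 * q ^ m.2‖
    · exact h3 i m hm
    · have hlt : ‖u i * p ^ m.1 * q ^ m.2‖ < δ := by
        rw [mul_assoc, norm_mul]
        exact (mul_le_mul_of_nonneg_right ((norm_le_pi_norm u i).trans h2.le)
          (norm_nonneg _)).trans_lt (not_le.1 hm)
      have hne : u i * p ^ m.1 * q ^ m.2 ≠ 0 :=
        mul_ne_zero (mul_ne_zero (h1 i) (pow_ne_zero _ hp0)) (pow_ne_zero _ hq0)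
      generalize u i * p ^ m.1 * q ^ m.2 = a at hlt hne
      have ha1 : ‖a‖ < r := hlt.trans_le (min_le_left _ _)
      have ha2 : R < ‖a⁻¹‖ := by
        rw [norm_inv, lt_inv_comm₀ hR (norm_pos_iff.2 hne)]
        exact hlt.trans_le (min_le_right _ _)
      have b1 (s) (hs : s ∈ Set.Icc (0 : ℝ) 1) (x : ℝ) (hx : 1 ≤ x) : a ≠ x * γ s := fun he => by
        have := (hrR s hs).1
        rw [he, norm_mul, Complex.norm_real, Real.norm_of_nonneg (by linarith)] at ha1
        nlinarith
      have b2 (s) (hs : s ∈ Set.Icc (0 : ℝ) 1) (x : ℝ) (hx : 1 ≤ x) : γ s ≠ x * a⁻¹ := fun he => by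
        have := (hrR s hs).2
        rw [he, norm_mul, Complex.norm_real, Real.norm_of_nonneg (by linarith)] at this
        nlinarith
      exact ⟨⟨fun s hs he => b1 s hs 1 le_rfl (by simp [he]), h.isLoop.windingNumber_eq_one b1⟩,
        ⟨fun s hs he => b2 s hs 1 le_rfl (by simp [he]),
          windingNumber_eq_zero h.contDiff h.closed (inv_ne_zero hne) b2⟩⟩
  refine ⟨h.contDiff, h.closed, h.ne_zero, ?_, h.origin, ?_, ?_⟩
  · rintro s hs (⟨i, j, k, he⟩ | ⟨i, j, k, he⟩)
    · exact (key i (j, k)).1.1 s hs he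
    · exact (key i (j, k)).2.1 s hs he
  · rintro w ⟨i, j, k, rfl⟩; exact (key i (j, k)).1.2
  · rintro w ⟨i, j, k, rfl⟩; exact (key i (j, k)).2.2

/-- A contour exists if no product of two inner poles is a real number at least `1`. -/
theorem exists_contour_of_star (hp0 : p ≠ 0) (hq0 : q ≠ 0) (hp : ‖p‖ < 1) (hq : ‖q‖ < 1)
    {u : Fin n → ℂ} (hu : ∀ r, u r ≠ 0)
    (h : ∀ r s : Fin n, ∀ j k : ℕ, ∀ x : ℝ, 1 ≤ x → u r * u s * p ^ j * q ^ k ≠ x) :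
    ∃ γ, IsSeparatingContour γ (innerPoles u p q) (outerPoles u p q) ∧ ∀ s, γ s ≠ 0 := by
  have hne (i : Fin n) (m : ℕ × ℕ) : u i * p ^ m.1 * q ^ m.2 ≠ 0 :=
    mul_ne_zero (mul_ne_zero (hu i) (pow_ne_zero _ hp0)) (pow_ne_zero _ hq0)
  have hfin (ε : ℝ) (hε : 0 < ε) :
      {z : Fin n × ℕ × ℕ | ε ≤ ‖u z.1 * p ^ z.2.1 * q ^ z.2.2‖}.Finite := by
    have h1 := ((summable_norm_pow_mul_pow hp hq).mul_left ‖u‖).tendsto_cofinite_zero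
    have h2 := h1.eventually_lt_const hε
    rw [Filter.eventually_cofinite] at h2
    refine (Set.finite_univ.prod h2).subset fun z hz => ⟨Set.mem_univ _, ?_⟩
    simp only [Set.mem_ofPred_eq, not_lt] at hz ⊢
    refine hz.trans ?_
    rw [mul_assoc, norm_mul]
    exact mul_le_mul_of_nonneg_right (norm_le_pi_norm u _) (norm_nonneg _)
  refine exists_isSeparatingContour ?_ ?_ ?_ ?_ ?_
  · rintro ⟨i, j, k, he⟩; exact hne i (j, k) he.symm
  · rintro ⟨i, j, k, he⟩; exact inv_ne_zero (hne i (j, k)) he.symm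
  · intro ε hε
    refine ((hfin ε hε).image fun z => u z.1 * p ^ z.2.1 * q ^ z.2.2).subset ?_
    rintro _ ⟨⟨i, j, k, rfl⟩, hz⟩
    exact ⟨(i, j, k), hz, rfl⟩
  · intro R
    refine ((hfin (max R 1)⁻¹ (by positivity)).image
      fun z => (u z.1 * p ^ z.2.1 * q ^ z.2.2)⁻¹).subset ?_
    rintro _ ⟨⟨i, j, k, rfl⟩, hz⟩
    refine ⟨(i, j, k), ?_, rfl⟩
    simp only [Set.mem_ofPred_eq] at hz ⊢
    rw [norm_inv] at hz
    rw [inv_le_comm₀ (by positivity) (norm_pos_iff.2 (hne i (j, k)))]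
    exact hz.trans (le_max_left _ _)
  · rintro _ ⟨i, j, k, rfl⟩ _ ⟨i', j', k', rfl⟩ x hx he
    refine h i i' (j + j') (k + k') x hx ?_
    rw [← div_eq_mul_inv, eq_div_iff (hne i' (j', k'))] at he
    rw [← he, pow_add, pow_add]; ring

end
end EllipticBeta
end

noncomputable section
namespace EllipticBeta

/-! ### The parameters of the elliptic hypergeometric integral -/

/-- The product of `f x y` over the pairs of entries of a list. -/
def pairProd (f : ℂ → ℂ → ℂ) : List ℂ → ℂ
  | [] => 1
  | x :: l => (l.map (f x)).prod * pairProd f l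

theorem pairProd_append (f : ℂ → ℂ → ℂ) (l m : List ℂ) : pairProd f (l ++ m) =
    pairProd f l * pairProd f m * (l.map fun x => (m.map (f x)).prod).prod := by
  induction l with
  | nil => simp [pairProd]
  | cons x l ih =>
    rw [List.cons_append, pairProd, pairProd, ih, List.map_append, List.prod_append, List.map_cons,
      List.prod_cons]
    ring

theorem prod_Ioi_eq_pairProd (f : ℂ → ℂ → ℂ) {n : ℕ} (u : Fin n → ℂ) :
    ∏ r, ∏ s ∈ Finset.Ioi r, f (u r) (u s) = pairProd f (List.ofFn u) := by
  induction n with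
  | zero => simp [pairProd]
  | succ n ih =>
    rw [List.ofFn_succ, pairProd, ← ih, Fin.prod_univ_succ, List.map_ofFn, List.prod_ofFn,
      Fin.prod_Ioi_zero]
    simp only [Fin.prod_Ioi_succ, Function.comp]

section
variable {p q b : ℂ} {t : Fin 4 → ℂ}

theorem sqrt_sq (x : ℂ) : (x ^ (1 / 2 : ℂ)) ^ 2 = x := by rw [← Complex.cpow_nat_mul]; simp

/-- The first eight parameters. -/
def mainList (b : ℂ) (t : Fin 4 → ℂ) (p q : ℂ) : List ℂ :=
  [t 0, p * q / (b * t 0), t 1, p * q / (b * t 1), t 2, p * q / (b * t 2), t 3, p * q / (b * t 3)]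

/-- The numbers `± r i`. -/
def signList (r : Fin 4 → ℂ) : List ℂ := [r 0, -r 0, r 1, -r 1, r 2, -r 2, r 3, -r 3]

/-- The square roots of `b`, `b q`, `b p`, `b p q`. -/
def rootVec (b p q : ℂ) : Fin 4 → ℂ :=
  ![b ^ (1 / 2 : ℂ), (b * q) ^ (1 / 2 : ℂ), (b * p) ^ (1 / 2 : ℂ), (b * p * q) ^ (1 / 2 : ℂ)]

def fullVec (b : ℂ) (t r : Fin 4 → ℂ) (p q : ℂ) : Fin 16 → ℂ :=
  ![t 0, p * q / (b * t 0), t 1, p * q / (b * t 1), t 2, p * q / (b * t 2), t 3, p * q / (b * t 3),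
    r 0, -r 0, r 1, -r 1, r 2, -r 2, r 3, -r 3]

theorem ofFn_fullVec (r : Fin 4 → ℂ) :
    List.ofFn (fullVec b t r p q) = mainList b t p q ++ signList r := rfl

theorem ellParams_eq : ellParams b t p q = fullVec b t (rootVec b p q) p q := rfl

/-- `r` consists of square roots of `b`, `b q`, `b p`, `b p q`. -/
def IsRootVec (r : Fin 4 → ℂ) (b p q : ℂ) : Prop :=
  r 0 ^ 2 = b ∧ r 1 ^ 2 = b * q ∧ r 2 ^ 2 = b * p ∧ r 3 ^ 2 = b * p * q

theorem isRootVec_rootVec (b p q : ℂ) : IsRootVec (rootVec b p q) b p q :=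
  ⟨sqrt_sq _, sqrt_sq _, sqrt_sq _, sqrt_sq _⟩

variable {r : Fin 4 → ℂ}

theorem IsRootVec.ne_zero (h : IsRootVec r b p q) (hb : b ≠ 0) (hp : p ≠ 0) (hq : q ≠ 0) (i : Fin 4) :
    r i ≠ 0 := by
  obtain ⟨h0, h1, h2, h3⟩ := h
  intro hi
  fin_cases i <;> simp only [Fin.zero_eta, Fin.mk_one, Fin.reduceFinMk] at hi
  · rw [hi] at h0; simp at h0; exact hb h0.symm
  · rw [hi] at h1; simp at h1; exact h1.elim hb hq
  · rw [hi] at h2; simp at h2; exact h2.elim hb hp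
  · rw [hi] at h3; simp at h3; tauto

theorem ellParams_ne_zero (hb : b ≠ 0) (ht : ∀ i, t i ≠ 0) (hp : p ≠ 0) (hq : q ≠ 0) (i) :
    ellParams b t p q i ≠ 0 := by
  have h : ∀ x ∈ List.ofFn (ellParams b t p q), x ≠ 0 := by
    have hr := (isRootVec_rootVec b p q).ne_zero hb hp hq
    rw [ellParams_eq, ofFn_fullVec]
    simp [mainList, signList, hb, ht, hp, hq, hr]
  exact h _ (List.mem_ofFn.2 ⟨i, rfl⟩)

theorem prod_ellParams (f : ℂ → ℂ) : ∏ i, f (ellParams b t p q i) =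
    ((mainList b t p q).map f).prod * ((signList (rootVec b p q)).map f).prod := by
  rw [← List.prod_append, ← List.map_append, ← ofFn_fullVec, ← ellParams_eq, List.map_ofFn,
    List.prod_ofFn]
  rfl

theorem prod_signList (hp : ‖p‖ < 1) (hq : ‖q‖ < 1) (h : IsRootVec r b p q) (c : ℂ) :
    ((signList r).map fun x => pqPoch (x * c) p q).prod = pqPoch (b * c ^ 2) p q := by
  obtain ⟨h0, h1, h2, h3⟩ := h
  have e (x : ℂ) : pqPoch (x * c) p q * pqPoch (-x * c) p q
      = pqPoch (x ^ 2 * c ^ 2) (p ^ 2) (q ^ 2) := by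
    rw [neg_mul, pqPoch_mul_neg hp hq, mul_pow]
  rw [pqPoch_quadruple hp hq, show b * c ^ 2 * q = b * q * c ^ 2 by ring,
    show b * c ^ 2 * p = b * p * c ^ 2 by ring, show b * p * c ^ 2 * q = b * p * q * c ^ 2 by ring,
    ← h3, ← h2, ← h1, ← h0, ← e, ← e, ← e, ← e]
  simp only [signList, List.map_cons, List.prod_cons, List.map_nil, List.prod_nil]
  ring

theorem prod_signList_inv (hp0 : p ≠ 0) (hq0 : q ≠ 0) (hb : b ≠ 0) (hp : ‖p‖ < 1) (hq : ‖q‖ < 1)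
    (h : IsRootVec r b p q) (c : ℂ) :
    ((signList r).map fun x => pqPoch (p * q / (x * c)) p q).prod =
      pqPoch (p * q / (b * c ^ 2)) p q := by
  have hr := h.ne_zero hb hp0 hq0
  obtain ⟨h0, h1, h2, h3⟩ := h
  -- The numbers pq/r_i, taken in reverse order, are square roots of pq/b times 1, q, p, pq. This
  -- reduces the claim to `prod_signList`.
  have e : IsRootVec ![p * q / r 3, p * q / r 2, p * q / r 1, p * q / r 0] (p * q / b) p q := by
    refine ⟨?_, ?_, ?_, ?_⟩ <;> simp [div_pow, h0, h1, h2, h3] <;> field_simp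
  have := prod_signList hp hq e c⁻¹
  rw [show p * q / b * c⁻¹ ^ 2 = p * q / (b * c ^ 2) by rw [inv_pow, ← div_eq_mul_inv, div_div]]
    at this
  rw [← this]
  have hx (x : ℂ) : p * q / (x * c) = p * q / x * c⁻¹ := by rw [← div_div, ← div_eq_mul_inv]
  have hx' (x : ℂ) : p * q / (-x * c) = -(p * q / x) * c⁻¹ := by rw [hx]; ring
  simp only [signList, List.map_cons, List.prod_cons, List.map_nil, List.prod_nil, Matrix.cons_val,
    hx, hx']
  ring_nf

/-- The numerator of the integrand at `ellParams`. -/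
def ellNum (q p b : ℂ) (t : Fin 4 → ℂ) (z : ℂ) : ℂ :=
  (∏ i, pqPoch (p * q / (t i * z)) p q * pqPoch (p * q * z / t i) p q *
    (pqPoch (b * t i / z) p q * pqPoch (b * t i * z) p q)) *
  (pqPoch (p * q / (b * z ^ 2)) p q * pqPoch (p * q * z ^ 2 / b) p q) *
  (qPoch (z ^ 2) p * qPoch (p / z ^ 2) p * (qPoch (q * z ^ 2) q * qPoch (1 / z ^ 2) q))

/-- The denominator of the integrand at `ellParams`. -/
def ellDen (q p b : ℂ) (t : Fin 4 → ℂ) (z : ℂ) : ℂ :=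
  (∏ i, pqPoch (t i * z) p q * pqPoch (t i / z) p q *
    (pqPoch (p * q * z / (b * t i)) p q * pqPoch (p * q / (b * t i * z)) p q)) *
  (pqPoch (b * z ^ 2) p q * pqPoch (b / z ^ 2) p q)

theorem betaDen_ellParams (hp : ‖p‖ < 1) (hq : ‖q‖ < 1) (z : ℂ) :
    betaDen (ellParams b t p q) p q z = ellDen q p b t z := by
  have hr := isRootVec_rootVec b p q
  rw [betaDen, prod_ellParams fun x => pqPoch (x * z) p q * pqPoch (x / z) p q, ellDen]
  congr 1
  · simp only [mainList, List.map_cons, List.prod_cons, List.map_nil, List.prod_nil,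
      Fin.prod_univ_four]
    have e1 (i : Fin 4) : p * q / (b * t i) * z = p * q * z / (b * t i) := by ring
    have e2 (i : Fin 4) : p * q / (b * t i) / z = p * q / (b * t i * z) := by rw [div_div]
    simp only [e1, e2]
    ring
  · rw [List.prod_map_mul, prod_signList hp hq hr]
    congr 1
    have := prod_signList hp hq hr z⁻¹
    simpa only [← div_eq_mul_inv, inv_pow] using this

theorem betaNum_ellParams (hp0 : p ≠ 0) (hq0 : q ≠ 0) (hb : b ≠ 0) (hp : ‖p‖ < 1) (hq : ‖q‖ < 1)
    (ht : ∀ i, t i ≠ 0) {z : ℂ} (hz : z ≠ 0) :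
    betaNum (ellParams b t p q) p q z = ellNum q p b t z := by
  have hr := isRootVec_rootVec b p q
  rw [betaNum, prod_ellParams fun x => pqPoch (p * q / (x * z)) p q * pqPoch (p * q / (x / z)) p q,
    ellNum]
  congr 1
  congr 1
  · simp only [mainList, List.map_cons, List.prod_cons, List.map_nil, List.prod_nil,
      Fin.prod_univ_four]
    have e1 (i : Fin 4) : p * q / (p * q / (b * t i) * z) = b * t i / z := by
      have := ht i; field_simp
    have e2 (i : Fin 4) : p * q / (p * q / (b * t i) / z) = b * t i * z := by
      have := ht i; field_simp
    have e3 (i : Fin 4) : p * q / (t i / z) = p * q * z / t i := by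
      have := ht i; field_simp
    simp only [e1, e2, e3]
    ring
  · rw [List.prod_map_mul, prod_signList_inv hp0 hq0 hb hp hq hr]
    congr 1
    have := prod_signList_inv hp0 hq0 hb hp hq hr z⁻¹
    simp only [← div_eq_mul_inv, inv_pow] at this
    rw [this]
    congr 1
    field_simp

/-- The factors from the parameters `x`, `p q / (b x)` and `y`, `p q / (b y)`. -/
def fourFactor (b p q x y : ℂ) : ℂ :=
  pqPoch (x * y) p q * pqPoch (p * q * x / (b * y)) p q * pqPoch (p * q * y / (b * x)) p q *
    pqPoch (p ^ 2 * q ^ 2 / (b ^ 2 * x * y)) p q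

/-- The product of `fourFactor` over the pairs of `t`. -/
def tFactor (b : ℂ) (t : Fin 4 → ℂ) (p q : ℂ) : ℂ :=
  fourFactor b p q (t 0) (t 1) * fourFactor b p q (t 0) (t 2) * fourFactor b p q (t 0) (t 3) *
    (fourFactor b p q (t 1) (t 2) * fourFactor b p q (t 1) (t 3) * fourFactor b p q (t 2) (t 3))

/-- The pairs of one of the first eight parameters with one of the eight square roots multiply to
`ellDenom`, which is why the integral is normalised by it. Pairs of square roots, and the pairs t_r,
pq/(b t_r), depend on b only; the other pairs give `tFactor`. -/
theorem prod_pairs_ellParams (hp0 : p ≠ 0) (hq0 : q ≠ 0) (hb : b ≠ 0) (hp : ‖p‖ < 1) (hq : ‖q‖ < 1)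
    (ht : ∀ i, t i ≠ 0) :
    (∏ i, ∏ j ∈ Finset.Ioi i, pqPoch (ellParams b t p q i * ellParams b t p q j) p q) *
      (qPoch p p * qPoch q q) = ellDenom b t p q *
      (qPoch (-b) q * qPoch (b ^ 2 * q) (q ^ 2) * basePrefactor q b p * tFactor b t p q) := by
  have hr := isRootVec_rootVec b p q
  obtain ⟨r0, r1, r2, r3⟩ := hr
  rw [prod_Ioi_eq_pairProd fun x y => pqPoch (x * y) p q, ellParams_eq, ofFn_fullVec,
    pairProd_append]
  have hT : pairProd (fun x y => pqPoch (x * y) p q) (mainList b t p q) =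
      pqPoch (p * q / b) p q ^ 4 * tFactor b t p q := by
    simp only [mainList, pairProd, List.map_cons, List.prod_cons, List.map_nil, List.prod_nil,
      tFactor, fourFactor]
    have e1 (i : Fin 4) : t i * (p * q / (b * t i)) = p * q / b := by have := ht i; field_simp
    have e2 (i j : Fin 4) : t i * (p * q / (b * t j)) = p * q * t i / (b * t j) := by ring
    have e3 (i j : Fin 4) : p * q / (b * t i) * t j = p * q * t j / (b * t i) := by ring
    have e4 (i j : Fin 4) : p * q / (b * t i) * (p * q / (b * t j)) =
      p ^ 2 * q ^ 2 / (b ^ 2 * t i * t j) := by field_simp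
    simp only [e1, e2, e3, e4]
    ring
  have hB : pairProd (fun x y => pqPoch (x * y) p q) (signList (rootVec b p q)) =
      pqPoch (-b) p q * pqPoch (-(b * q)) p q * (pqPoch (-(b * p)) p q * pqPoch (-(b * p * q)) p q) *
      (pqPoch (b ^ 2 * q) (p ^ 2) (q ^ 2) * pqPoch (b ^ 2 * p) (p ^ 2) (q ^ 2) *
        pqPoch (b ^ 2 * p * q) (p ^ 2) (q ^ 2) ^ 2 * pqPoch (b ^ 2 * p * q ^ 2) (p ^ 2) (q ^ 2) *
        pqPoch (b ^ 2 * p ^ 2 * q) (p ^ 2) (q ^ 2)) ^ 2 := by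
    generalize rootVec b p q = r at *
    have e (x y : ℂ) : pqPoch (x * y) p q * pqPoch (-(x * y)) p q =
        pqPoch (x ^ 2 * y ^ 2) (p ^ 2) (q ^ 2) := by rw [pqPoch_mul_neg hp hq, mul_pow]
    have f1 := e (r 0) (r 1)
    have f2 := e (r 0) (r 2)
    have f3 := e (r 0) (r 3)
    have f4 := e (r 1) (r 2)
    have f5 := e (r 1) (r 3)
    have f6 := e (r 2) (r 3)
    rw [r0, r1] at f1
    rw [r0, r2] at f2
    rw [r0, r3] at f3
    rw [r1, r2] at f4
    rw [r1, r3] at f5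
    rw [r2, r3] at f6
    rw [show b * (b * q) = b ^ 2 * q by ring] at f1
    rw [show b * (b * p) = b ^ 2 * p by ring] at f2
    rw [show b * (b * p * q) = b ^ 2 * p * q by ring] at f3
    rw [show b * q * (b * p) = b ^ 2 * p * q by ring] at f4
    rw [show b * q * (b * p * q) = b ^ 2 * p * q ^ 2 by ring] at f5
    rw [show b * p * (b * p * q) = b ^ 2 * p ^ 2 * q by ring] at f6
    have g (i : Fin 4) : r i * -r i = -(r i ^ 2) := by ring
    simp only [signList, pairProd, List.map_cons, List.prod_cons, List.map_nil, List.prod_nil,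
      g, r0, r1, r2, r3, mul_neg, neg_mul, neg_neg]
    rw [← f1, ← f2, ← f5, ← f6, show pqPoch (b ^ 2 * p * q) (p ^ 2) (q ^ 2) ^ 2 =
      pqPoch (r 0 * r 3) p q * pqPoch (-(r 0 * r 3)) p q *
      (pqPoch (r 1 * r 2) p q * pqPoch (-(r 1 * r 2)) p q) by rw [f3, f4, sq]]
    ring
  have hTB : ((mainList b t p q).map fun x => ((signList (rootVec b p q)).map
      fun y => pqPoch (x * y) p q).prod).prod = ellDenom b t p q := by
    have e (x : ℂ) : ((signList (rootVec b p q)).map fun y => pqPoch (x * y) p q).prod =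
        pqPoch (b * x ^ 2) p q := by
      rw [← prod_signList hp hq ⟨r0, r1, r2, r3⟩]; simp only [mul_comm]
    simp only [e]
    have e2 (i : Fin 4) : b * (p * q / (b * t i)) ^ 2 = p ^ 2 * q ^ 2 / (b * t i ^ 2) := by
      field_simp
    simp only [mainList, List.map_cons, List.prod_cons, List.map_nil, List.prod_nil, ellDenom,
      Fin.prod_univ_four, e2]
    ring
  rw [hT, hB, hTB, pqPoch_eq_mul hp hq (-b), pqPoch_eq_mul hp hq (-(b * q)), basePrefactor,
    pqPoch_eq_mul (norm_sq_lt_one hp) (norm_sq_lt_one hq) (b ^ 2 * q),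
    show -b * p = -(b * p) by ring, show -(b * q) * p = -(b * p * q) by ring,
    show b ^ 2 * q * p ^ 2 = b ^ 2 * p ^ 2 * q by ring]
  ring

/-- The factor in front of the integral for `ellE`. -/
def ellPre (q p b : ℂ) (t : Fin 4 → ℂ) : ℂ :=
  qPoch (-b) q * qPoch (b ^ 2 * q) (q ^ 2) * basePrefactor q b p * tFactor b t p q / 2

theorem ellE_eq_of_generic (hp0 : p ≠ 0) (hq0 : q ≠ 0) (hp : ‖p‖ < 1) (hq : ‖q‖ < 1)
    (h : (b, t) ∈ ellGeneric p q) {γ : ℝ → ℂ}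
    (hγ : IsSeparatingContour γ (innerPoles (ellParams b t p q) p q)
      (outerPoles (ellParams b t p q) p q)) :
    ellBeta 5 (ellParams b t p q) p q / ellDenom b t p q = ellPre q p b t *
      contourIntegral γ (fun z => ellNum q p b t z /
        (ellDen q p b t z * (2 * Real.pi * Complex.I * z))) := by
  obtain ⟨hb, ht, hc, hd⟩ := h
  dsimp only at hb ht hc hd
  have hu := ellParams_ne_zero (q := q) (p := p) hb ht hp0 hq0
  rw [ellBeta, if_pos hc, betaByContour, dif_pos hc,
    contourIntegral_beta_eq hp0 hq0 hp hq hu hc.choose_spec hγ,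
    contourIntegral_congr (f := fun z => betaNum (ellParams b t p q) p q z /
      (betaDen (ellParams b t p q) p q z * (2 * Real.pi * Complex.I * z)))
      (g := fun z => ellNum q p b t z / (ellDen q p b t z * (2 * Real.pi * Complex.I * z)))
      fun s hs => by
        rw [betaDen_ellParams hp hq, betaNum_ellParams hp0 hq0 hb hp hq ht (hγ.ne_zero s hs)]]
  have := prod_pairs_ellParams hp0 hq0 hb hp hq ht
  rw [ellPre, div_eq_iff hd]
  linear_combination (contourIntegral γ fun z => ellNum q p b t z /
    (ellDen q p b t z * (2 * Real.pi * Complex.I * z))) / 2 * this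

end
end EllipticBeta
end

noncomputable section
namespace EllipticBeta

/-! ### Stability in the parameters -/

section
variable {p q b : ℂ} {t r r' : Fin 4 → ℂ}

theorem mem_signList {x : ℂ} : x ∈ signList r ↔ ∃ i, x ^ 2 = r i ^ 2 := by
  simp only [signList, List.mem_cons, List.not_mem_nil, or_false,
    sq_eq_sq_iff_eq_or_eq_neg, Fin.exists_fin_succ, Fin.exists_fin_zero, Fin.succ_zero_eq_one,
    Fin.succ_one_eq_two]
  simp only [show Fin.succ (2 : Fin 3) = 3 from rfl]
  tauto

theorem IsRootVec.sq_eq (h : IsRootVec r b p q) (h' : IsRootVec r' b p q) (i : Fin 4) :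
    r i ^ 2 = r' i ^ 2 := by
  obtain ⟨h0, h1, h2, h3⟩ := h
  obtain ⟨g0, g1, g2, g3⟩ := h'
  fin_cases i <;> simp only [Fin.zero_eta, Fin.mk_one, Fin.reduceFinMk, *]

theorem mem_ofFn_fullVec_congr (h : IsRootVec r b p q) (h' : IsRootVec r' b p q) (x : ℂ) :
    x ∈ List.ofFn (fullVec b t r p q) ↔ x ∈ List.ofFn (fullVec b t r' p q) := by
  simp only [ofFn_fullVec, List.mem_append, mem_signList, h.sq_eq h']

theorem innerPoles_eq {n : ℕ} (u : Fin n → ℂ) (p q : ℂ) :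
    innerPoles u p q = {z | ∃ x ∈ List.ofFn u, ∃ j k : ℕ, z = x * p ^ j * q ^ k} := by
  ext z; simp [innerPoles, List.mem_ofFn]

theorem outerPoles_eq {n : ℕ} (u : Fin n → ℂ) (p q : ℂ) :
    outerPoles u p q = {z | ∃ x ∈ List.ofFn u, ∃ j k : ℕ, z = (x * p ^ j * q ^ k)⁻¹} := by
  ext z; simp [outerPoles, List.mem_ofFn]

/-- The principal square roots jump across the negative axis. Near b they are replaced by
(x/b)^{1/2} times the roots at b, which are continuous; the set of poles is unchanged because it
depends only on the squares of the roots. -/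
theorem IsSeparatingContour.eventually_ellParams (hp0 : p ≠ 0) (hq0 : q ≠ 0) (hp : ‖p‖ < 1)
    (hq : ‖q‖ < 1) (hb : b ≠ 0) (ht : ∀ i, t i ≠ 0) {γ : ℝ → ℂ}
    (h : IsSeparatingContour γ (innerPoles (ellParams b t p q) p q)
      (outerPoles (ellParams b t p q) p q)) :
    ∀ᶠ x in 𝓝 (b, t), IsSeparatingContour γ (innerPoles (ellParams x.1 x.2 p q) p q)
      (outerPoles (ellParams x.1 x.2 p q) p q) := by
  set ρ : ℂ → Fin 4 → ℂ := fun x i => (x / b) ^ (1 / 2 : ℂ) * rootVec b p q i with hρ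
  have hroot (x : ℂ) : IsRootVec (ρ x) x p q := by
    obtain ⟨h0, h1, h2, h3⟩ := isRootVec_rootVec b p q
    refine ⟨?_, ?_, ?_, ?_⟩ <;> simp only [hρ, mul_pow, sqrt_sq, *] <;> field_simp
  have hρb : ρ b = rootVec b p q := by ext i; simp [hρ, div_self hb]
  have hρc (i : Fin 4) : ContinuousAt (fun x : ℂ × (Fin 4 → ℂ) => ρ x.1 i) (b, t) := by
    refine ContinuousAt.mul (ContinuousAt.cpow ?_ continuousAt_const ?_) continuousAt_const
    · exact continuousAt_fst.div_const b
    · simp [div_self hb]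
  have ht' (i : Fin 4) : ContinuousAt (fun x : ℂ × (Fin 4 → ℂ) => p * q / (x.1 * x.2 i)) (b, t) :=
    ContinuousAt.div continuousAt_const (by fun_prop) (mul_ne_zero hb (ht i))
  have ht (i : Fin 4) : ContinuousAt (fun x : ℂ × (Fin 4 → ℂ) => x.2 i) (b, t) := by fun_prop
  have hc : ContinuousAt (fun x : ℂ × (Fin 4 → ℂ) => fullVec x.1 x.2 (ρ x.1) p q) (b, t) := by
    refine continuousAt_pi.2 fun i => ?_
    fin_cases i
    exacts [ht 0, ht' 0, ht 1, ht' 1, ht 2, ht' 2, ht 3, ht' 3, hρc 0, (hρc 0).neg, hρc 1,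
      (hρc 1).neg, hρc 2, (hρc 2).neg, hρc 3, (hρc 3).neg]
  rw [ellParams_eq, ← hρb] at h
  have h0 : ∀ i, fullVec b t (ρ b) p q i ≠ 0 := by
    rw [hρb, ← ellParams_eq]; exact ellParams_ne_zero hb ‹_› hp0 hq0
  filter_upwards [hc.eventually (h.eventually hp0 hq0 hp hq h0)] with x hx
  have e := mem_ofFn_fullVec_congr (t := x.2) (hroot x.1) (isRootVec_rootVec x.1 p q)
  rw [ellParams_eq]
  rw [innerPoles_eq, outerPoles_eq] at hx ⊢
  simpa only [e] using hx

/-- Nonzero parameters. -/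
def torus : Set (ℂ × (Fin 4 → ℂ)) := {x | x.1 ≠ 0 ∧ ∀ r, x.2 r ≠ 0}

theorem isOpen_torus : IsOpen torus := by
  have h (r : Fin 4) : IsOpen {z : ℂ × (Fin 4 → ℂ) | z.2 r ≠ 0} :=
    isOpen_ne_fun (by fun_prop) continuous_const
  have h2 : IsOpen {z : ℂ × (Fin 4 → ℂ) | ∀ r, z.2 r ≠ 0} := by
    have := isOpen_iInter_of_finite h
    convert! this using 1
    ext z; simp
  exact (isOpen_ne_fun (by fun_prop) continuous_const).inter h2

theorem continuousOn_ellDenom (hp : ‖p‖ < 1) (hq : ‖q‖ < 1) :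
    ContinuousOn (fun x : ℂ × (Fin 4 → ℂ) => ellDenom x.1 x.2 p q) torus := by
  refine continuousOn_finsetProd _ fun i _ => ContinuousOn.mul
    (ContinuousOn.pqPoch (by fun_prop) continuousOn_const (fun _ _ => hp) hq)
    (ContinuousOn.pqPoch (ContinuousOn.div (by fun_prop) (by fun_prop) fun x hx =>
      mul_ne_zero hx.1 (pow_ne_zero 2 (hx.2 i))) continuousOn_const (fun _ _ => hp) hq)

theorem isOpen_ellGeneric (hp0 : p ≠ 0) (hq0 : q ≠ 0) (hp : ‖p‖ < 1) (hq : ‖q‖ < 1) :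
    IsOpen (ellGeneric p q) := by
  rw [isOpen_iff_mem_nhds]
  rintro ⟨b, t⟩ ⟨hb, ht, ⟨γ, hγ⟩, hd⟩
  have hT : torus ∈ 𝓝 (b, t) := isOpen_torus.mem_nhds ⟨hb, ht⟩
  filter_upwards [hT, hγ.eventually_ellParams hp0 hq0 hp hq hb ht,
    ((continuousOn_ellDenom hp hq).continuousAt hT).eventually_ne hd] with x h1 h2 h3
  exact ⟨h1.1, h1.2, ⟨γ, h2⟩, h3⟩

theorem continuousOn_fourFactor (hp : ‖p‖ < 1) (hq : ‖q‖ < 1) (i j : Fin 4) :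
    ContinuousOn (fun x : ℂ × (Fin 4 → ℂ) => fourFactor x.1 p q (x.2 i) (x.2 j)) torus := by
  refine ContinuousOn.mul (ContinuousOn.mul (ContinuousOn.mul ?_ ?_) ?_) ?_ <;>
    refine ContinuousOn.pqPoch ?_ continuousOn_const (fun _ _ => hp) hq
  · fun_prop
  · exact ContinuousOn.div (by fun_prop) (by fun_prop) fun x hx => mul_ne_zero hx.1 (hx.2 j)
  · exact ContinuousOn.div (by fun_prop) (by fun_prop) fun x hx => mul_ne_zero hx.1 (hx.2 i)
  · exact ContinuousOn.div (by fun_prop) (by fun_prop) fun x hx =>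
      mul_ne_zero (mul_ne_zero (pow_ne_zero 2 hx.1) (hx.2 i)) (hx.2 j)

theorem continuousOn_ellPre (hp : ‖p‖ < 1) (hq : ‖q‖ < 1) :
    ContinuousOn (fun x : ℂ × (Fin 4 → ℂ) => ellPre q p x.1 x.2) torus := by
  have h (i j) := continuousOn_fourFactor hp hq i j
  refine ContinuousOn.div_const (((ContinuousOn.mul ?_ ?_).mul
    ((contDiffOn_basePrefactor hq hp).continuousOn.comp continuousOn_fst fun x hx => hx.1)).mul
    ((((h 0 1).mul (h 0 2)).mul (h 0 3)).mul (((h 1 2).mul (h 1 3)).mul (h 2 3)))) _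
  · exact ContinuousOn.qPoch (by fun_prop) continuousOn_const fun _ _ => hq
  · exact ContinuousOn.qPoch (by fun_prop) continuousOn_const fun _ _ => norm_sq_lt_one hq

theorem continuousOn_ellNum (hp : ‖p‖ < 1) (hq : ‖q‖ < 1) :
    ContinuousOn (fun x : (ℂ × (Fin 4 → ℂ)) × ℂ => ellNum q p x.1.1 x.1.2 x.2)
      (torus ×ˢ {0}ᶜ) := by
  have hP {f : (ℂ × (Fin 4 → ℂ)) × ℂ → ℂ} (hf : ContinuousOn f (torus ×ˢ {0}ᶜ)) :=
    hf.pqPoch continuousOn_const (fun _ _ => hp) hq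
  have hQ {q : ℂ} (hq : ‖q‖ < 1) {f : (ℂ × (Fin 4 → ℂ)) × ℂ → ℂ}
      (hf : ContinuousOn f (torus ×ˢ {0}ᶜ)) := hf.qPoch continuousOn_const (fun _ _ => hq)
  refine ContinuousOn.mul (ContinuousOn.mul (continuousOn_finsetProd _ fun i _ =>
    ContinuousOn.mul (ContinuousOn.mul ?_ ?_) (ContinuousOn.mul ?_ ?_)) (ContinuousOn.mul ?_ ?_))
    (ContinuousOn.mul (ContinuousOn.mul ?_ ?_) (ContinuousOn.mul ?_ ?_))
  · exact hP (ContinuousOn.div (by fun_prop) (by fun_prop) fun x hx =>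
      mul_ne_zero (hx.1.2 i) hx.2)
  · exact hP (ContinuousOn.div (by fun_prop) (by fun_prop) fun x hx => hx.1.2 i)
  · exact hP (ContinuousOn.div (by fun_prop) (by fun_prop) fun x hx => hx.2)
  · exact hP (by fun_prop)
  · exact hP (ContinuousOn.div (by fun_prop) (by fun_prop) fun x hx =>
      mul_ne_zero hx.1.1 (pow_ne_zero 2 hx.2))
  · exact hP (ContinuousOn.div (by fun_prop) (by fun_prop) fun x hx => hx.1.1)
  · exact hQ hp (by fun_prop)
  · exact hQ hp (ContinuousOn.div (by fun_prop) (by fun_prop) fun x hx => pow_ne_zero 2 hx.2)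
  · exact hQ hq (by fun_prop)
  · exact hQ hq (ContinuousOn.div (by fun_prop) (by fun_prop) fun x hx => pow_ne_zero 2 hx.2)

theorem continuousOn_ellDen (hp : ‖p‖ < 1) (hq : ‖q‖ < 1) :
    ContinuousOn (fun x : (ℂ × (Fin 4 → ℂ)) × ℂ => ellDen q p x.1.1 x.1.2 x.2)
      (torus ×ˢ {0}ᶜ) := by
  have hP {f : (ℂ × (Fin 4 → ℂ)) × ℂ → ℂ} (hf : ContinuousOn f (torus ×ˢ {0}ᶜ)) :=
    hf.pqPoch continuousOn_const (fun _ _ => hp) hq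
  refine ContinuousOn.mul (continuousOn_finsetProd _ fun i _ =>
    ContinuousOn.mul (ContinuousOn.mul ?_ ?_) (ContinuousOn.mul ?_ ?_)) (ContinuousOn.mul ?_ ?_)
  · exact hP (by fun_prop)
  · exact hP (ContinuousOn.div (by fun_prop) (by fun_prop) fun x hx => hx.2)
  · exact hP (ContinuousOn.div (by fun_prop) (by fun_prop) fun x hx =>
      mul_ne_zero hx.1.1 (hx.1.2 i))
  · exact hP (ContinuousOn.div (by fun_prop) (by fun_prop) fun x hx =>
      mul_ne_zero (mul_ne_zero hx.1.1 (hx.1.2 i)) hx.2)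
  · exact hP (by fun_prop)
  · exact hP (ContinuousOn.div (by fun_prop) (by fun_prop) fun x hx => pow_ne_zero 2 hx.2)

theorem ellDen_ne_zero (hp0 : p ≠ 0) (hq0 : q ≠ 0) (hp : ‖p‖ < 1) (hq : ‖q‖ < 1) (hb : b ≠ 0)
    (ht : ∀ i, t i ≠ 0) {γ : ℝ → ℂ}
    (h : IsSeparatingContour γ (innerPoles (ellParams b t p q) p q)
      (outerPoles (ellParams b t p q) p q)) {s : ℝ} (hs : s ∈ Set.Icc (0 : ℝ) 1) :
    ellDen q p b t (γ s) ≠ 0 := by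
  rw [← betaDen_ellParams hp hq, Ne, betaDen_eq_zero_iff hp0 hq0 hp hq
    (ellParams_ne_zero hb ht hp0 hq0) (h.ne_zero s hs)]
  exact h.avoids s hs

/-- A contour that works at one generic parameter works nearby, so the integral is locally one over
a fixed curve. -/
theorem continuousOn_ellBeta_div (hp0 : p ≠ 0) (hq0 : q ≠ 0) (hp : ‖p‖ < 1) (hq : ‖q‖ < 1) :
    ContinuousOn (fun x : ℂ × (Fin 4 → ℂ) => ellBeta 5 (ellParams x.1 x.2 p q) p q /
      ellDenom x.1 x.2 p q) (ellGeneric p q) := by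
  rintro ⟨b, t⟩ hx
  refine ContinuousAt.continuousWithinAt ?_
  obtain ⟨hb, ht, ⟨γ, hγ⟩, hd⟩ := id hx
  have hev : ∀ᶠ x in 𝓝 (b, t), x ∈ ellGeneric p q ∧
      IsSeparatingContour γ (innerPoles (ellParams x.1 x.2 p q) p q)
        (outerPoles (ellParams x.1 x.2 p q) p q) :=
    ((isOpen_ellGeneric hp0 hq0 hp hq).eventually_mem hx).and
      (hγ.eventually_ellParams hp0 hq0 hp hq hb ht)
  obtain ⟨U, hUs, hUo, hxU⟩ := eventually_nhds_iff.1 hev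
  have hmem : U ∈ 𝓝 (b, t) := hUo.mem_nhds hxU
  set S : Set ((ℂ × (Fin 4 → ℂ)) × ℂ) :=
    {x | x ∈ torus ×ˢ {0}ᶜ ∧ ellDen q p x.1.1 x.1.2 x.2 ≠ 0} with hS
  have hF : ContinuousOn (fun x : (ℂ × (Fin 4 → ℂ)) × ℂ => ellNum q p x.1.1 x.1.2 x.2 /
      (ellDen q p x.1.1 x.1.2 x.2 * (2 * Real.pi * Complex.I * x.2))) S :=
    ContinuousOn.div ((continuousOn_ellNum hp hq).mono fun x hx => hx.1)
      (((continuousOn_ellDen hp hq).mono fun x hx => hx.1).mul (by fun_prop))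
      fun x hx => mul_ne_zero hx.2 (two_pi_I_mul_ne_zero hx.1.2)
  have hI := continuousOn_integral_curve zero_le_one hγ.contDiff.continuous
    (hγ.contDiff.continuous_deriv le_rfl) hF (U := U) fun x hx s hs =>
      ⟨⟨⟨(hUs _ hx).1.1, (hUs _ hx).1.2.1⟩, (hUs _ hx).2.ne_zero s hs⟩, ellDen_ne_zero hp0 hq0 hp hq
        (hUs _ hx).1.1 (hUs _ hx).1.2.1 (hUs _ hx).2 hs⟩
  have hP := (continuousOn_ellPre hp hq).mono (s := torus) (t := U) fun x hx =>
    ⟨(hUs _ hx).1.1, (hUs _ hx).1.2.1⟩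
  refine ((hP.mul hI).congr fun x hx => ?_).continuousAt hmem
  exact ellE_eq_of_generic hp0 hq0 hp hq (hUs _ hx).1 (hUs _ hx).2

end
end EllipticBeta
end

noncomputable section
namespace EllipticBeta

/-! ### The rescaled integrand and the elliptic hypergeometric integral -/

section
variable {q : ℂ}

/-- None of the theta functions occurring in `thetaSplit` and its reflection vanishes. -/
structure ThetaRegular (q b T z : ℂ) : Prop where
  sq_div : theta (b / z ^ 2) q ≠ 0
  sq_mul : theta (b * z ^ 2) q ≠ 0
  inv_sq : theta (1 / z ^ 2) q ≠ 0
  sq : theta (z ^ 2) q ≠ 0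
  div : theta (T / z) q ≠ 0
  mul : theta (T * z) q ≠ 0
  mul_div : theta (b * T / z) q ≠ 0
  mul_mul : theta (b * T * z) q ≠ 0

theorem ThetaRegular.inv {b T z : ℂ} (h : ThetaRegular q b T z) : ThetaRegular q b T z⁻¹ := by
  obtain ⟨h1, h2, h3, h4, h5, h6, h7, h8⟩ := h
  constructor <;> simp_all [← div_eq_mul_inv]

theorem countable_theta_eq_zero (hq0 : q ≠ 0) (hq : ‖q‖ < 1) :
    {x : ℂ | x ≠ 0 ∧ theta x q = 0}.Countable := by
  refine (Set.countable_range fun n : ℤ => q ^ n).mono ?_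
  rintro x ⟨hx, h0⟩
  obtain ⟨n, hn⟩ := (theta_eq_zero_iff hq0 hq hx).1 h0
  exact ⟨n, hn.symm⟩

theorem countable_theta_mul_eq_zero (hq0 : q ≠ 0) (hq : ‖q‖ < 1) {c : ℂ} (hc : c ≠ 0) :
    {x : ℂ | x ≠ 0 ∧ theta (c * x) q = 0}.Countable :=
  ((countable_theta_eq_zero hq0 hq).preimage_of_injOn (mul_right_injective₀ hc).injOn).mono
    fun _ (hx : _ ∧ _) => show _ ∧ _ from ⟨mul_ne_zero hc hx.1, hx.2⟩

theorem countable_not_thetaRegular (hq0 : q ≠ 0) (hq : ‖q‖ < 1) {b T : ℂ} (hb : b ≠ 0)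
    (hT : T ≠ 0) : {z : ℂ | z ≠ 0 ∧ ¬ ThetaRegular q b T z}.Countable := by
  have h {c : ℂ} (hc : c ≠ 0) := countable_theta_mul_eq_zero hq0 hq hc
  have h2 {c : ℂ} (hc : c ≠ 0) := countable_setOf_sq_mem (h hc)
  have hbT := mul_ne_zero hb hT
  have e (c x : ℂ) : theta (c / x) q = theta (q / c * x) q := by
    rw [← theta_inv_mul hq0 (c / x)]
    congr 1
    rw [div_div_eq_mul_div, div_mul_eq_mul_div]
  refine ((((h2 (div_ne_zero hq0 hb)).union (h2 hb)).union ((h2 (div_ne_zero hq0 one_ne_zero)).union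
    (h2 one_ne_zero))).union (((h (div_ne_zero hq0 hT)).union (h hT)).union
    ((h (div_ne_zero hq0 hbT)).union (h hbT)))).mono ?_
  rintro z ⟨hz, hn⟩
  have hz2 := pow_ne_zero 2 hz
  by_contra hc
  simp only [Set.mem_union, Set.mem_ofPred_eq, not_or, not_and, ← e, one_mul] at hc
  obtain ⟨⟨⟨h1, h2⟩, h3, h4⟩, ⟨h5, h6⟩, h7, h8⟩ := hc
  exact hn ⟨h1 hz2, h2 hz2, h3 hz2, h4 hz2, h5 hz, h6 hz, h7 hz, h8 hz⟩

variable {b a s c z w : ℂ} {u e f : Fin 3 → ℂ}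

/-- The parameters `t` in terms of the scaled ones. -/
def fullT (a s c : ℂ) (u e : Fin 3 → ℂ) : Fin 4 → ℂ :=
  Fin.cons (c * s ^ 2 * s * a) fun r => s * e r * u r

/-- With t = p s a and z = s w the arguments that blow up as s → 0 are q/(a s² w) in the numerator
and q/(b a s² w) in the denominator. The theta functions of `thetaSplit` cancel the parts of these
factors of degree zero in p. What survives carries an extra p, and p/s² = c keeps its argument
bounded. -/
theorem ellFactor_main (hq0 : q ≠ 0) (hq : ‖q‖ < 1) (hs : s ≠ 0) (hc : c ≠ 0)
    (hp : ‖c * s ^ 2‖ < 1) (hb : b ≠ 0) (ha : a ≠ 0) (hw : w ≠ 0)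
    (h : ThetaRegular q b (a * s) (s * w)) {p t : ℂ} (hpe : p = c * s ^ 2) (hte : t = p * s * a) :
    pqPoch (p * q / (t * (s * w))) p q * pqPoch (p * q * (s * w) / t) p q *
        (pqPoch (b * t / (s * w)) p q * pqPoch (b * t * (s * w)) p q) /
      (pqPoch (t * (s * w)) p q * pqPoch (t / (s * w)) p q *
        (pqPoch (p * q * (s * w) / (b * t)) p q * pqPoch (p * q / (b * t * (s * w))) p q)) *
      (theta (a * s / (b * (s * w))) q * theta (1 / (b * (a * s) * (s * w))) q /
        (theta (a * s / (s * w)) q * theta (1 / (a * s * (s * w))) q)) =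
    b⁻¹ * (pqPoch (c * q / (a * w)) p q * (pqPoch (b * a * s ^ 2 * w) p q *
      pqPoch (p * q * w / a) p q * pqPoch (p * b * a / w) p q) * theta (a / (b * w)) q /
      (pqPoch (a / w) p q * pqPoch (c * q / (b * a * w)) p q *
        (pqPoch (q * w / (b * a)) p q * pqPoch (a * s ^ 2 * w) p q))) := by
  have hp0 : p ≠ 0 := by rw [hpe]; positivity
  rw [← hpe] at hp
  have hT : a * s * (s * w) ≠ 0 := by positivity
  have hbT : b * (a * s) * (s * w) ≠ 0 := by positivity
  have h1 := h.div
  have h2 := h.mul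
  have h3 := h.mul_mul
  rw [theta_one_div hq0 hq hT, theta_one_div hq0 hq hbT]
  rw [show a * s / (s * w) = a / w by field_simp] at h1 ⊢
  rw [show a * s / (b * (s * w)) = a / (b * w) by field_simp]
  rw [show a * s * (s * w) = a * s ^ 2 * w by ring] at h2 hT ⊢
  rw [show b * (a * s) * (s * w) = b * a * s ^ 2 * w by ring] at h3 hbT ⊢
  have e1 : p * q / (t * (s * w)) = q / (a * s ^ 2 * w) := by rw [hte]; field_simp
  have e2 : p * q * (s * w) / t = q / (a / w) := by rw [hte]; field_simp
  have e3 : b * t / (s * w) = p * b * a / w := by rw [hte]; field_simp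
  have e4 : b * t * (s * w) = b * a * s ^ 2 * w * p := by rw [hte]; ring
  have e5 : t * (s * w) = a * s ^ 2 * w * p := by rw [hte]; ring
  have e6 : t / (s * w) = a / w * p := by rw [hte]; field_simp
  have e7 : p * q * (s * w) / (b * t) = q * w / (b * a) := by rw [hte]; field_simp
  have e8 : p * q / (b * t * (s * w)) = q / (b * a * s ^ 2 * w) := by rw [hte]; field_simp
  rw [e8, e1, e2, e3, e4, e5, e6, e7]
  have g1 : pqPoch (q / (a * s ^ 2 * w)) p q = qPoch (q / (a * s ^ 2 * w)) q *
      pqPoch (c * q / (a * w)) p q := by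
    rw [pqPoch_eq_mul hp hq]; congr 2; rw [hpe]; field_simp
  have g2 : pqPoch (q / (a / w)) p q = qPoch (q / (a / w)) q * pqPoch (p * q * w / a) p q := by
    rw [pqPoch_eq_mul hp hq]; congr 2; field_simp
  have g3 := pqPoch_eq_mul hp hq (b * a * s ^ 2 * w)
  have g4 := pqPoch_eq_mul hp hq (a * s ^ 2 * w)
  have g5 := pqPoch_eq_mul hp hq (a / w)
  have g6 : pqPoch (q / (b * a * s ^ 2 * w)) p q = qPoch (q / (b * a * s ^ 2 * w)) q *
      pqPoch (c * q / (b * a * w)) p q := by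
    rw [pqPoch_eq_mul hp hq]; congr 2; rw [hpe]; field_simp
  rw [g1, g2, g3, g4, g5, g6]
  simp only [theta] at h1 h2 h3 ⊢
  generalize qPoch (q / (a * s ^ 2 * w)) q = X1 at *
  generalize qPoch (a * s ^ 2 * w) q = X2 at *
  generalize qPoch (q / (b * a * s ^ 2 * w)) q = X3 at *
  generalize qPoch (b * a * s ^ 2 * w) q = X4 at *
  generalize qPoch (q / (a / w)) q = X5 at *
  generalize qPoch (a / w) q = X6 at *
  generalize pqPoch (c * q / (a * w)) p q = Y1
  generalize pqPoch (p * q * w / a) p q = Y2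
  generalize pqPoch (p * b * a / w) p q = Y3
  generalize pqPoch (b * a * s ^ 2 * w * p) p q = Y4
  generalize pqPoch (a * s ^ 2 * w * p) p q = Y5
  generalize pqPoch (a / w * p) p q = Y6
  generalize pqPoch (q * w / (b * a)) p q = Y7
  generalize pqPoch (c * q / (b * a * w)) p q = Y8
  generalize qPoch (a / (b * w)) q = Y9
  generalize qPoch (q / (a / (b * w))) q = Y10
  clear e1 e2 e3 e4 e5 e6 e7 e8 g1 g2 g3 g4 g5 g6 h hte hpe
  obtain ⟨n6, n5⟩ := mul_ne_zero_iff.1 h1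
  obtain ⟨n2, n1⟩ := mul_ne_zero_iff.1 h2
  obtain ⟨n4, n3⟩ := mul_ne_zero_iff.1 h3
  field_simp

/-- The same mechanism for the factors in z²: the parts with arguments b/z² and 1/z², which blow up,
are cancelled by θ(b/z²)/θ(1/z²). -/
theorem ellFactor_base (hq0 : q ≠ 0) (hq : ‖q‖ < 1) (hs : s ≠ 0) 
    (hp : ‖c * s ^ 2‖ < 1) (hb : b ≠ 0) (hw : w ≠ 0)
    (h : ThetaRegular q b (a * s) (s * w)) {p : ℂ} (hpe : p = c * s ^ 2) :
    (pqPoch (p * q / (b * (s * w) ^ 2)) p q * pqPoch (p * q * (s * w) ^ 2 / b) p q) *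
        (qPoch ((s * w) ^ 2) p * qPoch (p / (s * w) ^ 2) p *
          (qPoch (q * (s * w) ^ 2) q * qPoch (1 / (s * w) ^ 2) q)) /
      (pqPoch (b * (s * w) ^ 2) p q * pqPoch (b / (s * w) ^ 2) p q) *
      (theta (b / (s * w) ^ 2) q / theta (1 / (s * w) ^ 2) q) =
    qPoch (s ^ 2 * w ^ 2) p * qPoch (c / w ^ 2) p * (pqPoch (c * q / (b * w ^ 2)) p q *
      pqPoch (q * s ^ 2 * w ^ 2 / b) p q) / (pqPoch (c * b / w ^ 2) p q *
        pqPoch (b * s ^ 2 * w ^ 2) p q) := by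
  rw [← hpe] at hp
  have h1 := h.sq_div
  have h2 := h.inv_sq
  have e1 : p * q / (b * (s * w) ^ 2) = c * q / (b * w ^ 2) := by rw [hpe]; field_simp
  have e2 : q / (b / (s * w) ^ 2) = q * s ^ 2 * w ^ 2 / b := by field_simp
  have e3 : q / (1 / (s * w) ^ 2) = q * (s * w) ^ 2 := by field_simp
  have e4 : (s * w) ^ 2 = s ^ 2 * w ^ 2 := by ring
  have e5 : b * (s * w) ^ 2 = b * s ^ 2 * w ^ 2 := by ring
  have e6 : p / (s * w) ^ 2 = c / w ^ 2 := by rw [hpe]; field_simp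
  have g1 : pqPoch (b / (s * w) ^ 2) p q = qPoch (b / (s * w) ^ 2) q *
      pqPoch (c * b / w ^ 2) p q := by
    rw [pqPoch_eq_mul hp hq]; congr 2; rw [hpe]; field_simp
  have g2 : pqPoch (q * s ^ 2 * w ^ 2 / b) p q = qPoch (q * s ^ 2 * w ^ 2 / b) q *
      pqPoch (p * q * (s * w) ^ 2 / b) p q := by
    rw [pqPoch_eq_mul hp hq]; congr 2; field_simp
  rw [theta, e2] at h1
  rw [theta, e3] at h2
  rw [theta, theta, e1, e2, e3, e6, e5, g1, g2]
  rw [← e4]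
  obtain ⟨n1, n2⟩ := mul_ne_zero_iff.1 h1
  obtain ⟨n3, n4⟩ := mul_ne_zero_iff.1 h2
  generalize qPoch (q * s ^ 2 * w ^ 2 / b) q = X1 at *
  generalize qPoch (b / (s * w) ^ 2) q = X2 at *
  generalize qPoch (q * (s * w) ^ 2) q = X3 at *
  generalize qPoch (1 / (s * w) ^ 2) q = X4 at *
  field_simp

def ellNumFactor (q p b t z : ℂ) : ℂ :=
  pqPoch (p * q / (t * z)) p q * pqPoch (p * q * z / t) p q *
    (pqPoch (b * t / z) p q * pqPoch (b * t * z) p q)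

def ellDenFactor (q p b t z : ℂ) : ℂ :=
  pqPoch (t * z) p q * pqPoch (t / z) p q *
    (pqPoch (p * q * z / (b * t)) p q * pqPoch (p * q / (b * t * z)) p q)

/-- For the other three parameters nothing blows up: each power of s in a denominator is
compensated, since p = e f s². No theta function is needed. -/
theorem ellFactor_div {p e f u : ℂ} (hs : s ≠ 0) (he : e ≠ 0) (hu : u ≠ 0)
    (hb : b ≠ 0) (hw : w ≠ 0) (hpe : p = e * f * s ^ 2) :
    ellNumFactor q p b (s * e * u) (s * w) / ellDenFactor q p b (s * e * u) (s * w) =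
      (pqPoch (q * f / (u * w)) p q * pqPoch (q * s ^ 2 * f * w / u) p q *
        pqPoch (b * u * e / w) p q * pqPoch (b * u * s ^ 2 * e * w) p q) /
      (pqPoch (u * e / w) p q * pqPoch (q * f / (b * u * w)) p q *
        (pqPoch (u * s ^ 2 * e * w) p q * pqPoch (q * s ^ 2 * f * w / (b * u)) p q)) := by
  have e1 : p * q / (s * e * u * (s * w)) = q * f / (u * w) := by rw [hpe]; field_simp
  have e2 : p * q * (s * w) / (s * e * u) = q * s ^ 2 * f * w / u := by rw [hpe]; field_simp
  have e3 : b * (s * e * u) / (s * w) = b * u * e / w := by field_simp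
  have e4 : b * (s * e * u) * (s * w) = b * u * s ^ 2 * e * w := by ring
  have e5 : s * e * u * (s * w) = u * s ^ 2 * e * w := by ring
  have e6 : s * e * u / (s * w) = u * e / w := by field_simp
  have e7 : p * q * (s * w) / (b * (s * e * u)) = q * s ^ 2 * f * w / (b * u) := by
    rw [hpe]; field_simp
  have e8 : p * q / (b * (s * e * u) * (s * w)) = q * f / (b * u * w) := by rw [hpe]; field_simp
  rw [ellNumFactor, ellDenFactor, e8, e1, e2, e3, e4, e5, e6, e7]
  ring

theorem ell_mul_thetaSplit (hq0 : q ≠ 0) (hq : ‖q‖ < 1) (hs : s ≠ 0) (hc : c ≠ 0)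
    (hef : ∀ r, e r * f r = c) (hp : ‖c * s ^ 2‖ < 1) (hb : b ≠ 0) (ha : a ≠ 0)
    (hu : ∀ r, u r ≠ 0) (hw : w ≠ 0) (h : ThetaRegular q b (a * s) (s * w)) :
    ellNum q (c * s ^ 2) b (fullT a s c u e) (s * w) /
        ellDen q (c * s ^ 2) b (fullT a s c u e) (s * w) * thetaSplit q b (a * s) (s * w) =
      b⁻¹ * scaledIntegrand q ((b, a, u), (s, c, e, f)) w := by
  have h0 := ellFactor_main hq0 hq hs hc hp hb ha hw h rfl rfl
  have h1 := ellFactor_base hq0 hq hs hp hb hw h rfl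
  have hr (r : Fin 3) := ellFactor_div (q := q) hs (fun h => hc (by rw [← hef r, h, zero_mul])) (hu r)
    hb hw (p := c * s ^ 2) (e := e r) (f := f r) (by rw [hef])
  set p := c * s ^ 2 with hpe
  have hR := (Finset.prod_div_distrib (s := Finset.univ)
    (fun r : Fin 3 => ellNumFactor q p b (s * e r * u r) (s * w))
    (fun r : Fin 3 => ellDenFactor q p b (s * e r * u r) (s * w))).symm.trans
    ((Finset.prod_congr rfl fun r _ => hr r).trans (Finset.prod_div_distrib _ _))
  have hS : thetaSplit q b (a * s) (s * w) =
      (theta (a * s / (b * (s * w))) q * theta (1 / (b * (a * s) * (s * w))) q /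
        (theta (a * s / (s * w)) q * theta (1 / (a * s * (s * w))) q)) *
      (theta (b / (s * w) ^ 2) q / theta (1 / (s * w) ^ 2) q) := by
    rw [thetaSplit, div_mul_div_comm]; ring
  have hN : ellNum q p b (fullT a s c u e) (s * w) = ellNumFactor q p b (p * s * a) (s * w) *
      (∏ r : Fin 3, ellNumFactor q p b (s * e r * u r) (s * w)) *
      (pqPoch (p * q / (b * (s * w) ^ 2)) p q * pqPoch (p * q * (s * w) ^ 2 / b) p q) *
      (qPoch ((s * w) ^ 2) p * qPoch (p / (s * w) ^ 2) p *
        (qPoch (q * (s * w) ^ 2) q * qPoch (1 / (s * w) ^ 2) q)) := by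
    rw [ellNum, Fin.prod_univ_succ]; rfl
  have hD : ellDen q p b (fullT a s c u e) (s * w) = ellDenFactor q p b (p * s * a) (s * w) *
      (∏ r : Fin 3, ellDenFactor q p b (s * e r * u r) (s * w)) *
      (pqPoch (b * (s * w) ^ 2) p q * pqPoch (b / (s * w) ^ 2) p q) := by
    rw [ellDen, Fin.prod_univ_succ]; rfl
  rw [← ellNumFactor, ← ellDenFactor] at h0
  rw [hN, hD, hS]
  generalize (∏ r : Fin 3, ellNumFactor q p b (s * e r * u r) (s * w)) = X at *
  generalize (∏ r : Fin 3, ellDenFactor q p b (s * e r * u r) (s * w)) = Y at *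
  rw [mul_assoc (_ * X), mul_div_mul_comm, mul_div_mul_comm, hR,
    show ∀ x y z k l : ℂ, x * y * z * (k * l) = (x * k) * (z * l) * y by intros; ring, h0, h1]
  simp only [scaledIntegrand, numer, nome, ← hpe, Fintype.prod_sum_type, Fintype.prod_prod_type,
    numerArg, innerArg, outerArg, extraArg, Sum.elim_inl, Sum.elim_inr, Fin.prod_univ_five,
    Fin.prod_univ_four, Matrix.cons_val, Finset.prod_mul_distrib]
  rw [Fin.prod_univ_three (fun i => pqPoch (![c * b / w ^ 2, a / w, c * q / (b * a * w)] i) p q),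
    Fin.prod_univ_three (fun i => pqPoch (![q * w / (b * a), b * s ^ 2 * w ^ 2, a * s ^ 2 * w] i) p q)]
  simp only [Matrix.cons_val]
  ring

end
end EllipticBeta
end

noncomputable section
namespace EllipticBeta

/-! ### Comparison of the contours -/

section
variable {q p : ℂ}

/-- Scales with nonzero nome. -/
structure IsProper (η : Scales) : Prop where
  s_ne : η.1 ≠ 0
  c_ne : η.2.1 ≠ 0
  mul_eq : ∀ r, η.2.2.1 r * η.2.2.2 r = η.2.1
  norm_lt : ‖nome η‖ < 1

theorem IsProper.nome_ne {η : Scales} (h : IsProper η) : nome η ≠ 0 :=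
  mul_ne_zero h.c_ne (pow_ne_zero 2 h.s_ne)

theorem IsProper.e_ne {η : Scales} (h : IsProper η) (r : Fin 3) : η.2.2.1 r ≠ 0 := fun h0 =>
  h.c_ne (by rw [← h.mul_eq r, h0, zero_mul])

/-- Nonzero parameters. -/
def Params.IsNonzero (x : Params) : Prop := x.1 ≠ 0 ∧ x.2.1 ≠ 0 ∧ ∀ r, x.2.2 r ≠ 0

/-- The parameters `t` for given scales. -/
def tVec (η : Scales) (x : Params) : Fin 4 → ℂ := fullT x.2.1 η.1 η.2.1 x.2.2 η.2.2.1

theorem tVec_zero (η : Scales) (x : Params) : tVec η x 0 = nome η * η.1 * x.2.1 := rfl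

theorem tVec_succ (η : Scales) (x : Params) (r : Fin 3) :
    tVec η x r.succ = η.1 * η.2.2.1 r * x.2.2 r := rfl

theorem tVec_ne_zero {η : Scales} {x : Params} (hη : IsProper η) (hx : x.IsNonzero) (i) :
    tVec η x i ≠ 0 := by
  refine Fin.cases ?_ (fun r => ?_) i
  · exact mul_ne_zero (mul_ne_zero hη.nome_ne hη.s_ne) hx.2.1
  · exact mul_ne_zero (mul_ne_zero hη.s_ne (hη.e_ne r)) (hx.2.2 r)

/-- The parameters of the integral, together with the pole of `thetaSplit`. -/
def poleVec (q : ℂ) (η : Scales) (x : Params) : Fin (2 * 5 + 6 + 1) → ℂ :=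
  Fin.cons (x.2.1 * η.1) (ellParams x.1 (tVec η x) (nome η) q)

theorem mem_innerPoles_of {n : ℕ} {u : Fin n → ℂ} (hp : ‖p‖ < 1) (hq : ‖q‖ < 1) {z : ℂ}
    (hz : z ≠ 0) (r : Fin n) (h : pqPoch (u r / z) p q = 0) : z ∈ innerPoles u p q := by
  obtain ⟨j, k, h⟩ := (pqPoch_eq_zero_iff hp hq).1 h
  refine ⟨r, j, k, ?_⟩
  field_simp at h
  exact h.symm

theorem mem_outerPoles_of {n : ℕ} {u : Fin n → ℂ} (hp : ‖p‖ < 1) (hq : ‖q‖ < 1) {z : ℂ}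
    (r : Fin n) (h : pqPoch (u r * z) p q = 0) : z ∈ outerPoles u p q := by
  obtain ⟨j, k, h⟩ := (pqPoch_eq_zero_iff hp hq).1 h
  exact ⟨r, j, k, eq_inv_of_mul_eq_one_right (by rw [← h]; ring)⟩

theorem exists_ellParams_eq (b : ℂ) (t : Fin 4 → ℂ) (p q : ℂ) (i : Fin 4) :
    ∃ k, ellParams b t p q k = t i := by
  fin_cases i
  exacts [⟨0, rfl⟩, ⟨2, rfl⟩, ⟨4, rfl⟩, ⟨6, rfl⟩]

theorem exists_ellParams_eq_div (b : ℂ) (t : Fin 4 → ℂ) (p q : ℂ) (i : Fin 4) :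
    ∃ k, ellParams b t p q k = p * q / (b * t i) := by
  fin_cases i
  exacts [⟨1, rfl⟩, ⟨3, rfl⟩, ⟨5, rfl⟩, ⟨7, rfl⟩]

theorem exists_ellParams_mul_eq_zero (hp : ‖p‖ < 1) (hq : ‖q‖ < 1) {b : ℂ} {t : Fin 4 → ℂ} {c : ℂ}
    (h : pqPoch (b * c ^ 2) p q = 0) : ∃ k, pqPoch (ellParams b t p q k * c) p q = 0 := by
  rw [← prod_signList hp hq (isRootVec_rootVec b p q), List.prod_eq_zero_iff, List.mem_map] at h
  obtain ⟨x, hx, h0⟩ := h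
  have : x ∈ List.ofFn (ellParams b t p q) := by
    rw [ellParams_eq, ofFn_fullVec]; exact List.mem_append_right _ hx
  obtain ⟨k, hk⟩ := List.mem_ofFn.1 this
  exact ⟨k, by rw [hk]; exact h0⟩

theorem pqPoch_eq_zero_of_mul (hp : ‖p‖ < 1) (hq : ‖q‖ < 1) {x : ℂ} (h : pqPoch (x * p) p q = 0) :
    pqPoch x p q = 0 := by rw [pqPoch_eq_mul hp hq, h, mul_zero]

variable {η : Scales} {x : Params}

theorem mul_mem_innerPoles (hq0 : q ≠ 0) (hq : ‖q‖ < 1) (hη : IsProper η) (hx : x.IsNonzero) {w : ℂ}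
    (hw : w ∈ innerZeros q (x, η)) : η.1 * w ∈ innerPoles (poleVec q η x) (nome η) q := by
  obtain ⟨hw0, i, hi⟩ := hw
  have hp := hη.norm_lt
  have hs := hη.s_ne
  have hc := hη.c_ne
  have hz : η.1 * w ≠ 0 := mul_ne_zero hs hw0
  have key (k : Fin (2 * 5 + 6)) (h : pqPoch (ellParams x.1 (tVec η x) (nome η) q k / (η.1 * w))
      (nome η) q = 0) : η.1 * w ∈ innerPoles (poleVec q η x) (nome η) q :=
    mem_innerPoles_of hp hq hz k.succ h
  obtain ⟨hb, ha, hu⟩ := hx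
  rcases i with i | r | r
  · fin_cases i <;> simp only [innerArg, Sum.elim_inl, Fin.zero_eta, Fin.mk_one, Fin.reduceFinMk,
      Matrix.cons_val] at hi
    · have h : pqPoch (x.1 * (η.1 * w)⁻¹ ^ 2) (nome η) q = 0 := by
        refine pqPoch_eq_zero_of_mul hp hq ?_
        rw [← hi, nome]; congr 1; field_simp
      obtain ⟨k, hk⟩ := exists_ellParams_mul_eq_zero (t := tVec η x) hp hq h
      exact key k hk
    · refine mem_innerPoles_of hp hq hz 0 ?_
      rw [← hi, poleVec, Fin.cons_zero]; congr 1; field_simp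
    · obtain ⟨k, hk⟩ := exists_ellParams_eq_div x.1 (tVec η x) (nome η) q 0
      refine key k ?_
      rw [hk, tVec_zero]
      refine pqPoch_eq_zero_of_mul hp hq ?_
      have := hη.nome_ne
      rw [← hi]; congr 1
      field_simp
      rw [nome, mul_comm]
  · obtain ⟨k, hk⟩ := exists_ellParams_eq x.1 (tVec η x) (nome η) q r.succ
    refine key k ?_
    simp only [innerArg, Sum.elim_inl, Sum.elim_inr] at hi
    rw [hk, tVec_succ, ← hi]; congr 1; field_simp
  · obtain ⟨k, hk⟩ := exists_ellParams_eq_div x.1 (tVec η x) (nome η) q r.succ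
    refine key k ?_
    simp only [innerArg, Sum.elim_inr] at hi
    have := hu r
    have := hη.e_ne r
    rw [hk, tVec_succ, ← hi, nome, ← hη.mul_eq r]; congr 1; field_simp

theorem mul_mem_outerPoles (hq0 : q ≠ 0) (hq : ‖q‖ < 1) (hη : IsProper η) (hx : x.IsNonzero) {w : ℂ}
    (hw : w ∈ outerZeros q (x, η)) : η.1 * w ∈ outerPoles (poleVec q η x) (nome η) q := by
  obtain ⟨hw0, i, hi⟩ := hw
  have hp := hη.norm_lt
  have hs := hη.s_ne
  have hc := hη.c_ne
  have key (k : Fin (2 * 5 + 6)) (h : pqPoch (ellParams x.1 (tVec η x) (nome η) q k * (η.1 * w))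
      (nome η) q = 0) : η.1 * w ∈ outerPoles (poleVec q η x) (nome η) q :=
    mem_outerPoles_of hp hq k.succ h
  obtain ⟨hb, ha, hu⟩ := hx
  rcases i with i | r | r
  · fin_cases i <;> simp only [outerArg, Sum.elim_inl, Fin.zero_eta, Fin.mk_one, Fin.reduceFinMk,
      Matrix.cons_val] at hi
    · obtain ⟨k, hk⟩ := exists_ellParams_eq_div x.1 (tVec η x) (nome η) q 0
      refine key k ?_
      have := hη.nome_ne
      rw [hk, tVec_zero, ← hi]; congr 1; field_simp
    · have h : pqPoch (x.1 * (η.1 * w) ^ 2) (nome η) q = 0 := by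
        rw [← hi]; congr 1; ring
      obtain ⟨k, hk⟩ := exists_ellParams_mul_eq_zero (t := tVec η x) hp hq h
      exact key k hk
    · refine mem_outerPoles_of hp hq 0 ?_
      rw [← hi, poleVec, Fin.cons_zero]; congr 1; ring
  · obtain ⟨k, hk⟩ := exists_ellParams_eq x.1 (tVec η x) (nome η) q r.succ
    refine key k ?_
    simp only [outerArg, Sum.elim_inl, Sum.elim_inr] at hi
    rw [hk, tVec_succ, ← hi]; congr 1; ring
  · obtain ⟨k, hk⟩ := exists_ellParams_eq_div x.1 (tVec η x) (nome η) q r.succ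
    refine key k ?_
    simp only [outerArg, Sum.elim_inr] at hi
    have := hu r
    have := hη.e_ne r
    rw [hk, tVec_succ, ← hi, nome, ← hη.mul_eq r]; congr 1; field_simp

/-- Every pole of the rescaled integrand comes from a pole of the original integrand or of
`thetaSplit`. Some original poles have been cancelled, so only inclusions hold, and these suffice.
-/
theorem IsSeparatingContour.rescale (hq0 : q ≠ 0) (hq : ‖q‖ < 1) (hη : IsProper η)
    (hx : x.IsNonzero) {γ : ℝ → ℂ} (h : IsSeparatingContour γ
      (innerPoles (poleVec q η x) (nome η) q) (outerPoles (poleVec q η x) (nome η) q)) :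
    IsSeparatingContour (fun s => η.1⁻¹ * γ s) (innerZeros q (x, η)) (outerZeros q (x, η)) :=
  (h.scale (inv_ne_zero hη.s_ne)).mono
    (fun _ hw => by simpa using mul_mem_innerPoles hq0 hq hη hx hw)
    (fun _ hw => by simpa using mul_mem_outerPoles hq0 hq hη hx hw)

theorem innerPoles_subset_cons {n : ℕ} (T : ℂ) (u : Fin n → ℂ) (p q : ℂ) :
    innerPoles u p q ⊆ innerPoles (Fin.cons T u : Fin (n + 1) → ℂ) p q := by
  rintro z ⟨r, j, k, h⟩
  exact ⟨r.succ, j, k, h⟩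

theorem outerPoles_subset_cons {n : ℕ} (T : ℂ) (u : Fin n → ℂ) (p q : ℂ) :
    outerPoles u p q ⊆ outerPoles (Fin.cons T u : Fin (n + 1) → ℂ) p q := by
  rintro z ⟨r, j, k, h⟩
  exact ⟨r.succ, j, k, h⟩

theorem inv_innerPoles {n : ℕ} (u : Fin n → ℂ) (p q : ℂ) :
    (innerPoles u p q)⁻¹ = outerPoles u p q := by
  ext z; simp only [innerPoles, outerPoles, Set.mem_inv, Set.mem_ofPred_eq, inv_eq_iff_eq_inv]

theorem inv_outerPoles {n : ℕ} (u : Fin n → ℂ) (p q : ℂ) :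
    (outerPoles u p q)⁻¹ = innerPoles u p q := by rw [← inv_innerPoles, inv_inv]

theorem zero_notMem_innerPoles {n : ℕ} {u : Fin n → ℂ} (hp : p ≠ 0) (hq : q ≠ 0)
    (hu : ∀ i, u i ≠ 0) : (0 : ℂ) ∉ innerPoles u p q := by
  rintro ⟨r, j, k, h⟩
  exact mul_ne_zero (mul_ne_zero (hu r) (pow_ne_zero j hp)) (pow_ne_zero k hq) h.symm

/-- The two integrals of the reflected pieces. -/
theorem contourIntegral_rescale_add {γ : ℝ → ℂ} (hγ : ContDiff ℝ 1 γ) (h0 : ∀ s, γ s ≠ 0) {s : ℂ}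
    (hs : s ≠ 0) {F : ℂ → ℂ}
    (h1 : ContinuousOn (fun x => F (s⁻¹ * γ x)) (Set.Icc 0 1))
    (h2 : ContinuousOn (fun x => F (s⁻¹ * (γ x)⁻¹)) (Set.Icc 0 1)) :
    contourIntegral (fun x => s⁻¹ * γ x) (fun w => F w / (2 * Real.pi * Complex.I * w)) +
      contourIntegral (fun x => s⁻¹ * invCurve γ x) (fun w => F w / (2 * Real.pi * Complex.I * w)) =
    contourIntegral γ (fun z => (F (s⁻¹ * z) + F (s⁻¹ * z⁻¹)) /
      (2 * Real.pi * Complex.I * z)) := by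
  rw [contourIntegral_scale, contourIntegral_scale, contourIntegral_invCurve hγ h0,
    ← contourIntegral_add hγ]
  · refine contourIntegral_congr fun x hx => ?_
    have := h0 x
    field_simp
  · have := hγ.continuous.continuousOn (s := Set.Icc 0 1)
    exact continuousOn_const.mul (h1.div (continuousOn_const.mul (continuousOn_const.mul this))
      fun x _ => two_pi_I_mul_ne_zero (mul_ne_zero (inv_ne_zero hs) (h0 x)))
  · have := hγ.continuous.continuousOn (s := Set.Icc 0 1)
    exact (continuousOn_const.mul (h2.div (continuousOn_const.mul (continuousOn_const.mul
      (this.inv₀ fun x _ => h0 x)))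
      fun x _ => two_pi_I_mul_ne_zero (mul_ne_zero (inv_ne_zero hs) (inv_ne_zero (h0 x))))).div
      (this.pow 2) fun x _ => pow_ne_zero 2 (h0 x)

/-- A pair containing t_1 yields two arguments without positive powers of s, collected in
`crossArg`. All other arguments contain a power of s and die in the limit. -/
theorem tFactor_eq (hη : IsProper η) (hx : x.IsNonzero) : tFactor x.1 (tVec η x) (nome η) q =
    (∏ i, pqPoch (pairArg q (x, η) i) (nome η) q) * ∏ i, pqPoch (crossArg q (x, η) i) (nome η) q := by
  obtain ⟨hb, ha, hu⟩ := hx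
  have hp0 := hη.nome_ne
  have hs := hη.s_ne
  have hpe : nome η = η.2.1 * η.1 ^ 2 := rfl
  have h0 (r : Fin 3) : fourFactor x.1 (nome η) q (tVec η x 0) (tVec η x r.succ) =
      pqPoch (pairArg q (x, η) (Sum.inl (r, 0))) (nome η) q *
        pqPoch (pairArg q (x, η) (Sum.inl (r, 1))) (nome η) q *
      (pqPoch (crossArg q (x, η) (Sum.inl r)) (nome η) q *
        pqPoch (crossArg q (x, η) (Sum.inr r)) (nome η) q) := by
    have he := hη.e_ne r
    have hm := hη.mul_eq r
    have hur := hu r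
    have e1 : nome η * η.1 * x.2.1 * (η.1 * η.2.2.1 r * x.2.2 r) =
        pairArg q (x, η) (Sum.inl (r, 0)) := by
      simp only [pairArg, Sum.elim_inl, Matrix.cons_val]; ring
    have e2 : nome η * q * (nome η * η.1 * x.2.1) / (x.1 * (η.1 * η.2.2.1 r * x.2.2 r)) =
        pairArg q (x, η) (Sum.inl (r, 1)) := by
      simp only [pairArg, Sum.elim_inl, Matrix.cons_val]
      generalize nome η = p at *
      field_simp
      rw [hpe, ← hm]; ring
    have e3 : nome η * q * (η.1 * η.2.2.1 r * x.2.2 r) / (x.1 * (nome η * η.1 * x.2.1)) =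
        crossArg q (x, η) (Sum.inl r) := by
      simp only [crossArg, Sum.elim_inl]; field_simp
    have e4 : nome η ^ 2 * q ^ 2 / (x.1 ^ 2 * (nome η * η.1 * x.2.1) * (η.1 * η.2.2.1 r * x.2.2 r)) =
        crossArg q (x, η) (Sum.inr r) := by
      simp only [crossArg, Sum.elim_inr]; field_simp
      rw [hpe, ← hm]; ring
    rw [fourFactor, tVec_zero, tVec_succ, e1, e2, e3, e4]
    ring
  have h1 (i j : Fin 3) (hij : i < j) :
      fourFactor x.1 (nome η) q (tVec η x i.succ) (tVec η x j.succ) =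
      pqPoch (pairArg q (x, η) (Sum.inr (i, j, 0))) (nome η) q *
        pqPoch (pairArg q (x, η) (Sum.inr (i, j, 2))) (nome η) q *
      (pqPoch (pairArg q (x, η) (Sum.inr (j, i, 0))) (nome η) q *
        pqPoch (pairArg q (x, η) (Sum.inr (j, i, 1))) (nome η) q) := by
    have hei := hη.e_ne i
    have hej := hη.e_ne j
    have hmi := hη.mul_eq i
    have hmj := hη.mul_eq j
    have hui := hu i
    have huj := hu j
    have hji : ¬ j < i := not_lt.2 hij.le
    have hne : j ≠ i := hij.ne'
    have e1 : η.1 * η.2.2.1 i * x.2.2 i * (η.1 * η.2.2.1 j * x.2.2 j) =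
        pairArg q (x, η) (Sum.inr (i, j, 0)) := by
      simp only [pairArg, Sum.elim_inr, if_pos hij, Matrix.cons_val]; ring
    have e2 : nome η * q * (η.1 * η.2.2.1 i * x.2.2 i) / (x.1 * (η.1 * η.2.2.1 j * x.2.2 j)) =
        pairArg q (x, η) (Sum.inr (j, i, 1)) := by
      simp only [pairArg, Sum.elim_inr, if_neg hji, if_neg hne, Matrix.cons_val]
      rw [hpe, ← hmj]; field_simp
    have e3 : nome η * q * (η.1 * η.2.2.1 j * x.2.2 j) / (x.1 * (η.1 * η.2.2.1 i * x.2.2 i)) =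
        pairArg q (x, η) (Sum.inr (j, i, 0)) := by
      simp only [pairArg, Sum.elim_inr, if_neg hji, if_neg hne, Matrix.cons_val]
      rw [hpe, ← hmi]; field_simp
    have e4 : nome η ^ 2 * q ^ 2 /
        (x.1 ^ 2 * (η.1 * η.2.2.1 i * x.2.2 i) * (η.1 * η.2.2.1 j * x.2.2 j)) =
        pairArg q (x, η) (Sum.inr (i, j, 2)) := by
      simp only [pairArg, Sum.elim_inr, if_pos hij, Matrix.cons_val]
      rw [show nome η ^ 2 = nome η * nome η by ring]
      nth_rw 1 [hpe]
      rw [← hmi, hpe, ← hmj]; field_simp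
    rw [fourFactor, tVec_succ, tVec_succ, e1, e2, e3, e4]
    ring
  -- Index triples that correspond to no pair carry the argument 0, whose factor is 1.
  have hz (i j k) (h : pairArg q (x, η) (Sum.inr (i, j, k)) = 0) :
      pqPoch (pairArg q (x, η) (Sum.inr (i, j, k))) (nome η) q = 1 := by
    rw [h, pqPoch_zero]
  have z1 (i : Fin 3) (k) := hz i i k (by simp [pairArg])
  have z2 (i j : Fin 3) (h : i < j) := hz i j 1 (by simp [pairArg, h])
  have z3 (i j : Fin 3) (h : j < i) := hz i j 2 (by simp [pairArg, h.ne', not_lt.2 h.le])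
  rw [tFactor, show (1 : Fin 4) = Fin.succ 0 from rfl, show (2 : Fin 4) = Fin.succ 1 from rfl,
    show (3 : Fin 4) = Fin.succ 2 from rfl, h0, h0, h0, h1 0 1 (by decide), h1 0 2 (by decide),
    h1 1 2 (by decide)]
  simp only [Fintype.prod_sum_type, Fintype.prod_prod_type, Fin.prod_univ_three, Fin.prod_univ_two,
    z1, z2 0 1 (by decide), z2 0 2 (by decide), z2 1 2 (by decide), z3 1 0 (by decide),
    z3 2 0 (by decide), z3 2 1 (by decide)]
  ring

end
end EllipticBeta
end

noncomputable section
namespace EllipticBeta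

/-! ### The regularised integral and the elliptic hypergeometric integral -/

section
variable {q p b : ℂ} {t : Fin 4 → ℂ} {r R : ℝ} {K : ℕ} {η : Scales} {x : Params}

/-- The factor relating the integral to its regularisation. -/
def poleFactor (q : ℂ) (K : ℕ) (y : Params × Scales) : ℂ :=
  qPoch (-(q / y.1.1)) q * qPoch (q / y.1.1 ^ 2) (q ^ 2) * singFactor q K y

theorem theta_sq (hq : ‖q‖ < 1) (hb : b ≠ 0) : theta (b ^ 2) q =
    theta b q * (qPoch (-b) q * qPoch (b ^ 2 * q) (q ^ 2)) *
      (qPoch (-(q / b)) q * qPoch (q / b ^ 2) (q ^ 2)) := by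
  rw [theta, theta, qPoch_even_odd hq (b ^ 2), qPoch_even_odd hq (q / b ^ 2), ← qPoch_mul_neg hq b,
    show q / b ^ 2 * q = (q / b) ^ 2 by field_simp, ← qPoch_mul_neg hq (q / b)]
  ring

/-- The constant of `thetaSplit_add` splits into a part in b, which also occurs in `ellPre`, and a
part in q/b, which becomes part of `poleFactor`. -/
theorem theta_one_div_sq_div (hq0 : q ≠ 0) (hq : ‖q‖ < 1) (hb : b ≠ 0) (hθ : theta b q ≠ 0) :
    b * (theta (1 / b ^ 2) q / theta (1 / b) q) = qPoch (-b) q * qPoch (b ^ 2 * q) (q ^ 2) *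
      (qPoch (-(q / b)) q * qPoch (q / b ^ 2) (q ^ 2)) := by
  rw [theta_one_div hq0 hq hb, theta_one_div hq0 hq (pow_ne_zero 2 hb), theta_sq hq hb]
  field_simp

theorem ellDen_inv (z : ℂ) : ellDen q p b t z⁻¹ = ellDen q p b t z := by
  simp only [ellDen, div_inv_eq_mul, ← div_eq_mul_inv, inv_pow]
  congr 1
  · refine Finset.prod_congr rfl fun i _ => ?_
    rw [show p * q / z / (b * t i) = p * q / (b * t i * z) by rw [div_div, mul_comm z],
      show p * q / (b * t i / z) = p * q * z / (b * t i) by rw [div_div_eq_mul_div]]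
    ring
  · ring

/-- The factor θ(z²;p) θ(z⁻²;q) is invariant because the two inversion multipliers, for base p and
for base q, are the same; everything else is visibly symmetric. -/
theorem ellNum_inv (hp0 : p ≠ 0) (hq0 : q ≠ 0) (hp : ‖p‖ < 1) (hq : ‖q‖ < 1) {z : ℂ} (hz : z ≠ 0) :
    ellNum q p b t z⁻¹ = ellNum q p b t z := by
  have hz2 : z ^ 2 ≠ 0 := pow_ne_zero 2 hz
  have e (y : ℂ) (hy : y ≠ 0) : qPoch y p * qPoch (p / y) p * (qPoch (q * y) q * qPoch (1 / y) q) =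
      theta y p * theta y⁻¹ q := by
    rw [theta, theta, div_inv_eq_mul, one_div, mul_comm (qPoch y⁻¹ q)]
  have e' : theta (z ^ 2)⁻¹ p * theta (z ^ 2) q = theta (z ^ 2) p * theta (z ^ 2)⁻¹ q := by
    rw [theta_inv hp0 hp hz2, theta_inv hq0 hq hz2]; ring
  simp only [ellNum]
  rw [e _ hz2, e _ (pow_ne_zero 2 (inv_ne_zero hz)), inv_pow, inv_inv, e']
  simp only [div_inv_eq_mul, ← div_eq_mul_inv]
  congr 2
  · refine Finset.prod_congr rfl fun i _ => ?_
    rw [show p * q / z / t i = p * q / (t i * z) by rw [div_div, mul_comm z],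
      show p * q / (t i / z) = p * q * z / t i by rw [div_div_eq_mul_div]]
    ring
  · rw [show p * q / z ^ 2 / b = p * q / (b * z ^ 2) by rw [div_div, mul_comm b],
      show p * q / (b / z ^ 2) = p * q * z ^ 2 / b by rw [div_div_eq_mul_div]]
    ring

theorem continuousOn_scaledIntegrand (hq : ‖q‖ < 1) {y : Params × Scales} (h : (y, 1) ∈ regular) :
    ContinuousOn (scaledIntegrand q y) {w | w ≠ 0 ∧ w ∉ innerZeros q y ∧ w ∉ outerZeros q y} := by
  have hp : ‖nome y.2‖ < 1 := h.2.2.2.2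
  have hm : Set.MapsTo (fun w : ℂ => (y, w))
      {w | w ≠ 0 ∧ w ∉ innerZeros q y ∧ w ∉ outerZeros q y} regular :=
    fun w (hw : _ ∧ _) => mem_regular_of h hw.1
  have hc : ContinuousOn (fun w : ℂ => (y, w))
    {w | w ≠ 0 ∧ w ∉ innerZeros q y ∧ w ∉ outerZeros q y} := by fun_prop
  have h1 := ((continuousOn_numer hq).comp hc hm).mul (((continuousOn_extraArg (q := q)).comp hc
    hm).pqPoch continuousOn_const (fun _ _ => hp) hq)
  have h2 (i) := ((continuousOn_innerArg (q := q) i).comp hc hm).pqPoch continuousOn_const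
    (fun _ _ => hp) hq
  have h3 (i) := ((continuousOn_outerArg (q := q) i).comp hc hm).pqPoch continuousOn_const
    (fun _ _ => hp) hq
  refine h1.div ((continuousOn_finsetProd _ fun i _ => h2 i).mul
    (continuousOn_finsetProd _ fun i _ => h3 i)) ?_
  rintro w ⟨hw, hi, ho⟩
  refine mul_ne_zero (Finset.prod_ne_zero_iff.2 fun i _ h0 => hi ⟨hw, i, h0⟩)
    (Finset.prod_ne_zero_iff.2 fun i _ h0 => ho ⟨hw, i, h0⟩)

theorem IsSeparatingContour.continuousOn_scaledIntegrand (hq : ‖q‖ < 1) {y : Params × Scales}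
    (h : (y, 1) ∈ regular) {γ : ℝ → ℂ}
    (hγ : IsSeparatingContour γ (innerZeros q y) (outerZeros q y)) :
    ContinuousOn (fun s => scaledIntegrand q y (γ s)) (Set.Icc 0 1) :=
  (EllipticBeta.continuousOn_scaledIntegrand hq h).comp hγ.contDiff.continuous.continuousOn
    fun s hs => show _ ∧ _ ∧ _ from ⟨hγ.ne_zero s hs, fun h => hγ.avoids s hs (Or.inl h),
      fun h => hγ.avoids s hs (Or.inr h)⟩

theorem add_scaledIntegrand (hq0 : q ≠ 0) (hq : ‖q‖ < 1) (hη : IsProper η) (hx : x.IsNonzero)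
    (hθ : theta x.1 q ≠ 0) {z : ℂ} (hz : z ≠ 0) (h : ThetaRegular q x.1 (x.2.1 * η.1) z) :
    scaledIntegrand q (x, η) (η.1⁻¹ * z) + scaledIntegrand q (x, η) (η.1⁻¹ * z⁻¹) =
      qPoch (-x.1) q * qPoch (x.1 ^ 2 * q) (q ^ 2) *
      (qPoch (-(q / x.1)) q * qPoch (q / x.1 ^ 2) (q ^ 2)) *
      (ellNum q (nome η) x.1 (tVec η x) z / ellDen q (nome η) x.1 (tVec η x) z) := by
  have hs := hη.s_ne
  have hT : x.2.1 * η.1 ≠ 0 := mul_ne_zero hx.2.1 hs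
  have key {z : ℂ} (hz : z ≠ 0) (h : ThetaRegular q x.1 (x.2.1 * η.1) z) :
      ellNum q (nome η) x.1 (tVec η x) z / ellDen q (nome η) x.1 (tVec η x) z *
        thetaSplit q x.1 (x.2.1 * η.1) z = x.1⁻¹ * scaledIntegrand q (x, η) (η.1⁻¹ * z) := by
    have := ell_mul_thetaSplit hq0 hq hs hη.c_ne hη.mul_eq hη.norm_lt hx.1 hx.2.1 hx.2.2
      (mul_ne_zero (inv_ne_zero hs) hz) (by rwa [mul_inv_cancel_left₀ hs])
    rwa [mul_inv_cancel_left₀ hs] at this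
  have h1 := key hz h
  have h2 := key (inv_ne_zero hz) h.inv
  rw [ellNum_inv hη.nome_ne hq0 hη.norm_lt hq hz, ellDen_inv] at h2
  have h3 := thetaSplit_add hq0 hq hx.1 hT hz (by
      rw [theta_one_div hq0 hq hx.1]
      exact mul_ne_zero (neg_ne_zero.2 (inv_ne_zero hx.1)) hθ)
    (by
      have : x.1 * z ^ 2 ≠ 0 := mul_ne_zero hx.1 (pow_ne_zero 2 hz)
      rw [theta_one_div hq0 hq this]
      exact mul_ne_zero (neg_ne_zero.2 (inv_ne_zero this)) h.sq_mul) h.inv_sq h.div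
    (by
      have : x.2.1 * η.1 * z ≠ 0 := mul_ne_zero hT hz
      rw [theta_one_div hq0 hq this]
      exact mul_ne_zero (neg_ne_zero.2 (inv_ne_zero this)) h.mul)
  rw [one_div z] at h3
  have h4 := theta_one_div_sq_div hq0 hq hx.1 hθ
  rw [← h4, ← h3]
  have hb := hx.1
  have : x.1 * x.1⁻¹ = 1 := mul_inv_cancel₀ hb
  linear_combination (-x.1) * h1 - x.1 * h2 + (-scaledIntegrand q (x, η) (η.1⁻¹ * z) -
    scaledIntegrand q (x, η) (η.1⁻¹ * z⁻¹)) * this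

theorem IsSeparatingContour.ellParams_of_poleVec {γ : ℝ → ℂ}
    (hγ : IsSeparatingContour γ (innerPoles (poleVec q η x) (nome η) q)
      (outerPoles (poleVec q η x) (nome η) q)) :
    IsSeparatingContour γ (innerPoles (ellParams x.1 (tVec η x) (nome η) q) (nome η) q)
      (outerPoles (ellParams x.1 (tVec η x) (nome η) q) (nome η) q) :=
  hγ.mono (innerPoles_subset_cons _ _ _ _) (outerPoles_subset_cons _ _ _ _)

/-- Both the contour and its inversion separate the poles, so each of them computes `regE`. Adding
the two computations recombines φ(z) + φ(1/z) into a constant under one integral, and the resulting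
factor 2 cancels the 1/2 of the beta integral. -/
theorem poleFactor_mul_eq (hq0 : q ≠ 0) (hq : ‖q‖ < 1) (hr : 0 < r) (hrR : r ≤ R)
    (hη : IsProper η) (h : IsAdmissible q r R K (x, η)) (hθ : theta x.1 q ≠ 0)
    (hg : (x.1, tVec η x) ∈ ellGeneric (nome η) q) {γ : ℝ → ℂ}
    (hγ : IsSeparatingContour γ (innerPoles (poleVec q η x) (nome η) q)
      (outerPoles (poleVec q η x) (nome η) q)) (h0 : ∀ s, γ s ≠ 0) :
    poleFactor q K (x, η) * (ellBeta 5 (ellParams x.1 (tVec η x) (nome η) q) (nome η) q /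
      ellDenom x.1 (tVec η x) (nome η) q) = regE q r R K (x, η) := by
  have hs := hη.s_ne
  have hx : x.IsNonzero := ⟨h.regular.1, h.regular.2.1, h.regular.2.2.1⟩
  have hγe := hγ.ellParams_of_poleVec
  have hγi : IsSeparatingContour (invCurve γ) (innerPoles (poleVec q η x) (nome η) q)
      (outerPoles (poleVec q η x) (nome η) q) := by
    have hu : ∀ i, poleVec q η x i ≠ 0 := Fin.cases (mul_ne_zero hx.2.1 hs)
      (ellParams_ne_zero hx.1 (tVec_ne_zero hη hx) hη.nome_ne hq0)
    have h0i := zero_notMem_innerPoles hη.nome_ne hq0 hu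
    have := hγ.inv h0 h0i (by rw [← inv_innerPoles, Set.mem_inv, inv_zero]; exact h0i)
    rwa [inv_innerPoles, inv_outerPoles] at this
  have c1 := hγ.rescale hq0 hq hη hx
  have c2 := hγi.rescale hq0 hq hη hx
  have e1 := regE_eq hq hr hrR h c1
  have e2 := regE_eq hq hr hrR h c2
  have hF2 : ContinuousOn (fun s => scaledIntegrand q (x, η) (η.1⁻¹ * (γ s)⁻¹)) (Set.Icc 0 1) := by
    have := (c2.continuousOn_scaledIntegrand hq h.regular).comp (s := Set.Icc 0 1)
      (f := fun s : ℝ => 1 - s) (by fun_prop) fun s hs => ⟨by linarith [hs.2], by linarith [hs.1]⟩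
    refine this.congr fun s _ => ?_
    simp [invCurve]
  have e3 := contourIntegral_rescale_add hγ.contDiff h0 hs
    (c1.continuousOn_scaledIntegrand hq h.regular) hF2
  rw [ellE_eq_of_generic hη.nome_ne hq0 hη.norm_lt hq hg hγe]
  have e4 : contourIntegral γ (fun z => (scaledIntegrand q (x, η) (η.1⁻¹ * z) +
      scaledIntegrand q (x, η) (η.1⁻¹ * z⁻¹)) / (2 * Real.pi * Complex.I * z)) =
      contourIntegral γ (fun z => (qPoch (-x.1) q * qPoch (x.1 ^ 2 * q) (q ^ 2) *
      (qPoch (-(q / x.1)) q * qPoch (q / x.1 ^ 2) (q ^ 2))) * (ellNum q (nome η) x.1 (tVec η x) z /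
        (ellDen q (nome η) x.1 (tVec η x) z * (2 * Real.pi * Complex.I * z)))) := by
    refine contourIntegral_congr_countable (countable_not_thetaRegular hq0 hq hx.1
      (mul_ne_zero hx.2.1 hs)) fun s _ hZ => ?_
    have hreg : ThetaRegular q x.1 (x.2.1 * η.1) (γ s) := by
      by_contra hc; exact hZ ⟨h0 s, hc⟩
    rw [add_scaledIntegrand hq0 hq hη hx hθ (h0 s) hreg, mul_div_assoc, div_div]
  rw [contourIntegral_const_mul] at e4
  rw [e4] at e3
  have e5 : ellPre q (nome η) x.1 (tVec η x) =
      qPoch (-x.1) q * qPoch (x.1 ^ 2 * q) (q ^ 2) * prefactor q (x, η) / 2 := by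
    rw [ellPre, tFactor_eq hη hx, prefactor, corePrefactor]; ring
  rw [e5, poleFactor]
  dsimp only
  linear_combination (-(singFactor q K (x, η) * prefactor q (x, η)) / 2) * e3 - e1 / 2 - e2 / 2

end
end EllipticBeta
end

noncomputable section
namespace EllipticBeta

/-! ### Generic parameters -/

/-- The condition fixes m ε modulo 2π. -/
theorem countable_mul_exp_pos {κ : ℂ} (hκ : κ ≠ 0) {m : ℤ} (hm : m ≠ 0) :
    {ε : ℝ | ∃ x : ℝ, 0 < x ∧ κ * Complex.exp (m * ε * Complex.I) = x}.Countable := by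
  refine (Set.countable_range fun n : ℤ =>
    ((Complex.log (‖κ‖ / κ)).im + n * (2 * Real.pi)) / m).mono ?_
  rintro ε ⟨x, hx, h⟩
  have hn : ‖κ‖ = x := by
    have := congrArg norm h
    rwa [norm_mul, show (m * ε * Complex.I : ℂ) = ((m * ε : ℝ) : ℂ) * Complex.I by push_cast; ring,
      Complex.norm_exp_ofReal_mul_I, mul_one, Complex.norm_real, Real.norm_of_nonneg hx.le] at this
  have h1 : Complex.exp (m * ε * Complex.I) = ‖κ‖ / κ := by
    rw [hn, eq_div_iff hκ, ← h, mul_comm]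
  have h0 : (‖κ‖ / κ : ℂ) ≠ 0 := div_ne_zero (by exact_mod_cast (norm_ne_zero_iff.2 hκ)) hκ
  rw [← Complex.exp_log h0, Complex.exp_eq_exp_iff_exists_int] at h1
  obtain ⟨n, hn⟩ := h1
  refine ⟨n, ?_⟩
  have := congrArg Complex.im hn
  have hm' : (m : ℝ) ≠ 0 := by exact_mod_cast hm
  simp at this
  rw [div_eq_iff hm', ← this, mul_comm]

/-- A pair whose speeds do not cancel meets the ray [1, ∞) for countably many ε only. A pair with
opposite speeds is not moved by the rotation, so for it the ray must be avoided from the start. -/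
theorem countable_exceptional {p q : ℂ} (hp : p ≠ 0) (hq : q ≠ 0) {ι : Type*} [Countable ι]
    (κ : ι → ℂ) (m : ι → ℤ) (hκ : ∀ i, κ i ≠ 0)
    (h : ∀ i j, m i + m j = 0 → ∀ (k l : ℕ) (x : ℝ), 1 ≤ x → κ i * κ j * p ^ k * q ^ l ≠ x) :
    {ε : ℝ | ∃ (i j : ι) (k l : ℕ) (x : ℝ), 1 ≤ x ∧
      κ i * κ j * p ^ k * q ^ l * Complex.exp ((m i + m j : ℤ) * ε * Complex.I) = x}.Countable := by
  simp only [Set.ofPred_exists]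
  refine Set.countable_iUnion fun i => Set.countable_iUnion fun j => Set.countable_iUnion fun k =>
    Set.countable_iUnion fun l => ?_
  by_cases hm : m i + m j = 0
  · convert Set.countable_empty (α := ℝ)
    ext ε
    simp only [hm, Set.mem_iUnion, Set.mem_ofPred_eq, Set.mem_empty_iff_false, iff_false]
    rintro ⟨x, hx, h'⟩
    exact h i j hm k l x hx (by simpa using h')
  · refine (countable_mul_exp_pos (mul_ne_zero (mul_ne_zero (mul_ne_zero (hκ i) (hκ j))
      (pow_ne_zero k hp)) (pow_ne_zero l hq)) hm).mono ?_
    intro ε hε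
    obtain ⟨x, hx, h'⟩ := Set.mem_iUnion.1 hε
    exact ⟨x, one_pos.trans_le hx, h'⟩

theorem frequently_of_countable {X : Type*} [TopologicalSpace X] {f : ℝ → X} (hf : Continuous f)
    {B : Set ℝ} (hB : B.Countable) {P : X → Prop} (h : ∀ ε ∉ B, P (f ε)) :
    ∃ᶠ x in 𝓝 (f 0), P x := by
  have h0 : ∃ᶠ ε in 𝓝 (0 : ℝ), ε ∈ Bᶜ := mem_closure_iff_frequently.1 (hB.dense_compl ℝ 0)
  exact (hf.tendsto 0).frequently (h0.mono h)

section
variable {p q b : ℂ} {t : Fin 4 → ℂ}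

theorem mem_ofFn_ellParams {x : ℂ} (hx : x ∈ List.ofFn (ellParams b t p q)) :
    (∃ r, x = t r) ∨ (∃ r, x = p * q / (b * t r)) ∨ ∃ k l : ℕ, x ^ 2 = b * p ^ k * q ^ l := by
  rw [ellParams_eq, ofFn_fullVec, List.mem_append, mem_signList] at hx
  rcases hx with hx | ⟨i, hx⟩
  · simp only [mainList, List.mem_cons, List.not_mem_nil, or_false] at hx
    rcases hx with h | h | h | h | h | h | h | h
    exacts [.inl ⟨_, h⟩, .inr (.inl ⟨_, h⟩), .inl ⟨_, h⟩, .inr (.inl ⟨_, h⟩), .inl ⟨_, h⟩,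
      .inr (.inl ⟨_, h⟩), .inl ⟨_, h⟩, .inr (.inl ⟨_, h⟩)]
  · right; right
    obtain ⟨h0, h1, h2, h3⟩ := isRootVec_rootVec b p q
    rw [hx]
    fin_cases i
    exacts [⟨0, 0, by simpa using h0⟩, ⟨0, 1, by simpa using h1⟩, ⟨1, 0, by simpa using h2⟩,
      ⟨1, 1, by simpa using h3⟩]

/-- No product of two parameters and powers of `p` and `q` lies on the ray `[1, ∞)`. -/
def AvoidsRay {n : ℕ} (u : Fin n → ℂ) (p q : ℂ) : Prop :=
  ∀ r s : Fin n, ∀ j k : ℕ, ∀ x : ℝ, 1 ≤ x → u r * u s * p ^ j * q ^ k ≠ x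

theorem AvoidsRay.mul_ne_zero {n : ℕ} {u : Fin n → ℂ} (h : AvoidsRay u p q) (hp : ‖p‖ < 1)
    (hq : ‖q‖ < 1) (r s : Fin n) : pqPoch (u r * u s) p q ≠ 0 := by
  rw [Ne, pqPoch_eq_zero_iff hp hq]
  rintro ⟨j, k, h0⟩
  exact h r s j k 1 le_rfl (by simpa using h0)

/-- A zero of `ellDenom` means that some main parameter times some square root equals p^{-j} q^{-k}.
-/
theorem AvoidsRay.ellDenom_ne_zero (h : AvoidsRay (ellParams b t p q) p q) (hp : ‖p‖ < 1)
    (hq : ‖q‖ < 1) (hb : b ≠ 0) (ht : ∀ i, t i ≠ 0) : ellDenom b t p q ≠ 0 := by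
  refine Finset.prod_ne_zero_iff.2 fun i _ => _root_.mul_ne_zero (fun h0 => ?_) fun h0 => ?_
  · obtain ⟨k, hk⟩ := exists_ellParams_mul_eq_zero (t := t) hp hq h0
    obtain ⟨l, hl⟩ := exists_ellParams_eq b t p q i
    rw [← hl] at hk
    exact h.mul_ne_zero hp hq k l hk
  · have hti := ht i
    rw [show p ^ 2 * q ^ 2 / (b * t i ^ 2) = b * (p * q / (b * t i)) ^ 2 by field_simp] at h0
    obtain ⟨k, hk⟩ := exists_ellParams_mul_eq_zero (t := t) hp hq h0
    obtain ⟨l, hl⟩ := exists_ellParams_eq_div b t p q i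
    rw [← hl] at hk
    exact h.mul_ne_zero hp hq k l hk

theorem AvoidsRay.mem_ellGeneric (h : AvoidsRay (ellParams b t p q) p q) (hp0 : p ≠ 0) (hq0 : q ≠ 0)
    (hp : ‖p‖ < 1) (hq : ‖q‖ < 1) (hb : b ≠ 0) (ht : ∀ i, t i ≠ 0) :
    (b, t) ∈ ellGeneric p q := by
  obtain ⟨γ, hγ, -⟩ := exists_contour_of_star hp0 hq0 hp hq (ellParams_ne_zero hb ht hp0 hq0) h
  exact ⟨hb, ht, ⟨γ, hγ⟩, h.ellDenom_ne_zero hp hq hb ht⟩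

abbrev KappaIndex := Fin 4 ⊕ Fin 4 ⊕ (ℕ × ℕ)

/-- The squares of the parameters. -/
def kappa (p q b : ℂ) (t : Fin 4 → ℂ) : KappaIndex → ℂ :=
  Sum.elim (fun r => t r ^ 2)
    (Sum.elim (fun r => (p * q / (b * t r)) ^ 2) fun k => b * p ^ k.1 * q ^ k.2)

/-- The speeds at which the squares of the parameters rotate. -/
def kappaExp (β : ℤ) : KappaIndex → ℤ :=
  Sum.elim (fun r => 4 * r + 4) (Sum.elim (fun r => -2 * β - 4 * r - 4) fun _ => β)

/-- The vector `t` with each entry rotated at its own speed. -/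
def rotVec (t : Fin 4 → ℂ) (ε : ℝ) (r : Fin 4) : ℂ :=
  t r * Complex.exp ((2 * r + 2 : ℤ) * ε * Complex.I)

theorem kappa_ne_zero (hp : p ≠ 0) (hq : q ≠ 0) (hb : b ≠ 0) (ht : ∀ i, t i ≠ 0) (i) :
    kappa p q b t i ≠ 0 := by
  rcases i with i | i | i
  · exact pow_ne_zero 2 (ht i)
  · exact pow_ne_zero 2 (div_ne_zero (mul_ne_zero hp hq) (mul_ne_zero hb (ht i)))
  · exact mul_ne_zero (mul_ne_zero hb (pow_ne_zero _ hp)) (pow_ne_zero _ hq)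

theorem exists_sq_eq_kappa (hb : b ≠ 0) (ht : ∀ i, t i ≠ 0) (β : ℤ) (ε : ℝ) (i : Fin (2 * 5 + 6)) :
    ∃ k, ellParams (b * Complex.exp (β * ε * Complex.I)) (rotVec t ε) p q i ^ 2 =
      kappa p q b t k * Complex.exp (kappaExp β k * ε * Complex.I) := by
  rcases mem_ofFn_ellParams (List.mem_ofFn.2 ⟨i, rfl⟩ :
    ellParams (b * Complex.exp (β * ε * Complex.I)) (rotVec t ε) p q i ∈ List.ofFn _)
    with ⟨r, h⟩ | ⟨r, h⟩ | ⟨k, l, h⟩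
  · refine ⟨Sum.inl r, ?_⟩
    rw [h, rotVec, mul_pow, ← Complex.exp_nat_mul]
    simp only [kappa, kappaExp, Sum.elim_inl]
    push_cast; ring_nf
  · refine ⟨Sum.inr (Sum.inl r), ?_⟩
    have := ht r
    simp only [kappa, kappaExp, Sum.elim_inl, Sum.elim_inr]
    rw [h, rotVec, show b * Complex.exp (β * ε * Complex.I) *
      (t r * Complex.exp ((2 * r + 2 : ℤ) * ε * Complex.I)) = b * t r *
      (Complex.exp (β * ε * Complex.I) * Complex.exp ((2 * r + 2 : ℤ) * ε * Complex.I)) by ring,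
      ← Complex.exp_add, ← div_div, div_pow, ← Complex.exp_nat_mul, div_eq_mul_inv,
      ← Complex.exp_neg]
    push_cast; ring_nf
  · refine ⟨Sum.inr (Sum.inr (k, l)), ?_⟩
    simp only [kappa, kappaExp, Sum.elim_inr]
    rw [h]; ring

/-- The squares of the parameters, including the pole of `thetaSplit`. -/
def kappaOpt (p q b : ℂ) (t : Fin 4 → ℂ) (T : ℂ) : Option KappaIndex → ℂ
  | none => T ^ 2
  | some k => kappa p q b t k

def kappaOptExp (β : ℤ) : Option KappaIndex → ℤ
  | none => 4
  | some k => kappaExp β k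

/-- Passing to squares removes the choice of square roots: if a product lies on [1, ∞), so does its
square. -/
theorem avoidsRay_of_sq {n : ℕ} {u : Fin n → ℂ} {ι : Type*} {κ : ι → ℂ} {m : ι → ℤ} {ε : ℝ}
    (hu : ∀ i, ∃ k, u i ^ 2 = κ k * Complex.exp (m k * ε * Complex.I))
    (hε : ε ∉ {ε : ℝ | ∃ (i j : ι) (k l : ℕ) (x : ℝ), 1 ≤ x ∧
      κ i * κ j * p ^ k * q ^ l * Complex.exp ((m i + m j : ℤ) * ε * Complex.I) = x}) :
    AvoidsRay u p q := by
  intro i j k l x hx h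
  obtain ⟨i', hi⟩ := hu i
  obtain ⟨j', hj⟩ := hu j
  refine hε ⟨i', j', 2 * k, 2 * l, x ^ 2, one_le_pow₀ hx, ?_⟩
  have h2 : (u i * u j * p ^ k * q ^ l) ^ 2 = (x : ℂ) ^ 2 := by rw [h]
  push_cast
  rw [← h2, mul_pow, mul_pow, mul_pow, hi, hj, add_mul, add_mul, Complex.exp_add]
  ring

/-- Here b stays fixed, so the speeds of t_r and pq/(b t_r) cancel, as do those of any two square
roots. Such products have modulus below 1 thanks to |pq| < |b| and |b| < 1. -/
theorem countable_not_avoidsRay (hp0 : p ≠ 0) (hq0 : q ≠ 0) (hp : ‖p‖ < 1) (hq : ‖q‖ < 1)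
    (hb : b ≠ 0) (ht : ∀ i, t i ≠ 0) (hb1 : ‖b‖ < 1) (hb2 : ‖p * q‖ < ‖b‖) :
    {ε : ℝ | ¬ AvoidsRay (ellParams b (rotVec t ε) p q) p q}.Countable := by
  have hpow (k l : ℕ) : ‖p ^ k * q ^ l‖ ≤ 1 := by
    rw [norm_mul, norm_pow, norm_pow]
    exact mul_le_one₀ (pow_le_one₀ (norm_nonneg _) hp.le) (by positivity)
      (pow_le_one₀ (norm_nonneg _) hq.le)
  have hlt {y : ℂ} (hy : ‖y‖ < 1) (k l : ℕ) (x : ℝ) (hx : 1 ≤ x) : y * p ^ k * q ^ l ≠ x := by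
    intro h
    have h1 : ‖y * p ^ k * q ^ l‖ < 1 := by
      rw [mul_assoc, norm_mul]
      exact (mul_le_of_le_one_right (norm_nonneg y) (hpow k l)).trans_lt hy
    rw [h, Complex.norm_real, Real.norm_of_nonneg (zero_le_one.trans hx)] at h1
    linarith
  have hc : ‖p * q / b‖ < 1 := by
    rw [norm_div, div_lt_one (norm_pos_iff.2 hb)]; exact hb2
  refine (countable_exceptional hp0 hq0 (kappa p q b t) (kappaExp 0)
    (kappa_ne_zero hp0 hq0 hb ht) ?_).mono fun ε hε => ?_
  · have hAB (r : Fin 4) : ‖t r ^ 2 * (p * q / (b * t r)) ^ 2‖ < 1 := by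
      have := ht r
      rw [show t r ^ 2 * (p * q / (b * t r)) ^ 2 = (p * q / b) ^ 2 by field_simp, norm_pow]
      exact pow_lt_one₀ (norm_nonneg _) hc two_ne_zero
    have hCC (k l : ℕ × ℕ) : ‖b * p ^ k.1 * q ^ k.2 * (b * p ^ l.1 * q ^ l.2)‖ < 1 := by
      have h (k : ℕ × ℕ) : ‖b * p ^ k.1 * q ^ k.2‖ < 1 := by
        rw [mul_assoc, norm_mul]
        exact (mul_le_of_le_one_right (norm_nonneg b) (hpow _ _)).trans_lt hb1
      rw [norm_mul]
      exact mul_lt_one_of_nonneg_of_lt_one_left (norm_nonneg _) (h k) (h l).le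
    rintro (i | i | i) (j | j | j) hm k l x hx <;>
      simp only [kappaExp, Sum.elim_inl, Sum.elim_inr] at hm <;>
      simp only [kappa, Sum.elim_inl, Sum.elim_inr] <;> try (exfalso; omega)
    · obtain rfl : i = j := by ext; omega
      exact hlt (hAB i) k l x hx
    · obtain rfl : i = j := by ext; omega
      exact hlt (by rw [mul_comm]; exact hAB i) k l x hx
    · exact hlt (hCC i j) k l x hx
  · by_contra hn
    refine hε (avoidsRay_of_sq (fun i => ?_) hn)
    have := exists_sq_eq_kappa (p := p) (q := q) hb ht 0 ε i
    simpa using this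

/-- With b rotating at speed 1 no two speeds add up to zero, as one sees modulo 4; hence no bounds
on moduli are needed. -/
theorem countable_not_avoidsRay_cons (hp0 : p ≠ 0) (hq0 : q ≠ 0) (hb : b ≠ 0) (ht : ∀ i, t i ≠ 0)
    {T : ℂ} (hT : T ≠ 0) : {ε : ℝ | ¬ AvoidsRay (Fin.cons
      (T * Complex.exp ((2 : ℤ) * ε * Complex.I))
      (ellParams (b * Complex.exp ((1 : ℤ) * ε * Complex.I)) (rotVec t ε) p q) :
        Fin (2 * 5 + 6 + 1) → ℂ) p q}.Countable := by
  refine (countable_exceptional hp0 hq0 (kappaOpt p q b t T) (kappaOptExp 1) ?_ ?_).mono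
    fun ε hε => ?_
  · rintro (_ | i)
    exacts [pow_ne_zero 2 hT, kappa_ne_zero hp0 hq0 hb ht i]
  · intro i j hm
    exfalso
    revert hm
    rcases i with _ | i | i | i <;> rcases j with _ | j | j | j <;>
      simp only [kappaOptExp, kappaExp, Sum.elim_inl, Sum.elim_inr] <;> omega
  · by_contra hn
    refine hε (avoidsRay_of_sq (Fin.cases ?_ fun i => ?_) hn)
    · refine ⟨none, ?_⟩
      rw [Fin.cons_zero, mul_pow, ← Complex.exp_nat_mul]
      simp only [kappaOpt, kappaOptExp]
      push_cast; ring_nf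
    · obtain ⟨k, hk⟩ := exists_sq_eq_kappa (p := p) (q := q) hb ht 1 ε i
      exact ⟨some k, by rw [Fin.cons_succ]; exact hk⟩

theorem countable_mul_exp_eq_zpow (hq0 : q ≠ 0) {κ : ℂ} (hκ : κ ≠ 0) {m : ℤ} (hm : m ≠ 0) :
    {ε : ℝ | ∃ n : ℤ, κ * Complex.exp (m * ε * Complex.I) = q ^ n}.Countable := by
  simp only [Set.ofPred_exists]
  refine Set.countable_iUnion fun n => (countable_mul_exp_pos (mul_ne_zero hκ
    (inv_ne_zero (zpow_ne_zero n hq0))) hm).mono fun ε (hε : _ = _) =>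
      show ∃ x : ℝ, _ from ⟨1, one_pos, ?_⟩
  rw [mul_right_comm, hε, mul_inv_cancel₀ (zpow_ne_zero n hq0), Complex.ofReal_one]

end

/-! ### Density of generic parameters in the scaled variables -/

section
variable {q : ℂ} {η : Scales} {x : Params}

/-- The parameters rotated with different speeds. -/
def rotParams (β : ℤ) (x : Params) (ε : ℝ) : Params :=
  (x.1 * Complex.exp (β * ε * Complex.I), x.2.1 * Complex.exp ((2 : ℤ) * ε * Complex.I),
    fun r => x.2.2 r * Complex.exp ((2 * r + 4 : ℤ) * ε * Complex.I))

theorem continuous_rotParams (β : ℤ) (x : Params) : Continuous (rotParams β x) := by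
  unfold rotParams; fun_prop

theorem rotParams_zero (β : ℤ) (x : Params) : rotParams β x 0 = x := by simp [rotParams]

theorem Params.IsNonzero.rot (hx : x.IsNonzero) (β : ℤ) (ε : ℝ) : (rotParams β x ε).IsNonzero :=
  ⟨mul_ne_zero hx.1 (Complex.exp_ne_zero _), mul_ne_zero hx.2.1 (Complex.exp_ne_zero _),
    fun r => mul_ne_zero (hx.2.2 r) (Complex.exp_ne_zero _)⟩

theorem tVec_rotParams (β : ℤ) (ε : ℝ) : tVec η (rotParams β x ε) = rotVec (tVec η x) ε := by
  ext i
  refine Fin.cases ?_ (fun r => ?_) i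
  · simp only [tVec_zero, rotParams, rotVec, Fin.val_zero]
    push_cast; ring_nf
  · simp only [tVec_succ, rotParams, rotVec, Fin.val_succ]
    push_cast; ring_nf

/-- Parameters at which the regularised integral can be compared with the original one. -/
structure IsGood (q : ℂ) (η : Scales) (x : Params) : Prop where
  ne_zero : x.IsNonzero
  avoids : AvoidsRay (poleVec q η x) (nome η) q
  sq_ne : ∀ n : ℤ, x.1 ^ 2 ≠ q ^ n
  sq_mul_ne : ∀ n : ℤ, η.2.1 / (x.1 * x.2.1) ^ 2 ≠ q ^ n

/-- Good parameters are dense at proper scales. The squares b² and c/(ba)² rotate with speeds 2 and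
-6, so they avoid the powers of q for all but countably many angles. -/
theorem frequently_isGood (hq0 : q ≠ 0) (hη : IsProper η) (hx : x.IsNonzero) :
    ∃ᶠ x' in 𝓝 x, IsGood q η x' := by
  have h1 := countable_not_avoidsRay_cons hη.nome_ne hq0 hx.1 (tVec_ne_zero hη hx)
    (mul_ne_zero hx.2.1 hη.s_ne)
  have h2 := countable_mul_exp_eq_zpow hq0 (pow_ne_zero 2 hx.1) (two_ne_zero (α := ℤ))
  have h3 := countable_mul_exp_eq_zpow hq0 (div_ne_zero hη.c_ne (pow_ne_zero 2
    (mul_ne_zero hx.1 hx.2.1))) (show (-6 : ℤ) ≠ 0 by norm_num)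
  have := frequently_of_countable (continuous_rotParams 1 x) ((h1.union h2).union h3)
    (P := IsGood q η) fun ε hε => ?_
  · rwa [rotParams_zero] at this
  simp only [Set.mem_union, not_or, Set.mem_ofPred_eq, not_not, not_exists] at hε
  obtain ⟨⟨h1, h2⟩, h3⟩ := hε
  refine ⟨hx.rot 1 ε, ?_, fun n h => h2 n ?_, fun n h => h3 n ?_⟩
  · rw [poleVec, tVec_rotParams]
    convert h1 using 2
    · simp only [rotParams]; ring
    · rfl
  · rw [← h]
    simp only [rotParams]
    rw [mul_pow, ← Complex.exp_nat_mul]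
    push_cast; ring_nf
  · rw [← h]
    simp only [rotParams]
    rw [mul_mul_mul_comm, ← Complex.exp_add, mul_pow (x.1 * x.2.1), ← Complex.exp_nat_mul,
      ← div_div,
      div_eq_mul_inv _ (Complex.exp _), ← Complex.exp_neg]
    push_cast; ring_nf

/-- Parameters `(a, u)` in general position with respect to the powers of `q`. -/
structure IsGeneric (q : ℂ) (e f : Fin 3 → ℂ) (y : ℂ × (Fin 3 → ℂ)) : Prop where
  fst_ne : y.1 ≠ 0
  snd_ne : ∀ r, y.2 r ≠ 0
  fst_sq : ∀ n : ℤ, y.1 ^ 2 ≠ q ^ n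
  snd_sq : ∀ r, ∀ n : ℤ, (y.2 r * e r) ^ 2 ≠ q ^ n
  div_sq : ∀ r, ∀ n : ℤ, (f r * y.1 / y.2 r) ^ 2 ≠ q ^ n

/-- There are only countably many b with b² a positive power of q, so one choice of (a, u) can be
generic for all of them at once. This serves to fill in the quotient `regE`/`poleFactor` at these b.
-/
theorem frequently_forall_mem_ellGeneric (hq0 : q ≠ 0) (hq : ‖q‖ < 1) (hη : IsProper η)
    (hx : x.IsNonzero) : ∃ᶠ y in 𝓝 x.2, IsGeneric q η.2.2.1 η.2.2.2 y ∧
      ∀ b : ℂ, (∃ j : ℕ, b ^ 2 = q ^ (j + 1)) → ‖nome η * q‖ < ‖b‖ →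
        (b, tVec η (b, y)) ∈ ellGeneric (nome η) q := by
  set S : Set ℂ := {b | b ^ 2 ∈ Set.range fun j : ℕ => q ^ (j + 1)} ∩ {b | ‖nome η * q‖ < ‖b‖}
  have hS : S.Countable := (countable_setOf_sq_mem (Set.countable_range _)).mono
    Set.inter_subset_left
  have hS0 {b : ℂ} (hb : b ∈ S) : b ≠ 0 ∧ ‖b‖ < 1 := by
    obtain ⟨⟨j, hj⟩, hb⟩ := hb
    refine ⟨norm_pos_iff.1 ((norm_nonneg _).trans_lt hb), ?_⟩
    by_contra! hle
    have h1 : ‖b ^ 2‖ < 1 := by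
      rw [← hj, norm_pow]; exact pow_lt_one₀ (norm_nonneg q) hq (by omega)
    rw [norm_pow] at h1
    exact absurd (one_le_pow₀ hle (n := 2)) (not_le.2 h1)
  have h1 : (⋃ b ∈ S, {ε : ℝ | ¬ AvoidsRay (ellParams b (rotVec (tVec η x) ε) (nome η) q)
      (nome η) q}).Countable := hS.biUnion fun b hb => countable_not_avoidsRay hη.nome_ne hq0
        hη.norm_lt hq (hS0 hb).1 (tVec_ne_zero hη hx) (hS0 hb).2 hb.2
  have h2 := countable_mul_exp_eq_zpow hq0 (pow_ne_zero 2 hx.2.1) (four_ne_zero (α := ℤ))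
  have hf0 (r) : η.2.2.2 r ≠ 0 := right_ne_zero_of_mul (hη.mul_eq r ▸ hη.c_ne)
  have h3 := Set.countable_iUnion fun r => countable_mul_exp_eq_zpow hq0
    (pow_ne_zero 2 (mul_ne_zero (hx.2.2 r) (hη.e_ne r)))
    (show (4 * r + 8 : ℤ) ≠ 0 by omega)
  have h4 := Set.countable_iUnion fun r => countable_mul_exp_eq_zpow hq0
    (pow_ne_zero 2 (div_ne_zero (mul_ne_zero (hf0 r) hx.2.1) (hx.2.2 r)))
    (show (-4 * r - 4 : ℤ) ≠ 0 by omega)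
  have := frequently_of_countable (f := fun ε => (rotParams 0 x ε).2)
    (continuous_snd.comp (continuous_rotParams 0 x)) (((h1.union h2).union h3).union h4)
    (P := fun y => IsGeneric q η.2.2.1 η.2.2.2 y ∧
      ∀ b : ℂ, (∃ j : ℕ, b ^ 2 = q ^ (j + 1)) → ‖nome η * q‖ < ‖b‖ →
        (b, tVec η (b, y)) ∈ ellGeneric (nome η) q) fun ε hε => ?_
  · rwa [rotParams_zero] at this
  simp only [Set.mem_union, not_or, Set.mem_iUnion, Set.mem_ofPred_eq, not_not, not_exists] at hε
  obtain ⟨⟨⟨h1, h2⟩, h3⟩, h4⟩ := hε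
  have hnz := hx.rot 0 ε
  refine ⟨⟨hnz.2.1, hnz.2.2, fun n h => h2 n ?_, fun r n h => h3 r n ?_, fun r n h => h4 r n ?_⟩,
    fun b ⟨j, hj⟩ hb => ?_⟩
  · rw [← h]
    simp only [rotParams]
    rw [mul_pow, ← Complex.exp_nat_mul]
    push_cast; ring_nf
  · rw [← h]
    simp only [rotParams]
    rw [mul_right_comm (x.2.2 r), mul_pow (x.2.2 r * η.2.2.1 r), ← Complex.exp_nat_mul]
    push_cast; ring_nf
  · rw [← h]
    simp only [rotParams]
    rw [← mul_assoc, mul_div_mul_comm, mul_pow (η.2.2.2 r * x.2.1 / x.2.2 r), ← Complex.exp_sub,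
      ← Complex.exp_nat_mul]
    push_cast; ring_nf
  · have hbS : b ∈ S := ⟨⟨j, hj.symm⟩, hb⟩
    have ht : tVec η (b, (rotParams 0 x ε).2) = tVec η (rotParams 0 x ε) := rfl
    refine AvoidsRay.mem_ellGeneric ?_ hη.nome_ne hq0 hη.norm_lt hq (hS0 hbS).1
      (by rw [ht]; exact tVec_ne_zero hη hnz)
    rw [ht, tVec_rotParams]
    exact h1 b hbS

end
end EllipticBeta
end

noncomputable section
namespace EllipticBeta

/-! ### Antisymmetry of the residues -/

section
variable {q p : ℂ} {b a s w : ℂ} {u e f : Fin 3 → ℂ} {m : ℤ}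

theorem theta_mul_of_sq (hq0 : q ≠ 0) (hq : ‖q‖ < 1) (hw : w ≠ 0) (hwm : w ^ 2 = q ^ m) {x : ℂ}
    (hx : x ≠ 0) : theta (x * w) q = thetaMult q m * (x / w) ^ (-m) * theta (x / w) q := by
  rw [← theta_zpow_mul hq0 hq (div_ne_zero hx hw), ← hwm]
  congr 1; field_simp

/-- When w² is a power of q, θ(xw) and θ(x/w) differ by an explicit multiplier. The powers of b in
these multipliers are b^{3m} from the factors with a and b and b^{-3m} from the three u_r; they
cancel, and the sign comes from 1 - w² = -w² (1 - w⁻²). -/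
theorem theta_antisymm (hq0 : q ≠ 0) (hq : ‖q‖ < 1) (hb : b ≠ 0) (ha : a ≠ 0)
    (hu : ∀ r, u r ≠ 0) (hw : w ≠ 0) (hwm : w ^ 2 = q ^ m) :
    (1 - w ^ 2) * theta (a * w / b) q * theta (b / w ^ 2) q * theta (a / w) q *
      ∏ r, theta (u r / w) q * theta (b * u r * w) q =
    -((1 - 1 / w ^ 2) * theta (a / (b * w)) q * theta (b * w ^ 2) q * theta (a * w) q *
      ∏ r, theta (u r * w) q * theta (b * u r / w) q) := by
  have h {x : ℂ} (hx : x ≠ 0) := theta_mul_of_sq hq0 hq hw hwm hx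
  have hbm : b ^ m ≠ 0 := zpow_ne_zero m hb
  have hw2 : w ^ 2 ≠ 0 := pow_ne_zero 2 hw
  have e1 : theta (a * w / b) q * theta (a / w) q =
      b ^ m * (theta (a * w) q * theta (a / (b * w)) q) := by
    rw [show a * w / b = a / b * w by ring, h (div_ne_zero ha hb), div_div, h ha,
      show a / (b * w) = a / w / b by field_simp, div_zpow, zpow_neg b, div_inv_eq_mul]
    ring
  have e2 (r : Fin 3) : theta (u r / w) q * theta (b * u r * w) q =
      (b ^ m)⁻¹ * (theta (u r * w) q * theta (b * u r / w) q) := by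
    rw [h (mul_ne_zero hb (hu r)), h (hu r), mul_div_assoc, mul_zpow, zpow_neg b]
    ring
  have e3 : theta (b * w ^ 2) q = thetaMult q m * (b ^ m)⁻¹ * theta b q := by
    rw [hwm, mul_comm, theta_zpow_mul hq0 hq hb, zpow_neg]
  have e4 : theta (b / w ^ 2) q = thetaMult q (-m) * b ^ m * theta b q := by
    have := theta_zpow_mul hq0 hq hb (-m)
    rw [neg_neg] at this
    rw [← this, zpow_neg, ← hwm, div_eq_mul_inv, mul_comm]
  have e5 : theta (b / w ^ 2) q = b ^ m * b ^ m * (w ^ 2)⁻¹ * theta (b * w ^ 2) q := by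
    rw [e3, e4, thetaMult_neg hq0 m, ← hwm]
    generalize b ^ m = Z at *
    field_simp
  rw [Finset.prod_congr rfl fun r _ => e2 r, Finset.prod_mul_distrib, Fin.prod_const, e5]
  generalize (∏ r, theta (u r * w) q * theta (b * u r / w) q) = P
  have e6 : b ^ m * b ^ m * b ^ m * (b ^ m)⁻¹ ^ 3 = 1 := by
    generalize b ^ m = Z at *
    field_simp
  have e7 : (1 - w ^ 2) * (w ^ 2)⁻¹ = -(1 - 1 / w ^ 2) := by field_simp; ring
  linear_combination (1 - w ^ 2) * (w ^ 2)⁻¹ * b ^ m * b ^ m * theta (b * w ^ 2) q *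
    (b ^ m)⁻¹ ^ 3 * P * e1 + theta (b * w ^ 2) q * P * theta (a * w) q * theta (a / (b * w)) q *
    ((1 - w ^ 2) * (w ^ 2)⁻¹ * e6 + e7)

theorem pqPoch_pair (hp : ‖p‖ < 1) (hq : ‖q‖ < 1) (x w : ℂ) :
    pqPoch (x / w) p q * pqPoch (x * p * w) p q =
      qPoch (x / w) q * (pqPoch (x * p / w) p q * pqPoch (x * p * w) p q) := by
  rw [pqPoch_eq_mul hp hq (x / w), show x / w * p = x * p / w by ring]; ring

/-- The numerator of `scaledIntegrand`. -/
def fullNumer (q : ℂ) (y : Params × Scales) (w : ℂ) : ℂ :=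
  numer q y w * pqPoch (extraArg q y w) (nome y.2) q

/-- The denominator of `scaledIntegrand`, without the pair of factors that share zeros. -/
def restDenom (q : ℂ) (y : Params × Scales) (w : ℂ) : ℂ :=
  (∏ i ∈ {Sum.inl 2}ᶜ, pqPoch (innerArg q y w i) (nome y.2) q) *
    ∏ i ∈ {mainOuter}ᶜ, pqPoch (outerArg q y w i) (nome y.2) q

theorem prod_compl_two (F : PoleIndex → ℂ) : ∏ i ∈ {Sum.inl 2}ᶜ, F i =
    F (Sum.inl 0) * F (Sum.inl 1) *
      ∏ r, F (Sum.inr (Sum.inl r)) * F (Sum.inr (Sum.inr r)) := by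
  have e : ({Sum.inl 2}ᶜ : Finset PoleIndex) = {Sum.inl 0, Sum.inl 1} ∪
      Finset.univ.map ⟨Sum.inr, Sum.inr_injective⟩ := by
    ext i; rcases i with i | i
    · fin_cases i <;> simp
    · simp
  rw [e, Finset.prod_union (by rw [Finset.disjoint_left]; simp), Finset.prod_pair (by simp),
    Finset.prod_map, Fintype.prod_sum_type, Finset.prod_mul_distrib]
  rfl

theorem prod_compl_mainOuter (F : PoleIndex → ℂ) : ∏ i ∈ {mainOuter}ᶜ, F i =
    F (Sum.inl 1) * F (Sum.inl 2) *
      ∏ r, F (Sum.inr (Sum.inl r)) * F (Sum.inr (Sum.inr r)) := by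
  have e : ({mainOuter}ᶜ : Finset PoleIndex) = {Sum.inl 1, Sum.inl 2} ∪
      Finset.univ.map ⟨Sum.inr, Sum.inr_injective⟩ := by
    ext i; rcases i with i | i
    · fin_cases i <;> simp [mainOuter]
    · simp [mainOuter]
  rw [e, Finset.prod_union (by rw [Finset.disjoint_left]; simp), Finset.prod_pair (by simp),
    Finset.prod_map, Fintype.prod_sum_type, Finset.prod_mul_distrib]
  rfl

/-- The part of the numerator common to `w` and `w⁻¹`. -/
def numerCommon (q p b a : ℂ) (u e f : Fin 3 → ℂ) (w : ℂ) : ℂ :=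
  qPoch (p * w ^ 2) p * qPoch (p / w ^ 2) p *
    (pqPoch (q / b * p / w ^ 2) p q * pqPoch (q / b * p * w ^ 2) p q) *
    (pqPoch (b * a * p * w) p q * pqPoch (b * a * p / w) p q) *
    (pqPoch (q / a * p / w) p q * pqPoch (q / a * p * w) p q) *
    ∏ r, (pqPoch (q * f r / u r * p / w) p q * pqPoch (q * f r / u r * p * w) p q) *
      (pqPoch (b * u r * e r * p / w) p q * pqPoch (b * u r * e r * p * w) p q)

def restCommon (q p b a : ℂ) (u e f : Fin 3 → ℂ) (w : ℂ) : ℂ :=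
  (pqPoch (b * p / w ^ 2) p q * pqPoch (b * p * w ^ 2) p q) *
    (pqPoch (a * p / w) p q * pqPoch (a * p * w) p q) *
    ∏ r, (pqPoch (u r * e r * p / w) p q * pqPoch (u r * e r * p * w) p q) *
      (pqPoch (q * f r / (b * u r) * p / w) p q * pqPoch (q * f r / (b * u r) * p * w) p q)

theorem fullNumer_eq (hq : ‖q‖ < 1) (hp : ‖p‖ < 1) (hps : p = s ^ 2) (hw : w ≠ 0) :
    fullNumer q ((b, a, u), (s, 1, e, f)) w = numerCommon q p b a u e f w *
      ((1 - 1 / w ^ 2) * theta (a / (b * w)) q * qPoch (q / b / w ^ 2) q * qPoch (q / a / w) q *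
      ∏ r, qPoch (q * f r / u r / w) q * qPoch (b * u r * e r / w) q) := by
  have hn : nome (s, 1, e, f) = p := by rw [nome, hps]; ring
  rw [fullNumer, numer]
  simp only [hn, Fintype.prod_sum_type, Fintype.prod_prod_type, numerArg, extraArg, Sum.elim_inl,
    Sum.elim_inr, Fin.prod_univ_five, Fin.prod_univ_four, Matrix.cons_val, one_mul, ← hps]
  have e1 := pqPoch_pair hp hq (q / b) (w ^ 2)
  have e2 : pqPoch (q / a / w) p q = qPoch (q / a / w) q * pqPoch (q / a * p / w) p q := by
    rw [pqPoch_eq_mul hp hq (q / a / w), show q / a / w * p = q / a * p / w by ring]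
  have e3 (r : Fin 3) : pqPoch (q * f r / (u r * w)) p q * pqPoch (q * p * f r * w / u r) p q *
      pqPoch (b * u r * e r / w) p q * pqPoch (b * u r * p * e r * w) p q =
      (pqPoch (q * f r / u r * p / w) p q * pqPoch (q * f r / u r * p * w) p q) *
      (pqPoch (b * u r * e r * p / w) p q * pqPoch (b * u r * e r * p * w) p q) *
      (qPoch (q * f r / u r / w) q * qPoch (b * u r * e r / w) q) := by
    have h1 := pqPoch_pair hp hq (q * f r / u r) w
    have h2 := pqPoch_pair hp hq (b * u r * e r) w
    rw [show q * f r / (u r * w) = q * f r / u r / w by rw [div_div],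
      show q * p * f r * w / u r = q * f r / u r * p * w by ring,
      show b * u r * p * e r * w = b * u r * e r * p * w by ring, mul_assoc, h1, h2]
    ring
  rw [Finset.prod_congr rfl fun r _ => e3 r, Finset.prod_mul_distrib,
    qPoch_eq_mul hp (1 / w ^ 2), show 1 / w ^ 2 * p = p / w ^ 2 by ring,
    show q / (b * w ^ 2) = q / b / w ^ 2 by rw [div_div],
    show q * p * w ^ 2 / b = q / b * p * w ^ 2 by ring,
    show p * q * w / a = q / a * p * w by ring, show p * b * a / w = b * a * p / w by ring,
    show q / (a * w) = q / a / w by rw [div_div], numerCommon, e1, e2]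
  ring

theorem restDenom_eq (hq : ‖q‖ < 1) (hp : ‖p‖ < 1) (hps : p = s ^ 2) :
    restDenom q ((b, a, u), (s, 1, e, f)) w = restCommon q p b a u e f w *
      (qPoch (b / w ^ 2) q * qPoch (a / w) q *
      ∏ r, qPoch (u r * e r / w) q * qPoch (q * f r / (b * u r) / w) q) := by
  have hn : nome (s, 1, e, f) = p := by rw [nome, hps]; ring
  rw [restDenom, prod_compl_two, prod_compl_mainOuter]
  simp only [hn, innerArg, outerArg, Sum.elim_inl, Sum.elim_inr, Matrix.cons_val, one_mul, ← hps]
  have e1 := pqPoch_pair hp hq b (w ^ 2)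
  have e2 := pqPoch_pair hp hq a w
  have e3 (r : Fin 3) : pqPoch (u r * e r / w) p q * pqPoch (q * f r / (b * u r * w)) p q *
      (pqPoch (u r * p * e r * w) p q * pqPoch (q * p * f r * w / (b * u r)) p q) =
      (pqPoch (u r * e r * p / w) p q * pqPoch (u r * e r * p * w) p q) *
      (pqPoch (q * f r / (b * u r) * p / w) p q * pqPoch (q * f r / (b * u r) * p * w) p q) *
      (qPoch (u r * e r / w) q * qPoch (q * f r / (b * u r) / w) q) := by
    have h1 := pqPoch_pair hp hq (q * f r / (b * u r)) w
    have h2 := pqPoch_pair hp hq (u r * e r) w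
    rw [show q * f r / (b * u r * w) = q * f r / (b * u r) / w by rw [div_div],
      show q * p * f r * w / (b * u r) = q * f r / (b * u r) * p * w by ring,
      show u r * p * e r * w = u r * e r * p * w by ring, mul_mul_mul_comm, h1, h2]
    ring
  rw [show ∀ x y X k l Y : ℂ, x * y * X * (k * l * Y) = x * k * (y * l) * (X * Y) by intros; ring,
    ← Finset.prod_mul_distrib, Finset.prod_congr rfl fun r _ => e3 r, Finset.prod_mul_distrib, e1,
    e2, restCommon]
  ring

theorem numerCommon_inv : numerCommon q p b a u e f w⁻¹ = numerCommon q p b a u e f w := by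
  simp only [numerCommon, inv_pow, div_inv_eq_mul, ← div_eq_mul_inv]
  congr 1
  · ring
  · exact Finset.prod_congr rfl fun r _ => by ring

theorem restCommon_inv : restCommon q p b a u e f w⁻¹ = restCommon q p b a u e f w := by
  simp only [restCommon, inv_pow, div_inv_eq_mul, ← div_eq_mul_inv]
  congr 1
  · ring
  · exact Finset.prod_congr rfl fun r _ => by ring

/-- The residues at `w` and `w⁻¹` are opposite. -/
theorem fullNumer_inv_mul_restDenom (hq0 : q ≠ 0) (hq : ‖q‖ < 1) (hp : ‖s ^ 2‖ < 1) (hb : b ≠ 0)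
    (ha : a ≠ 0) (hu : ∀ r, u r ≠ 0) (hef : ∀ r, e r * f r = 1) (hw : w ≠ 0) (hwm : w ^ 2 = q ^ m) :
    fullNumer q ((b, a, u), (s, 1, e, f)) w⁻¹ * restDenom q ((b, a, u), (s, 1, e, f)) w =
      -(fullNumer q ((b, a, u), (s, 1, e, f)) w *
        restDenom q ((b, a, u), (s, 1, e, f)) w⁻¹) := by
  have he (r : Fin 3) : e r ≠ 0 := left_ne_zero_of_mul_eq_one (hef r)
  rw [fullNumer_eq hq hp rfl hw, fullNumer_eq hq hp rfl (inv_ne_zero hw), restDenom_eq hq hp rfl,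
    restDenom_eq hq hp rfl, numerCommon_inv, restCommon_inv]
  have h := theta_antisymm hq0 hq hb ha (fun r => mul_ne_zero (hu r) (he r)) hw hwm
  -- Because c = 1, the q-factorials at w and at 1/w pair up into theta functions with parameters
  -- u_r e_r, to which the antisymmetry applies.
  have hf (r : Fin 3) : f r = (e r)⁻¹ := eq_inv_of_mul_eq_one_right (hef r)
  have e1 (r : Fin 3) : q / (u r * e r / w) = q * f r / u r * w := by
    have := he r; have := hu r; rw [hf]; field_simp
  have e2 (r : Fin 3) : q / (b * (u r * e r) * w) = q * f r / (b * u r) / w := by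
    have := he r; have := hu r; rw [hf]; field_simp
  have e3 (r : Fin 3) : q / (u r * e r * w) = q * f r / u r / w := by
    have := he r; have := hu r; rw [hf]; field_simp
  have e4 (r : Fin 3) : q / (b * (u r * e r) / w) = q * f r / (b * u r) * w := by
    have := he r; have := hu r; rw [hf]; field_simp
  have e5 : q / (b / w ^ 2) = q / b * w ^ 2 := by field_simp
  have e6 : q / (a / w) = q / a * w := by field_simp
  have e7 : q / (b * w ^ 2) = q / b / w ^ 2 := by field_simp
  have e8 : q / (a * w) = q / a / w := by field_simp
  have e9 : a / (b * w⁻¹) = a * w / b := by field_simp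
  simp only [theta, e1, e2, e3, e4, e5, e6, e7, e8] at h
  rw [← theta, ← theta] at h
  simp only [inv_pow, div_inv_eq_mul, e9, one_mul]
  simp only [Fin.prod_univ_three] at h ⊢
  simp only [← mul_assoc b] at h
  linear_combination (numerCommon q (s ^ 2) b a u e f w * restCommon q (s ^ 2) b a u e f w) * h

end
end EllipticBeta
end

noncomputable section
namespace EllipticBeta

/-! ### Vanishing of the regularised integral -/

theorem circleIntegral_sub_inv {R : ℝ} (hR : 0 < R) (a : ℂ) : (∮ z in C(0, R), (z - a)⁻¹) =
    2 * Real.pi * Complex.I * windingNumber (circleCurve R) a := by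
  rw [windingNumber, mul_inv_cancel_left₀ Complex.two_pi_I_ne_zero, contourIntegral_circleCurve hR]

/-- Riemann's removable singularity theorem, with the growth condition in the form in which residues
are computed. -/
theorem differentiableAt_update_of_tendsto {f : ℂ → ℂ} {a : ℂ}
    (hf : ∀ᶠ w in 𝓝[≠] a, DifferentiableAt ℂ f w)
    (h : Tendsto (fun w => (w - a) * f w) (𝓝[≠] a) (𝓝 0)) :
    ∃ c, DifferentiableAt ℂ (Function.update f a c) a := by
  obtain ⟨s, hs, hs'⟩ := (eventually_nhdsWithin_iff.1 hf).exists_mem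
  refine ⟨_, (Complex.differentiableOn_update_limUnder_of_isLittleO hs
    (fun w hw => (hs' w hw.1 hw.2).differentiableWithinAt) ?_).differentiableAt hs⟩
  rw [Asymptotics.isLittleO_iff_tendsto']
  · have h2 : Tendsto (fun w => (w - a) * f a) (𝓝[≠] a) (𝓝 0) := by
      have : Tendsto (fun w => (w - a) * f a) (𝓝 a) (𝓝 ((a - a) * f a)) :=
        Continuous.tendsto (by fun_prop) a
      rw [sub_self, zero_mul] at this
      exact this.mono_left nhdsWithin_le_nhds
    have := h.sub h2
    rw [sub_zero] at this
    refine this.congr fun w => ?_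
    rw [div_inv_eq_mul]; ring
  · filter_upwards [self_mem_nhdsWithin] with w hw h0
    exact absurd (inv_eq_zero.1 h0) (sub_ne_zero.2 hw)

/-- The residue theorem for simple poles in an annulus. -/
theorem circleIntegral_sub_circleIntegral_eq_sum {r R : ℝ} (hr : 0 < r) (hrR : r ≤ R) {ι : Type*}
    {I : Finset ι} {a ρ : ι → ℂ} (ha : Set.InjOn a I) (har : ∀ i ∈ I, r < ‖a i‖)
    (haR : ∀ i ∈ I, ‖a i‖ < R) {f : ℂ → ℂ}
    (hf : ∀ w, r ≤ ‖w‖ → ‖w‖ ≤ R → (∀ i ∈ I, w ≠ a i) → DifferentiableAt ℂ f w)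
    (hρ : ∀ i ∈ I, Tendsto (fun w => (w - a i) * f w) (𝓝[≠] a i) (𝓝 (ρ i))) :
    (∮ z in C(0, R), f z) - (∮ z in C(0, r), f z) = 2 * Real.pi * Complex.I * ∑ i ∈ I, ρ i := by
  classical
  have hR := hr.trans_le hrR
  induction I using Finset.induction_on generalizing f with
  | empty =>
    rw [Finset.sum_empty, mul_zero, sub_eq_zero]
    have hd (w : ℂ) (h1 : r ≤ ‖w‖) (h2 : ‖w‖ ≤ R) : DifferentiableAt ℂ f w := hf w h1 h2 (by simp)
    refine Complex.circleIntegral_eq_of_differentiable_on_annulus_off_countable hr hrR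
      Set.countable_empty (fun w hw => (hd w ?_ ?_).continuousAt.continuousWithinAt)
      fun w hw => hd w ?_ ?_
    · simpa using hw.2
    · simpa using hw.1
    · have := hw.1.2; simp at this; exact this.le
    · have := hw.1.1; simp at this; exact this.le
  | insert i I hi ih =>
    have hai : ∀ j ∈ I, a j ≠ a i := fun j hj h => hi (by
      rwa [← ha (Finset.mem_coe.2 (Finset.mem_insert_of_mem hj))
        (Finset.mem_coe.2 (Finset.mem_insert_self i I)) h])
    have hmem := Finset.mem_insert_self i I
    -- The principal part at one pole is subtracted, the singularity there is removed, and the other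
    -- residues are unchanged.
    set g : ℂ → ℂ := fun w => f w - ρ i * (w - a i)⁻¹ with hg
    have hgd (w : ℂ) (hw : w ≠ a i) (h : DifferentiableAt ℂ f w) : DifferentiableAt ℂ g w :=
      h.sub (by
        have := sub_ne_zero.2 hw
        fun_prop (disch := assumption))
    have hnhds : ∀ᶠ w in 𝓝[≠] a i, DifferentiableAt ℂ g w := by
      have h1 : ∀ᶠ w in 𝓝 (a i), r < ‖w‖ :=
        continuous_norm.continuousAt.eventually_const_lt (har i hmem)
      have h2 : ∀ᶠ w in 𝓝 (a i), ‖w‖ < R :=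
        continuous_norm.continuousAt.eventually_lt_const (haR i hmem)
      have h3 : ∀ᶠ w in 𝓝 (a i), ∀ j ∈ I, w ≠ a j :=
        (Filter.eventually_all_finset I).2 fun j hj => eventually_ne_nhds (hai j hj).symm
      filter_upwards [h1.filter_mono nhdsWithin_le_nhds, h2.filter_mono nhdsWithin_le_nhds,
        h3.filter_mono nhdsWithin_le_nhds, self_mem_nhdsWithin] with w h1 h2 h3 h4
      exact hgd w h4 (hf w h1.le h2.le fun j hj => by
        rcases Finset.mem_insert.1 hj with rfl | hj
        exacts [h4, h3 j hj])
    obtain ⟨c, hc⟩ := differentiableAt_update_of_tendsto hnhds (by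
      have := (hρ i hmem).sub_const (ρ i)
      rw [sub_self] at this
      refine this.congr' ?_
      filter_upwards [self_mem_nhdsWithin] with w hw
      have : w - a i ≠ 0 := sub_ne_zero.2 hw
      simp only [hg]
      field_simp)
    have heq {w : ℂ} (hw : w ≠ a i) : Function.update g (a i) c =ᶠ[𝓝 w] g := by
      filter_upwards [eventually_ne_nhds hw] with z hz
      exact Function.update_of_ne hz _ _
    have key := ih (f := Function.update g (a i) c)
      (ha.mono (Finset.coe_subset.2 (Finset.subset_insert i I)))
      (fun j hj => har j (Finset.mem_insert_of_mem hj))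
      (fun j hj => haR j (Finset.mem_insert_of_mem hj)) (fun w h1 h2 h3 => ?_) fun j hj => ?_
    · have hcirc (ρ' : ℝ) (h0 : 0 < ρ') (hne : ρ' ≠ ‖a i‖) (h1 : r ≤ ρ') (h2 : ρ' ≤ R)
          (h3 : ∀ j ∈ insert i I, ρ' ≠ ‖a j‖) :
          (∮ z in C(0, ρ'), Function.update g (a i) c z) = (∮ z in C(0, ρ'), f z) -
            ρ i * (2 * Real.pi * Complex.I * windingNumber (circleCurve ρ') (a i)) := by
        have hw {w : ℂ} (hw : w ∈ Metric.sphere (0 : ℂ) ρ') : ‖w‖ = ρ' := by simpa using hw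
        have hwa {w : ℂ} (hw' : w ∈ Metric.sphere (0 : ℂ) ρ') : w ≠ a i := fun h =>
          hne (by rw [← hw hw', h])
        rw [circleIntegral.integral_congr h0.le fun w hw => Function.update_of_ne (hwa hw) _ _,
          circleIntegral.integral_sub, circleIntegral.integral_const_mul,
          circleIntegral_sub_inv h0]
        · refine ContinuousOn.circleIntegrable h0.le fun w hw' => ContinuousAt.continuousWithinAt
            (hf w (by rwa [hw hw']) (by rwa [hw hw']) fun j hj h => h3 j hj ?_).continuousAt
          rw [← hw hw', h]
        · refine ContinuousOn.circleIntegrable h0.le (ContinuousOn.mul continuousOn_const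
            (ContinuousOn.inv₀ (by fun_prop) fun w hw => sub_ne_zero.2 (hwa hw)))
      rw [hcirc R hR (haR i hmem).ne' hrR le_rfl fun j hj => (haR j hj).ne',
        hcirc r hr (har i hmem).ne le_rfl hrR fun j hj => (har j hj).ne,
        windingNumber_circleCurve_of_lt hR (haR i hmem),
        windingNumber_circleCurve_of_gt hr (har i hmem)] at key
      rw [Finset.sum_insert hi]
      linear_combination key
    · by_cases hw : w = a i
      · rwa [hw]
      · exact (hgd w hw (hf w h1 h2 fun j hj => by
          rcases Finset.mem_insert.1 hj with rfl | hj
          exacts [hw, h3 j hj])).congr_of_eventuallyEq (heq hw)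
    · have h1 := hρ j (Finset.mem_insert_of_mem hj)
      have hne := hai j hj
      have h2 : Tendsto (fun w => (w - a j) * (ρ i * (w - a i)⁻¹)) (𝓝 (a j)) (𝓝 0) := by
        have : ContinuousAt (fun w => (w - a j) * (ρ i * (w - a i)⁻¹)) (a j) := by
          have : a j - a i ≠ 0 := sub_ne_zero.2 hne
          fun_prop (disch := assumption)
        simpa [ContinuousAt] using this
      have := h1.sub (h2.mono_left nhdsWithin_le_nhds)
      rw [sub_zero] at this
      refine this.congr' ?_
      filter_upwards [(heq hne).filter_mono nhdsWithin_le_nhds] with w hw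
      rw [hw, hg]; ring

/-! ### The Bezout coefficient and the denominator factors at a simple zero -/

/-- `qFin q x N` without the factor with index `k`. -/
def qFinErase (q x : ℂ) (N k : ℕ) : ℂ := ∏ j ∈ (Finset.range N).erase k, (1 - x * q ^ j)

theorem qFin_eq_mul_erase (q x : ℂ) {N k : ℕ} (hk : k < N) :
    qFin q x N = (1 - x * q ^ k) * qFinErase q x N k := by
  rw [qFin, qFinErase, Finset.mul_prod_erase _ (fun j => 1 - x * q ^ j) (Finset.mem_range.2 hk)]

theorem continuous_qFinErase (q : ℂ) (N k : ℕ) : Continuous fun x => qFinErase q x N k := by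
  unfold qFinErase; fun_prop

theorem pow_injective_of_norm_lt {q : ℂ} (hq0 : q ≠ 0) (hq : ‖q‖ < 1) :
    Function.Injective fun k : ℕ => q ^ k := fun k l h => by
  have h1 := congrArg norm h
  simp only [norm_pow] at h1
  exact pow_right_injective₀ (norm_pos_iff.2 hq0) hq.ne h1

theorem qFinErase_ne_zero {q : ℂ} (hq0 : q ≠ 0) (hq : ‖q‖ < 1) {x : ℂ} {N k : ℕ}
    (hx : x * q ^ k = 1) : qFinErase q x N k ≠ 0 := by
  refine Finset.prod_ne_zero_iff.2 fun j hj h => (Finset.mem_erase.1 hj).1 ?_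
  refine pow_injective_of_norm_lt hq0 hq (mul_left_cancel₀ (left_ne_zero_of_mul_eq_one hx) ?_)
  dsimp only
  rw [hx, ← sub_eq_zero.1 h]

section
variable {q : ℂ} {r R : ℝ} {K : ℕ} {y : Params × Scales} {w : ℂ}

/-- This evaluates the otherwise inexplicit coefficient V at points where inner and outer zeros
meet. With the inner product equal to zero the identity involves V alone. -/
theorem bezoutV_mul_erase (hq0 : q ≠ 0) (K : ℕ) (α : PoleIndex → ℂ) {i : PoleIndex} {k l : ℕ}
    (hα : α i * q ^ k = 1) (hk : k < K) (hl : l < K) (β : ℂ) (hβ : β * q ^ l = 1) :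
    (∏ j ∈ {i}ᶜ, qFin q (α j * β) (2 * K)) * qFinErase q (α i * β) (2 * K) (k + l) =
      bezoutV q K (α, β) * qFinErase q β K l := by
  have hV := (contDiff_bezoutV q K).continuous
  have hf : Continuous fun β => (∏ j ∈ {i}ᶜ, qFin q (α j * β) (2 * K)) *
      qFinErase q (α i * β) (2 * K) (k + l) := by
    have := continuous_qFinErase q (2 * K) (k + l)
    have h (j) : Continuous fun β => qFin q (α j * β) (2 * K) :=
      (continuous_qFin (2 * K)).comp (continuous_const_mul _)
    fun_prop
  have hg : Continuous fun β => bezoutV q K (α, β) * qFinErase q β K l := by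
    have := continuous_qFinErase q K l
    fun_prop
  refine tendsto_nhds_unique_of_eventuallyEq (hf.continuousAt.mono_left nhdsWithin_le_nhds)
    (hg.continuousAt.mono_left nhdsWithin_le_nhds) (l := 𝓝[≠] β) ?_
  filter_upwards [self_mem_nhdsWithin] with β' hβ'
  have hb := bezout_qFin q K α β'
  have hz : ∏ j, qFin q (α j) K = 0 :=
    Finset.prod_eq_zero (Finset.mem_univ i) (qFin_eq_zero_iff.2 ⟨k, hk, hα⟩)
  rw [hz, mul_zero, zero_add,
    ← Finset.prod_mul_prod_compl {i}, Finset.prod_singleton,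
    qFin_eq_mul_erase q (α i * β') (k := k + l) (by omega), qFin_eq_mul_erase q β' hl] at hb
  -- Since α_i q^k = 1, the same linear factor 1 - β q^l occurs on both sides. It is divided out for
  -- nearby β, and continuity gives the value at the zero.
  have h1 : α i * β' * q ^ (k + l) = β' * q ^ l := by
    rw [pow_add]; linear_combination β' * q ^ l * hα
  rw [h1] at hb
  have h0 : 1 - β' * q ^ l ≠ 0 := fun h => hβ' (mul_right_cancel₀ (pow_ne_zero l hq0) (by
    rw [hβ, ← sub_eq_zero.1 h]))
  refine mul_left_cancel₀ h0 ?_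
  linear_combination hb

theorem continuousAt_prod_outer (hq : ‖q‖ < 1) (h : (y, 1) ∈ regular) (hw : w ≠ 0)
    (s : Finset PoleIndex) : ContinuousAt (fun w => (∏ i ∈ s, pqPoch (outerArg q y w i) (nome y.2) q)) w := by
  have hO : ContinuousAt (fun w : ℂ => (y, w)) w := by fun_prop
  refine tendsto_finsetProd _ fun i _ => ?_
  exact ((differentiable_pqPoch h.2.2.2.2 hq).continuous.continuousAt.comp
    (((continuousOn_outerArg i).continuousAt (isOpen_regular.mem_nhds (mem_regular_of h hw))).comp hO) :)

theorem continuousAt_prod_inner (hq : ‖q‖ < 1) (h : (y, 1) ∈ regular) (hw : w ≠ 0)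
    (s : Finset PoleIndex) : ContinuousAt (fun w => (∏ i ∈ s, pqPoch (innerArg q y w i) (nome y.2) q)) w := by
  have hO : ContinuousAt (fun w : ℂ => (y, w)) w := by fun_prop
  refine tendsto_finsetProd _ fun i _ => ?_
  exact ((differentiable_pqPoch h.2.2.2.2 hq).continuous.continuousAt.comp
    (((continuousOn_innerArg i).continuousAt (isOpen_regular.mem_nhds (mem_regular_of h hw))).comp hO) :)

theorem eventually_notMem_outerZeros (hq : ‖q‖ < 1) (h : (y, 1) ∈ regular) (hw : w ≠ 0)
    (h0 : w ∉ outerZeros q y) : ∀ᶠ z in 𝓝 w, z ∉ outerZeros q y := by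
  have h1 : ∏ i, pqPoch (outerArg q y w i) (nome y.2) q ≠ 0 :=
    Finset.prod_ne_zero_iff.2 fun i _ hi => h0 ⟨hw, i, hi⟩
  filter_upwards [(continuousAt_prod_outer hq h hw Finset.univ).eventually_ne h1] with z hz
  rintro ⟨-, i, hi⟩
  exact hz (Finset.prod_eq_zero (Finset.mem_univ i) hi)

theorem eventually_notMem_innerZeros (hq : ‖q‖ < 1) (h : (y, 1) ∈ regular) (hw : w ≠ 0)
    (h0 : w ∉ innerZeros q y) : ∀ᶠ z in 𝓝 w, z ∉ innerZeros q y := by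
  have h1 : ∏ i, pqPoch (innerArg q y w i) (nome y.2) q ≠ 0 :=
    Finset.prod_ne_zero_iff.2 fun i _ hi => h0 ⟨hw, i, hi⟩
  filter_upwards [(continuousAt_prod_inner hq h hw Finset.univ).eventually_ne h1] with z hz
  rintro ⟨-, i, hi⟩
  exact hz (Finset.prod_eq_zero (Finset.mem_univ i) hi)

theorem exists_innerArg_mul_pow (hq : ‖q‖ < 1) (hr : 0 < r) (h : IsAdmissible q r R K y)
    (hw : r ≤ ‖w‖) {i : PoleIndex} (hi : pqPoch (innerArg q y w i) (nome y.2) q = 0) :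
    ∃ k < K, innerArg q y w i * q ^ k = 1 := by
  rw [pqPoch_eq_qFin_mul h.nome_lt hq _ K] at hi
  have := norm_innerArg_le (q := q) (y := y) hr hw i
  exact qFin_eq_zero_iff.1 ((mul_eq_zero.1 hi).resolve_right (pqTail_ne_zero h.nome_lt hq
    (norm_mul_le_of_le this (h.inner_pow i)) (norm_mul_le_of_le this (h.inner_nome i))))

theorem exists_outerArg_mul_pow (hq : ‖q‖ < 1) (h : IsAdmissible q r R K y)
    (hw : ‖w‖ ≤ R) {i : PoleIndex} (hi : pqPoch (outerArg q y w i) (nome y.2) q = 0) :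
    i = mainOuter ∧ ∃ k < K, outerArg q y w mainOuter * q ^ k = 1 := by
  by_cases him : i = mainOuter
  · subst him
    refine ⟨rfl, ?_⟩
    rw [pqPoch_eq_qFin_mul h.nome_lt hq _ K] at hi
    have := norm_outerArg_le (q := q) (y := y) hw mainOuter
    exact qFin_eq_zero_iff.1 ((mul_eq_zero.1 hi).resolve_right (pqTail_ne_zero h.nome_lt hq
      (norm_mul_le_of_le this h.main_pow) (norm_mul_le_of_le this h.main_nome)))
  · exact absurd hi (pqPoch_ne_zero_of_norm_lt h.nome_lt hq
      ((norm_outerArg_le hw _).trans_lt (h.outer i him)))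

end

end EllipticBeta
end

noncomputable section
namespace EllipticBeta

/-! ### The residues at the common zeros when c = 1 -/

section
variable {q : ℂ} {r R : ℝ} {K : ℕ} {b a s : ℂ} {u e f : Fin 3 → ℂ} {n : ℕ}

theorem eq_zpow_of_mul_pow_eq (hq0 : q ≠ 0) {x : ℂ} {m : ℤ} {i j : ℕ}
    (h : x * q ^ i = q ^ m * q ^ j) : x = q ^ (m + j - i) := by
  rw [zpow_sub₀ hq0, zpow_add₀ hq0, zpow_natCast, zpow_natCast, eq_div_iff (pow_ne_zero i hq0), h]

/-- Otherwise, since w² and (ba)² are powers of q, the square of a, of u_r e_r or of f_r a/u_r would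
be a power of q. Hence at the points where residues are taken only the argument with index `Sum.inl
2` contributes a pole, and it is simple. -/
theorem innerArg_mul_pow_ne_one (hq0 : q ≠ 0) (hb : b ≠ 0) (hg : IsGeneric q e f (a, u))
    (hn1 : q ^ 2 / (b * a) ^ 2 * q ^ n = 1) {w : ℂ} {m : ℤ} (hw : w ≠ 0) (hwm : w ^ 2 = q ^ m)
    {i : PoleIndex} (hi : i ≠ Sum.inl 2) (k : ℕ) :
    innerArg q ((b, a, u), (s, 1, e, f)) w i * q ^ k ≠ 1 := by
  have ha : a ≠ 0 := hg.fst_ne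
  have hba : q ^ (n + 2) = (b * a) ^ 2 := by
    have : (b * a) ^ 2 ≠ 0 := pow_ne_zero 2 (mul_ne_zero hb ha)
    field_simp at hn1
    linear_combination hn1
  intro h
  rcases i with i | i | i
  · fin_cases i <;> simp only [innerArg, Sum.elim_inl, Fin.zero_eta, Fin.mk_one, Fin.reduceFinMk,
      Matrix.cons_val] at h
    · have hb' : b * q ^ k = w ^ 2 := by field_simp at h; linear_combination h
      refine hg.fst_sq _ (eq_zpow_of_mul_pow_eq hq0 (m := -(2 * m)) (i := 0) (j := n + 2 + 2 * k) ?_)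
      have : q ^ (-(2 * m)) * (w ^ 2) ^ 2 = 1 := by
        rw [hwm, ← zpow_natCast, ← zpow_mul, ← zpow_add₀ hq0]; simp [mul_comm]
      dsimp only
      rw [pow_add, hba, pow_mul']
      have h2 : (w ^ 2) ^ 2 = b ^ 2 * (q ^ k) ^ 2 := by rw [← hb']; ring
      linear_combination (-a ^ 2) * this + q ^ (-(2 * m)) * a ^ 2 * h2
    · have ha' : a * q ^ k = w := by field_simp at h; linear_combination h
      refine hg.fst_sq _ (eq_zpow_of_mul_pow_eq hq0 (m := m) (i := 2 * k) (j := 0) ?_)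
      rw [← hwm, ← ha']; ring
    · exact hi rfl
  · simp only [innerArg, Sum.elim_inl, Sum.elim_inr] at h
    have hu' : u i * e i * q ^ k = w := by field_simp at h; linear_combination h
    refine hg.snd_sq i _ (eq_zpow_of_mul_pow_eq hq0 (m := m) (i := 2 * k) (j := 0) ?_)
    rw [← hwm, ← hu']; ring
  · have hui : u i ≠ 0 := hg.snd_ne i
    simp only [innerArg, Sum.elim_inr] at h
    have hu' : q * f i * q ^ k = b * u i * w := by field_simp at h; linear_combination h
    refine hg.div_sq i _ (eq_zpow_of_mul_pow_eq hq0 (m := m) (i := 2 * k + 2) (j := n + 2) ?_)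
    rw [← hwm, hba]
    dsimp only
    field_simp
    linear_combination (f i * q * q ^ k + b * u i * w) * hu'

/-- The Bezout multiplier vanishes, so the two integrands on the circles are opposite and glue to
one function F. The regularised integral is then the difference of the integrals of F over the two
circles, a sum of residues at W_k = q^{k+1}/(ba), 0 ≤ k ≤ n. Inversion maps W_k to W_{n-k} and
changes the sign of the residue. -/
theorem regIntegral_eq_zero (hq0 : q ≠ 0) (hq : ‖q‖ < 1) (hr : 0 < r) (hrR : r ≤ R)
    (h : IsAdmissible q r R K ((b, a, u), (s, 1, e, f))) (hef : ∀ r, e r * f r = 1)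
    (hg : IsGeneric q e f (a, u)) (hnK : n < 2 * K) (hn1 : q ^ 2 / (b * a) ^ 2 * q ^ n = 1) :
    regIntegral q r R K ((b, a, u), (s, 1, e, f)) = 0 := by
  classical
  have hR := hr.trans_le hrR
  have hb : b ≠ 0 := h.regular.1
  have ha : a ≠ 0 := h.regular.2.1
  set A : ℂ := q / (b * a) with hA
  have hA0 : A ≠ 0 := div_ne_zero hq0 (mul_ne_zero hb ha)
  have hAn : A ^ 2 * q ^ n = 1 := by rw [hA, div_pow]; exact hn1
  set W : ℕ → ℂ := fun k => A * q ^ k with hW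
  have hW0 (k) : W k ≠ 0 := mul_ne_zero hA0 (pow_ne_zero k hq0)
  have hWW {k : ℕ} (hk : k ≤ n) : W k * W (n - k) = 1 := by
    rw [← hAn, ← Nat.add_sub_of_le hk, pow_add, Nat.add_sub_cancel_left]; simp only [hW]; ring
  have hW2 (k : ℕ) : W k ^ 2 = q ^ ((2 * k : ℤ) - n) := by
    refine (eq_zpow_of_mul_pow_eq hq0 (m := 0) (i := n) (j := 2 * k) ?_).trans (by push_cast; ring_nf)
    rw [zpow_zero, one_mul, pow_mul']; simp only [hW]; linear_combination (q ^ k) ^ 2 * hAn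
  set y : Params × Scales := ((b, a, u), (s, 1, e, f)) with hy
  have hp := h.nome_lt
  have a2 (w : ℂ) : innerArg q y w (Sum.inl 2) = A / w := by
    simp only [innerArg, Sum.elim_inl, Matrix.cons_val, hy, one_mul, hA, div_div]
  have a0 (w : ℂ) : outerArg q y w mainOuter = A * w := by
    simp only [outerArg, mainOuter, Sum.elim_inl, Matrix.cons_val, hy, hA]; ring
  have hWA (k) : ‖W k‖ ≤ ‖A‖ := by
    simp only [hW]
    rw [norm_mul, norm_pow]
    exact mul_le_of_le_one_right (norm_nonneg _) (pow_le_one₀ (norm_nonneg _) hq.le)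
  have hWR (k) : ‖W k‖ < R := by
    have := h.inner (Sum.inl 2)
    rw [a2, norm_div, Complex.norm_real, Real.norm_of_nonneg hR.le, div_lt_one hR] at this
    exact (hWA k).trans_lt this
  have hWinv {k : ℕ} (hk : k ≤ n) : ‖W k‖ * ‖W (n - k)‖ = 1 := by
    rw [← norm_mul, hWW hk, norm_one]
  have hWr {k : ℕ} (hk : k ≤ n) : r < ‖W k‖ := by
    have h1 := h.main
    rw [a0, norm_mul, Complex.norm_real, Real.norm_of_nonneg hr.le] at h1
    have h2 := hWinv hk
    have h3 := hWA (n - k)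
    have h4 := norm_pos_iff.2 (hW0 (n - k))
    by_contra! hle
    nlinarith
  -- If k ≥ K, then |W_k| ≤ |A q^K| < 1/R, and the partner W_{n-k} = 1/W_k would lie outside the
  -- large circle.
  have hkK {k : ℕ} (hk : k ≤ n) : k < K := by
    by_contra! hle
    have h1 := h.main_pow
    rw [a0, norm_mul, norm_mul, norm_pow, Complex.norm_real, Real.norm_of_nonneg hR.le] at h1
    have h2 := hWinv hk
    have h3 := hWR (n - k)
    have h4 : ‖W k‖ ≤ ‖A‖ * ‖q‖ ^ K := by
      simp only [hW]
      rw [norm_mul, norm_pow]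
      exact mul_le_mul_of_nonneg_left (pow_le_pow_of_le_one (norm_nonneg _) hq.le hle)
        (norm_nonneg _)
    have h5 := norm_pos_iff.2 (hW0 k)
    nlinarith
  have hgen {w : ℂ} {m : ℤ} (hw : w ≠ 0) (hwm : w ^ 2 = q ^ m) {i : PoleIndex} (hwr : r ≤ ‖w‖)
      (hi : pqPoch (innerArg q y w i) (nome y.2) q = 0) : i = Sum.inl 2 := by
    by_contra hne
    obtain ⟨k, -, hk⟩ := exists_innerArg_mul_pow hq hr h hwr hi
    exact innerArg_mul_pow_ne_one hq0 hb hg hn1 hw hwm hne k hk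
  -- common zeros
  have hcommon {w : ℂ} (hwr : r ≤ ‖w‖) (hwR : ‖w‖ ≤ R) (h1 : w ∈ innerZeros q y)
      (h2 : w ∈ outerZeros q y) : ∃ k ∈ Finset.range (n + 1), w = W k := by
    obtain ⟨hw, i, hi⟩ := h1
    obtain ⟨-, j, hj⟩ := h2
    obtain ⟨rfl, l, -, hl⟩ := exists_outerArg_mul_pow hq h hwR hj
    rw [a0] at hl
    have hwm : w ^ 2 = q ^ ((n : ℤ) + 0 - (2 * l : ℕ)) := by
      refine eq_zpow_of_mul_pow_eq hq0 (j := 0) ?_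
      rw [zpow_natCast]
      have h3 : A ^ 2 * (w ^ 2 * q ^ (2 * l)) = 1 := by
        rw [pow_mul']; linear_combination (A * w * q ^ l + 1) * hl
      refine mul_left_cancel₀ (pow_ne_zero 2 hA0) ?_
      rw [h3, pow_zero, mul_one, hAn]
    obtain rfl := hgen hw hwm hwr hi
    obtain ⟨k, -, hk⟩ := exists_innerArg_mul_pow hq hr h hwr hi
    rw [a2] at hk
    have hwk : w = W k := by field_simp at hk; simp only [hW]; linear_combination -hk
    have hkl : q ^ (k + l) = q ^ n := by
      refine mul_left_cancel₀ (pow_ne_zero 2 hA0) ?_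
      rw [hAn, ← hl, hwk]; simp only [hW]; ring
    have := pow_injective_of_norm_lt hq0 hq hkl
    exact ⟨k, Finset.mem_range.2 (by omega), hwk⟩
  obtain ⟨c1, c2, c3, c4⟩ := differentiableOn_reg hq K h.regular
  have hlin : DifferentiableOn ℂ (fun w : ℂ => 2 * Real.pi * Complex.I * w) {0}ᶜ := by fun_prop
  set FU : ℂ → ℂ := fun w => regNumU q K y w / (regDenU q K y w * (2 * Real.pi * Complex.I * w))
    with hFU
  set FV : ℂ → ℂ := fun w => regNumV q K y w / (regDenV q K y w * (2 * Real.pi * Complex.I * w))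
    with hFV
  have hUV {w : ℂ} (hw : w ≠ 0) (h1 : w ∉ innerZeros q y) (h2 : w ∉ outerZeros q y) :
      FV w = -FU w := by
    have := bezout_scaledIntegrand hq K h.regular hw h1 h2
    rw [prod_qFin_cross h.regular hw, (qFin_eq_zero_iff (x := y.2.2.1 * q ^ 2 /
      (y.1.1 * y.1.2.1) ^ 2)).2 ⟨n, hnK, by simpa [hy] using hn1⟩, mul_zero, zero_mul, zero_mul]
      at this
    have hd (N D : ℂ) : N / (D * (2 * Real.pi * Complex.I * w)) =
        N / D / (2 * Real.pi * Complex.I * w) := (div_div _ _ _).symm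
    simp only [hFU, hFV]
    rw [hd, hd, ← neg_div]
    congr 1
    linear_combination -this
  -- F equals the V-integrand away from the inner zeros and minus the U-integrand away from the
  -- outer zeros. Between the circles its only possible singularities are therefore the common
  -- zeros.
  set F : ℂ → ℂ := fun w => if w ∈ innerZeros q y then -FU w else FV w with hF
  have hFV' {w : ℂ} (h1 : w ∉ innerZeros q y) : F w = FV w := if_neg h1
  have hFU' {w : ℂ} (hw : w ≠ 0) (h2 : w ∉ outerZeros q y) : F w = -FU w := by
    by_cases h1 : w ∈ innerZeros q y
    · exact if_pos h1
    · rw [hFV' h1, hUV hw h1 h2]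
  have hn0 {w : ℂ} (h1 : r ≤ ‖w‖) : w ≠ 0 := norm_pos_iff.1 (hr.trans_le h1)
  have hdiff (w : ℂ) (h1 : r ≤ ‖w‖) (h2 : ‖w‖ ≤ R) (h3 : ∀ k ∈ Finset.range (n + 1), w ≠ W k) :
      DifferentiableAt ℂ F w := by
    have hw := hn0 h1
    have hnh : ({0}ᶜ : Set ℂ) ∈ 𝓝 w := isOpen_compl_singleton.mem_nhds hw
    by_cases h4 : w ∈ outerZeros q y
    · have h5 : w ∉ innerZeros q y := fun h5 => by
        obtain ⟨k, hk, hk'⟩ := hcommon h1 h2 h5 h4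
        exact h3 k hk hk'
      refine DifferentiableAt.congr_of_eventuallyEq (f := FV) ?_
        ((eventually_notMem_innerZeros hq h.regular hw h5).mono fun z hz => hFV' hz)
      refine (c2.differentiableAt hnh).div ((c4.differentiableAt hnh).mul
        (hlin.differentiableAt hnh)) (mul_ne_zero (fun h0 => ?_) (two_pi_I_mul_ne_zero hw))
      rcases regDenV_eq_zero hq hr hrR h hw h0 with h6 | h6
      exacts [h5 h6.2, absurd h6.1 (not_lt.2 h2)]
    · refine DifferentiableAt.congr_of_eventuallyEq (f := fun w => -FU w) ?_
        (((eventually_notMem_outerZeros hq h.regular hw h4).and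
          (eventually_ne_nhds hw)).mono fun z hz => hFU' hz.2 hz.1)
      refine ((c1.differentiableAt hnh).div ((c3.differentiableAt hnh).mul
        (hlin.differentiableAt hnh)) (mul_ne_zero (fun h0 => ?_) (two_pi_I_mul_ne_zero hw))).neg
      rcases regDenU_eq_zero hq hr hrR h hw h0 with h6 | h6
      exacts [absurd h6.1 (not_lt.2 h1), h4 h6.2]
  -- the residues
  set P : ℂ := ∏ i ∈ {Sum.inl 2}ᶜ \ {Sum.inl 0},
    qFin q (innerArg q y 1 i * outerArg q y 1 mainOuter) (2 * K) with hP
  set g : ℕ → ℂ := fun k => qFinErase q (q ^ k)⁻¹ K k * pqTail (nome y.2) q K (q ^ k)⁻¹ with hgdef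
  set C : ℂ := P * qFinErase q (q ^ n)⁻¹ (2 * K) n / (2 * Real.pi * Complex.I) with hC
  set ρ : ℕ → ℂ := fun k => C / (g k * g (n - k)) * (fullNumer q y (W k) / restDenom q y (W k))
    with hρdef
  have hrest {k : ℕ} (hk : k ≤ n) : restDenom q y (W k) ≠ 0 := by
    refine mul_ne_zero (Finset.prod_ne_zero_iff.2 fun i hi h0 => ?_)
      (Finset.prod_ne_zero_iff.2 fun i hi h0 => ?_)
    · exact (by simpa using hi : i ≠ Sum.inl 2) (hgen (hW0 k) (hW2 k) (hWr hk).le h0)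
    · exact (by simpa using hi : i ≠ mainOuter) (exists_outerArg_mul_pow hq h (hWR k).le h0).1
  have hres : ∀ k ∈ Finset.range (n + 1),
      Tendsto (fun w => (w - W k) * F w) (𝓝[≠] W k) (𝓝 (ρ k)) := by
    intro k hk
    have hk : k ≤ n := Nat.lt_succ_iff.1 (Finset.mem_range.1 hk)
    have hqk : q ^ k ≠ 0 := pow_ne_zero k hq0
    have hqn : q ^ (n - k) ≠ 0 := pow_ne_zero _ hq0
    have α2 : innerArg q y (W k) (Sum.inl 2) = (q ^ k)⁻¹ := by
      rw [a2]; simp only [hW]; field_simp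
    have hAk : A * W k * q ^ (n - k) = 1 := by
      have := hWW hk
      simp only [hW] at this ⊢
      linear_combination this
    have β0 : outerArg q y (W k) mainOuter = (q ^ (n - k))⁻¹ := by
      rw [a0]; exact eq_inv_of_mul_eq_one_left hAk
    -- The denominator of the V-integrand without its simple factor w - W_k.
    set Y : ℂ → ℂ := fun w => qFinErase q (A / w) K k * pqTail (nome y.2) q K (A / w) *
      ((∏ i ∈ {Sum.inl 2}ᶜ, pqPoch (innerArg q y w i) (nome y.2) q) *
      (pqTail (nome y.2) q K (outerArg q y w mainOuter) *
      ∏ i ∈ {mainOuter}ᶜ, pqPoch (outerArg q y w i) (nome y.2) q)) * (2 * Real.pi * Complex.I)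
      with hY
    have hDY {w : ℂ} (hw : w ≠ 0) : regDenV q K y w * (2 * Real.pi * Complex.I * w) =
        (w - W k) * Y w := by
      have e1 : (1 - A / w * q ^ k) * w = w - W k := by simp only [hW]; field_simp
      rw [regDenV, ← Finset.prod_mul_prod_compl {Sum.inl 2}, Finset.prod_singleton, a2,
        pqPoch_eq_qFin_mul hp hq _ K, qFin_eq_mul_erase q (A / w) (hkK hk), hY, ← e1]
      ring
    have hYk : Y (W k) = g k * pqTail (nome y.2) q K (q ^ (n - k))⁻¹ * restDenom q y (W k) *
        (2 * Real.pi * Complex.I) := by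
      simp only [hY, hgdef, restDenom]
      rw [β0, ← a2, α2]; ring
    have hE {k : ℕ} (N : ℕ) : qFinErase q (q ^ k)⁻¹ N k ≠ 0 :=
      qFinErase_ne_zero hq0 hq (inv_mul_cancel₀ (pow_ne_zero k hq0))
    have hT2 : pqTail (nome y.2) q K (q ^ (n - k))⁻¹ ≠ 0 := by
      rw [← β0]
      have := norm_outerArg_le (q := q) (y := y) (hWR k).le mainOuter
      exact pqTail_ne_zero hp hq (norm_mul_le_of_le this h.main_pow)
        (norm_mul_le_of_le this h.main_nome)
    have hT1 : pqTail (nome y.2) q K (q ^ k)⁻¹ ≠ 0 := by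
      rw [← α2]
      have := norm_innerArg_le (q := q) (y := y) hr (hWr hk).le (Sum.inl 2)
      exact pqTail_ne_zero hp hq (norm_mul_le_of_le this (h.inner_pow _))
        (norm_mul_le_of_le this (h.inner_nome _))
    have hY0 : Y (W k) ≠ 0 := by
      rw [hYk]
      exact mul_ne_zero (mul_ne_zero (mul_ne_zero (mul_ne_zero (hE K) hT1) hT2) (hrest hk))
        Complex.two_pi_I_ne_zero
    have hpt : Continuous fun x => pqTail (nome y.2) q K x := by
      have h1 := (differentiable_qPoch hq).continuous
      have h2 := (differentiable_pqPoch hp hq).continuous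
      unfold pqTail
      exact (h1.comp (by fun_prop)).mul (h2.comp (by fun_prop))
    have hYc : ContinuousAt Y (W k) := by
      have hdiv : ContinuousAt (fun w => A / w) (W k) := by
        have := hW0 k
        fun_prop (disch := assumption)
      have hb' : ContinuousAt (fun w => outerArg q y w mainOuter) (W k) := by
        simp only [a0]; fun_prop
      exact ((((continuous_qFinErase q K k).continuousAt.comp hdiv).mul
        (hpt.continuousAt.comp hdiv)).mul ((continuousAt_prod_inner hq h.regular (hW0 k) _).mul
        ((hpt.continuousAt.comp hb').mul
        (continuousAt_prod_outer hq h.regular (hW0 k) _)))).mul continuousAt_const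
    -- Inserting the value of V turns the residue into a constant, symmetric under k ↔ n - k, times
    -- the ratio of `fullNumer` to `restDenom`.
    have hρk : ρ k = regNumV q K y (W k) / Y (W k) := by
      have hbz := bezoutV_mul_erase hq0 K (innerArg q y (W k)) (i := Sum.inl 2) (k := k)
        (l := n - k) (by rw [α2, inv_mul_cancel₀ hqk]) (hkK hk) (hkK (Nat.sub_le n k))
        (outerArg q y (W k) mainOuter) (by rw [a0, hAk])
      have hx : extraArg q y (W k) = innerArg q y (W k) (Sum.inl 0) *
          outerArg q y (W k) mainOuter := by
        have := hW0 k
        simp only [extraArg, innerArg, outerArg, mainOuter, Sum.elim_inl, Matrix.cons_val_zero, hy]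
        field_simp
      have hαβ : innerArg q y (W k) (Sum.inl 2) * outerArg q y (W k) mainOuter = (q ^ n)⁻¹ := by
        rw [α2, β0, ← mul_inv, ← pow_add, Nat.add_sub_of_le hk]
      have hPk : ∏ i ∈ {Sum.inl 2}ᶜ, qFin q (innerArg q y (W k) i *
          outerArg q y (W k) mainOuter) (2 * K) = qFin q (extraArg q y (W k)) (2 * K) * P := by
        rw [← Finset.mul_prod_erase _ _ (show Sum.inl 0 ∈ ({Sum.inl 2}ᶜ : Finset PoleIndex) by simp),
          hx, hP, Finset.sdiff_singleton_eq_erase]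
        congr 1
        refine Finset.prod_congr rfl fun i hi => ?_
        congr 1
        have := hW0 k
        rcases i with i | i | i
        · fin_cases i
          · simp at hi
          · simp only [innerArg, outerArg, mainOuter, Sum.elim_inl, Fin.mk_one, Matrix.cons_val, hy]
            field_simp
          · simp at hi
        · simp only [innerArg, outerArg, mainOuter, Sum.elim_inl, Sum.elim_inr, Matrix.cons_val, hy]
          field_simp
        · have hui : u i ≠ 0 := hg.snd_ne i
          simp only [innerArg, outerArg, mainOuter, Sum.elim_inl, Sum.elim_inr, Matrix.cons_val, hy]
          field_simp
      rw [hαβ, hPk, Nat.add_sub_of_le hk, β0] at hbz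
      have hr0 := hrest hk
      simp only [hρdef, hC]
      rw [hYk, regNumV, regNum, fullNumer, pqPoch_eq_qFin_mul hp hq (extraArg q y (W k)) (2 * K)]
      simp only [hgdef]
      have e1 : bezoutV q K (innerArg q y (W k), outerArg q y (W k) mainOuter) =
          qFin q (extraArg q y (W k)) (2 * K) * P * qFinErase q (q ^ n)⁻¹ (2 * K) n /
            qFinErase q (q ^ (n - k))⁻¹ K (n - k) := by
        rw [eq_div_iff (hE K), hbz, β0]
      rw [e1]
      have h1 := hE (k := k) K
      have h2 := hE (k := n - k) K
      generalize qFinErase q (q ^ k)⁻¹ K k = x1 at *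
      generalize qFinErase q (q ^ (n - k))⁻¹ K (n - k) = x2 at *
      generalize pqTail (nome y.2) q K (q ^ k)⁻¹ = x3 at *
      generalize pqTail (nome y.2) q K (q ^ (n - k))⁻¹ = x4 at *
      generalize restDenom q y (W k) = x5 at *
      have := Complex.two_pi_I_ne_zero
      generalize 2 * (Real.pi : ℂ) * Complex.I = x6 at *
      field_simp
    rw [hρk]
    have hNc : ContinuousAt (regNumV q K y) (W k) :=
      (c2.differentiableAt (isOpen_compl_singleton.mem_nhds (hW0 k))).continuousAt
    refine ((hNc.div hYc hY0).mono_left nhdsWithin_le_nhds).congr' ?_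
    filter_upwards [(hYc.eventually_ne hY0).filter_mono nhdsWithin_le_nhds,
      (eventually_ne_nhds (hW0 k)).filter_mono nhdsWithin_le_nhds, self_mem_nhdsWithin]
      with w h1 h2 h3
    have h4 : w - W k ≠ 0 := sub_ne_zero.2 h3
    have h5 : w ∉ innerZeros q y := by
      rintro ⟨-, i, hi⟩
      have h6 := hDY h2
      rw [regDenV, Finset.prod_eq_zero (Finset.mem_univ i) hi, zero_mul, zero_mul] at h6
      exact mul_ne_zero h4 h1 h6.symm
    rw [hFV' h5]
    simp only [hFV, Pi.div_apply]
    rw [hDY h2]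
    field_simp
  have hinj : Set.InjOn W (Finset.range (n + 1)) := fun k _ l _ hkl =>
    pow_injective_of_norm_lt hq0 hq (mul_left_cancel₀ hA0 hkl)
  have key := circleIntegral_sub_circleIntegral_eq_sum hr hrR hinj
    (fun k hk => hWr (Nat.lt_succ_iff.1 (Finset.mem_range.1 hk))) (fun k _ => hWR k) hdiff hres
  -- Reversing the order of summation replaces W_k by its inverse, which flips the sign of every
  -- term; the sum equals its own negative.
  have hsum : ∑ k ∈ Finset.range (n + 1), ρ k = 0 := by
    have h1 := Finset.sum_range_reflect ρ (n + 1)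
    have h2 : ∑ k ∈ Finset.range (n + 1), ρ (n + 1 - 1 - k) = -∑ k ∈ Finset.range (n + 1), ρ k := by
      rw [← Finset.sum_neg_distrib]
      refine Finset.sum_congr rfl fun k hk => ?_
      have hk : k ≤ n := Nat.lt_succ_iff.1 (Finset.mem_range.1 hk)
      have hnk : n - (n - k) = k := by omega
      have hinv : W (n - k) = (W k)⁻¹ := eq_inv_of_mul_eq_one_right (hWW hk)
      have h3 := fullNumer_inv_mul_restDenom hq0 hq (by simpa [nome, hy] using hp) hb ha
        h.regular.2.2.1 hef (hW0 k) (hW2 k)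
      rw [← hinv] at h3
      have h4 : fullNumer q y (W (n - k)) / restDenom q y (W (n - k)) =
          -(fullNumer q y (W k) / restDenom q y (W k)) := by
        have h5 := hrest hk
        have h6 := hrest (Nat.sub_le n k)
        field_simp
        linear_combination h3
      simp only [hρdef, Nat.add_sub_cancel]
      rw [hnk, h4, mul_comm (g (n - k))]; ring
    rw [h2] at h1
    exact self_eq_neg.1 h1.symm
  rw [hsum, mul_zero, sub_eq_zero] at key
  have hcR : contourIntegral (circleCurve R) FV = ∮ w in C(0, R), F w := by
    rw [contourIntegral_circleCurve hR]
    refine circleIntegral.integral_congr hR.le fun w hw => ?_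
    have hw' : ‖w‖ = R := by simpa using hw
    refine (hFV' ?_).symm
    rintro ⟨-, i, hi⟩
    exact pqPoch_ne_zero_of_norm_lt hp hq
      ((norm_innerArg_le hR hw'.ge i).trans_lt (h.inner i)) hi
  have hcr : contourIntegral (circleCurve r) FU = -∮ w in C(0, r), F w := by
    rw [contourIntegral_circleCurve hr, ← neg_one_mul, ← circleIntegral.integral_const_mul]
    refine circleIntegral.integral_congr hr.le fun w hw => ?_
    have hw' : ‖w‖ = r := by simpa using hw
    rw [hFU' (hn0 hw'.ge), neg_one_mul, neg_neg]
    rintro ⟨-, i, hi⟩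
    obtain ⟨rfl, -⟩ := exists_outerArg_mul_pow hq h (hw'.le.trans hrR) hi
    exact pqPoch_ne_zero_of_norm_lt hp hq
      ((norm_outerArg_le hw'.le _).trans_lt h.main) hi
  rw [regIntegral, hcR, hcr, key, neg_add_cancel]

end
end EllipticBeta
end

noncomputable section
namespace EllipticBeta

/-! ### Zeros of the pole factor -/

section
variable {q : ℂ} {r R : ℝ} {K : ℕ} {η : Scales} {x : Params}

theorem exists_sq_eq_pow (hq : ‖q‖ < 1) {b : ℂ} (hb : b ≠ 0) {N : ℕ}
    (h : qPoch (-(q / b)) q * qPoch (q / b ^ 2) (q ^ 2) * qFin q (q / b) N = 0) :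
    ∃ j : ℕ, b ^ 2 = q ^ (j + 1) := by
  rcases mul_eq_zero.1 h with h | h
  · rcases mul_eq_zero.1 h with h | h
    · obtain ⟨k, hk⟩ := (qPoch_eq_zero_iff hq).1 h
      refine ⟨2 * k + 1, ?_⟩
      field_simp at hk
      have : b = -q ^ (k + 1) := by rw [pow_succ]; linear_combination -hk
      rw [this]; ring
    · obtain ⟨k, hk⟩ := (qPoch_eq_zero_iff (norm_sq_lt_one hq)).1 h
      refine ⟨2 * k, ?_⟩
      field_simp at hk
      rw [← hk]; ring
  · obtain ⟨k, -, hk⟩ := qFin_eq_zero_iff.1 h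
    refine ⟨2 * k + 1, ?_⟩
    field_simp at hk
    rw [← hk]; ring

theorem poleFactor_eq (y : Params × Scales) : poleFactor q K y =
    qPoch (-(q / y.1.1)) q * qPoch (q / y.1.1 ^ 2) (q ^ 2) * qFin q (q / y.1.1) (2 * K) *
      qFin q (y.2.2.1 * q ^ 2 / (y.1.1 * y.1.2.1) ^ 2) (2 * K) := by
  rw [poleFactor, singFactor]; ring

theorem IsGood.poleFactor_ne_zero (hq : ‖q‖ < 1) (h : IsGood q η x) (K : ℕ) :
    poleFactor q K (x, η) ≠ 0 := by
  rw [poleFactor_eq]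
  refine mul_ne_zero (fun h0 => ?_) fun h0 => ?_
  · obtain ⟨j, hj⟩ := exists_sq_eq_pow hq h.ne_zero.1 h0
    exact h.sq_ne (j + 1) (by rw [hj]; norm_cast)
  · obtain ⟨k, -, hk⟩ := qFin_eq_zero_iff.1 h0
    refine h.sq_mul_ne (-(k + 2 : ℕ)) ?_
    rw [zpow_neg, zpow_natCast]
    exact eq_inv_of_mul_eq_one_left (by rw [← hk]; ring)

theorem IsGood.theta_ne_zero (hq0 : q ≠ 0) (hq : ‖q‖ < 1) (h : IsGood q η x) :
    theta x.1 q ≠ 0 := fun h0 => by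
  obtain ⟨n, hn⟩ := (theta_eq_zero_iff hq0 hq h.ne_zero.1).1 h0
  exact h.sq_ne (n + n) (by rw [zpow_add₀ hq0, ← hn]; ring)

theorem AvoidsRay.of_cons {n : ℕ} {p a : ℂ} {u : Fin n → ℂ}
    (h : AvoidsRay (Fin.cons a u : Fin (n + 1) → ℂ) p q) : AvoidsRay u p q :=
  fun i j => by simpa using h i.succ j.succ

theorem IsGood.mem_ellGeneric (hq0 : q ≠ 0) (hq : ‖q‖ < 1) (hη : IsProper η) (h : IsGood q η x) :
    (x.1, tVec η x) ∈ ellGeneric (nome η) q :=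
  AvoidsRay.mem_ellGeneric h.avoids.of_cons hη.nome_ne hq0 hη.norm_lt hq h.ne_zero.1
    (tVec_ne_zero hη h.ne_zero)

theorem IsGood.poleFactor_mul_eq (hq0 : q ≠ 0) (hq : ‖q‖ < 1) (hr : 0 < r) (hrR : r ≤ R)
    (hη : IsProper η) (h : IsAdmissible q r R K (x, η)) (hx : IsGood q η x) :
    poleFactor q K (x, η) * (ellBeta 5 (ellParams x.1 (tVec η x) (nome η) q) (nome η) q /
      ellDenom x.1 (tVec η x) (nome η) q) = regE q r R K (x, η) := by
  have hu : ∀ i, poleVec q η x i ≠ 0 := Fin.cases (mul_ne_zero hx.ne_zero.2.1 hη.s_ne)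
    (ellParams_ne_zero hx.ne_zero.1 (tVec_ne_zero hη hx.ne_zero) hη.nome_ne hq0)
  obtain ⟨γ, hγ, h0⟩ := exists_contour_of_star hη.nome_ne hq0 hη.norm_lt hq hu hx.avoids
  exact EllipticBeta.poleFactor_mul_eq hq0 hq hr hrR hη h (hx.theta_ne_zero hq0 hq)
    (hx.mem_ellGeneric hq0 hq hη) hγ h0

/-- The elliptic hypergeometric integral at generic parameters. -/
def genericE (q : ℂ) (η : Scales) (x : Params) : ℂ :=
  ellBeta 5 (ellParams x.1 (tVec η x) (nome η) q) (nome η) q / ellDenom x.1 (tVec η x) (nome η) q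

theorem continuous_tVec (η : Scales) : Continuous (tVec η) := by
  refine continuous_pi fun i => ?_
  refine Fin.cases ?_ (fun r => ?_) i
  · simp only [tVec_zero]; fun_prop
  · simp only [tVec_succ]; fun_prop

theorem continuousAt_genericE (hq0 : q ≠ 0) (hq : ‖q‖ < 1) (hη : IsProper η)
    (hg : (x.1, tVec η x) ∈ ellGeneric (nome η) q) : ContinuousAt (genericE q η) x := by
  have hc : Continuous fun x : Params => (x.1, tVec η x) :=
    continuous_fst.prodMk (continuous_tVec η)
  exact ContinuousAt.comp (f := fun x : Params => (x.1, tVec η x))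
    ((continuousOn_ellBeta_div hη.nome_ne hq0 hη.norm_lt hq).continuousAt
      ((isOpen_ellGeneric hη.nome_ne hq0 hη.norm_lt hq).mem_nhds hg)) hc.continuousAt

theorem eventually_mem_ellGeneric (hq0 : q ≠ 0) (hq : ‖q‖ < 1) (hη : IsProper η)
    (hg : (x.1, tVec η x) ∈ ellGeneric (nome η) q) :
    ∀ᶠ x' : Params in 𝓝 x, (x'.1, tVec η x') ∈ ellGeneric (nome η) q :=
  (continuous_fst.prodMk (continuous_tVec η)).continuousAt.eventually_mem
    ((isOpen_ellGeneric hη.nome_ne hq0 hη.norm_lt hq).mem_nhds hg)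

theorem eq_of_frequently_eq {X Y : Type*} [TopologicalSpace X] [TopologicalSpace Y] [T2Space Y]
    {f g : X → Y} {x : X} (hf : ContinuousAt f x) (hg : ContinuousAt g x)
    (h : ∃ᶠ x' in 𝓝 x, f x' = g x') : f x = g x :=
  tendsto_nhds_unique_of_frequently_eq hf hg h

theorem contDiffOn_poleFactor (hq : ‖q‖ < 1) (η : Scales) :
    ContDiffOn ℂ 1 (fun x => poleFactor q K (x, η)) {x | ((x, η), 1) ∈ regular} := by
  unfold poleFactor
  refine ContDiffOn.mul (ContDiffOn.mul ?_ ?_) (contDiffOn_singFactor η)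
  · exact (ContDiffOn.div (by fun_prop) (by fun_prop) fun z hz => hz.1).neg.qPoch hq
  · exact (ContDiffOn.div (by fun_prop) (by fun_prop) fun z hz => pow_ne_zero 2 hz.1).qPoch
      (norm_sq_lt_one hq)

theorem continuousOn_poleFactor (hq : ‖q‖ < 1) :
    ContinuousOn (poleFactor q K) {y | (y, 1) ∈ regular} := by
  unfold poleFactor
  refine ContinuousOn.mul (ContinuousOn.mul ?_ ?_) continuousOn_singFactor
  · exact (ContinuousOn.div (by fun_prop) (by fun_prop) fun z hz => hz.1).neg.qPoch
      continuousOn_const fun _ _ => hq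
  · exact (ContinuousOn.div (by fun_prop) (by fun_prop) fun z hz => pow_ne_zero 2 hz.1).qPoch
      continuousOn_const fun _ _ => norm_sq_lt_one hq

theorem continuousAt_poleFactor (hq : ‖q‖ < 1) (hr : 0 < r) (hrR : r ≤ R)
    {y : Params × Scales} (h : IsAdmissible q r R K y) : ContinuousAt (poleFactor q K) y :=
  ((continuousOn_poleFactor hq).mono fun _ h => h.regular).continuousAt
    ((isOpen_isAdmissible hr hrR).mem_nhds h)

theorem continuousAt_regE (hq : ‖q‖ < 1) (hr : 0 < r) (hrR : r ≤ R)
    {y : Params × Scales} (h : IsAdmissible q r R K y) : ContinuousAt (regE q r R K) y :=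
  (continuousOn_regE hq hr hrR).continuousAt ((isOpen_isAdmissible hr hrR).mem_nhds h)

/-- The comparison via `thetaSplit` needs a contour that also respects the pole of φ. Good
parameters have one and are dense, and both sides are continuous at every generic parameter. -/
theorem poleFactor_mul_genericE (hq0 : q ≠ 0) (hq : ‖q‖ < 1) (hr : 0 < r) (hrR : r ≤ R)
    (hη : IsProper η) (h : IsAdmissible q r R K (x, η))
    (hg : (x.1, tVec η x) ∈ ellGeneric (nome η) q) :
    poleFactor q K (x, η) * genericE q η x = regE q r R K (x, η) := by
  have hc : ContinuousAt (fun x : Params => (x, η)) x := by fun_prop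
  have hx : x.IsNonzero := ⟨h.regular.1, h.regular.2.1, h.regular.2.2.1⟩
  refine eq_of_frequently_eq
    (f := fun x => poleFactor q K (x, η) * genericE q η x) (g := fun x => regE q r R K (x, η))
    ((ContinuousAt.comp (f := fun x : Params => (x, η)) (continuousAt_poleFactor hq hr hrR h)
      hc).mul (continuousAt_genericE hq0 hq hη hg))
    (ContinuousAt.comp (f := fun x : Params => (x, η)) (continuousAt_regE hq hr hrR h) hc) ?_
  exact ((frequently_isGood hq0 hη hx).and_eventually
    ((isOpen_setOf_isAdmissible hr hrR η).mem_nhds h)).mono fun x' hx' =>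
      hx'.1.poleFactor_mul_eq hq0 hq hr hrR hη hx'.2

/-! ### Continuation in `b` -/

/-- The continuation of the elliptic hypergeometric integral to a disc in `b`. -/
def extE (q : ℂ) (r R : ℝ) (K : ℕ) (c : ℂ) (ε : ℝ) (y : Params × Scales) : ℂ :=
  (2 * Real.pi * Complex.I)⁻¹ * ∮ β in C(c, ε),
    regE q r R K ((β, y.1.2), y.2) / poleFactor q K ((β, y.1.2), y.2) / (β - y.1.1)

/-- Parameters for which `extE` is the continuation. -/
structure IsLocal (q : ℂ) (r R : ℝ) (K : ℕ) (c : ℂ) (ε : ℝ) (y : Params × Scales) : Prop where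
  mem_ball : y.1.1 ∈ Metric.ball c ε
  admissible : ∀ β ∈ Metric.closedBall c ε, IsAdmissible q r R K ((β, y.1.2), y.2)
  pole : ∀ β ∈ Metric.sphere c ε, poleFactor q K ((β, y.1.2), y.2) ≠ 0
  nome : ∀ β ∈ Metric.closedBall c ε, ‖nome y.2 * q‖ < ‖β‖

variable {c : ℂ} {ε : ℝ} {y : Params × Scales}

theorem IsLocal.self (h : IsLocal q r R K c ε y) : IsAdmissible q r R K y :=
  h.admissible y.1.1 (Metric.ball_subset_closedBall h.mem_ball)

/-- All conditions are open and are imposed on a compact disc or circle. -/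
theorem isOpen_isLocal (hq : ‖q‖ < 1) (hr : 0 < r) (hrR : r ≤ R) :
    IsOpen {y | IsLocal q r R K c ε y} := by
  rw [isOpen_iff_mem_nhds]
  intro y h
  have hcont (β : ℂ) : Continuous fun z : (Params × Scales) × ℂ => (((z.2, z.1.1.2), z.1.2) :
    Params × Scales) := by fun_prop
  have e1 : ∀ᶠ y' in 𝓝 y, ∀ β ∈ Metric.closedBall c ε, IsAdmissible q r R K ((β, y'.1.2), y'.2) := by
    refine (isCompact_closedBall c ε).eventually_forall_of_forall_eventually fun β hβ => ?_
    exact (hcont β).continuousAt.eventually_mem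
      ((isOpen_isAdmissible hr hrR).mem_nhds (h.admissible β hβ))
  have e2 : ∀ᶠ y' in 𝓝 y, ∀ β ∈ Metric.sphere c ε, poleFactor q K ((β, y'.1.2), y'.2) ≠ 0 := by
    refine (isCompact_sphere c ε).eventually_forall_of_forall_eventually fun β hβ => ?_
    exact ContinuousAt.eventually_ne (ContinuousAt.comp
      (f := fun z : (Params × Scales) × ℂ => (((z.2, z.1.1.2), z.1.2) : Params × Scales))
      (continuousAt_poleFactor hq hr hrR
      (h.admissible β (Metric.sphere_subset_closedBall hβ))) (hcont β).continuousAt) (h.pole β hβ)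
  have e3 : ∀ᶠ y' in 𝓝 y, ∀ β ∈ Metric.closedBall c ε, ‖EllipticBeta.nome y'.2 * q‖ < ‖β‖ := by
    refine (isCompact_closedBall c ε).eventually_forall_of_forall_eventually fun β hβ => ?_
    have c1 : Continuous fun z : (Params × Scales) × ℂ => ‖EllipticBeta.nome z.1.2 * q‖ :=
      ((continuous_nome.comp (continuous_snd.comp continuous_fst)).mul continuous_const).norm
    exact c1.continuousAt.eventually_lt continuous_snd.norm.continuousAt (h.nome β hβ)
  have e4 : ∀ᶠ y' in 𝓝 y, y'.1.1 ∈ Metric.ball c ε :=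
    (continuous_fst.comp continuous_fst).continuousAt.eventually_mem
      (Metric.isOpen_ball.mem_nhds h.mem_ball)
  filter_upwards [e1, e2, e3, e4] with y' h1 h2 h3 h4
  exact ⟨h4, h1, h2, h3⟩

theorem extE_eq_integral (y : Params × Scales) : extE q r R K c ε y =
    (2 * Real.pi * Complex.I)⁻¹ * ∫ θ in (0 : ℝ)..2 * Real.pi,
      regE q r R K ((circleMap c ε θ, y.1.2), y.2) /
        poleFactor q K ((circleMap c ε θ, y.1.2), y.2) / (circleMap c ε θ - y.1.1) *
        (circleMap 0 ε θ * Complex.I) := by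
  rw [extE, circleIntegral]
  congr 1
  refine intervalIntegral.integral_congr fun θ _ => ?_
  simp only [deriv_circleMap, smul_eq_mul]
  ring

theorem IsLocal.circleMap_ne (h : IsLocal q r R K c ε y) (θ : ℝ) : circleMap c ε θ - y.1.1 ≠ 0 :=
  sub_ne_zero.2 fun h0 => by
    have := h.mem_ball
    rw [← h0] at this
    have hε : 0 < ε := dist_nonneg.trans_lt this
    simp [circleMap, abs_of_pos hε] at this

theorem IsLocal.pos (h : IsLocal q r R K c ε y) : 0 < ε := dist_nonneg.trans_lt h.mem_ball

theorem continuousOn_extE (hq : ‖q‖ < 1) (hr : 0 < r) (hrR : r ≤ R) :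
    ContinuousOn (extE q r R K c ε) {y | IsLocal q r R K c ε y} := by
  rw [show extE q r R K c ε = fun y => _ from funext extE_eq_integral]
  refine continuousOn_const.mul (continuousOn_integral_curve (F := fun z : (Params × Scales) × ℂ =>
    regE q r R K ((z.2, z.1.1.2), z.1.2) / poleFactor q K ((z.2, z.1.1.2), z.1.2) /
      (z.2 - z.1.1.1)) (S := {z | IsAdmissible q r R K ((z.2, z.1.1.2), z.1.2) ∧
        poleFactor q K ((z.2, z.1.1.2), z.1.2) ≠ 0 ∧ z.2 - z.1.1.1 ≠ 0})
    Real.two_pi_pos.le (continuous_circleMap c ε)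
    ((continuous_circleMap 0 ε).mul continuous_const) ?_ fun y hy θ _ =>
      show _ ∧ _ ∧ _ from ⟨hy.admissible _ (circleMap_mem_closedBall _ hy.pos.le _),
        hy.pole _ (circleMap_mem_sphere _ hy.pos.le _), hy.circleMap_ne θ⟩)
  have hc : Continuous fun z : (Params × Scales) × ℂ => (((z.2, z.1.1.2), z.1.2) :
    Params × Scales) := by fun_prop
  refine ContinuousOn.div (ContinuousOn.div ((continuousOn_regE hq hr hrR).comp hc.continuousOn
    fun z hz => hz.1) ((continuousOn_poleFactor hq).comp hc.continuousOn fun z hz => hz.1.regular)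
    fun z hz => hz.2.1) (by fun_prop) fun z hz => hz.2.2

theorem contDiffOn_extE (hq : ‖q‖ < 1) (hr : 0 < r) (hrR : r ≤ R) (hη : ‖nome η‖ < 1) :
    ContDiffOn ℂ 1 (fun x => extE q r R K c ε (x, η)) {x | IsLocal q r R K c ε (x, η)} := by
  simp only [extE_eq_integral]
  have hc : ContDiff ℂ 1 fun z : Params × ℂ => ((z.2, z.1.2) : Params) := by fun_prop
  have hO : IsOpen {z : Params × ℂ | IsAdmissible q r R K ((z.2, z.1.2), η)} :=
    (isOpen_setOf_isAdmissible hr hrR η).preimage hc.continuous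
  have h2 : ContDiffOn ℂ 1 (fun z : Params × ℂ => poleFactor q K ((z.2, z.1.2), η))
      {z : Params × ℂ | IsAdmissible q r R K ((z.2, z.1.2), η)} :=
    (contDiffOn_poleFactor hq η).comp hc.contDiffOn fun z (hz : IsAdmissible _ _ _ _ _) => hz.regular
  refine contDiffOn_const.mul (contDiffOn_integral_curve (F := fun z : Params × ℂ =>
    regE q r R K ((z.2, z.1.2), η) / poleFactor q K ((z.2, z.1.2), η) /
      (z.2 - z.1.1)) (S := {z | IsAdmissible q r R K ((z.2, z.1.2), η)} ∩
        {z | poleFactor q K ((z.2, z.1.2), η) ≠ 0} ∩ {z | z.2 - z.1.1 ≠ 0})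
    Real.two_pi_pos.le (continuous_circleMap c ε)
    ((continuous_circleMap 0 ε).mul continuous_const) ?_ ?_ ?_ fun y hy θ _ =>
      ⟨⟨hy.admissible _ (circleMap_mem_closedBall _ hy.pos.le _),
        hy.pole _ (circleMap_mem_sphere _ hy.pos.le _)⟩, hy.circleMap_ne θ⟩)
  · exact (h2.continuousOn.isOpen_inter_preimage hO isOpen_compl_singleton).inter
      (isOpen_ne_fun (by fun_prop) continuous_const)
  · refine ContDiffOn.div (ContDiffOn.div ((contDiffOn_regE hq hr hrR hη).comp hc.contDiffOn
      fun z hz => hz.1.1) (h2.mono fun z hz => hz.1.1) fun z hz => hz.1.2) (by fun_prop)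
      fun z hz => hz.2
  · exact (isOpen_isLocal hq hr hrR).preimage (by fun_prop : Continuous fun x : Params => (x, η))

end
end EllipticBeta
end

noncomputable section
namespace EllipticBeta

/-! ### The continuation agrees with the integral -/

theorem tendsto_div_of_simple_zero {N M h : ℂ → ℂ} {z : ℂ} (hN : DifferentiableAt ℂ N z)
    (hN0 : N z = 0) (hh : ContinuousAt h z) (hh0 : h z ≠ 0)
    (hM : ∀ᶠ β in 𝓝[≠] z, M β = (β - z) * h β) :
    Tendsto (fun β => N β / M β) (𝓝[≠] z) (𝓝 (deriv N z / h z)) := by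
  refine (hN.hasDerivAt.tendsto_slope.div (hh.mono_left nhdsWithin_le_nhds) hh0).congr' ?_
  filter_upwards [hM] with β hβ
  simp only [Pi.div_apply]
  rw [slope_def_field, hN0, sub_zero, hβ, div_div]

section
variable {q : ℂ} {r R : ℝ} {K : ℕ} {η : Scales} {x : Params} {c : ℂ} {ε : ℝ} {y : ℂ × (Fin 3 → ℂ)}

/-- Either `c = 1`, or certain poles do not meet the disc. -/
def IsSmall (q : ℂ) (c : ℂ) (ε : ℝ) (y : Params × Scales) : Prop :=
  y.2.2.1 ≠ 1 → ∀ β ∈ Metric.closedBall c ε, ‖y.2.2.1 * q ^ 2 / (β * y.1.2.1) ^ 2‖ < 1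

theorem differentiableAt_of_admissible (hq : ‖q‖ < 1) (hr : 0 < r) (hrR : r ≤ R) {β : ℂ}
    (h : IsAdmissible q r R K ((β, y), η)) :
    DifferentiableAt ℂ (fun β => regE q r R K ((β, y), η)) β ∧
      DifferentiableAt ℂ (fun β => poleFactor q K ((β, y), η)) β := by
  have hd : DifferentiableAt ℂ (fun β : ℂ => ((β, y) : Params)) β := by fun_prop
  have hO := isOpen_setOf_isAdmissible (q := q) (K := K) hr hrR η
  constructor
  · exact DifferentiableAt.comp (g := fun x : Params => regE q r R K (x, η)) β
      (((contDiffOn_regE hq hr hrR h.nome_lt).differentiableOn one_ne_zero).differentiableAt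
        (hO.mem_nhds h)) hd
  · exact DifferentiableAt.comp (g := fun x : Params => poleFactor q K (x, η)) β
      ((((contDiffOn_poleFactor hq η).mono fun x (hx : IsAdmissible _ _ _ _ _) =>
        hx.regular).differentiableOn one_ne_zero).differentiableAt (hO.mem_nhds h)) hd

/-- The factor is analytic in b near the disc and nonzero on its boundary circle, so its zeros in
the disc are isolated. -/
theorem IsLocal.eventually_poleFactor_ne_zero (hq : ‖q‖ < 1) (hr : 0 < r) (hrR : r ≤ R)
    (h : IsLocal q r R K c ε (x, η)) {z : ℂ} (hz : z ∈ Metric.ball c ε) :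
    ∀ᶠ β in 𝓝[≠] z, poleFactor q K ((β, x.2), η) ≠ 0 := by
  set V : Set ℂ := {β | IsAdmissible q r R K ((β, x.2), η)}
  have hV : IsOpen V := (isOpen_isAdmissible hr hrR).preimage
    (by fun_prop : Continuous fun β : ℂ => (((β, x.2), η) : Params × Scales))
  have hball : Metric.closedBall c ε ⊆ V := fun β hβ => h.admissible β hβ
  have han : AnalyticOnNhd ℂ (fun β => poleFactor q K ((β, x.2), η)) (Metric.closedBall c ε) :=
    (DifferentiableOn.analyticOnNhd (fun β hβ => (differentiableAt_of_admissible hq hr hrR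
      hβ).2.differentiableWithinAt) hV).mono hball
  rcases (han z (Metric.ball_subset_closedBall hz)).eventually_eq_zero_or_eventually_ne_zero
    with h0 | h0
  · have := han.eqOn_zero_of_preconnected_of_eventuallyEq_zero
      (convex_closedBall c ε).isPreconnected (Metric.ball_subset_closedBall hz) h0
    have hs : circleMap c ε 0 ∈ Metric.sphere c ε := circleMap_mem_sphere _ h.pos.le _
    exact absurd (this (Metric.sphere_subset_closedBall hs)) (h.pole _ hs)
  · exact h0

/-- Near a zero at which the original integral is generic, the quotient is that integral, which is
continuous. -/
theorem exists_tendsto_of_sq_eq (hq0 : q ≠ 0) (hq : ‖q‖ < 1) (hr : 0 < r) (hrR : r ≤ R)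
    (hη : IsProper η) (h : IsLocal q r R K c ε (x, η)) {z : ℂ} (hz : z ∈ Metric.ball c ε)
    (hg : (z, tVec η (z, x.2)) ∈ ellGeneric (nome η) q) :
    ∃ L, Tendsto (fun β => regE q r R K ((β, x.2), η) / poleFactor q K ((β, x.2), η)) (𝓝[≠] z)
      (𝓝 L) := by
  refine ⟨genericE q η (z, x.2), ?_⟩
  have hc : ContinuousAt (fun β : ℂ => ((β, x.2) : Params)) z := by fun_prop
  refine ((ContinuousAt.comp (f := fun β : ℂ => ((β, x.2) : Params)) (continuousAt_genericE hq0 hq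
    hη hg) hc).mono_left nhdsWithin_le_nhds).congr' ?_
  have h1 : ∀ᶠ β in 𝓝 z, β ∈ Metric.ball c ε := Metric.isOpen_ball.mem_nhds hz
  filter_upwards [h.eventually_poleFactor_ne_zero hq hr hrR hz,
    (hc.eventually (eventually_mem_ellGeneric hq0 hq hη hg)).filter_mono nhdsWithin_le_nhds,
    h1.filter_mono nhdsWithin_le_nhds] with β h2 h3 h4
  rw [eq_div_iff h2, mul_comm]
  exact poleFactor_mul_genericE hq0 hq hr hrR hη
    (h.admissible β (Metric.ball_subset_closedBall h4)) h3

/-- The factor 1 - q^{n+2}/(βa)² equals (β-z)(β+z)/β², a simple zero, and genericity of a keeps the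
other factors of `poleFactor` away from zero. As the regularised integral vanishes at z, the
quotient stays finite. -/
theorem exists_tendsto_of_c_eq_one (hq0 : q ≠ 0) (hq : ‖q‖ < 1) (hr : 0 < r) (hrR : r ≤ R)
    (hη : IsProper η) (h : IsLocal q r R K c ε (x, η)) {z : ℂ} (hz : z ∈ Metric.ball c ε)
    (hc : η.2.1 = 1) (hg : IsGeneric q η.2.2.1 η.2.2.2 x.2) {n : ℕ} (hn : n < 2 * K)
    (hn1 : q ^ 2 / (z * x.2.1) ^ 2 * q ^ n = 1) :
    ∃ L, Tendsto (fun β => regE q r R K ((β, x.2), η) / poleFactor q K ((β, x.2), η)) (𝓝[≠] z)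
      (𝓝 L) := by
  have hadm := h.admissible z (Metric.ball_subset_closedBall hz)
  have hz0 : z ≠ 0 := hadm.regular.1
  have ha : x.2.1 ≠ 0 := hg.fst_ne
  have hza : q ^ 2 * q ^ n = z ^ 2 * x.2.1 ^ 2 := by field_simp at hn1; linear_combination hn1
  set g : ℂ → ℂ := fun β => qPoch (-(q / β)) q * qPoch (q / β ^ 2) (q ^ 2) *
    qFin q (q / β) (2 * K) with hgd
  have hg0 : g z ≠ 0 := fun h0 => by
    obtain ⟨j, hj⟩ := exists_sq_eq_pow hq hz0 h0
    refine hg.fst_sq ((0 : ℤ) + (n + 2 : ℕ) - (j + 1 : ℕ)) (eq_zpow_of_mul_pow_eq hq0 ?_)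
    rw [← hj, zpow_zero, one_mul, pow_add]
    linear_combination -hza
  have hdiv {m : ℕ} : ContinuousAt (fun β => q / β ^ m) z := by
    have := pow_ne_zero m hz0
    fun_prop (disch := assumption)
  have hd1 : ContinuousAt (fun β => q / β) z := by simpa using hdiv (m := 1)
  have hgc : ContinuousAt g z :=
    ((ContinuousAt.comp (f := fun β => -(q / β)) (g := fun x => qPoch x q)
      (differentiable_qPoch hq).continuous.continuousAt hd1.neg).mul
    (ContinuousAt.comp (f := fun β => q / β ^ 2) (g := fun x => qPoch x (q ^ 2))
      (differentiable_qPoch (norm_sq_lt_one hq)).continuous.continuousAt hdiv)).mul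
    (ContinuousAt.comp (f := fun β => q / β) (g := fun x => qFin q x (2 * K))
      (continuous_qFin _).continuousAt hd1)
  have hd2 : ContinuousAt (fun β => q ^ 2 / (β * x.2.1) ^ 2) z := by
    have := pow_ne_zero 2 (mul_ne_zero hz0 ha)
    fun_prop (disch := assumption)
  refine ⟨_, tendsto_div_of_simple_zero (h := fun β => g β * ((β + z) / β ^ 2 *
    qFinErase q (q ^ 2 / (β * x.2.1) ^ 2) (2 * K) n))
    (differentiableAt_of_admissible hq hr hrR hadm).1 ?_ ?_ ?_ ?_⟩
  · obtain ⟨b, a, u⟩ := x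
    obtain ⟨s, c, e, f⟩ := η
    obtain rfl : c = 1 := hc
    exact mul_eq_zero_of_right _ (regIntegral_eq_zero hq0 hq hr hrR hadm hη.mul_eq hg hn hn1)
  · refine hgc.mul (ContinuousAt.mul ?_ (ContinuousAt.comp
      (f := fun β => q ^ 2 / (β * x.2.1) ^ 2) (g := fun x => qFinErase q x (2 * K) n)
      (continuous_qFinErase q (2 * K) n).continuousAt hd2))
    have := pow_ne_zero 2 hz0
    fun_prop (disch := assumption)
  · refine mul_ne_zero hg0 (mul_ne_zero (div_ne_zero ?_ (pow_ne_zero 2 hz0))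
      (qFinErase_ne_zero hq0 hq hn1))
    rw [← two_mul]; exact mul_ne_zero two_ne_zero hz0
  · filter_upwards [(eventually_ne_nhds hz0).filter_mono nhdsWithin_le_nhds] with β hβ
    rw [poleFactor_eq]
    simp only [hc, one_mul, hgd]
    rw [qFin_eq_mul_erase q (q ^ 2 / (β * x.2.1) ^ 2) hn]
    have : 1 - q ^ 2 / (β * x.2.1) ^ 2 * q ^ n = (β - z) * ((β + z) / β ^ 2) := by
      field_simp
      linear_combination -hza
    rw [this]
    ring

/-- The two kinds of zeros of `poleFactor` are treated separately; the second kind does not occur in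
the disc unless c = 1. -/
theorem IsLocal.poleFactor_mul_extE_of_generic (hq0 : q ≠ 0) (hq : ‖q‖ < 1) (hr : 0 < r)
    (hrR : r ≤ R) (hη : IsProper η) (h : IsLocal q r R K c ε (x, η)) (hs : IsSmall q c ε (x, η))
    (hg : IsGeneric q η.2.2.1 η.2.2.2 x.2)
    (hell : ∀ b : ℂ, (∃ j : ℕ, b ^ 2 = q ^ (j + 1)) → ‖EllipticBeta.nome η * q‖ < ‖b‖ →
        (b, tVec η (b, x.2)) ∈ ellGeneric (EllipticBeta.nome η) q) :
    poleFactor q K (x, η) * extE q r R K c ε (x, η) = regE q r R K (x, η) := by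
  refine mul_cauchy_integral_div (N := fun β => regE q r R K ((β, x.2), η))
    (M := fun β => poleFactor q K ((β, x.2), η))
    (fun z hz => (differentiableAt_of_admissible hq hr hrR (h.admissible z hz)).1)
    (fun z hz => (differentiableAt_of_admissible hq hr hrR (h.admissible z hz)).2)
    (fun z hz => h.pole z hz) (fun z hz h0 => ⟨h.eventually_poleFactor_ne_zero hq hr hrR hz, ?_⟩)
    h.mem_ball
  have hzc := Metric.ball_subset_closedBall hz
  rw [poleFactor_eq] at h0
  rcases mul_eq_zero.1 h0 with h0 | h0
  · exact exists_tendsto_of_sq_eq hq0 hq hr hrR hη h hz (hell z (exists_sq_eq_pow hq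
      (h.admissible z hzc).regular.1 h0) (h.nome z hzc))
  · obtain ⟨n, hn, hn1⟩ := qFin_eq_zero_iff.1 h0
    have hc : η.2.1 = 1 := by
      by_contra hc
      have := hs hc z hzc
      have h2 := congrArg norm hn1
      rw [norm_mul, norm_pow, norm_one] at h2
      have h3 : ‖q‖ ^ n ≤ 1 := pow_le_one₀ (norm_nonneg _) hq.le
      exact absurd h2 (ne_of_lt ((mul_le_of_le_one_right (norm_nonneg _) h3).trans_lt this))
    refine exists_tendsto_of_c_eq_one hq0 hq hr hrR hη h hz hc hg hn ?_
    simpa [hc] using hn1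

theorem isOpen_isSmall (η : Scales) (hx0 : ∀ β ∈ Metric.closedBall c ε, β ≠ 0) (ha : x.2.1 ≠ 0)
    (hs : IsSmall q c ε (x, η)) : ∀ᶠ x' : Params in 𝓝 x, IsSmall q c ε (x', η) := by
  by_cases hc : η.2.1 = 1
  · exact Eventually.of_forall fun x' h => absurd hc h
  refine ((isCompact_closedBall c ε).eventually_forall_of_forall_eventually
    (P := fun x' β => ‖η.2.1 * q ^ 2 / (β * x'.2.1) ^ 2‖ < 1) fun β hβ => ?_).mono
    fun x' hx' _ => hx'
  have : ContinuousAt (fun z : Params × ℂ => ‖η.2.1 * q ^ 2 / (z.2 * z.1.2.1) ^ 2‖) (x, β) := by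
    have : ((x, β) : Params × ℂ).2 * (x, β).1.2.1 ≠ 0 := mul_ne_zero (hx0 β hβ) ha
    have := pow_ne_zero 2 this
    fun_prop (disch := assumption)
  exact this.eventually_lt_const (hs hc β hβ)

/-- Both sides are continuous in (a, u), so the genericity used to fill in the quotient can be
dropped. -/
theorem IsLocal.poleFactor_mul_extE (hq0 : q ≠ 0) (hq : ‖q‖ < 1) (hr : 0 < r)
    (hrR : r ≤ R) (hη : IsProper η) (h : IsLocal q r R K c ε (x, η)) (hs : IsSmall q c ε (x, η)) :
    poleFactor q K (x, η) * extE q r R K c ε (x, η) = regE q r R K (x, η) := by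
  have hadm := h.self
  have hx : x.IsNonzero := ⟨hadm.regular.1, hadm.regular.2.1, hadm.regular.2.2.1⟩
  have hc : Continuous fun y : ℂ × (Fin 3 → ℂ) => (((x.1, y), η) : Params × Scales) := by fun_prop
  have hcomp {F : Params × Scales → ℂ} (hF : ContinuousAt F (x, η)) :
      ContinuousAt (fun y : ℂ × (Fin 3 → ℂ) => F ((x.1, y), η)) x.2 :=
    ContinuousAt.comp (f := fun y : ℂ × (Fin 3 → ℂ) => (((x.1, y), η) : Params × Scales)) hF
      hc.continuousAt
  have hO := (isOpen_isLocal (q := q) (K := K) (c := c) (ε := ε) hq hr hrR).mem_nhds h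
  refine eq_of_frequently_eq (x := x.2) (f := fun y => poleFactor q K ((x.1, y), η) *
      extE q r R K c ε ((x.1, y), η)) (g := fun y => regE q r R K ((x.1, y), η))
    ((hcomp (continuousAt_poleFactor hq hr hrR hadm)).mul
      (hcomp ((continuousOn_extE hq hr hrR).continuousAt hO)))
    (hcomp (continuousAt_regE hq hr hrR hadm)) ?_
  have e1 : ∀ᶠ y in 𝓝 x.2, IsLocal q r R K c ε ((x.1, y), η) :=
    hc.continuousAt.eventually_mem hO
  have e2 : ∀ᶠ y in 𝓝 x.2, IsSmall q c ε ((x.1, y), η) :=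
    (by fun_prop : Continuous fun y : ℂ × (Fin 3 → ℂ) => ((x.1, y) : Params)).continuousAt.eventually
      (isOpen_isSmall η (fun β hβ => (h.admissible β hβ).regular.1) hx.2.1 hs)
  exact ((frequently_forall_mem_ellGeneric hq0 hq hη hx).and_eventually (e1.and e2)).mono
    fun y ⟨⟨h1, h2⟩, h3, h4⟩ => h3.poleFactor_mul_extE_of_generic hq0 hq hr hrR hη h4 h1 h2

/-- At good parameters `poleFactor` is nonzero and can be cancelled; density and continuity carry
the equality to all generic parameters. -/
theorem IsLocal.genericE_eq (hq0 : q ≠ 0) (hq : ‖q‖ < 1) (hr : 0 < r)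
    (hrR : r ≤ R) (hη : IsProper η) (h : IsLocal q r R K c ε (x, η)) (hs : IsSmall q c ε (x, η))
    (hg : (x.1, tVec η x) ∈ ellGeneric (EllipticBeta.nome η) q) :
    genericE q η x = extE q r R K c ε (x, η) := by
  have hadm := h.self
  have hx : x.IsNonzero := ⟨hadm.regular.1, hadm.regular.2.1, hadm.regular.2.2.1⟩
  have hc : ContinuousAt (fun x : Params => (x, η)) x := by fun_prop
  have hO := (isOpen_isLocal (q := q) (K := K) (c := c) (ε := ε) hq hr hrR).mem_nhds h
  refine eq_of_frequently_eq (g := fun x => extE q r R K c ε (x, η))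
    (continuousAt_genericE hq0 hq hη hg)
    (ContinuousAt.comp (f := fun x : Params => (x, η))
      ((continuousOn_extE hq hr hrR).continuousAt hO) hc) ?_
  have e1 : ∀ᶠ x in 𝓝 x, IsLocal q r R K c ε (x, η) := hc.eventually_mem hO
  have e2 := isOpen_isSmall (q := q) η (fun β hβ => (h.admissible β hβ).regular.1) hx.2.1 hs
  refine ((frequently_isGood hq0 hη hx).and_eventually (e1.and e2)).mono fun x' ⟨h1, h2, h3⟩ => ?_
  have h4 := poleFactor_mul_genericE hq0 hq hr hrR hη h2.self (h1.mem_ellGeneric hq0 hq hη)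
  have h5 := h2.poleFactor_mul_extE hq0 hq hr hrR hη h3
  exact mul_left_cancel₀ (h1.poleFactor_ne_zero hq K) (h4.trans h5.symm)

/-! ### Return to the variables (b, t) -/

/-- The parameters that correspond to `(b, t)` at given scales. -/
def paramsOf (η : Scales) (z : ℂ × (Fin 4 → ℂ)) : Params :=
  (z.1, z.2 0 / (nome η * η.1), fun r => z.2 r.succ / (η.1 * η.2.2.1 r))

theorem continuous_paramsOf (η : Scales) : Continuous (paramsOf η) := by
  unfold paramsOf; fun_prop

theorem paramsOf_tVec (hη : IsProper η) (x : Params) : paramsOf η (x.1, tVec η x) = x := by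
  have := hη.nome_ne
  have := hη.s_ne
  refine Prod.ext rfl (Prod.ext ?_ (funext fun r => ?_))
  · simp only [paramsOf, tVec_zero]; field_simp
  · have := hη.e_ne r
    simp only [paramsOf, tVec_succ]; field_simp

theorem tVec_paramsOf (hη : IsProper η) (z : ℂ × (Fin 4 → ℂ)) : tVec η (paramsOf η z) = z.2 := by
  have := hη.nome_ne
  have := hη.s_ne
  refine funext fun i => ?_
  refine Fin.cases ?_ (fun r => ?_) i
  · simp only [paramsOf, tVec_zero]; field_simp
  · have := hη.e_ne r
    simp only [paramsOf, tVec_succ]; field_simp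

/-- At an exceptional parameter the integral is by definition a limit along generic parameters.
These are dense, the values there are those of `extE`, and `extE` is continuous. -/
theorem IsLocal.ellE_eq (hq0 : q ≠ 0) (hq : ‖q‖ < 1) (hr : 0 < r)
    (hrR : r ≤ R) (hη : IsProper η) (h : IsLocal q r R K c ε (x, η)) (hs : IsSmall q c ε (x, η)) :
    ellE x.1 (tVec η x) (EllipticBeta.nome η) q = extE q r R K c ε (x, η) := by
  by_cases hg : (x.1, tVec η x) ∈ ellGeneric (EllipticBeta.nome η) q
  · rw [ellE, if_pos hg]
    exact h.genericE_eq hq0 hq hr hrR hη hs hg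
  rw [ellE, if_neg hg]
  have hadm := h.self
  have hx : x.IsNonzero := ⟨hadm.regular.1, hadm.regular.2.1, hadm.regular.2.2.1⟩
  have hO := (isOpen_isLocal (q := q) (K := K) (c := c) (ε := ε) hq hr hrR).mem_nhds h
  have hc1 : Continuous fun x : Params => (x.1, tVec η x) :=
    continuous_fst.prodMk (continuous_tVec η)
  have hne : (𝓝[ellGeneric (EllipticBeta.nome η) q] (x.1, tVec η x)).NeBot := by
    rw [← mem_closure_iff_nhdsWithin_neBot, mem_closure_iff_frequently]
    exact (hc1.tendsto x).frequently ((frequently_isGood hq0 hη hx).mono fun x' hx' =>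
      hx'.mem_ellGeneric hq0 hq hη)
  have hcp : ContinuousAt (fun z => (paramsOf η z, η)) (x.1, tVec η x) :=
    ((continuous_paramsOf η).prodMk continuous_const).continuousAt
  have hp := paramsOf_tVec hη x
  refine Tendsto.limUnder_eq ?_
  have hlim : Tendsto (fun z => extE q r R K c ε (paramsOf η z, η)) (𝓝 (x.1, tVec η x))
      (𝓝 (extE q r R K c ε (x, η))) := by
    have := ContinuousAt.comp (f := fun z => (paramsOf η z, η)) (x := (x.1, tVec η x))
      (g := extE q r R K c ε) (by
        rw [hp]; exact (continuousOn_extE hq hr hrR).continuousAt hO) hcp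
    rw [ContinuousAt, Function.comp_apply, hp] at this
    exact this
  refine (hlim.mono_left nhdsWithin_le_nhds).congr' ?_
  have e1 : ∀ᶠ z in 𝓝 (x.1, tVec η x), IsLocal q r R K c ε (paramsOf η z, η) :=
    hcp.eventually_mem (by rw [hp]; exact hO)
  have e2 : ∀ᶠ z in 𝓝 (x.1, tVec η x), IsSmall q c ε (paramsOf η z, η) := by
    have := isOpen_isSmall (q := q) η (fun β hβ => (h.admissible β hβ).regular.1) hx.2.1 hs
    rw [← hp] at this
    exact (continuous_paramsOf η).continuousAt.eventually this
  filter_upwards [e1.filter_mono nhdsWithin_le_nhds, e2.filter_mono nhdsWithin_le_nhds,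
    self_mem_nhdsWithin] with z h1 h2 h3
  have ht := tVec_paramsOf hη z
  have := h1.genericE_eq hq0 hq hr hrR hη h2 (by rw [ht]; exact h3)
  rw [← this, genericE, ht]
  rfl

end
end EllipticBeta
end

noncomputable section
namespace EllipticBeta

/-! ### The scales in the limit -/

/-- The limit of `exp (x * ℓ)` as `ℓ → -∞`, for `x ≥ 0`. -/
def limExp (x : ℝ) : ℂ := if x = 0 then 1 else 0

/-- For real x the modulus of exp(x ℓ(p)) is |p|^x, whichever logarithm is chosen. -/
theorem tendsto_exp_mul_log {ℓ : ℂ → ℂ} (hℓ : ∀ p : ℂ, p ≠ 0 → Complex.exp (ℓ p) = p) {x : ℝ}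
    (hx : 0 ≤ x) : Tendsto (fun p => Complex.exp (x * ℓ p)) (𝓝[≠] 0) (𝓝 (limExp x)) := by
  rcases hx.eq_or_lt with rfl | hx
  · simp [limExp]
  rw [limExp, if_neg hx.ne', tendsto_zero_iff_norm_tendsto_zero]
  have h1 : Tendsto (fun p : ℂ => ‖p‖ ^ x) (𝓝[≠] 0) (𝓝 0) := by
    have : Tendsto (fun p : ℂ => ‖p‖ ^ x) (𝓝 0) (𝓝 (‖(0 : ℂ)‖ ^ x)) :=
      (continuous_norm.tendsto 0).rpow_const (Or.inr hx.le)
    rw [norm_zero, Real.zero_rpow hx.ne'] at this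
    exact this.mono_left nhdsWithin_le_nhds
  refine h1.congr' ?_
  filter_upwards [self_mem_nhdsWithin] with p hp
  have h2 : ‖p‖ = Real.exp (ℓ p).re := by rw [← Complex.norm_exp, hℓ p hp]
  rw [h2, ← Real.exp_mul, Complex.norm_exp, Complex.re_ofReal_mul, mul_comm]

/-- The scales for `p = exp L`. -/
def scalesOf (τ : Fin 4 → ℝ) (L : ℂ) : Scales :=
  (Complex.exp ((τ 0 - 1 : ℝ) * L), Complex.exp ((3 - 2 * τ 0 : ℝ) * L),
    fun r => Complex.exp ((τ r.succ - (τ 0 - 1) : ℝ) * L),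
    fun r => Complex.exp ((2 - τ 0 - τ r.succ : ℝ) * L))

/-- The scales for `p = 0`. -/
def limScales (τ : Fin 4 → ℝ) : Scales :=
  (0, limExp (3 - 2 * τ 0), fun r => limExp (τ r.succ - (τ 0 - 1)),
    fun r => limExp (2 - τ 0 - τ r.succ))

section
variable {q : ℂ} {τ : Fin 4 → ℝ} {ℓ : ℂ → ℂ}

theorem nome_limScales : nome (limScales τ) = 0 := by simp [nome, limScales]

theorem nome_scalesOf (τ : Fin 4 → ℝ) (L : ℂ) : nome (scalesOf τ L) = Complex.exp L := by
  rw [nome, scalesOf, ← Complex.exp_nat_mul, ← Complex.exp_add]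
  congr 1; push_cast; ring

theorem isProper_scalesOf {L : ℂ} (hL : ‖Complex.exp L‖ < 1) : IsProper (scalesOf τ L) :=
  ⟨Complex.exp_ne_zero _, Complex.exp_ne_zero _, fun r => by
    simp only [scalesOf]; rw [← Complex.exp_add]; congr 1; push_cast; ring,
    by rwa [nome_scalesOf]⟩

theorem tendsto_scalesOf (hℓ : ∀ p : ℂ, p ≠ 0 → Complex.exp (ℓ p) = p) (hτ : 1 < τ 0)
    (hτr : ∀ r : Fin 4, r ≠ 0 → τ 0 - 1 ≤ τ r ∧ τ r ≤ 2 - τ 0) :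
    Tendsto (fun p => scalesOf τ (ℓ p)) (𝓝[≠] 0) (𝓝 (limScales τ)) := by
  -- The interval for τ_2 is nonempty, which gives τ_1 ≤ 3/2 and makes the exponent of c
  -- nonnegative.
  have h1 := hτr 1 one_ne_zero
  have h0 : Tendsto (fun p => Complex.exp ((τ 0 - 1 : ℝ) * ℓ p)) (𝓝[≠] 0) (𝓝 0) := by
    have := tendsto_exp_mul_log hℓ (x := τ 0 - 1) (by linarith)
    rwa [limExp, if_neg (by linarith)] at this
  exact h0.prodMk_nhds ((tendsto_exp_mul_log hℓ (by linarith)).prodMk_nhds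
    ((tendsto_pi_nhds.2 fun r => tendsto_exp_mul_log hℓ
      (by linarith [hτr r.succ (Fin.succ_ne_zero r)])).prodMk_nhds
    (tendsto_pi_nhds.2 fun r => tendsto_exp_mul_log hℓ
      (by linarith [hτr r.succ (Fin.succ_ne_zero r)]))))

/-- The parameters `(b, t)` as an element of `Params`. -/
def toParams (z : ℂ × (Fin 4 → ℂ)) : Params := (z.1, z.2 0, fun r => z.2 r.succ)

theorem tVec_scalesOf (z : ℂ × (Fin 4 → ℂ)) (L : ℂ) :
    tVec (scalesOf τ L) (toParams z) = fun r => z.2 r * Complex.exp ((τ r : ℂ) * L) := by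
  refine funext fun i => ?_
  refine Fin.cases ?_ (fun r => ?_) i
  · rw [tVec_zero, nome_scalesOf]
    simp only [scalesOf, toParams]
    rw [← Complex.exp_add, mul_comm]
    congr 2; push_cast; ring
  · rw [tVec_succ]
    simp only [scalesOf, toParams]
    rw [← Complex.exp_add, mul_comm]
    congr 2; push_cast; ring

theorem contDiff_toParams : ContDiff ℂ 1 toParams := by unfold toParams; fun_prop

/-! ### Choice of the radii -/

variable {x : Params}

theorem tendsto_innerArg (y : Params × Scales) (i : PoleIndex) :
    Tendsto (fun R : ℝ => innerArg q y R i) atTop (𝓝 0) := by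
  have h1 : Tendsto (fun R : ℝ => (R : ℂ)⁻¹) atTop (𝓝 0) := by
    rw [tendsto_zero_iff_norm_tendsto_zero]
    refine tendsto_inv_atTop_zero.congr' ?_
    filter_upwards [eventually_ge_atTop 0] with R hR
    rw [norm_inv, Complex.norm_real, Real.norm_of_nonneg hR]
  have h2 (k : ℂ) : Tendsto (fun R : ℝ => k * (R : ℂ)⁻¹) atTop (𝓝 0) := by
    simpa using h1.const_mul k
  rcases i with i | i | i
  · fin_cases i
    · have := (h1.pow 2).const_mul (y.2.2.1 * y.1.1)
      simp only [ne_eq, OfNat.ofNat_ne_zero, not_false_eq_true, zero_pow, mul_zero] at this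
      refine this.congr fun R => ?_
      simp [innerArg, div_eq_mul_inv]
    · exact (h2 y.1.2.1).congr fun R => by simp [innerArg, div_eq_mul_inv]
    · refine (h2 (y.2.2.1 * q / (y.1.1 * y.1.2.1))).congr fun R => ?_
      simp [innerArg, div_eq_mul_inv]; ring
  · exact (h2 (y.1.2.2 i * y.2.2.2.1 i)).congr fun R => by simp [innerArg, div_eq_mul_inv]
  · refine (h2 (q * y.2.2.2.2 i / (y.1.1 * y.1.2.2 i))).congr fun R => ?_
    simp [innerArg, div_eq_mul_inv]; ring

/-- At the limiting scales s = p = 0. The inner arguments become small on a large circle, the main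
outer argument on a small one, and the remaining outer arguments vanish identically. Then K is taken
large for these two radii. -/
theorem exists_isAdmissible (hq : ‖q‖ < 1) (hx : x.IsNonzero) (τ : Fin 4 → ℝ) :
    ∃ (r R : ℝ) (K : ℕ), 0 < r ∧ r ≤ R ∧ IsAdmissible q r R K (x, limScales τ) := by
  set y : Params × Scales := (x, limScales τ) with hy
  have hn : nome y.2 = 0 := nome_limScales
  have hlt {f : ℂ → Prop} (h : ∀ᶠ z in 𝓝 0, f z) {X : Type} {l : Filter X} {g : X → ℂ}
    (hg : Tendsto g l (𝓝 0)) : ∀ᶠ x in l, f (g x) := hg.eventually h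
  have h1 : ∀ᶠ z : ℂ in 𝓝 0, ‖z‖ < 1 := by
    have := Metric.ball_mem_nhds (0 : ℂ) one_pos
    filter_upwards [this] with z hz
    simpa using hz
  obtain ⟨R, hR, hR1⟩ := ((eventually_all.2 fun i => hlt h1 (tendsto_innerArg (q := q) y i)).and
    (eventually_ge_atTop 1)).exists
  have hm : Tendsto (fun r : ℝ => outerArg q y r mainOuter) (𝓝[>] 0) (𝓝 0) := by
    have : Continuous fun r : ℝ => outerArg q y r mainOuter := by
      simp only [outerArg, mainOuter, Sum.elim_inl, Matrix.cons_val]; fun_prop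
    have h := this.tendsto 0
    refine (tendsto_nhdsWithin_of_tendsto_nhds h).trans (le_of_eq ?_)
    simp [outerArg, mainOuter]
  obtain ⟨r, hr, hr0, hr1⟩ := ((hlt h1 hm).and (Ioc_mem_nhdsGT (one_pos (α := ℝ)))).exists
  have hK (z : ℂ) : ∀ᶠ K : ℕ in atTop, ‖z * q ^ K‖ < 1 := by
    have := (tendsto_pow_atTop_nhds_zero_of_norm_lt_one hq).const_mul z
    rw [mul_zero] at this
    exact hlt h1 this
  obtain ⟨K, hK1, hK2⟩ := ((eventually_all.2 fun i => hK (innerArg q y r i)).and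
    (hK (outerArg q y R mainOuter))).exists
  refine ⟨r, R, K, hr0, hr1.trans hR1, ⟨⟨hx.1, hx.2.1, hx.2.2, one_ne_zero, ?_⟩, hR, hK1, ?_, hr,
    hK2, ?_, ?_⟩⟩
  · change ‖nome y.2‖ < 1
    rw [hn, norm_zero]; exact one_pos
  · intro i; rw [hn]; simp
  · rw [hn]; simp
  · intro i hi
    rcases i with i | i | i
    · fin_cases i
      · exact absurd rfl hi
      · simp [outerArg, hy, limScales]
      · simp [outerArg, hy, limScales]
    · simp [outerArg, hy, limScales]
    · simp [outerArg, hy, limScales]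

theorem countable_poleFactor_eq_zero (hq : ‖q‖ < 1) (K : ℕ) (η : Scales) (y : ℂ × (Fin 3 → ℂ))
    (ha : y.1 ≠ 0) : {β : ℂ | β ≠ 0 ∧ poleFactor q K ((β, y), η) = 0}.Countable := by
  refine (countable_setOf_sq_mem ((Set.countable_range fun j : ℕ => q ^ (j + 1)).union
    (Set.countable_range fun j : ℕ => η.2.1 * q ^ (j + 2) / y.1 ^ 2))).mono ?_
  rintro β ⟨hβ, h0⟩
  rw [poleFactor_eq] at h0
  rcases mul_eq_zero.1 h0 with h0 | h0
  · obtain ⟨j, hj⟩ := exists_sq_eq_pow hq hβ h0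
    exact Or.inl ⟨j, hj.symm⟩
  · obtain ⟨k, -, hk⟩ := qFin_eq_zero_iff.1 h0
    refine Or.inr ⟨k, ?_⟩
    dsimp only at hk ⊢
    field_simp at hk ⊢
    rw [← hk]; ring

/-- The zeros of `poleFactor` in b are countable, so arbitrarily small radii avoid all their
distances from the centre. -/
theorem exists_isLocal (hq : ‖q‖ < 1) (hx : x.IsNonzero) (τ : Fin 4 → ℝ) :
    ∃ (r R : ℝ) (K : ℕ) (ε : ℝ), 0 < r ∧ r ≤ R ∧ IsLocal q r R K x.1 ε (x, limScales τ) := by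
  obtain ⟨r, R, K, hr, hrR, h⟩ := exists_isAdmissible (q := q) hq hx τ
  have hc : Continuous fun β : ℂ => (((β, x.2), limScales τ) : Params × Scales) := by fun_prop
  obtain ⟨δ, hδ, hball⟩ := Metric.mem_nhds_iff.1
    (hc.continuousAt.eventually_mem ((isOpen_isAdmissible hr hrR).mem_nhds
      (show IsAdmissible q r R K ((x.1, x.2), limScales τ) from h)))
  have hcount := (countable_poleFactor_eq_zero hq K (limScales τ) x.2 hx.2.1).image
    fun β => dist β x.1
  obtain ⟨ε, hε, hε'⟩ := (hcount.dense_compl ℝ).exists_between hδ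
  have hsub {β : ℂ} (hβ : β ∈ Metric.closedBall x.1 ε) :
      IsAdmissible q r R K ((β, x.2), limScales τ) :=
    hball (Metric.closedBall_subset_ball hε'.2 hβ)
  refine ⟨r, R, K, ε, hr, hrR, ⟨Metric.mem_ball_self hε'.1, fun β hβ => hsub hβ,
    fun β hβ h0 => hε ⟨β, ⟨(hsub (Metric.sphere_subset_closedBall hβ)).regular.1, h0⟩, hβ⟩,
    fun β hβ => ?_⟩⟩
  rw [nome_limScales, zero_mul, norm_zero]
  exact norm_pos_iff.2 (hsub hβ).regular.1

variable {r R : ℝ} {K : ℕ} {c : ℂ} {ε : ℝ}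

/-- If τ_1 = 3/2, then c is identically 1 and nothing is claimed; otherwise c → 0. -/
theorem eventually_isSmall (hℓ : ∀ p : ℂ, p ≠ 0 → Complex.exp (ℓ p) = p) (hτ : 1 < τ 0)
    (hτr : ∀ r : Fin 4, r ≠ 0 → τ 0 - 1 ≤ τ r ∧ τ r ≤ 2 - τ 0)
    (h : IsLocal q r R K c ε (x, limScales τ)) :
    ∀ᶠ p in 𝓝[≠] 0, IsSmall q c ε (x, scalesOf τ (ℓ p)) := by
  by_cases h3 : 3 - 2 * τ 0 = 0
  · refine Eventually.of_forall fun p hp => absurd ?_ hp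
    simp [scalesOf, h3]
  have hlim := tendsto_scalesOf hℓ hτ hτr
  have : ∀ᶠ η in 𝓝 (limScales τ), ∀ β ∈ Metric.closedBall c ε,
      ‖η.2.1 * q ^ 2 / (β * x.2.1) ^ 2‖ < 1 := by
    refine (isCompact_closedBall c ε).eventually_forall_of_forall_eventually fun β hβ => ?_
    have hadm := (h.admissible β hβ).regular
    have hc : ContinuousAt (fun z : Scales × ℂ => ‖z.1.2.1 * q ^ 2 / (z.2 * x.2.1) ^ 2‖)
        (limScales τ, β) := by
      have := pow_ne_zero 2 (mul_ne_zero hadm.1 hadm.2.1)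
      dsimp only at this
      fun_prop (disch := assumption)
    refine hc.eventually_lt_const ?_
    simp [limScales, limExp, h3]
  exact (hlim.eventually this).mono fun p hp _ => hp

theorem eventually_isLocal (hq : ‖q‖ < 1) (hr : 0 < r) (hrR : r ≤ R)
    (hℓ : ∀ p : ℂ, p ≠ 0 → Complex.exp (ℓ p) = p) (hτ : 1 < τ 0)
    (hτr : ∀ r : Fin 4, r ≠ 0 → τ 0 - 1 ≤ τ r ∧ τ r ≤ 2 - τ 0)
    (h : IsLocal q r R K c ε (x, limScales τ)) :
    ∀ᶠ p in 𝓝[≠] 0, IsProper (scalesOf τ (ℓ p)) ∧ IsLocal q r R K c ε (x, scalesOf τ (ℓ p)) ∧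
      IsSmall q c ε (x, scalesOf τ (ℓ p)) := by
  have hlim := tendsto_scalesOf hℓ hτ hτr
  have hpair : Tendsto (fun p => ((x, scalesOf τ (ℓ p)) : Params × Scales)) (𝓝[≠] 0)
      (𝓝 (x, limScales τ)) := tendsto_const_nhds.prodMk_nhds hlim
  filter_upwards [hpair.eventually ((isOpen_isLocal hq hr hrR).mem_nhds h),
    eventually_isSmall hℓ hτ hτr h, self_mem_nhdsWithin] with p h1 h2 h3
  refine ⟨isProper_scalesOf ?_, h1, h2⟩
  have := h1.self.nome_lt
  rwa [nome_scalesOf] at this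

/-- The limit of the elliptic hypergeometric integral. -/
theorem IsLocal.tendsto_ellE (hq0 : q ≠ 0) (hq : ‖q‖ < 1) (hr : 0 < r) (hrR : r ≤ R)
    (hℓ : ∀ p : ℂ, p ≠ 0 → Complex.exp (ℓ p) = p) (hτ : 1 < τ 0)
    (hτr : ∀ r : Fin 4, r ≠ 0 → τ 0 - 1 ≤ τ r ∧ τ r ≤ 2 - τ 0) {z : ℂ × (Fin 4 → ℂ)}
    (h : IsLocal q r R K c ε (toParams z, limScales τ)) :
    Tendsto (fun p => ellE z.1 (fun r => z.2 r * Complex.exp ((τ r : ℂ) * ℓ p)) p q) (𝓝[≠] 0)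
      (𝓝 (extE q r R K c ε (toParams z, limScales τ))) := by
  have hpair : Tendsto (fun p => ((toParams z, scalesOf τ (ℓ p)) : Params × Scales)) (𝓝[≠] 0)
      (𝓝 (toParams z, limScales τ)) := tendsto_const_nhds.prodMk_nhds (tendsto_scalesOf hℓ hτ hτr)
  refine (((continuousOn_extE hq hr hrR).continuousAt
    ((isOpen_isLocal hq hr hrR).mem_nhds h)).tendsto.comp hpair).congr' ?_
  filter_upwards [eventually_isLocal hq hr hrR hℓ hτ hτr h, self_mem_nhdsWithin] with p h1 hp
  rw [Function.comp_apply, ← h1.2.1.ellE_eq hq0 hq hr hrR h1.1 h1.2.2, nome_scalesOf, hℓ p hp,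
    tVec_scalesOf]
  rfl

/-- The limiting scales are not proper, as their nome is 0, so the identity is obtained as the limit
of the one at proper scales. -/
theorem IsLocal.poleFactor_mul_extE_limScales (hq0 : q ≠ 0) (hq : ‖q‖ < 1) (hr : 0 < r)
    (hrR : r ≤ R) (hτ : 1 < τ 0)
    (hτr : ∀ r : Fin 4, r ≠ 0 → τ 0 - 1 ≤ τ r ∧ τ r ≤ 2 - τ 0)
    (h : IsLocal q r R K c ε (x, limScales τ)) :
    poleFactor q K (x, limScales τ) * extE q r R K c ε (x, limScales τ) =
      regE q r R K (x, limScales τ) := by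
  have hℓ : ∀ p : ℂ, p ≠ 0 → Complex.exp (Complex.log p) = p := fun p hp => Complex.exp_log hp
  have hpair : Tendsto (fun p => ((x, scalesOf τ (Complex.log p)) : Params × Scales)) (𝓝[≠] 0)
      (𝓝 (x, limScales τ)) := tendsto_const_nhds.prodMk_nhds (tendsto_scalesOf hℓ hτ hτr)
  have hadm := h.self
  refine tendsto_nhds_unique_of_eventuallyEq ((((continuousAt_poleFactor hq hr hrR hadm).mul
    ((continuousOn_extE hq hr hrR).continuousAt ((isOpen_isLocal hq hr hrR).mem_nhds h))).tendsto).comp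
      hpair) ((continuousAt_regE hq hr hrR hadm).tendsto.comp hpair) ?_
  filter_upwards [eventually_isLocal hq hr hrR hℓ hτ hτr h] with p h1
  exact h1.2.1.poleFactor_mul_extE hq0 hq hr hrR h1.1 h1.2.2

/-- The limit of the elliptic hypergeometric integral as `p → 0`. -/
def limitE (q : ℂ) (τ : Fin 4 → ℝ) (z : ℂ × (Fin 4 → ℂ)) : ℂ :=
  limUnder (𝓝[≠] 0) fun p =>
    ellE z.1 (fun r => z.2 r * Complex.exp ((τ r : ℂ) * Complex.log p)) p q

theorem IsLocal.limitE_eq (hq0 : q ≠ 0) (hq : ‖q‖ < 1) (hr : 0 < r) (hrR : r ≤ R) (hτ : 1 < τ 0)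
    (hτr : ∀ r : Fin 4, r ≠ 0 → τ 0 - 1 ≤ τ r ∧ τ r ≤ 2 - τ 0) {z : ℂ × (Fin 4 → ℂ)}
    (h : IsLocal q r R K c ε (toParams z, limScales τ)) :
    limitE q τ z = extE q r R K c ε (toParams z, limScales τ) :=
  (h.tendsto_ellE hq0 hq hr hrR (fun _ hp => Complex.exp_log hp) hτ hτr).limUnder_eq

theorem differentiableOn_limitE (hq0 : q ≠ 0) (hq : ‖q‖ < 1) (hτ : 1 < τ 0)
    (hτr : ∀ r : Fin 4, r ≠ 0 → τ 0 - 1 ≤ τ r ∧ τ r ≤ 2 - τ 0) :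
    DifferentiableOn ℂ (limitE q τ) {x | x.1 ≠ 0 ∧ ∀ r, x.2 r ≠ 0} := by
  rintro z ⟨hb, ht⟩
  obtain ⟨r, R, K, ε, hr, hrR, h⟩ := exists_isLocal (q := q) hq
    (x := toParams z) ⟨hb, ht 0, fun r => ht r.succ⟩ τ
  have hO : IsOpen {x | IsLocal q r R K z.1 ε (x, limScales τ)} :=
    (isOpen_isLocal hq hr hrR).preimage
      (by fun_prop : Continuous fun x : Params => (x, limScales τ))
  have hd : DifferentiableAt ℂ (fun z' => extE q r R K z.1 ε (toParams z', limScales τ)) z :=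
    DifferentiableAt.comp (g := fun x => extE q r R K z.1 ε (x, limScales τ)) z
      (((contDiffOn_extE hq hr hrR h.self.nome_lt).differentiableOn one_ne_zero).differentiableAt
        (hO.mem_nhds h)) (contDiff_toParams.differentiable one_ne_zero z)
  refine (hd.congr_of_eventuallyEq ?_).differentiableWithinAt
  filter_upwards [contDiff_toParams.continuous.continuousAt.eventually_mem (hO.mem_nhds h)]
    with z' hz'
  exact hz'.limitE_eq hq0 hq hr hrR hτ hτr

end
end EllipticBeta
end

noncomputable section
namespace EllipticBeta

/-! ### The limiting integral -/

section
variable {q : ℂ} {τ : Fin 4 → ℝ} {b : ℂ} {t : Fin 4 → ℂ}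

theorem prod_fin_four (F : Fin 4 → ℂ) (P : Fin 4 → Prop) [DecidablePred P] :
    ∏ r with r ≠ 0 ∧ P r, F r = ∏ r : Fin 3, if P r.succ then F r.succ else 1 := by
  rw [Finset.prod_filter, Fin.prod_univ_succ]
  simp

theorem cond_e (τ : Fin 4 → ℝ) (r : Fin 3) :
    (τ r.succ - (τ 0 - 1) = 0) = (τ r.succ = τ 0 - 1) := by rw [sub_eq_zero]

theorem cond_f (τ : Fin 4 → ℝ) (r : Fin 3) :
    (2 - τ 0 - τ r.succ = 0) = (τ r.succ = 2 - τ 0) := by rw [sub_eq_zero, @eq_comm _ (2 - τ 0)]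

theorem cond_c (τ : Fin 4 → ℝ) : (3 - 2 * τ 0 = 0) = (τ 0 = 3 / 2) :=
  propext ⟨fun h => by linarith, fun h => by linarith⟩

/-- At nome 0 double factorials reduce to single ones, and every factor whose scale tends to 0
becomes 1. What remains are the factors with a vanishing exponent. -/
theorem scaledIntegrand_limScales (hq0 : q ≠ 0) (hq : ‖q‖ < 1) (hb : b ≠ 0) (ht : ∀ r, t r ≠ 0)
    {w : ℂ} (hw : w ≠ 0) :
    scaledIntegrand q (toParams (b, t), limScales τ) w = limitIntegrand q τ b t w := by
  have hn := nome_limScales (τ := τ)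
  have h0 := ht 0
  rw [scaledIntegrand, numer]
  simp only [hn, Fintype.prod_sum_type, Fintype.prod_prod_type, numerArg, extraArg, Sum.elim_inl,
    Sum.elim_inr, Fin.prod_univ_five, Fin.prod_univ_four, Matrix.cons_val, innerArg, outerArg,
    pqPoch_zero_mid hq]
  simp only [limScales, toParams]
  have e1 : theta (t 0 / (b * w)) q = theta (q * b * w / t 0) q := by
    rw [← theta_inv_mul hq0]
    congr 1; field_simp
  have he (r : Fin 3) : qPoch (b * t r.succ * limExp (τ r.succ - (τ 0 - 1)) / w) q /
      qPoch (t r.succ * limExp (τ r.succ - (τ 0 - 1)) / w) q =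
      if τ r.succ = τ 0 - 1 then qPoch (b * t r.succ / w) q / qPoch (t r.succ / w) q else 1 := by
    simp only [limExp, cond_e]; split_ifs <;> simp
  have hf (r : Fin 3) : qPoch (q * limExp (2 - τ 0 - τ r.succ) / (t r.succ * w)) q /
      qPoch (q * limExp (2 - τ 0 - τ r.succ) / (b * t r.succ * w)) q =
      if τ r.succ = 2 - τ 0 then
        qPoch (q / (t r.succ * w)) q / qPoch (q / (b * t r.succ * w)) q else 1 := by
    simp only [limExp, cond_f]; split_ifs <;> simp
  have hc : (1 - limExp (3 - 2 * τ 0) / w ^ 2) * qPoch (limExp (3 - 2 * τ 0) * q / (b * w ^ 2)) q *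
      qPoch (limExp (3 - 2 * τ 0) * q / (t 0 * w)) q / (qPoch (limExp (3 - 2 * τ 0) * b / w ^ 2) q *
        qPoch (limExp (3 - 2 * τ 0) * q / (b * t 0 * w)) q) =
      if τ 0 = 3 / 2 then ((1 - 1 / w ^ 2) * qPoch (q / (b * w ^ 2)) q * qPoch (q / (t 0 * w)) q) /
        (qPoch (b / w ^ 2) q * qPoch (q / (b * t 0 * w)) q) else 1 := by
    simp only [limExp, cond_c]; split_ifs <;> simp
  rw [limitIntegrand, prod_fin_four _ fun r => τ r = τ 0 - 1, prod_fin_four _ fun r => τ r = 2 - τ 0,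
    ← hc, ← Finset.prod_congr rfl fun r _ => he r, ← Finset.prod_congr rfl fun r _ => hf r, e1]
  simp only [Fin.prod_univ_three, Matrix.cons_val, qPoch_zero_right, zero_mul, mul_zero, zero_div,
    qPoch_zero, ne_eq, OfNat.ofNat_ne_zero, not_false_eq_true, zero_pow, mul_one, one_mul, sub_zero]
  rw [show q * w / (b * t 0) = q / (b * t 0) * w by ring]
  ring

theorem innerZeros_limScales (hq : ‖q‖ < 1) (hb : b ≠ 0) (ht : ∀ r, t r ≠ 0) :
    innerZeros q (toParams (b, t), limScales τ) ⊆ limitInnerPoles q τ b t := by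
  rintro w ⟨hw, i, hi⟩
  rw [nome_limScales, pqPoch_zero_mid hq] at hi
  obtain ⟨k, hk⟩ := (qPoch_eq_zero_iff hq).1 hi
  have h0 := ht 0
  refine ⟨k, ?_⟩
  have c1 (h : τ 0 = 3 / 2) : limExp (3 - 2 * τ 0) = 1 := by rw [limExp, if_pos (by linarith)]
  have c0 (h : τ 0 ≠ 3 / 2) : limExp (3 - 2 * τ 0) = 0 := by
    rw [limExp, if_neg fun h' => h (by linarith)]
  rcases i with i | i | i
  · fin_cases i
    · by_cases h : τ 0 = 3 / 2
      · refine Or.inr (Or.inl ⟨h, Or.inl ?_⟩)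
        simp [innerArg, limScales, toParams, c1 h] at hk
        field_simp at hk; exact hk.symm
      · simp [innerArg, limScales, toParams, c0 h] at hk
    · left
      simp [innerArg, toParams] at hk
      field_simp at hk; exact hk.symm
    · by_cases h : τ 0 = 3 / 2
      · refine Or.inr (Or.inl ⟨h, Or.inr ?_⟩)
        simp [innerArg, limScales, toParams, c1 h] at hk
        field_simp at hk ⊢; rw [← hk]
      · simp [innerArg, limScales, toParams, c0 h] at hk
  · by_cases h : τ i.succ = τ 0 - 1
    · refine Or.inr (Or.inr (Or.inl ⟨i.succ, Fin.succ_ne_zero i, h, ?_⟩))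
      simp [innerArg, limScales, limExp, toParams, h] at hk
      field_simp at hk; exact hk.symm
    · simp only [innerArg, Sum.elim_inl, Sum.elim_inr, limScales, limExp, toParams, cond_e, if_neg h] at hk
      simp at hk
  · by_cases h : τ i.succ = 2 - τ 0
    · refine Or.inr (Or.inr (Or.inr ⟨i.succ, Fin.succ_ne_zero i, h, ?_⟩))
      have := ht i.succ
      simp only [innerArg, Sum.elim_inr, limScales, limExp, toParams, cond_f, if_pos h] at hk
      field_simp at hk ⊢; rw [← hk]
    · simp only [innerArg, Sum.elim_inr, limScales, limExp, toParams, cond_f, if_neg h] at hk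
      simp at hk

theorem outerZeros_limScales (hq : ‖q‖ < 1) :
    outerZeros q (toParams (b, t), limScales τ) ⊆ limitOuterPoles q b t := by
  rintro w ⟨hw, i, hi⟩
  rw [nome_limScales, pqPoch_zero_mid hq] at hi
  obtain ⟨k, hk⟩ := (qPoch_eq_zero_iff hq).1 hi
  rcases i with i | i | i
  · fin_cases i
    · refine ⟨k, ?_⟩
      simp [outerArg, toParams] at hk
      rw [← hk]; ring
    · simp [outerArg, limScales] at hk
    · simp [outerArg, limScales] at hk
  · simp [outerArg, limScales] at hk
  · simp [outerArg, limScales] at hk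

/-- This accounts for the quotient in front of G: it converts the part of `poleFactor` in q/b into
the part of `basePrefactor` in b that survives at nome 0. -/
theorem qPoch_quotient_eq (hq : ‖q‖ < 1) (hb : b ≠ 0) (h1 : qPoch (q / b ^ 2) q ≠ 0)
    (h2 : qPoch (q * b) q ≠ 0) :
    qPoch (-(q / b)) q * qPoch (q / b ^ 2) (q ^ 2) *
      ((qPoch (q / b) q * qPoch (q * b ^ 2) q) / (qPoch (q / b ^ 2) q * qPoch (q * b) q)) =
    qPoch (-(b * q)) q * qPoch (b ^ 2 * q) (q ^ 2) := by
  have e1 : qPoch (q / b ^ 2) q = qPoch (q / b ^ 2) (q ^ 2) * (qPoch (q / b) q * qPoch (-(q / b)) q) := by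
    rw [qPoch_even_odd hq (q / b ^ 2), qPoch_mul_neg hq]
    congr 2; field_simp
  have e2 : qPoch (q * b ^ 2) q = qPoch (b ^ 2 * q) (q ^ 2) * (qPoch (q * b) q * qPoch (-(b * q)) q) := by
    rw [qPoch_even_odd hq (q * b ^ 2), mul_comm b q, qPoch_mul_neg hq]
    congr 2 <;> ring
  rw [e1] at h1
  rw [e1, e2]
  have := left_ne_zero_of_mul h1
  have := left_ne_zero_of_mul (right_ne_zero_of_mul h1)
  have := right_ne_zero_of_mul (right_ne_zero_of_mul h1)
  field_simp

theorem pairArg_limScales (x : Params) (i) : pairArg q (x, limScales τ) i = 0 := by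
  rcases i with ⟨i, j⟩ | ⟨i, i', j⟩
  · fin_cases j <;> simp [pairArg, limScales]
  · simp only [pairArg, Sum.elim_inr, limScales]
    split_ifs
    · fin_cases j <;> simp
    · rfl
    · fin_cases j <;> simp

theorem prefactor_limScales (hq : ‖q‖ < 1) :
    prefactor q (toParams (b, t), limScales τ) =
      qPoch (-(b * q)) q * qPoch (b ^ 2 * q) (q ^ 2) * qPoch q q *
      ((∏ r with r ≠ 0 ∧ τ r = τ 0 - 1, qPoch (q * t r / (b * t 0)) q) *
      (∏ r with r ≠ 0 ∧ τ r = 2 - τ 0, qPoch (q ^ 2 / (b ^ 2 * t 0 * t r)) q)) := by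
  rw [prefactor, corePrefactor, basePrefactor]
  simp only [nome_limScales, pairArg_limScales, pqPoch_zero_mid hq, Fintype.prod_sum_type, crossArg,
    Sum.elim_inl, Sum.elim_inr]
  rw [prod_fin_four _ fun r => τ r = τ 0 - 1, prod_fin_four _ fun r => τ r = 2 - τ 0]
  have he (r : Fin 3) : qPoch (q * (t r.succ * limExp (τ r.succ - (τ 0 - 1))) / (b * t 0)) q =
      if τ r.succ = τ 0 - 1 then qPoch (q * t r.succ / (b * t 0)) q else 1 := by
    simp only [limExp, cond_e]; split_ifs <;> simp
  have hf (r : Fin 3) : qPoch (q ^ 2 * limExp (2 - τ 0 - τ r.succ) / (b ^ 2 * t 0 * t r.succ)) q =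
      if τ r.succ = 2 - τ 0 then qPoch (q ^ 2 / (b ^ 2 * t 0 * t r.succ)) q else 1 := by
    simp only [limExp, cond_f]; split_ifs <;> simp
  simp only [toParams, limScales]
  rw [Finset.prod_congr rfl fun r _ => he r, Finset.prod_congr rfl fun r _ => hf r]
  simp [qPoch_zero_right]

theorem windingNumber_ne {γ : ℝ → ℂ} (hγ : IsSeparatingContour γ (limitInnerPoles q τ b t)
    (limitOuterPoles q b t)) {z : ℂ} (h1 : z ∈ limitInnerPoles q τ b t)
    (h2 : z ∈ limitOuterPoles q b t) : False := by
  have := hγ.inside z h1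
  rw [hγ.outside z h2] at this
  exact zero_ne_one this

/-- A zero of the first factor would be a zero of (q/b²;q). For c = 1, a zero of the second would
make q/(b t_1) both an inner and an outer pole, which no contour can separate; for c = 0 the second
factor is 1. -/
theorem singFactor_limScales_ne_zero (hq : ‖q‖ < 1) (h1 : qPoch (q / b ^ 2) q ≠ 0)
    {γ : ℝ → ℂ} (hγ : IsSeparatingContour γ (limitInnerPoles q τ b t) (limitOuterPoles q b t))
    (K : ℕ) : singFactor q K (toParams (b, t), limScales τ) ≠ 0 := by
  refine mul_ne_zero (fun h0 => ?_) fun h0 => ?_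
  · obtain ⟨k, -, hk⟩ := qFin_eq_zero_iff.1 h0
    refine h1 ((qPoch_eq_zero_iff hq).2 ⟨2 * k + 1, ?_⟩)
    simp only [toParams] at hk
    rw [show q / b ^ 2 * q ^ (2 * k + 1) = (q / b * q ^ k) ^ 2 by ring, hk, one_pow]
  · obtain ⟨k, -, hk⟩ := qFin_eq_zero_iff.1 h0
    simp only [toParams, limScales, limExp, cond_c] at hk
    split_ifs at hk with h
    · refine windingNumber_ne hγ (z := q / (b * t 0)) ⟨0, Or.inr (Or.inl ⟨h, Or.inr (by simp)⟩)⟩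
        ⟨k, ?_⟩
      rw [← hk]; ring
    · simp at hk

theorem limitE_eq_contourIntegral (hq0 : q ≠ 0) (hq : ‖q‖ < 1) (hτ : 1 < τ 0)
    (hτr : ∀ r : Fin 4, r ≠ 0 → τ 0 - 1 ≤ τ r ∧ τ r ≤ 2 - τ 0) (hb : b ≠ 0) (ht : ∀ r, t r ≠ 0)
    (h1 : qPoch (q / b ^ 2) q ≠ 0) (h2 : qPoch (q * b) q ≠ 0) {γ : ℝ → ℂ}
    (hγ : IsSeparatingContour γ (limitInnerPoles q τ b t) (limitOuterPoles q b t)) :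
    limitE q τ (b, t) = limitPrefactor q τ b t * contourIntegral γ
      (fun z => limitIntegrand q τ b t z / (2 * Real.pi * Complex.I * z)) := by
  obtain ⟨r, R, K, ε, hr, hrR, h⟩ := exists_isLocal (q := q) hq
    (x := toParams (b, t)) ⟨hb, ht 0, fun r => ht r.succ⟩ τ
  have e1 := h.poleFactor_mul_extE_limScales hq0 hq hr hrR hτ hτr
  rw [← h.limitE_eq hq0 hq hr hrR hτ hτr, regE_eq hq hr hrR h.self
    (hγ.mono (innerZeros_limScales hq hb ht) (outerZeros_limScales hq)), poleFactor,
    contourIntegral_congr (g := fun w => limitIntegrand q τ b t w / (2 * Real.pi * Complex.I * w))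
      fun s hs => by rw [scaledIntegrand_limScales hq0 hq hb ht (hγ.ne_zero s hs)], prefactor_limScales hq] at e1
  have hs := singFactor_limScales_ne_zero hq h1 hγ K
  have hqt := qPoch_quotient_eq hq hb h1 h2
  have hM : qPoch (-(q / b)) q * qPoch (q / b ^ 2) (q ^ 2) ≠ 0 := by
    refine mul_ne_zero (fun h0 => ?_) fun h0 => ?_
    · obtain ⟨k, hk⟩ := (qPoch_eq_zero_iff hq).1 h0
      refine h1 ((qPoch_eq_zero_iff hq).2 ⟨2 * k + 1, ?_⟩)
      rw [show q / b ^ 2 * q ^ (2 * k + 1) = (-(q / b) * q ^ k) ^ 2 by ring, hk, one_pow]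
    · exact h1 (by rw [qPoch_even_odd hq, h0, zero_mul])
  refine mul_left_cancel₀ (mul_ne_zero hM hs) ?_
  rw [limitPrefactor]
  refine e1.trans ?_
  rw [← hqt]
  ring

end
end EllipticBeta
end

/-! ### The limit theorem -/

theorem mainTheorem9 (q : ℂ) (hq0 : q ≠ 0) (hq1 : ‖q‖ < 1)
    (τ : Fin 4 → ℝ) (hτ : 1 < τ 0)
    (hτr : ∀ r : Fin 4, r ≠ 0 → τ 0 - 1 ≤ τ r ∧ τ r ≤ 2 - τ 0) :
    ∃ G : ℂ × (Fin 4 → ℂ) → ℂ,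
      DifferentiableOn ℂ G {x | x.1 ≠ 0 ∧ ∀ r, x.2 r ≠ 0} ∧
      (∀ (b : ℂ) (t : Fin 4 → ℂ), b ≠ 0 → (∀ r, t r ≠ 0) →
        EllipticBeta.qPoch (q / b ^ 2) q ≠ 0 → EllipticBeta.qPoch (q * b) q ≠ 0 →
        ∀ γ : ℝ → ℂ,
          EllipticBeta.IsSeparatingContour γ (EllipticBeta.limitInnerPoles q τ b t)
            (EllipticBeta.limitOuterPoles q b t) →
          G (b, t) = EllipticBeta.limitPrefactor q τ b t *
            EllipticBeta.contourIntegral γ (fun z =>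
              EllipticBeta.limitIntegrand q τ b t z / (2 * Real.pi * Complex.I * z))) ∧
      (∀ (b : ℂ) (t : Fin 4 → ℂ), b ≠ 0 → (∀ r, t r ≠ 0) →
        ∀ ℓ : ℂ → ℂ, (∀ p : ℂ, p ≠ 0 → Complex.exp (ℓ p) = p) →
          Filter.Tendsto
            (fun p : ℂ =>
              EllipticBeta.ellE b (fun r => t r * Complex.exp ((τ r : ℂ) * ℓ p)) p q)
            (nhdsWithin 0 {0}ᶜ) (nhds (G (b, t)))) := by
  refine ⟨EllipticBeta.limitE q τ, EllipticBeta.differentiableOn_limitE hq0 hq1 hτ hτr,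
    fun b t hb ht h1 h2 γ hγ =>
      EllipticBeta.limitE_eq_contourIntegral hq0 hq1 hτ hτr hb ht h1 h2 hγ,
    fun b t hb ht ℓ hℓ => ?_⟩
  -- The limit function is defined with the principal logarithm. Both it and the limit for an
  -- arbitrary choice ℓ equal the same value of `extE`, so the choice is immaterial.
  obtain ⟨r, R, K, ε, hr, hrR, h⟩ := EllipticBeta.exists_isLocal (q := q) hq1
    (x := EllipticBeta.toParams (b, t)) ⟨hb, ht 0, fun r => ht r.succ⟩ τ
  rw [h.limitE_eq hq0 hq1 hr hrR hτ hτr]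
  exact h.tendsto_ellE hq0 hq1 hr hrR hℓ hτ hτr
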